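/- Let $p,q\ge 0$ be integers with $n=p+q\ge 2$, let $g_0=\mathrm{diag}(1,\dots,1,-1,\dots,-1)$ be the flat metric of signature $(p,q)$ on $\mathbb R^n$, put $x_i=(g_0)_{ij}x^j$, and let $\mathrm{o}(p+1,q+1)\subset\mathrm{Vect}(\mathbb R^n)$ be the conformal Lie algebra, the real span of the vector fields $$\partial_i,\qquad x_i\partial_j-x_j\partial_i,\qquad x^i\partial_i,\qquad x_jx^j\,\partial_i-2x_i\,x^j\partial_j .$$ Let $(M,\mathrm g)$ be a conformally flat pseudo-Riemannian manifold of signature $(p,q)$: $M$ is a smooth Hausdorff manifold covered by a given set $\mathcal A$ of smooth charts in each of which $\mathrm g$ is a positive function times $g_0$. If $n=2$, assume moreover that the local actions of $\mathrm{o}(p+1,q+1)$ on $M$ given by any two charts of $\mathcal A$ agree: near each point common to their domains, the pull-back by one chart of an element of $\mathrm{o}(p+1,q+1)$ is the pull-back by the other chart of an element of $\mathrm{o}(p+1,q+1)$. (For $n\ge 3$ this is automatic.) A vector field on an open set $U\subseteq M$ belongs to the local action of $\mathrm{o}(p+1,q+1)$ on $M$ if, in the charts of $\mathcal A$, it is locally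 an element of $\mathrm{o}(p+1,q+1)$. Let $\mathbb K$ be $\mathbb R$ or $\mathbb C$, let $\lambda,\mu\in\mathbb K$ and $\delta=\mu-\lambda$. - Densities. Using the volume density $|\mathrm{vol}|$ of $\mathrm g$, write $\lambda$-densities as $f|\mathrm{vol}|^\lambda$ with $f\in C^\infty(M,\mathbb K)$. A vector field $X$ acts on them by $L_X^\lambda f=X(f)+\lambda\,\mathrm{Div}(X)f$, where $\mathrm{Div}$ is the divergence with respect to $|\mathrm{vol}|$. - Operators. $\mathcal D^k_{\lambda,\mu}$ is the space of differential operators of order at most $k$ from $\lambda$-densities to $\mu$-densities on $M$; thus $\mathcal D^0_{\lambda,\mu}$ consists of the multiplications by functions, and $A\in\mathcal D^{k+1}_{\lambda,\mu}$ if and only if $[A,f]\in\mathcal D^{k}_{\lambda,\mu}$ for all $f\in C^\infty(M,\mathbb K)$. Vector fields act by $L_X^{\lambda,\mu}(A)=L_X^\mu A-A\,L_X^\lambda$. - Symbols. $\mathcal S^2_\delta$ is the space of smooth $\mathbb K$-valued functions $P(x,\xi)$ on $T^*M$ that are polynomials of degree at most $2$ in $\xi$, regarded as symbols with values in $\delta$-densities.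 Vector fields act by $$L_X^\delta(P)=X^i\frac{\partial P}{\partial x^i}-\xi_j\,\partial_iX^j\,\frac{\partial P}{\partial\xi_i}+\delta\,\mathrm{Div}(X)P .$$ - Principal symbols. For $A\in\mathcal D^k_{\lambda,\mu}$, $\sigma_k(A)$ is the symbol homogeneous of degree $k$ with $\sigma_k(A)(df)=\frac1{k!}[\dots[[A,f],f],\dots,f](1)$ ($k$ commutators) for all real $f\in C^\infty(M)$. A linear map $Q:\mathcal S^2_\delta\to\mathcal D^2_{\lambda,\mu}$ preserves the principal symbol at each order if, for $k=0,1,2$ and every $P\in\mathcal S^2_\delta$ homogeneous of degree $k$ in $\xi$, $Q(P)\in\mathcal D^k_{\lambda,\mu}$ and $\sigma_k(Q(P))=P$. A linear map $Q:\mathcal S^2_\delta\to\mathcal D^2_{\lambda,\mu}$ is called equivariant over an open set $U\subseteq M$ if, for every vector field $X$ on $U$ that belongs to the local action of $\mathrm{o}(p+1,q+1)$ and all $P,P'\in\mathcal S^2_\delta$ with $P'=L_X^\delta P$ on $U$, one has $Q(P')=L_X^{\lambda,\mu}(Q(P))$ on $U$. It is called equivariant for the local action if it is equivariant over every open $U\subseteq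 M$. **Theorem.** Suppose that $$\delta=\mu-\lambda\notin\Big\{\frac2n,\ \frac{n+2}{2n},\ 1,\ \frac{n+1}{n},\ \frac{n+2}{n}\Big\}.$$ (i) There exists a linear isomorphism $Q_{\lambda,\mu}:\mathcal S^2_\delta\to\mathcal D^2_{\lambda,\mu}$ that is equivariant for the local action of $\mathrm{o}(p+1,q+1)$, i.e. an isomorphism of $\mathrm{o}(p+1,q+1)$-modules; it can be chosen to preserve the principal symbol at each order. (ii) It is the only linear isomorphism $\mathcal S^2_\delta\to\mathcal D^2_{\lambda,\mu}$ that is equivariant for the local action and preserves the principal symbol at each order. If the local action of $\mathrm{o}(p+1,q+1)$ is global, i.e. if each of its germs at a point of $M$ extends to a vector field on $M$ belonging to the local action (as for $M=\mathbb R^n$), it is even the only linear isomorphism that is equivariant over $U=M$ and preserves the principal symbol at each order; no locality is assumed. -/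

import Mathlib

open scoped Manifold ContDiff Topology

noncomputable section

namespace ConfQuant

/-- The model space `ℝⁿ`. -/
abbrev Model (n : ℕ) : Type := EuclideanSpace ℝ (Fin n)

/-! ### The flat space of signature `(p, q)` and its conformal Lie algebra -/

section Flat

variable (p q : ℕ)

/-- The diagonal entries of `diag(1, …, 1, -1, …, -1)` (`p` times `1`, `q` times `-1`). -/
def flatSign (i : Fin (p + q)) : ℝ := if i.val < p then 1 else -1

/-- The flat metric of signature `(p, q)` on `ℝ^{p+q}`. -/
def flatMetric (u v : Model (p + q)) : ℝ := ∑ i, flatSign p q i * u i * v i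

/-- The constant vector field `∂ᵢ`. -/
def basisVec (n : ℕ) (i : Fin n) : Model n := EuclideanSpace.single i (1 : ℝ)

/-- Translations `Xᵢ = ∂ᵢ`. -/
def translationField (i : Fin (p + q)) : Model (p + q) → Model (p + q) :=
  fun _ => basisVec (p + q) i

/-- Rotations `Xᵢⱼ = xᵢ ∂ⱼ - xⱼ ∂ᵢ`, where `xᵢ = gᵢⱼ xʲ`. -/
def rotationField (i j : Fin (p + q)) : Model (p + q) → Model (p + q) :=
  fun x => (flatSign p q i * x i) • basisVec (p + q) j
    - (flatSign p q j * x j) • basisVec (p + q) i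

/-- The homothety `X₀ = xⁱ ∂ᵢ`. -/
def homothetyField : Model (p + q) → Model (p + q) := fun x => x

/-- Inversions `X̄ᵢ = xⱼ xʲ ∂ᵢ - 2 xᵢ xʲ ∂ⱼ`. -/
def inversionField (i : Fin (p + q)) : Model (p + q) → Model (p + q) :=
  fun x => flatMetric p q x x • basisVec (p + q) i - (2 * (flatSign p q i * x i)) • x

/-- The conformal Lie algebra `o(p+1, q+1)` of vector fields on `ℝ^{p+q}`: the real span of the
translations, the rotations, the homothety and the inversions. -/
def confAlg : Submodule ℝ (Model (p + q) → Model (p + q)) :=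
  Submodule.span ℝ (Set.range (translationField p q)
    ∪ Set.range (fun ij : Fin (p + q) × Fin (p + q) => rotationField p q ij.1 ij.2)
    ∪ {homothetyField p q}
    ∪ Set.range (inversionField p q))

end Flat

/-! ### Functions, vector fields and differential operators on a smooth manifold -/

section Manifold

variable {n : ℕ} {M : Type*} [TopologicalSpace M] [ChartedSpace (Model n) M]

variable (M) in
/-- The smooth charts of `M`, i.e. the maximal smooth atlas. -/
abbrev smoothCharts : Set (OpenPartialHomeomorph M (Model n)) :=
  IsManifold.maximalAtlas (𝓡 n) ∞ M

/-- Vector fields on `M` (no regularity imposed). -/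
abbrev VField (n : ℕ) (M : Type*) [TopologicalSpace M] [ChartedSpace (Model n) M] : Type _ :=
  (x : M) → TangentSpace (𝓡 n) x

/-- The cotangent space `T*ₓM`. -/
abbrev Cotangent (n : ℕ) {M : Type*} [TopologicalSpace M] [ChartedSpace (Model n) M] (x : M) :
    Type _ :=
  TangentSpace (𝓡 n) x →L[ℝ] ℝ

/-- The algebra `C^∞(M, 𝕜)` of smooth `𝕜`-valued functions, `𝕜 = ℝ` or `ℂ`. -/
def smoothFun (n : ℕ) (𝕜 : Type*) [RCLike 𝕜]
    (M : Type*) [TopologicalSpace M] [ChartedSpace (Model n) M] : Subalgebra 𝕜 (M → 𝕜) where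
  carrier := {f | ContMDiff (𝓡 n) 𝓘(ℝ, 𝕜) ∞ f}
  mul_mem' {f g} hf hg := by
    intro x
    have h : ContDiff ℝ ∞ (fun z : 𝕜 × 𝕜 => z.1 * z.2) := contDiff_mul
    exact h.contMDiff.contMDiffAt.comp (I' := 𝓘(ℝ, 𝕜 × 𝕜)) x ((hf x).prodMk_space (hg x))
  add_mem' {f g} hf hg := by
    intro x
    have h : ContDiff ℝ ∞ (fun z : 𝕜 × 𝕜 => z.1 + z.2) := contDiff_add
    exact h.contMDiff.contMDiffAt.comp (I' := 𝓘(ℝ, 𝕜 × 𝕜)) x ((hf x).prodMk_space (hg x))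
  algebraMap_mem' c := contMDiff_const

/-- The `𝕜`-linear endomorphisms of `C^∞(M, 𝕜)`. -/
abbrev FunOp (n : ℕ) (𝕜 : Type*) [RCLike 𝕜]
    (M : Type*) [TopologicalSpace M] [ChartedSpace (Model n) M] : Type _ :=
  Module.End 𝕜 (smoothFun n 𝕜 M)

variable {𝕜 : Type*} [RCLike 𝕜]

/-- Multiplication by a smooth function. -/
def mulOp (f : smoothFun n 𝕜 M) : FunOp n 𝕜 M := LinearMap.mulLeft 𝕜 f

/-- The commutator `[A, f] = A ∘ f - f ∘ A` with the multiplication by `f`. -/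
def commOp (A : FunOp n 𝕜 M) (f : smoothFun n 𝕜 M) : FunOp n 𝕜 M :=
  A * mulOp f - mulOp f * A

/-- The space of differential operators of order at most `k`: those of order `0` are the
multiplications by functions, and `A` has order at most `k + 1` if `[A, f]` has order at most `k`
for every smooth function `f`. -/
def diffOp (n : ℕ) (𝕜 : Type*) [RCLike 𝕜]
    (M : Type*) [TopologicalSpace M] [ChartedSpace (Model n) M] :
    ℕ → Submodule 𝕜 (FunOp n 𝕜 M)
  | 0 =>
    { carrier := {A | ∃ a : smoothFun n 𝕜 M, A = mulOp a}
      add_mem' := by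
        rintro _ _ ⟨a, rfl⟩ ⟨b, rfl⟩
        exact ⟨a + b, by ext1 f; simp [mulOp, add_mul]⟩
      zero_mem' := ⟨0, by ext1 f; simp [mulOp]⟩
      smul_mem' := by
        rintro c _ ⟨a, rfl⟩
        exact ⟨c • a, by ext1 f; simp [mulOp]⟩ }
  | k + 1 =>
    { carrier := {A | ∀ f : smoothFun n 𝕜 M, commOp A f ∈ diffOp n 𝕜 M k}
      add_mem' := by
        intro A B hA hB f
        have h : commOp (A + B) f = commOp A f + commOp B f := by
          simp only [commOp, add_mul, mul_add]; abel
        rw [h]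
        exact Submodule.add_mem _ (hA f) (hB f)
      zero_mem' := by
        intro f
        have h : commOp (0 : FunOp n 𝕜 M) f = 0 := by
          ext1 a; simp [commOp]
        rw [h]
        exact Submodule.zero_mem _
      smul_mem' := by
        intro c A hA f
        have h : commOp (c • A) f = c • commOp A f := by
          ext1 a; simp [commOp, smul_sub]
        rw [h]
        exact Submodule.smul_mem _ c (hA f) }

/-- A smooth real function as an element of `C^∞(M, 𝕜)`. -/
def ofRealFun (f : M → ℝ) (hf : ContMDiff (𝓡 n) 𝓘(ℝ, ℝ) ∞ f) : smoothFun n 𝕜 M :=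
  ⟨fun x => (f x : 𝕜), fun x =>
    (RCLike.ofRealCLM (K := 𝕜)).contDiff.contMDiff.contMDiffAt.comp x (hf x)⟩

/-! ### Coordinate expressions -/

/-- The components of the vector field `X` in the chart `φ`, as a function of the coordinates. -/
def vfCoord (φ : OpenPartialHomeomorph M (Model n)) (X : VField n M) (y : Model n) : Model n :=
  mfderiv (𝓡 n) (𝓡 n) φ (φ.symm y) (X (φ.symm y))

/-- The coordinate vector `∂ᵢ` of the chart `φ` at the point with coordinates `y`. -/
def coordVec (φ : OpenPartialHomeomorph M (Model n)) (y : Model n) (i : Fin n) :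
    TangentSpace (𝓡 n) (φ.symm y) :=
  mfderiv (𝓡 n) (𝓡 n) φ.symm y (basisVec n i)

/-- The expression in the chart `φ` of a function `P` on the cotangent bundle, as a function of the
coordinates `y` of the base point and of the covector `η = (ξ₁, …, ξₙ)`. -/
def symbolCoord (φ : OpenPartialHomeomorph M (Model n)) (P : (x : M) → Cotangent n x → 𝕜)
    (y : Model n) (η : Model n →L[ℝ] ℝ) : 𝕜 :=
  P (φ.symm y) (η.comp (mfderiv (𝓡 n) (𝓡 n) φ (φ.symm y)))

/-! ### Pseudo-Riemannian metrics and divergence -/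

variable (n M) in
/-- A smooth pseudo-Riemannian metric: a smooth field of nondegenerate symmetric bilinear forms. -/
structure PseudoRiemannianMetric [IsManifold (𝓡 n) ∞ M] where
  /-- the bilinear form on each tangent space -/
  form : (x : M) → TangentSpace (𝓡 n) x →L[ℝ] TangentSpace (𝓡 n) x →L[ℝ] ℝ
  symm : ∀ x u v, form x u v = form x v u
  nondegenerate : ∀ x u, (∀ v, form x u v = 0) → u = 0
  smooth : ContMDiff (𝓡 n) ((𝓡 n).prod 𝓘(ℝ, Model n →L[ℝ] Model n →L[ℝ] ℝ)) ∞
    (fun x => Bundle.TotalSpace.mk' (Model n →L[ℝ] Model n →L[ℝ] ℝ)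
      (E := fun x : M => TangentSpace (𝓡 n) x →L[ℝ] TangentSpace (𝓡 n) x →L[ℝ] ℝ) x (form x))

variable [IsManifold (𝓡 n) ∞ M] (g : PseudoRiemannianMetric n M)

/-- `√|det (gᵢⱼ)|` in the chart `φ`: the coefficient of the Riemannian volume density `|vol|`. -/
def volCoord (φ : OpenPartialHomeomorph M (Model n)) (y : Model n) : ℝ :=
  √|Matrix.det (Matrix.of fun i j : Fin n =>
    g.form (φ.symm y) (coordVec φ y i) (coordVec φ y j))|

/-- The divergence of `X` with respect to the volume of `g`, computed in the chart at `x`: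
`Div X = (1/√|g|) ∂ᵢ(√|g| Xⁱ)`. -/
def divergence (X : VField n M) (x : M) : ℝ :=
  let φ := chartAt (Model n) x
  (volCoord g φ (φ x))⁻¹ *
    ∑ i, fderiv ℝ (fun y => volCoord g φ y * vfCoord φ X y i) (φ x) (basisVec n i)

/-! ### Densities and symbols

A density of weight `w` is written `f |vol|^w` with `f ∈ C^∞(M, 𝕜)`, so the space of `w`-densities
is `C^∞(M, 𝕜)` with the Lie derivative `X f + w Div(X) f`. In the same way a symbol with values in
`w`-densities is a symbol times `|vol|^w`. -/

/-- The derivative `X f` of the function `f` along `X`. -/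
def derivAlong (X : VField n M) (f : M → 𝕜) (x : M) : 𝕜 :=
  mfderiv (𝓡 n) 𝓘(ℝ, 𝕜) f x (X x)

/-- The Lie derivative of the `w`-density `f |vol|^w`. -/
def lieDensity (w : 𝕜) (X : VField n M) (f : M → 𝕜) (x : M) : 𝕜 :=
  derivAlong X f x + w * (divergence g X x : 𝕜) * f x

/-- Symbols of degree at most two: functions on the cotangent bundle that are polynomials of degree
at most two on each cotangent space, with coefficients that are smooth in every chart. -/
def symbols2 (n : ℕ) (𝕜 : Type*) [RCLike 𝕜]
    (M : Type*) [TopologicalSpace M] [ChartedSpace (Model n) M]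
    [IsManifold (𝓡 n) ∞ M] : Submodule 𝕜 ((x : M) → Cotangent n x → 𝕜) where
  carrier := {P |
    (∀ x, ∃ (b : Cotangent n x →ₗ[ℝ] Cotangent n x →ₗ[ℝ] 𝕜) (l : Cotangent n x →ₗ[ℝ] 𝕜) (c : 𝕜),
      ∀ ξ, P x ξ = b ξ ξ + l ξ + c) ∧
    ∀ φ ∈ smoothCharts (n := n) M, ∀ η : Model n →L[ℝ] ℝ,
      ContDiffOn ℝ ∞ (fun y => symbolCoord φ P y η) φ.target}
  add_mem' := by
    rintro P R ⟨hP, hP'⟩ ⟨hR, hR'⟩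
    refine ⟨fun x => ?_, fun φ hφ η => (hP' φ hφ η).add (hR' φ hφ η)⟩
    obtain ⟨b, l, c, h⟩ := hP x
    obtain ⟨b', l', c', h'⟩ := hR x
    refine ⟨b + b', l + l', c + c', fun ξ => ?_⟩
    simp only [Pi.add_apply, LinearMap.add_apply, h, h']
    ring
  zero_mem' := ⟨fun x => ⟨0, 0, 0, fun ξ => by simp⟩, fun φ _ η => contDiffOn_const⟩
  smul_mem' := by
    rintro a P ⟨hP, hP'⟩
    refine ⟨fun x => ?_, fun φ hφ η => (contDiffOn_const (c := a)).mul (hP' φ hφ η)⟩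
    obtain ⟨b, l, c, h⟩ := hP x
    refine ⟨b.compr₂ (LinearMap.mulLeft ℝ a), (LinearMap.mulLeft ℝ a).comp l, a * c, fun ξ => ?_⟩
    simp only [Pi.smul_apply, smul_eq_mul, h, LinearMap.compr₂_apply, LinearMap.comp_apply,
      LinearMap.mulLeft_apply]
    ring

/-- The Lie derivative of the symbol `P |vol|^w`, computed in the chart at `x`:
`Xⁱ ∂P/∂xⁱ - ξⱼ ∂ᵢXʲ ∂P/∂ξᵢ + w Div(X) P`. -/
def lieSymbol (w : 𝕜) (X : VField n M) (P : (x : M) → Cotangent n x → 𝕜) (x : M)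
    (ξ : Cotangent n x) : 𝕜 :=
  let φ := chartAt (Model n) x
  let η : Model n →L[ℝ] ℝ := ξ.comp (mfderiv (𝓡 n) (𝓡 n) φ x).inverse
  fderiv ℝ (fun y => symbolCoord φ P y η) (φ x) (vfCoord φ X (φ x))
    - fderiv ℝ (symbolCoord φ P (φ x)) η (η.comp (fderiv ℝ (vfCoord φ X) (φ x)))
    + w * (divergence g X x : 𝕜) * P x ξ

/-- On the open set `U`, the operator `A'` is the Lie derivative `L_X^μ ∘ A - A ∘ L_X^λ` of the
operator `A` from `λ`-densities to `μ`-densities. The vector field `X` matters on `U` only, so this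
is tested on global densities `f`, `f'` such that `f' = L_X^λ f` on `U`. -/
def IsLieOperatorOn (lam mu : 𝕜) (U : Set M) (X : VField n M) (A A' : FunOp n 𝕜 M) : Prop :=
  ∀ f f' : smoothFun n 𝕜 M, (∀ x ∈ U, f'.1 x = lieDensity g lam X f.1 x) →
    ∀ x ∈ U, (A' f).1 x = lieDensity g mu X (A f).1 x - (A f').1 x

/-- On the set `U`, the symbol `P'` is the Lie derivative of the symbol `P`. -/
def IsLieSymbolOn (w : 𝕜) (U : Set M) (X : VField n M) (P P' : symbols2 n 𝕜 M) : Prop :=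
  ∀ x ∈ U, ∀ ξ : Cotangent n x, P'.1 x ξ = lieSymbol g w X P.1 x ξ

end Manifold

/-! ### Conformally flat manifolds and conformal equivariance -/

section Conformal

variable {p q : ℕ} {M : Type*} [TopologicalSpace M] [ChartedSpace (Model (p + q)) M]

/-- The vector field `φ* Y` for a chart `φ` and a vector field `Y` on `ℝⁿ`. -/
def chartPullback (φ : OpenPartialHomeomorph M (Model (p + q)))
    (Y : Model (p + q) → Model (p + q)) : VField (p + q) M :=
  VectorField.mpullback (𝓡 (p + q)) (𝓡 (p + q)) φ Y

/-- A set `𝒜` of charts that makes `(M, g)` conformally flat of signature `(p, q)`: the charts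
cover `M`, in each of them `g` is a positive multiple of the flat metric of signature `(p, q)`, and
the local actions of `o(p+1, q+1)` given by any two of the charts agree. In dimension at least three
the last property follows from the others, so it is required in dimension two only. -/
structure IsConformallyFlat [IsManifold (𝓡 (p + q)) ∞ M] (g : PseudoRiemannianMetric (p + q) M)
    (𝒜 : Set (OpenPartialHomeomorph M (Model (p + q)))) : Prop where
  smooth : 𝒜 ⊆ smoothCharts (n := p + q) M
  cover : ∀ x : M, ∃ φ ∈ 𝒜, x ∈ φ.source
  conformal : ∀ φ ∈ 𝒜, ∀ x ∈ φ.source, ∃ c : ℝ, 0 < c ∧ ∀ u v : TangentSpace (𝓡 (p + q)) x,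
    g.form x u v = c * flatMetric p q (mfderiv (𝓡 (p + q)) (𝓡 (p + q)) φ x u)
      (mfderiv (𝓡 (p + q)) (𝓡 (p + q)) φ x v)
  compatible : p + q = 2 → ∀ φ ∈ 𝒜, ∀ ψ ∈ 𝒜, ∀ x ∈ φ.source ∩ ψ.source, ∀ Y ∈ confAlg p q,
    ∃ Z ∈ confAlg p q, ∀ᶠ z in 𝓝 x, chartPullback φ Y z = chartPullback ψ Z z

variable (𝒜 : Set (OpenPartialHomeomorph M (Model (p + q))))

/-- On the open set `U`, the vector field `X` belongs to the local action of `o(p+1, q+1)` on `M`: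
in the charts of `𝒜` it is locally an element of the conformal Lie algebra of `ℝⁿ`. -/
def IsConformalFieldOn (U : Set M) (X : VField (p + q) M) : Prop :=
  ∀ x ∈ U, ∀ φ ∈ 𝒜, x ∈ φ.source →
    ∃ Y ∈ confAlg p q, ∀ᶠ z in 𝓝 x, X z = chartPullback φ Y z

/-- The local action of `o(p+1, q+1)` on `M` is global: each of its germs extends to a vector field
on `M` that belongs everywhere to the local action. -/
def ActsGlobally : Prop :=
  ∀ φ ∈ 𝒜, ∀ x ∈ φ.source, ∀ Y ∈ confAlg p q,
    ∃ X : VField (p + q) M, IsConformalFieldOn 𝒜 Set.univ X ∧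
      ∀ᶠ z in 𝓝 x, X z = chartPullback φ Y z

variable [IsManifold (𝓡 (p + q)) ∞ M] (g : PseudoRiemannianMetric (p + q) M)
  {𝕜 : Type*} [RCLike 𝕜] (lam mu : 𝕜)

/-- `Q` intertwines the action of those elements of the local action of `o(p+1, q+1)` that are
defined on the open set `U`, on the restrictions to `U` of symbols of weight `μ - λ` and of
operators from `λ`-densities to `μ`-densities. For `U = M` these are the actions on symbols and
operators on `M` themselves. -/
def IsEquivariantOn (U : Set M) (Q : symbols2 (p + q) 𝕜 M ≃ₗ[𝕜] diffOp (p + q) 𝕜 M 2) : Prop :=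
  ∀ X : VField (p + q) M, IsConformalFieldOn 𝒜 U X →
    ∀ P P' : symbols2 (p + q) 𝕜 M, IsLieSymbolOn g (mu - lam) U X P P' →
      IsLieOperatorOn g lam mu U X (Q P).1 (Q P').1

/-- `Q` intertwines the local actions of `o(p+1, q+1)`. -/
def IsLocallyEquivariant (Q : symbols2 (p + q) 𝕜 M ≃ₗ[𝕜] diffOp (p + q) 𝕜 M 2) : Prop :=
  ∀ U : Set M, IsOpen U → IsEquivariantOn 𝒜 g lam mu U Q


/-- `Q` preserves the principal symbol at each order `k ≤ 2`: if `P` is homogeneous of degree `k`,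
then `Q P` has order at most `k` and its principal symbol
`df ↦ (1/k!) [… [Q P, f], …, f]` (`k` commutators) is `P`. -/
def PreservesPrincipalSymbol (Q : symbols2 (p + q) 𝕜 M ≃ₗ[𝕜] diffOp (p + q) 𝕜 M 2) : Prop :=
  ∀ k ≤ 2, ∀ P : symbols2 (p + q) 𝕜 M,
    (∀ (x : M) (t : ℝ) (ξ : Cotangent (p + q) x), P.1 x (t • ξ) = (t : 𝕜) ^ k * P.1 x ξ) →
    (Q P).1 ∈ diffOp (p + q) 𝕜 M k ∧
    ∀ (f : M → ℝ) (hf : ContMDiff (𝓡 (p + q)) 𝓘(ℝ, ℝ) ∞ f) (x : M),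
      (((fun B => commOp B (ofRealFun f hf))^[k] (Q P).1) 1).1 x
        = (k.factorial : 𝕜) * P.1 x (mfderiv (𝓡 (p + q)) 𝓘(ℝ, ℝ) f x)

end Conformal

end ConfQuant

end

set_option linter.unusedSectionVars false
set_option linter.unusedSimpArgs false

noncomputable section

open Finset (sum_congr mul_sum sum_comm sum_add_distrib sum_mul sum_sub_distrib
  sum_const_zero sum_ite_eq sum_ite_eq' sum_neg_distrib smul_sum sum_eq_zero)

namespace ConfQuant

/-! ### Lie derivatives over a commutative ring with commuting derivations -/

section Algebra

variable {K R : Type*} [Field K] [CommRing R] [Algebra K R] {n : ℕ} (d : Fin n → Derivation K R R)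

/-- The derivation `∑ Xᵏ ∂ₖ`. -/
def dirDer (X : Fin n → R) : Derivation K R R := ∑ k, X k • d k

lemma dirDer_apply (X : Fin n → R) (F : R) : dirDer d X F = ∑ k, X k * d k F := by
  have h : ⇑(∑ k, X k • d k) = ∑ k, ⇑(X k • d k) :=
    map_sum (Derivation.coeFnAddMonoidHom (R := K) (A := R) (M := R)) (fun k => X k • d k) _
  rw [dirDer, h, Finset.sum_apply]
  rfl

/-- The divergence `∑ ∂ₖ Xᵏ`. -/
def divg (X : Fin n → R) : R := ∑ k, d k (X k)

/-- The Lie derivative of a scalar density of weight `w`. -/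
def lie0 (w : R) (X : Fin n → R) (F : R) : R := dirDer d X F + w * divg d X * F

/-- The Lie derivative of a vector field with values in densities of weight `w`. -/
def lie1 (w : R) (X : Fin n → R) (v : Fin n → R) (i : Fin n) : R :=
  dirDer d X (v i) - ∑ k, v k * d k (X i) + w * divg d X * v i

/-- The Lie derivative of a contravariant tensor of degree two with values in densities of
weight `w`. -/
def lie2 (w : R) (X : Fin n → R) (a : Fin n → Fin n → R) (i j : Fin n) : R :=
  dirDer d X (a i j) - ∑ k, a k j * d k (X i) - ∑ k, a i k * d k (X j) + w * divg d X * a i j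

/-- The differential operator with coefficients `a2`, `a1`, `a0`. -/
def opr (a2 : Fin n → Fin n → R) (a1 : Fin n → R) (a0 F : R) : R :=
  ∑ i, ∑ j, a2 i j * d i (d j F) + ∑ i, a1 i * d i F + a0 * F

variable {d} (hd : ∀ i j F, d i (d j F) = d j (d i F))
include hd

lemma der_dirDer (X : Fin n → R) (i : Fin n) (F : R) :
    d i (dirDer d X F) = dirDer d X (d i F) + ∑ k, d i (X k) * d k F := by
  simp only [dirDer_apply, map_sum, Derivation.leibniz, smul_eq_mul, ← sum_add_distrib]
  refine sum_congr rfl fun k _ => ?_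
  rw [hd i k]; ring

lemma der_divg (X : Fin n → R) (i : Fin n) : d i (divg d X) = ∑ k, d k (d i (X k)) := by
  simp only [divg, map_sum]
  exact sum_congr rfl fun k _ => hd _ _ _

lemma divg_lie1 {w : R} (hw : ∀ i, d i w = 0) (X v : Fin n → R) :
    divg d (lie1 d w X v) = lie0 d w X (divg d v) + (w - 1) * ∑ k, v k * d k (divg d X) := by
  have e1 : ∀ i, d i (lie1 d w X v i) = dirDer d X (d i (v i)) + ∑ k, d i (X k) * d k (v i)
      - ∑ k, d i (v k) * d k (X i) - ∑ k, v k * d i (d k (X i))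
      + w * divg d X * d i (v i) + w * (v i * d i (divg d X)) := by
    intro i
    simp only [lie1, map_add, map_sub, map_sum, Derivation.leibniz, smul_eq_mul, hw,
      der_dirDer hd, sum_add_distrib]
    simp only [mul_comm (d _ (X i))]
    ring
  have e2 : ∑ i, ∑ k, d i (X k) * d k (v i) = ∑ i, ∑ k, d i (v k) * d k (X i) := by
    rw [sum_comm]
    exact sum_congr rfl fun i _ => sum_congr rfl fun k _ => mul_comm _ _
  have e3 : ∑ i, ∑ k, v k * d i (d k (X i)) = ∑ k, v k * d k (divg d X) := by
    rw [sum_comm]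
    refine sum_congr rfl fun k _ => ?_
    rw [der_divg hd, mul_sum]
  have e4 : divg d (lie1 d w X v) = ∑ i, d i (lie1 d w X v i) := rfl
  rw [e4]
  simp only [e1, sum_add_distrib, sum_sub_distrib, e2, e3, ← mul_sum]
  rw [← map_sum]
  simp only [lie0, show ∑ i, d i (v i) = divg d v from rfl]
  ring

/-- The divergence `∑ ∂ᵢ aⁱʲ`. -/
def divg2 (d : Fin n → Derivation K R R) (a : Fin n → Fin n → R) (j : Fin n) : R :=
  ∑ i, d i (a i j)

lemma divg2_lie2 {w : R} (hw : ∀ i, d i w = 0) (X : Fin n → R) (a : Fin n → Fin n → R)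
    (j : Fin n) :
    divg2 d (lie2 d w X a) j = lie1 d w X (divg2 d a) j
      + (w - 1) * ∑ i, a i j * d i (divg d X) - ∑ i, ∑ k, a i k * d i (d k (X j)) := by
  have e1 : ∀ i, d i (lie2 d w X a i j) = dirDer d X (d i (a i j))
      + ∑ k, d i (X k) * d k (a i j)
      - ∑ k, d i (a k j) * d k (X i) - ∑ k, a k j * d i (d k (X i))
      - ∑ k, d i (a i k) * d k (X j) - ∑ k, a i k * d i (d k (X j))
      + w * divg d X * d i (a i j) + w * (a i j * d i (divg d X)) := by
    intro i
    simp only [lie2, map_add, map_sub, map_sum, Derivation.leibniz, smul_eq_mul, hw,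
      der_dirDer hd, sum_add_distrib]
    simp only [mul_comm (d _ (X i)), mul_comm (d _ (X j))]
    ring
  have e2 : ∑ i, ∑ k, d i (X k) * d k (a i j) = ∑ i, ∑ k, d i (a k j) * d k (X i) := by
    rw [sum_comm]
    exact sum_congr rfl fun i _ => sum_congr rfl fun k _ => mul_comm _ _
  have e3 : ∑ i, ∑ k, a k j * d i (d k (X i)) = ∑ k, a k j * d k (divg d X) := by
    rw [sum_comm]
    refine sum_congr rfl fun k _ => ?_
    rw [der_divg hd, mul_sum]
  have e5 : ∑ i, ∑ k, d i (a i k) * d k (X j) = ∑ k, divg2 d a k * d k (X j) := by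
    rw [sum_comm]
    refine sum_congr rfl fun k _ => ?_
    rw [divg2, sum_mul]
  have e4 : divg2 d (lie2 d w X a) j = ∑ i, d i (lie2 d w X a i j) := rfl
  rw [e4]
  simp only [e1, sum_add_distrib, sum_sub_distrib, e2, e3, e5, ← mul_sum]
  rw [← map_sum]
  simp only [lie1, show ∑ i, d i (a i j) = divg2 d a j from rfl]
  ring

/-- How the coefficients of a second order operator change under the Lie derivative. -/
lemma lie_opr {l m : R} (hl : ∀ i, d i l = 0) (X : Fin n → R)
    {a2 : Fin n → Fin n → R} (hs : ∀ i j, a2 i j = a2 j i) (a1 : Fin n → R) (a0 F : R) :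
    lie0 d m X (opr d a2 a1 a0 F) - opr d a2 a1 a0 (lie0 d l X F)
      = opr d (lie2 d (m - l) X a2)
          (fun i => lie1 d (m - l) X a1 i - ∑ k, ∑ j, a2 k j * d k (d j (X i))
            - 2 * l * ∑ k, a2 k i * d k (divg d X))
          (lie0 d (m - l) X a0 - l * ∑ k, a1 k * d k (divg d X)
            - l * ∑ k, ∑ j, a2 k j * d k (d j (divg d X))) F := by
  have b0 : dirDer d X (opr d a2 a1 a0 F) =
      ∑ i, ∑ j, (dirDer d X (a2 i j) * d i (d j F) + a2 i j * dirDer d X (d i (d j F)))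
      + ∑ i, (dirDer d X (a1 i) * d i F + a1 i * dirDer d X (d i F))
      + (dirDer d X a0 * F + a0 * dirDer d X F) := by
    simp only [opr, map_add, map_sum, Derivation.leibniz, smul_eq_mul]
    congr 1
    · congr 1
      · exact sum_congr rfl fun i _ => sum_congr rfl fun j _ => by ring
      · exact sum_congr rfl fun i _ => by ring
    · ring
  have b1 : ∀ i, d i (lie0 d l X F) = dirDer d X (d i F) + ∑ k, d i (X k) * d k F
      + l * divg d X * d i F + l * d i (divg d X) * F := by
    intro i
    simp only [lie0, map_add, der_dirDer hd, Derivation.leibniz, smul_eq_mul, hl]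
    ring
  have b2 : ∀ i j, d i (d j (lie0 d l X F)) = dirDer d X (d i (d j F))
      + ∑ k, d i (X k) * d k (d j F) + ∑ k, d j (X k) * d k (d i F)
      + ∑ k, d i (d j (X k)) * d k F
      + l * divg d X * d i (d j F) + l * d i (divg d X) * d j F
      + l * d j (divg d X) * d i F + l * d i (d j (divg d X)) * F := by
    intro i j
    have e : ∀ k, d i (d j (X k) * d k F)
        = d j (X k) * d k (d i F) + d i (d j (X k)) * d k F := by
      intro k
      rw [Derivation.leibniz, hd i k F, smul_eq_mul, smul_eq_mul, mul_comm (d k F)]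
    rw [b1]
    simp only [map_add, map_sum, e, der_dirDer hd, sum_add_distrib]
    simp only [Derivation.leibniz, smul_eq_mul, hl]
    ring
  have c1 : ∑ i, a1 i * ∑ k, d i (X k) * d k F
      = ∑ i, (∑ k, a1 k * d k (X i)) * d i F := by
    simp only [mul_sum, sum_mul]
    rw [sum_comm]
    exact sum_congr rfl fun i _ => sum_congr rfl fun k _ => by ring
  have c2 : ∑ i, ∑ j, a2 i j * ∑ k, d i (X k) * d k (d j F)
      = ∑ i, ∑ j, (∑ k, a2 k j * d k (X i)) * d i (d j F) := by
    simp only [mul_sum, sum_mul]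
    rw [sum_comm]
    conv_rhs => rw [sum_comm]
    refine sum_congr rfl fun j _ => ?_
    rw [sum_comm]
    exact sum_congr rfl fun i _ => sum_congr rfl fun k _ => by ring
  have c3 : ∑ i, ∑ j, a2 i j * ∑ k, d j (X k) * d k (d i F)
      = ∑ i, ∑ j, (∑ k, a2 i k * d k (X j)) * d i (d j F) := by
    simp only [mul_sum, sum_mul]
    refine sum_congr rfl fun i _ => ?_
    rw [sum_comm]
    refine sum_congr rfl fun j _ => sum_congr rfl fun k _ => ?_
    rw [hd j i]; ring
  have c4 : ∑ i, ∑ j, a2 i j * ∑ k, d i (d j (X k)) * d k F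
      = ∑ i, (∑ k, ∑ j, a2 k j * d k (d j (X i))) * d i F := by
    simp only [mul_sum, sum_mul]
    conv_rhs => rw [sum_comm]
    refine sum_congr rfl fun i _ => ?_
    rw [sum_comm]
    exact sum_congr rfl fun j _ => sum_congr rfl fun k _ => by ring
  have c5 : ∑ i, ∑ j, a2 i j * (l * d i (divg d X) * d j F)
      = ∑ i, (l * ∑ k, a2 k i * d k (divg d X)) * d i F := by
    rw [sum_comm]
    simp only [mul_sum, sum_mul]
    exact sum_congr rfl fun i _ => sum_congr rfl fun k _ => by ring
  have c6 : ∑ i, ∑ j, a2 i j * (l * d j (divg d X) * d i F)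
      = ∑ i, (l * ∑ k, a2 k i * d k (divg d X)) * d i F := by
    simp only [mul_sum, sum_mul]
    exact sum_congr rfl fun i _ => sum_congr rfl fun k _ => by rw [hs i k]; ring
  have lhs : lie0 d m X (opr d a2 a1 a0 F) = dirDer d X (opr d a2 a1 a0 F)
      + m * divg d X * opr d a2 a1 a0 F := rfl
  rw [lhs, b0]
  simp only [opr, b2, lie2, lie1]
  simp only [b1]
  simp only [add_mul, sub_mul, mul_add, sum_add_distrib, sum_sub_distrib, c1, c2,
    c3, c4, c5, c6]
  have c7 : ∑ i, ∑ j, a2 i j * (l * d i (d j (divg d X)) * F)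
      = l * (∑ k, ∑ j, a2 k j * d k (d j (divg d X))) * F := by
    simp only [mul_sum, sum_mul]
    exact sum_congr rfl fun i _ => sum_congr rfl fun k _ => by ring
  have c8 : ∑ i, a1 i * (l * d i (divg d X) * F) = l * (∑ k, a1 k * d k (divg d X)) * F := by
    simp only [mul_sum, sum_mul]
    exact sum_congr rfl fun i _ => by ring
  have c9 : ∀ c : R, ∑ i, ∑ j, c * divg d X * a2 i j * d i (d j F)
      = c * divg d X * ∑ i, ∑ j, a2 i j * d i (d j F) := by
    intro c
    simp only [mul_sum]
    exact sum_congr rfl fun i _ => sum_congr rfl fun k _ => by ring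
  have c9' : ∑ i, ∑ j, a2 i j * (l * divg d X * d i (d j F))
      = l * divg d X * ∑ i, ∑ j, a2 i j * d i (d j F) := by
    simp only [mul_sum]
    exact sum_congr rfl fun i _ => sum_congr rfl fun k _ => by ring
  have c10 : ∀ c : R, ∑ i, c * divg d X * a1 i * d i F = c * divg d X * ∑ i, a1 i * d i F := by
    intro c
    simp only [mul_sum]
    exact sum_congr rfl fun i _ => by ring
  have c10' : ∑ i, a1 i * (l * divg d X * d i F) = l * divg d X * ∑ i, a1 i * d i F := by
    simp only [mul_sum]
    exact sum_congr rfl fun i _ => by ring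
  have c11 : ∑ i, 2 * l * (∑ k, a2 k i * d k (divg d X)) * d i F
      = 2 * ∑ i, l * (∑ k, a2 k i * d k (divg d X)) * d i F := by
    rw [mul_sum]
    exact sum_congr rfl fun i _ => by ring
  simp only [c7, c8, c9, c9', c10, c10', c11, lie0]
  ring

/-! ### Conformal vector fields -/

variable (d) in
/-- `X` is a conformal vector field of the metric `diag e`, with an affine conformal factor `s`. -/
structure IsConf (e : Fin n → R) (X : Fin n → R) (s : R) : Prop where
  sym : ∀ i j, e j * d i (X j) + e i * d j (X i) = if i = j then 2 * s * e i else 0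
  aff : ∀ i j, d i (d j s) = 0

omit hd in
lemma two_mul_cancel [CharZero K] {a b : R} (h : 2 * a = 2 * b) : a = b := by
  have h2 : algebraMap K R 2⁻¹ * 2 = 1 := by
    rw [← map_ofNat (algebraMap K R) 2, ← map_mul, inv_mul_cancel₀ two_ne_zero, map_one]
  calc a = algebraMap K R 2⁻¹ * (2 * a) := by rw [← mul_assoc, h2, one_mul]
    _ = algebraMap K R 2⁻¹ * (2 * b) := by rw [h]
    _ = b := by rw [← mul_assoc, h2, one_mul]

variable [CharZero K] {e : Fin n → R} (he : ∀ i j, d i (e j) = 0) (hee : ∀ i, e i * e i = 1)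
include he hee

lemma second_der_of_sym {X : Fin n → R} {s : R}
    (sym : ∀ i j, e j * d i (X j) + e i * d j (X i) = if i = j then 2 * s * e i else 0)
    (i j k : Fin n) :
    d i (d j (X k)) = e k * ((if j = k then e j * d i s else 0) + (if i = k then e i * d j s else 0)
      - if i = j then e i * d k s else 0) := by
  have key : ∀ i j k, e k * d i (d j (X k)) + e j * d i (d k (X j))
      = 2 * if j = k then e j * d i s else 0 := by
    intro i j k
    have h2 : d i (2 : R) = 0 := by
      have := Derivation.map_natCast (d i) 2; simpa using this
    have h := congrArg (d i) (sym j k)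
    rw [map_add, Derivation.leibniz, Derivation.leibniz, he, he] at h
    simp only [smul_eq_mul, mul_zero, add_zero] at h
    rw [h]
    split_ifs
    · simp only [Derivation.leibniz, he, h2, smul_eq_mul]; ring
    · simp
  have h : 2 * (e k * d i (d j (X k))) = 2 * ((if j = k then e j * d i s else 0)
      + (if i = k then e i * d j s else 0) - if i = j then e i * d k s else 0) := by
    have h1 := key i j k
    have h2 := key j i k
    have h3 := key k i j
    rw [hd j i] at h2
    rw [hd k i, hd k j] at h3
    linear_combination h1 + h2 - h3
  rw [← two_mul_cancel (K := K) h, ← mul_assoc, hee, one_mul]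

lemma IsConf.der {X : Fin n → R} {s : R} (h : IsConf d e X s) (i : Fin n) : d i (X i) = s := by
  have h1 := h.sym i i
  rw [if_pos rfl] at h1
  have h2 : 2 * (e i * d i (X i)) = 2 * (e i * s) := by linear_combination h1
  have h3 := two_mul_cancel (K := K) h2
  calc d i (X i) = e i * (e i * d i (X i)) := by rw [← mul_assoc, hee, one_mul]
    _ = s := by rw [h3, ← mul_assoc, hee, one_mul]

lemma IsConf.divg_eq {X : Fin n → R} {s : R} (h : IsConf d e X s) : divg d X = n * s := by
  simp [divg, h.der hd he hee]

/-- In dimension at least three the conformal factor of a conformal vector field is affine. -/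
lemma isConf_of_three_le (hn : 3 ≤ n) {X : Fin n → R} {s : R}
    (sym : ∀ i j, e j * d i (X j) + e i * d j (X i) = if i = j then 2 * s * e i else 0) :
    IsConf d e X s := by
  refine ⟨sym, ?_⟩
  have key := second_der_of_sym hd he hee sym
  have third : ∀ l i j k : Fin n, d l (d i (d j (X k)))
      = e k * ((if j = k then e j * d l (d i s) else 0) + (if i = k then e i * d l (d j s) else 0)
      - if i = j then e i * d l (d k s) else 0) := by
    intro l i j k
    rw [key i j k]
    split_ifs <;> simp [he]
  have exch : ∀ l i j k : Fin n,
      ((if j = k then e j * d l (d i s) else 0) + (if i = k then e i * d l (d j s) else 0)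
      - if i = j then e i * d l (d k s) else 0) =
      ((if j = k then e j * d i (d l s) else 0) + (if l = k then e l * d i (d j s) else 0)
      - if l = j then e l * d i (d k s) else 0) := by
    intro l i j k
    have h1 := third l i j k
    rw [hd l i, third i l j k] at h1
    have h2 := congrArg (fun z => e k * z) h1
    simp only [← mul_assoc, hee, one_mul] at h2
    exact h2.symm
  have ex3 : ∀ a b : Fin n, ∃ c, c ≠ a ∧ c ≠ b := by
    intro a b
    have : ({a, b} : Finset (Fin n)).card < (Finset.univ : Finset (Fin n)).card := by
      rw [Finset.card_univ, Fintype.card_fin]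
      exact lt_of_le_of_lt Finset.card_le_two (by omega)
    obtain ⟨c, -, hc⟩ := Finset.exists_mem_notMem_of_card_lt_card this
    simp only [Finset.mem_insert, Finset.mem_singleton, not_or] at hc
    exact ⟨c, hc.1, hc.2⟩
  have unit : ∀ i (z : R), e i * z = 0 → z = 0 := by
    intro i z h
    have := congrArg (fun z => e i * z) h
    simpa [← mul_assoc, hee] using this
  have off : ∀ l j, l ≠ j → d l (d j s) = 0 := by
    intro l j hlj
    obtain ⟨i, hil, hij⟩ := ex3 l j
    have := exch l i j i
    simp only [if_neg hij.symm, if_neg hij, if_neg hil.symm, if_neg hlj, if_true] at this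
    exact unit i _ (by linear_combination this)
  have diag : ∀ i j, i ≠ j → e i * d j (d j s) = - (e j * d i (d i s)) := by
    intro i j hij
    have := exch j i j i
    simp only [if_neg hij.symm, if_neg hij, if_true] at this
    linear_combination this
  intro i j
  by_cases hij : i = j
  · subst hij
    obtain ⟨k, hk, -⟩ := ex3 i i
    obtain ⟨l, hl, hl'⟩ := ex3 i k
    have f : ∀ a b, a ≠ b → e b * d b (d b s) = - (e a * d a (d a s)) := by
      intro a b hab
      have h1 := diag a b hab
      have h2 : e a * e b * (e a * d b (d b s)) = e a * e b * (- (e b * d a (d a s))) := by rw [h1]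
      have e1 := hee a
      have e2 := hee b
      linear_combination h2 - e b * d b (d b s) * e1 - e a * d a (d a s) * e2
    have h1 := f i k hk.symm
    have h2 := f k l hl'.symm
    have h3 := f l i hl
    have h4 : 2 * (e i * d i (d i s)) = 2 * 0 := by linear_combination h3 - h2 + h1
    exact unit i _ (two_mul_cancel (K := K) h4)
  · exact off i j hij

/-- The trace `∑ eᵢ aⁱⁱ`. -/
def trc (e : Fin n → R) (a : Fin n → Fin n → R) : R := ∑ i, e i * a i i

/-- The gradient `eᵢ ∂ᵢ t`. -/
def grad (d : Fin n → Derivation K R R) (e : Fin n → R) (t : R) (i : Fin n) : R := e i * d i t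

lemma IsConf.contract {X : Fin n → R} {s : R} (h : IsConf d e X s) {a : Fin n → Fin n → R}
    (ha : ∀ i j, a i j = a j i) (j : Fin n) :
    ∑ i, ∑ k, a i k * d i (d k (X j)) = 2 * ∑ k, a k j * d k s - trc e a * (e j * d j s) := by
  have e1 : ∀ i k, a i k * d i (d k (X j)) = (if k = j then a i j * d i s else 0)
      + (if i = j then a j k * d k s else 0) - (if i = k then e i * a i i * (e j * d j s) else 0) := by
    intro i k
    rw [second_der_of_sym hd he hee h.sym]
    have f1 : e j * (if k = j then e k * d i s else 0) = if k = j then d i s else 0 := by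
      split_ifs with hk
      · subst hk; rw [← mul_assoc, hee, one_mul]
      · simp
    have f2 : e j * (if i = j then e i * d k s else 0) = if i = j then d k s else 0 := by
      split_ifs with hi
      · subst hi; rw [← mul_assoc, hee, one_mul]
      · simp
    have g1 : a i k * (if k = j then d i s else 0) = if k = j then a i j * d i s else 0 := by
      split_ifs with hk
      · rw [hk]
      · simp
    have g2 : a i k * (if i = j then d k s else 0) = if i = j then a j k * d k s else 0 := by
      split_ifs with hi
      · rw [hi]
      · simp
    have g3 : a i k * (e j * if i = k then e i * d j s else 0)
        = if i = k then e i * a i i * (e j * d j s) else 0 := by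
      split_ifs with hi
      · subst hi; ring
      · simp
    linear_combination g1 + g2 - g3 + a i k * f1 + a i k * f2
  simp only [e1, sum_add_distrib, sum_sub_distrib, sum_ite_eq',
    sum_ite_eq, Finset.mem_univ, if_true, trc, sum_mul]
  rw [sum_comm (f := fun i k => if i = j then a j k * d k s else 0)]
  simp only [sum_ite_eq', Finset.mem_univ, if_true, ha j]
  ring

lemma IsConf.trc_lie2 {X : Fin n → R} {s : R} (h : IsConf d e X s) {a : Fin n → Fin n → R}
    (ha : ∀ i j, a i j = a j i) (w : R) :
    trc e (lie2 d w X a) = dirDer d X (trc e a) + (w * n - 2) * s * trc e a := by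
  have h1 : ∑ i, ∑ k, e i * (a i k * d k (X i)) = s * trc e a := by
    have h2 : 2 * ∑ i, ∑ k, e i * (a i k * d k (X i)) = 2 * (s * trc e a) := by
      rw [two_mul]
      nth_rewrite 2 [sum_comm]
      rw [← sum_add_distrib]
      simp only [← sum_add_distrib, trc, mul_sum]
      refine sum_congr rfl fun i _ => ?_
      have h3 : ∀ k, e i * (a i k * d k (X i)) + e k * (a k i * d i (X k))
          = if i = k then 2 * (s * (e i * a i i)) else 0 := by
        intro k
        rw [ha k i]
        have := h.sym i k
        split_ifs with hik
        · rw [if_pos hik] at this; subst hik; linear_combination a i i * this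
        · rw [if_neg hik] at this; linear_combination a i k * this
      simp [h3]
    exact two_mul_cancel (K := K) h2
  have h1' : ∑ i, ∑ k, e i * (a k i * d k (X i)) = s * trc e a := by
    rw [← h1]
    exact sum_congr rfl fun i _ => sum_congr rfl fun k _ => by rw [ha k i]
  have h2 : dirDer d X (trc e a) = ∑ i, e i * dirDer d X (a i i) := by
    have he' : ∀ i, dirDer d X (e i) = 0 := fun i => by simp [dirDer_apply, he]
    simp [trc, he']
  have h3 : trc e (lie2 d w X a) = ∑ i, (e i * dirDer d X (a i i) - ∑ k, e i * (a k i * d k (X i))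
      - ∑ k, e i * (a i k * d k (X i)) + w * divg d X * (e i * a i i)) := by
    refine sum_congr rfl fun i _ => ?_
    simp only [lie2, ← mul_sum]
    ring
  rw [h3]
  simp only [sum_add_distrib, sum_sub_distrib, h1, h1', ← h2]
  rw [← mul_sum, h.divg_eq hd he hee, show ∑ i, e i * a i i = trc e a from rfl]
  ring

lemma IsConf.grad_lie {X : Fin n → R} {s : R} (h : IsConf d e X s) {w : R}
    (hw : ∀ i, d i w = 0) (t : R) (i : Fin n) :
    grad d e (dirDer d X t + (w * n - 2) * s * t) i
      = lie1 d w X (grad d e t) i + (w * n - 2) * t * (e i * d i s) := by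
  have h1 : d i (dirDer d X t + (w * n - 2) * s * t) = dirDer d X (d i t) + ∑ k, d i (X k) * d k t
      + (w * n - 2) * (s * d i t + t * d i s) := by
    have h2 : d i (2 : R) = 0 := by
      have := Derivation.map_natCast (d i) 2; simpa using this
    simp only [map_add, der_dirDer hd, Derivation.leibniz, smul_eq_mul, map_sub, hw, h2,
      Derivation.map_natCast]
    ring
  have he' : dirDer d X (e i) = 0 := by simp [dirDer_apply, he]
  have h2 : ∑ k, e i * (d i (X k) * d k t) + ∑ k, grad d e t k * d k (X i) = 2 * s * grad d e t i := by
    rw [← sum_add_distrib]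
    have h3 : ∀ k, e i * (d i (X k) * d k t) + grad d e t k * d k (X i)
        = if i = k then 2 * s * grad d e t i else 0 := by
      intro k
      have h4 := h.sym i k
      have h5 := hee k
      have h6 := hee i
      simp only [grad]
      split_ifs with hik
      · rw [if_pos hik] at h4; subst hik
        linear_combination d i t * h4
      · rw [if_neg hik] at h4
        linear_combination (e i * e k * d k t) * h4 - (e i * d i (X k) * d k t) * h5
          - (e k * d k t * d k (X i)) * h6
    simp [h3]
  rw [← mul_sum] at h2
  simp only [lie1, h.divg_eq hd he hee]
  have h3 : grad d e (dirDer d X t + (w * n - 2) * s * t) i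
    = e i * d i (dirDer d X t + (w * n - 2) * s * t) := rfl
  have h4 : dirDer d X (grad d e t i) = e i * dirDer d X (d i t) := by
    simp [grad, he']
  rw [h3, h1, h4]
  have h5 : grad d e t i = e i * d i t := rfl
  rw [h5] at h2 ⊢
  linear_combination h2

/-! ### The equivariant quantization in flat coordinates -/

/-- The coefficients of order one of the quantization. -/
def quant1 (d : Fin n → Derivation K R R) (e : Fin n → R) (b1 b2 : R) (P2 : Fin n → Fin n → R)
    (P1 : Fin n → R) (i : Fin n) : R :=
  P1 i + b1 * divg2 d P2 i + b2 * grad d e (trc e P2) i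

/-- The coefficient of order zero of the quantization. -/
def quant0 (d : Fin n → Derivation K R R) (e : Fin n → R) (c b3 b4 : R) (P2 : Fin n → Fin n → R)
    (P1 : Fin n → R) (P0 : R) : R :=
  P0 + c * divg d P1 + b3 * divg d (divg2 d P2) + b4 * divg d (grad d e (trc e P2))

lemma lie_quant {l m b1 b2 b3 b4 c : R} (hl : ∀ i, d i l = 0) (hm : ∀ i, d i m = 0)
    (hb1 : ∀ i, d i b1 = 0) (hb2 : ∀ i, d i b2 = 0)
    (hb3 : ∀ i, d i b3 = 0) (hb4 : ∀ i, d i b4 = 0) (hc : ∀ i, d i c = 0)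
    (r1 : b1 * (n * (m - l - 1) - 2) = -2 - 2 * l * n)
    (r2 : b2 * ((m - l) * n - 2) = 1 - b1)
    (r3 : c * (m - l - 1) = -l)
    (r4 : b3 * (2 * n * (m - l - 1) - 2) = - (l * n * b1))
    (r5 : b3 + b4 * (n * (2 * (m - l) - 1) - 2) = - (l * n * b2))
    {X : Fin n → R} {s : R} (h : IsConf d e X s) {P2 : Fin n → Fin n → R}
    (hs : ∀ i j, P2 i j = P2 j i) (P1 : Fin n → R) (P0 F : R) :
    lie0 d m X (opr d P2 (quant1 d e b1 b2 P2 P1) (quant0 d e c b3 b4 P2 P1 P0) F)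
      - opr d P2 (quant1 d e b1 b2 P2 P1) (quant0 d e c b3 b4 P2 P1 P0) (lie0 d l X F)
      = opr d (lie2 d (m - l) X P2)
          (quant1 d e b1 b2 (lie2 d (m - l) X P2) (lie1 d (m - l) X P1))
          (quant0 d e c b3 b4 (lie2 d (m - l) X P2) (lie1 d (m - l) X P1)
            (lie0 d (m - l) X P0)) F := by
  have hw : ∀ i, d i (m - l) = 0 := fun i => by rw [map_sub, hl, hm, sub_zero]
  set w := m - l with hwdef
  have ds : ∀ k, d k (divg d X) = n * d k s := by
    intro k; rw [h.divg_eq hd he hee]; simp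
  have dds : ∀ k j, d k (d j (divg d X)) = 0 := by
    intro k j; rw [ds]; simp [h.aff]
  have hdiv2 : ∀ j, divg2 d (lie2 d w X P2) j = lie1 d w X (divg2 d P2) j
      + ((n * (w - 1) - 2) * ∑ k, P2 k j * d k s + trc e P2 * (e j * d j s)) := by
    intro j
    rw [divg2_lie2 hd hw, h.contract hd he hee hs]
    simp only [ds]
    have : ∑ i, P2 i j * (n * d i s) = n * ∑ i, P2 i j * d i s := by
      rw [mul_sum]; exact sum_congr rfl fun i _ => by ring
    rw [this]; ring
  have hgrad : ∀ j, grad d e (trc e (lie2 d w X P2)) j = lie1 d w X (grad d e (trc e P2)) j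
      + (w * n - 2) * trc e P2 * (e j * d j s) := by
    intro j
    rw [h.trc_lie2 hd he hee hs, h.grad_lie hd he hee hw]
  have lin1 : ∀ (a b : R) (u v : Fin n → R) (ha : ∀ i, d i a = 0) (hb : ∀ i, d i b = 0) (i : Fin n),
      lie1 d w X (fun i => P1 i + a * u i + b * v i) i
        = lie1 d w X P1 i + a * lie1 d w X u i + b * lie1 d w X v i := by
    intro a b u v ha hb i
    have ha' : dirDer d X a = 0 := by simp [dirDer_apply, ha]
    have hb' : dirDer d X b = 0 := by simp [dirDer_apply, hb]
    simp only [lie1, map_add, Derivation.leibniz, smul_eq_mul, ha', hb', add_mul,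
      sum_add_distrib, mul_assoc, ← mul_sum]
    ring
  have hsum : ∑ k, (quant1 d e b1 b2 P2 P1 k) * d k (divg d X)
      = n * ∑ k, P1 k * d k s + b1 * n * ∑ k, divg2 d P2 k * d k s
        + b2 * n * ∑ k, grad d e (trc e P2) k * d k s := by
    simp only [quant1, ds, mul_sum, ← sum_add_distrib]
    exact sum_congr rfl fun i _ => by ring
  rw [lie_opr hd hl X hs]
  have first : (fun i => lie1 d w X (quant1 d e b1 b2 P2 P1) i
      - ∑ k, ∑ j, P2 k j * d k (d j (X i)) - 2 * l * ∑ k, P2 k i * d k (divg d X))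
      = quant1 d e b1 b2 (lie2 d w X P2) (lie1 d w X P1) := by
    funext i
    have e1 := lin1 b1 b2 (divg2 d P2) (grad d e (trc e P2)) hb1 hb2 i
    have e2 : lie1 d w X (quant1 d e b1 b2 P2 P1) i = lie1 d w X P1 i
      + b1 * lie1 d w X (divg2 d P2) i + b2 * lie1 d w X (grad d e (trc e P2)) i := e1
    have e3 : ∑ k, P2 k i * d k (divg d X) = n * ∑ k, P2 k i * d k s := by
      simp only [ds, mul_sum]
      exact sum_congr rfl fun i _ => by ring
    rw [e2, h.contract hd he hee hs, e3, quant1, hdiv2, hgrad]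
    linear_combination (-(∑ k, P2 k i * d k s)) * r1 - (trc e P2 * (e i * d i s)) * r2
  have zero : lie0 d w X (quant0 d e c b3 b4 P2 P1 P0)
      - l * ∑ k, quant1 d e b1 b2 P2 P1 k * d k (divg d X)
      - l * ∑ k, ∑ j, P2 k j * d k (d j (divg d X))
      = quant0 d e c b3 b4 (lie2 d w X P2) (lie1 d w X P1) (lie0 d w X P0) := by
    have cst : ∀ a : R, (∀ i, d i a = 0) → dirDer d X a = 0 := fun a ha => by
      simp [dirDer_apply, ha]
    have d2 : ∀ i, d i (2 : R) = 0 := fun i => by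
      have := Derivation.map_natCast (d i) 2; simpa using this
    have z1 : divg d (lie1 d w X P1) = lie0 d w X (divg d P1) + (w - 1) * n * ∑ k, P1 k * d k s := by
      rw [divg_lie1 hd hw]
      simp only [ds, mul_sum]
      congr 1
      exact sum_congr rfl fun i _ => by ring
    have z2 : divg d (divg2 d (lie2 d w X P2)) = lie0 d w X (divg d (divg2 d P2))
        + ((w - 1) * n + (n * (w - 1) - 2)) * ∑ k, divg2 d P2 k * d k s
        + ∑ k, grad d e (trc e P2) k * d k s := by
      have y1 : divg d (divg2 d (lie2 d w X P2)) = divg d (lie1 d w X (divg2 d P2))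
          + ∑ j, d j ((n * (w - 1) - 2) * ∑ k, P2 k j * d k s + trc e P2 * (e j * d j s)) := by
        simp only [divg, hdiv2, map_add, sum_add_distrib]
      have y2 : ∀ j, d j ((n * (w - 1) - 2) * ∑ k, P2 k j * d k s + trc e P2 * (e j * d j s))
          = (n * (w - 1) - 2) * ∑ k, d j (P2 j k) * d k s + grad d e (trc e P2) j * d j s := by
        intro j
        simp only [map_add, map_sub, map_sum, Derivation.leibniz, smul_eq_mul, hw, d2, h.aff, he,
          Derivation.map_natCast, Derivation.map_one_eq_zero, grad, hs j]
        simp only [mul_comm (d j (P2 _ j))]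
        simp only [mul_zero, zero_add, add_zero, sub_self, zero_mul]
        ring
      have y3 : ∑ j, ∑ k, d j (P2 j k) * d k s = ∑ k, divg2 d P2 k * d k s := by
        rw [sum_comm]
        refine sum_congr rfl fun k _ => ?_
        rw [divg2, sum_mul]
      rw [y1, divg_lie1 hd hw]
      simp only [y2, sum_add_distrib]
      rw [← mul_sum, y3]
      simp only [ds]
      have y4 : ∑ k, divg2 d P2 k * (n * d k s) = n * ∑ k, divg2 d P2 k * d k s := by
        rw [mul_sum]; exact sum_congr rfl fun i _ => by ring
      rw [y4]; ring
    have z3 : divg d (grad d e (trc e (lie2 d w X P2))) = lie0 d w X (divg d (grad d e (trc e P2)))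
        + ((w - 1) * n + (w * n - 2)) * ∑ k, grad d e (trc e P2) k * d k s := by
      have y1 : divg d (grad d e (trc e (lie2 d w X P2)))
          = divg d (lie1 d w X (grad d e (trc e P2)))
          + ∑ j, d j ((w * n - 2) * trc e P2 * (e j * d j s)) := by
        simp only [divg, hgrad, map_add, sum_add_distrib]
      have y2 : ∀ j, d j ((w * n - 2) * trc e P2 * (e j * d j s))
          = (w * n - 2) * (grad d e (trc e P2) j * d j s) := by
        intro j
        simp only [map_sub, Derivation.leibniz, smul_eq_mul, hw, d2, h.aff, he,
          Derivation.map_natCast, grad]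
        ring
      rw [y1, divg_lie1 hd hw]
      simp only [y2, ds]
      rw [← mul_sum]
      have y4 : ∑ k, grad d e (trc e P2) k * (n * d k s)
          = n * ∑ k, grad d e (trc e P2) k * d k s := by
        rw [mul_sum]; exact sum_congr rfl fun i _ => by ring
      rw [y4]; ring
    have z4 : lie0 d w X (quant0 d e c b3 b4 P2 P1 P0) = lie0 d w X P0 + c * lie0 d w X (divg d P1)
        + b3 * lie0 d w X (divg d (divg2 d P2))
        + b4 * lie0 d w X (divg d (grad d e (trc e P2))) := by
      simp only [lie0, quant0, map_add, Derivation.leibniz, smul_eq_mul, cst c hc, cst b3 hb3,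
        cst b4 hb4]
      ring
    have z5 : ∑ k, ∑ j, P2 k j * d k (d j (divg d X)) = 0 := by simp [dds]
    rw [z4, hsum, z5, quant0, z1, z2, z3]
    linear_combination (-(n * ∑ k, P1 k * d k s)) * r3 - (∑ k, divg2 d P2 k * d k s) * r4
      - (∑ k, grad d e (trc e P2) k * d k s) * r5
  rw [first, zero]

end Algebra

/-! ### The Casimir operator -/

section Casimir

variable {K R : Type*} [Field K] [CommRing R] [Algebra K R] {n : ℕ} {d : Fin n → Derivation K R R}

/-- The second derivatives `∂ₗ∂ₘ` of `|x|² eⁱʲ - 2 xⁱ xʲ`. -/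
def casCoeff (e : Fin n → R) (i j l m : Fin n) : R :=
  2 * ((if l = m then if i = j then e l * e i else 0 else 0)
    - (if i = l then if j = m then 1 else 0 else 0) - (if i = m then if j = l then 1 else 0 else 0))

variable (d) in
/-- The tensor `∑ Yᵣ ⊗ Zᵣ` has the two-jet of the Casimir element of the conformal Lie algebra along
the diagonal. -/
structure IsCasimir {ι : Type*} [Fintype ι] (e : Fin n → R) (Y Z : ι → Fin n → R) : Prop where
  zero : ∀ i j, ∑ r, Y r i * Z r j = 0
  one : ∀ l i j, ∑ r, d l (Y r i) * Z r j = 0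
  two : ∀ l m i j, ∑ r, d l (d m (Y r i)) * Z r j = casCoeff e i j l m

variable {ι : Type*} [Fintype ι] {e : Fin n → R} {Y Z : ι → Fin n → R}
  (h : IsCasimir d e Y Z) (hd : ∀ i j F, d i (d j F) = d j (d i F))
  (he : ∀ i j, d i (e j) = 0) (hee : ∀ i, e i * e i = 1)
include h hd he hee

lemma IsCasimir.one' (l i j : Fin n) : ∑ r, Y r i * d l (Z r j) = 0 := by
  have h1 := congrArg (d l) (h.zero i j)
  simp only [map_sum, Derivation.leibniz, smul_eq_mul, map_zero, sum_add_distrib] at h1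
  have h2 := h.one l i j
  have h3 : ∑ r, d l (Y r i) * Z r j = ∑ r, Z r j * d l (Y r i) :=
    sum_congr rfl fun r _ => mul_comm _ _
  rw [← h3, h2, add_zero] at h1
  exact h1

lemma IsCasimir.mixed (l m i j : Fin n) :
    ∑ r, d l (Y r i) * d m (Z r j) = - casCoeff e i j m l := by
  have h1 := congrArg (d m) (h.one l i j)
  simp only [map_sum, Derivation.leibniz, smul_eq_mul, map_zero, sum_add_distrib] at h1
  have h2 := h.two m l i j
  have h3 : ∑ r, d m (d l (Y r i)) * Z r j = ∑ r, Z r j * d m (d l (Y r i)) :=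
    sum_congr rfl fun r _ => mul_comm _ _
  rw [← h3, h2] at h1
  linear_combination h1

lemma IsCasimir.two' (l m i j : Fin n) :
    ∑ r, Y r i * d l (d m (Z r j)) = casCoeff e i j m l := by
  have h1 := congrArg (d l) (h.one' hd he hee m i j)
  simp only [map_sum, Derivation.leibniz, smul_eq_mul, map_zero, sum_add_distrib] at h1
  have h2 := h.mixed hd he hee l m i j
  have h3 : ∑ r, d l (Y r i) * d m (Z r j) = ∑ r, d m (Z r j) * d l (Y r i) :=
    sum_congr rfl fun r _ => mul_comm _ _
  rw [← h3, h2] at h1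
  linear_combination h1

lemma IsCasimir.dirDer_dirDer (F : R) : ∑ r, dirDer d (Y r) (dirDer d (Z r) F) = 0 := by
  have e1 : ∀ r, dirDer d (Y r) (dirDer d (Z r) F)
      = ∑ a, ∑ b, ((Y r a * Z r b) * d a (d b F) + (Y r a * d a (Z r b)) * d b F) := by
    intro r
    rw [dirDer_apply]
    refine sum_congr rfl fun a _ => ?_
    rw [dirDer_apply, map_sum, mul_sum]
    refine sum_congr rfl fun b _ => ?_
    rw [Derivation.leibniz, smul_eq_mul, smul_eq_mul]; ring
  simp only [e1]
  rw [sum_comm]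
  refine sum_eq_zero fun a _ => ?_
  rw [sum_comm]
  refine sum_eq_zero fun b _ => ?_
  rw [sum_add_distrib, ← sum_mul, ← sum_mul, h.zero, h.one' hd he hee]
  ring

lemma IsCasimir.dirDer_mul_der (F G : R) (k j : Fin n) :
    ∑ r, dirDer d (Y r) F * (d k (Z r j) * G) = 0 := by
  have e1 : ∀ r, dirDer d (Y r) F * (d k (Z r j) * G) = ∑ a, (Y r a * d k (Z r j)) * (d a F * G) := by
    intro r
    simp only [dirDer_apply, sum_mul]
    exact sum_congr rfl fun a _ => by ring
  simp only [e1]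
  rw [sum_comm]
  refine sum_eq_zero fun a _ => ?_
  rw [← sum_mul, h.one' hd he hee, zero_mul]

lemma IsCasimir.der_mul_dirDer (F G : R) (k j : Fin n) :
    ∑ r, d k (Y r j) * (dirDer d (Z r) F * G) = 0 := by
  have e1 : ∀ r, d k (Y r j) * (dirDer d (Z r) F * G) = ∑ a, (d k (Y r j) * Z r a) * (d a F * G) := by
    intro r
    simp only [dirDer_apply, sum_mul, mul_sum]
    exact sum_congr rfl fun a _ => by ring
  simp only [e1]
  rw [sum_comm]
  refine sum_eq_zero fun a _ => ?_
  rw [← sum_mul, h.one, zero_mul]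

omit h hd he in
lemma sum_casCoeff (k j : Fin n) :
    ∑ a, casCoeff e a j k a = if j = k then -(2 * (n : R)) else 0 := by
  have e1 : ∀ a, casCoeff e a j k a = 2 * ((if k = a then if a = j then e k * e a else 0 else 0)
      - (if a = k then if j = a then 1 else 0 else 0) - if j = k then 1 else 0) := by
    intro a; simp [casCoeff]
  simp only [e1, ← mul_sum, sum_sub_distrib, sum_ite_eq, sum_ite_eq',
    Finset.mem_univ, if_true, Finset.sum_const, Finset.card_univ, Fintype.card_fin]
  by_cases hjk : j = k
  · subst hjk; simp [hee]
  · simp [hjk, Ne.symm hjk]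

omit h hd he hee in
lemma casCoeff_symm (i j l m : Fin n) : casCoeff e i j l m = casCoeff e i j m l := by
  simp only [casCoeff]
  have : (if l = m then if i = j then e l * e i else 0 else 0)
      = if m = l then if i = j then e m * e i else 0 else 0 := by
    by_cases hlm : l = m
    · subst hlm; rfl
    · rw [if_neg hlm, if_neg (Ne.symm hlm)]
  rw [this]; ring

omit h hd he hee in
lemma casCoeff_swap (i j l m : Fin n) : casCoeff e i j l m = casCoeff e j i l m := by
  simp only [casCoeff]
  have : (if i = j then e l * e i else 0) = if j = i then e l * e j else 0 := by
    by_cases hlm : i = j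
    · subst hlm; rfl
    · rw [if_neg hlm, if_neg (Ne.symm hlm)]
  rw [this]
  have t : ∀ a b c f : Fin n, (if a = b then if c = f then (1:R) else 0 else 0)
      = if c = f then if a = b then 1 else 0 else 0 := by
    intro a b c f; split_ifs <;> rfl
  rw [t i l j m, t i m j l]; ring

lemma IsCasimir.dirDer_der (k j : Fin n) (G : R) :
    ∑ r, dirDer d (Y r) (d k (Z r j)) * G = if j = k then -(2 * (n : R)) * G else 0 := by
  have e1 : ∀ r, dirDer d (Y r) (d k (Z r j)) * G = ∑ a, (Y r a * d a (d k (Z r j))) * G := by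
    intro r
    simp only [dirDer_apply, sum_mul]
  simp only [e1]
  rw [sum_comm]
  simp only [← sum_mul, h.two' hd he hee, sum_casCoeff hee]
  split_ifs <;> simp

lemma IsCasimir.dirDer_divg (G : R) :
    ∑ r, dirDer d (Y r) (divg d (Z r)) * G = -(2 * n * n) * G := by
  have e1 : ∀ r, dirDer d (Y r) (divg d (Z r)) * G = ∑ k, dirDer d (Y r) (d k (Z r k)) * G := by
    intro r; simp only [divg, map_sum, sum_mul]
  simp only [e1]
  rw [sum_comm]
  simp only [h.dirDer_der hd he hee]
  simp; ring

lemma IsCasimir.der_divg (k j : Fin n) (G : R) :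
    ∑ r, d k (Y r j) * (divg d (Z r) * G) = if j = k then 2 * (n : R) * G else 0 := by
  have e1 : ∀ r, d k (Y r j) * (divg d (Z r) * G) = ∑ a, (d k (Y r j) * d a (Z r a)) * G := by
    intro r
    simp only [divg, sum_mul, mul_sum]
    exact sum_congr rfl fun a _ => by ring
  simp only [e1]
  rw [sum_comm]
  simp only [← sum_mul, h.mixed hd he hee]
  have e2 : ∀ a, -casCoeff e j a a k = - casCoeff e a j k a := fun a => by
    rw [casCoeff_symm, casCoeff_swap]
  simp only [e2, sum_neg_distrib, sum_casCoeff hee]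
  split_ifs <;> simp

lemma IsCasimir.divg_der (k j : Fin n) (G : R) :
    ∑ r, divg d (Y r) * (d k (Z r j) * G) = if j = k then 2 * (n : R) * G else 0 := by
  have e1 : ∀ r, divg d (Y r) * (d k (Z r j) * G) = ∑ a, (d a (Y r a) * d k (Z r j)) * G := by
    intro r
    simp only [divg, sum_mul]
    exact sum_congr rfl fun a _ => by ring
  simp only [e1]
  rw [sum_comm]
  simp only [← sum_mul, h.mixed hd he hee, sum_neg_distrib, sum_casCoeff hee]
  split_ifs <;> simp

lemma IsCasimir.divg_divg (G : R) :
    ∑ r, divg d (Y r) * (divg d (Z r) * G) = 2 * n * n * G := by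
  have e1 : ∀ r, divg d (Y r) * (divg d (Z r) * G)
      = ∑ k, divg d (Y r) * (d k (Z r k) * G) := by
    intro r
    simp only [divg, sum_mul, mul_sum]
  simp only [e1]
  rw [sum_comm]
  simp only [h.divg_der hd he hee]
  simp; ring

lemma IsCasimir.divg_dirDer (F G : R) :
    ∑ r, divg d (Y r) * (dirDer d (Z r) F * G) = 0 := by
  have e1 : ∀ r, divg d (Y r) * (dirDer d (Z r) F * G)
      = ∑ k, d k (Y r k) * (dirDer d (Z r) F * G) := by
    intro r; simp only [divg, sum_mul]
  simp only [e1]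
  rw [sum_comm]
  simp [h.der_mul_dirDer hd he hee]

lemma IsCasimir.dirDer_mul_divg (F G : R) :
    ∑ r, dirDer d (Y r) F * (divg d (Z r) * G) = 0 := by
  have e1 : ∀ r, dirDer d (Y r) F * (divg d (Z r) * G)
      = ∑ k, dirDer d (Y r) F * (d k (Z r k) * G) := by
    intro r; simp only [divg, sum_mul, mul_sum]
  simp only [e1]
  rw [sum_comm]
  simp [h.dirDer_mul_der hd he hee]

lemma IsCasimir.der_der (l m i j : Fin n) (G : R) :
    ∑ r, d l (Y r i) * (d m (Z r j) * G) = - casCoeff e i j l m * G := by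
  simp only [← mul_assoc, ← sum_mul, h.mixed hd he hee]
  rw [casCoeff_symm]

/-- The Casimir operator on scalar densities. -/
lemma IsCasimir.lie0_lie0 {w : R} (hw : ∀ i, d i w = 0) (F : R) :
    ∑ r, lie0 d w (Y r) (lie0 d w (Z r) F) = 2 * n * n * w * (w - 1) * F := by
  have hw' : ∀ X, dirDer d X w = 0 := fun X => by simp [dirDer_apply, hw]
  have e1 : ∀ r, lie0 d w (Y r) (lie0 d w (Z r) F) = dirDer d (Y r) (dirDer d (Z r) F)
      + w * (dirDer d (Y r) (divg d (Z r)) * F) + w * (dirDer d (Y r) F * (divg d (Z r) * 1))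
      + w * (divg d (Y r) * (dirDer d (Z r) F * 1))
      + w * w * (divg d (Y r) * (divg d (Z r) * F)) := by
    intro r
    simp only [lie0, map_add, Derivation.leibniz, hw', smul_eq_mul]
    ring
  simp only [e1, sum_add_distrib, ← mul_sum, h.dirDer_dirDer hd he hee,
    h.dirDer_divg hd he hee, h.dirDer_mul_divg hd he hee, h.divg_dirDer hd he hee,
    h.divg_divg hd he hee]
  ring

/-- The Casimir operator on vector fields with values in densities. -/
lemma IsCasimir.lie1_lie1 {w : R} (hw : ∀ i, d i w = 0) (v : Fin n → R) (i : Fin n) :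
    ∑ r, lie1 d w (Y r) (lie1 d w (Z r) v) i
      = (2 * n * n * w * (w - 1) + 4 * n * (1 - w)) * v i := by
  have hw' : ∀ X, dirDer d X w = 0 := fun X => by simp [dirDer_apply, hw]
  have e1 : ∀ r, lie1 d w (Y r) (lie1 d w (Z r) v) i = dirDer d (Y r) (dirDer d (Z r) (v i))
      - ∑ k, dirDer d (Y r) (v k) * (d k (Z r i) * 1)
      - ∑ k, dirDer d (Y r) (d k (Z r i)) * v k
      + w * (dirDer d (Y r) (divg d (Z r)) * v i) + w * (dirDer d (Y r) (v i) * (divg d (Z r) * 1))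
      - ∑ k, d k (Y r i) * (dirDer d (Z r) (v k) * 1)
      + ∑ k, ∑ l, d k (Y r i) * (d l (Z r k) * v l)
      - w * (∑ k, d k (Y r i) * (divg d (Z r) * v k))
      + w * (divg d (Y r) * (dirDer d (Z r) (v i) * 1))
      - w * (∑ k, divg d (Y r) * (d k (Z r i) * v k))
      + w * w * (divg d (Y r) * (divg d (Z r) * v i)) := by
    intro r
    simp only [lie1, map_add, map_sub, map_sum, Derivation.leibniz, hw', smul_eq_mul,
      sum_add_distrib, sum_sub_distrib, add_mul, sub_mul]
    have f1 : ∑ k, (∑ l, v l * d l (Z r k)) * d k (Y r i)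
        = ∑ k, ∑ l, d k (Y r i) * (d l (Z r k) * v l) := by
      simp only [sum_mul]
      exact sum_congr rfl fun a _ => sum_congr rfl fun b _ => by ring
    have f2 : ∑ k, w * divg d (Z r) * v k * d k (Y r i)
        = w * (∑ k, d k (Y r i) * (divg d (Z r) * v k)) := by
      rw [mul_sum]; exact sum_congr rfl fun a _ => by ring
    have f3 : ∑ k, divg d (Y r) * (d k (Z r i) * v k) = divg d (Y r) * ∑ k, v k * d k (Z r i) := by
      rw [mul_sum]; exact sum_congr rfl fun a _ => by ring
    have f4 : ∑ k, v k * dirDer d (Y r) (d k (Z r i)) = ∑ k, dirDer d (Y r) (d k (Z r i)) * v k :=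
      sum_congr rfl fun a _ => by ring
    have f5 : ∑ k, d k (Z r i) * dirDer d (Y r) (v k)
        = ∑ k, dirDer d (Y r) (v k) * (d k (Z r i) * 1) :=
      sum_congr rfl fun a _ => by ring
    have f6 : ∑ k, dirDer d (Z r) (v k) * d k (Y r i)
        = ∑ k, d k (Y r i) * (dirDer d (Z r) (v k) * 1) :=
      sum_congr rfl fun a _ => by ring
    rw [f1, f2, f3, f4, f5, f6]
    ring
  have s1 : ∀ f : ι → Fin n → R, ∑ r, ∑ k, f r k = ∑ k, ∑ r, f r k := fun f => sum_comm
  have s2 : ∀ f : ι → Fin n → Fin n → R,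
      ∑ r, ∑ k, ∑ l, f r k l = ∑ k, ∑ l, ∑ r, f r k l := fun f => by
    rw [sum_comm]
    exact sum_congr rfl fun k _ => sum_comm
  have s3 : ∀ f : ι → R, ∑ r, w * f r = w * ∑ r, f r := fun f => (mul_sum _ _ _).symm
  have s4 : ∀ f : ι → R, ∑ r, w * w * f r = w * w * ∑ r, f r := fun f =>
    (mul_sum _ _ _).symm
  simp only [e1, sum_add_distrib, sum_sub_distrib, s3, s4, s2]
  simp only [s1, h.dirDer_dirDer hd he hee,
    h.dirDer_divg hd he hee, h.dirDer_mul_divg hd he hee, h.divg_dirDer hd he hee,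
    h.divg_divg hd he hee, h.dirDer_mul_der hd he hee, h.der_mul_dirDer hd he hee,
    h.dirDer_der hd he hee, h.der_divg hd he hee, h.divg_der hd he hee, h.der_der hd he hee]
  have f1 : ∑ k, ∑ l, -casCoeff e i k k l * v l = 2 * n * v i := by
    rw [sum_comm]
    simp only [← sum_mul, sum_neg_distrib]
    have : ∀ l, ∑ k, casCoeff e i k k l = if i = l then -(2 * (n : R)) else 0 := fun l => by
      rw [← sum_casCoeff hee]
      exact sum_congr rfl fun k _ => by rw [casCoeff_symm, casCoeff_swap]
    simp only [this]
    simp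
  rw [f1]
  simp
  ring

/-- The Casimir operator on symmetric contravariant tensors with values in densities. -/
lemma IsCasimir.lie2_lie2 {w : R} (hw : ∀ i, d i w = 0) {a : Fin n → Fin n → R}
    (ha : ∀ i j, a i j = a j i) (i j : Fin n) :
    ∑ r, lie2 d w (Y r) (lie2 d w (Z r) a) i j
      = (2 * n * n * w * (w - 1) + 8 * (n * (1 - w) + 1)) * a i j
        - if i = j then 4 * (e i * trc e a) else 0 := by
  have hw' : ∀ X, dirDer d X w = 0 := fun X => by simp [dirDer_apply, hw]
  have e1 : ∀ r, lie2 d w (Y r) (lie2 d w (Z r) a) i j = dirDer d (Y r) (dirDer d (Z r) (a i j))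
      - ∑ k, dirDer d (Y r) (a k j) * (d k (Z r i) * 1)
      - ∑ k, dirDer d (Y r) (d k (Z r i)) * a k j
      - ∑ k, dirDer d (Y r) (a i k) * (d k (Z r j) * 1)
      - ∑ k, dirDer d (Y r) (d k (Z r j)) * a i k
      + w * (dirDer d (Y r) (divg d (Z r)) * a i j)
      + w * (dirDer d (Y r) (a i j) * (divg d (Z r) * 1))
      - ∑ k, d k (Y r i) * (dirDer d (Z r) (a k j) * 1)
      + ∑ k, ∑ l, d k (Y r i) * (d l (Z r k) * a l j)
      + ∑ k, ∑ l, d k (Y r i) * (d l (Z r j) * a k l)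
      - w * (∑ k, d k (Y r i) * (divg d (Z r) * a k j))
      - ∑ k, d k (Y r j) * (dirDer d (Z r) (a i k) * 1)
      + ∑ k, ∑ l, d k (Y r j) * (d l (Z r i) * a l k)
      + ∑ k, ∑ l, d k (Y r j) * (d l (Z r k) * a i l)
      - w * (∑ k, d k (Y r j) * (divg d (Z r) * a i k))
      + w * (divg d (Y r) * (dirDer d (Z r) (a i j) * 1))
      - w * (∑ k, divg d (Y r) * (d k (Z r i) * a k j))
      - w * (∑ k, divg d (Y r) * (d k (Z r j) * a i k))
      + w * w * (divg d (Y r) * (divg d (Z r) * a i j)) := by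
    intro r
    have f1 : ∀ (u : Fin n → R) (p q : Fin n), ∑ k, dirDer d (Y r) (u k * d k (Z r p))
        = ∑ k, dirDer d (Y r) (u k) * (d k (Z r p) * 1)
          + ∑ k, dirDer d (Y r) (d k (Z r p)) * u k := by
      intro u p q
      rw [← sum_add_distrib]
      refine sum_congr rfl fun k _ => ?_
      rw [Derivation.leibniz, smul_eq_mul, smul_eq_mul]; ring
    have f2 : ∑ k, lie2 d w (Z r) a k j * d k (Y r i)
        = ∑ k, d k (Y r i) * (dirDer d (Z r) (a k j) * 1)
          - ∑ k, ∑ l, d k (Y r i) * (d l (Z r k) * a l j)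
          - ∑ k, ∑ l, d k (Y r i) * (d l (Z r j) * a k l)
          + w * (∑ k, d k (Y r i) * (divg d (Z r) * a k j)) := by
      rw [mul_sum, ← sum_sub_distrib, ← sum_sub_distrib,
        ← sum_add_distrib]
      refine sum_congr rfl fun k _ => ?_
      rw [← mul_sum, ← mul_sum]
      simp only [lie2]
      simp only [mul_comm (a _ j), mul_comm (a k _)]
      ring
    have f3 : ∑ k, lie2 d w (Z r) a i k * d k (Y r j)
        = ∑ k, d k (Y r j) * (dirDer d (Z r) (a i k) * 1)
          - ∑ k, ∑ l, d k (Y r j) * (d l (Z r i) * a l k)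
          - ∑ k, ∑ l, d k (Y r j) * (d l (Z r k) * a i l)
          + w * (∑ k, d k (Y r j) * (divg d (Z r) * a i k)) := by
      rw [mul_sum, ← sum_sub_distrib, ← sum_sub_distrib,
        ← sum_add_distrib]
      refine sum_congr rfl fun k _ => ?_
      rw [← mul_sum, ← mul_sum]
      simp only [lie2]
      simp only [mul_comm (a _ k), mul_comm (a i _)]
      ring
    have f4 : ∀ (u : Fin n → R) (p : Fin n), ∑ k, divg d (Y r) * (d k (Z r p) * u k)
        = divg d (Y r) * ∑ k, u k * d k (Z r p) := by
      intro u p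
      rw [mul_sum]; exact sum_congr rfl fun k _ => by ring
    have f5 : lie2 d w (Y r) (lie2 d w (Z r) a) i j = dirDer d (Y r) (lie2 d w (Z r) a i j)
      - ∑ k, lie2 d w (Z r) a k j * d k (Y r i) - ∑ k, lie2 d w (Z r) a i k * d k (Y r j)
      + w * divg d (Y r) * lie2 d w (Z r) a i j := rfl
    rw [f5, f2, f3, f4 (fun k => a k j), f4 (fun k => a i k)]
    simp only [lie2, map_add, map_sub, map_sum, f1 (fun k => a k j) i i, f1 (fun k => a i k) j j]
    simp only [Derivation.leibniz, hw', smul_eq_mul]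
    ring
  have s1 : ∀ f : ι → Fin n → R, ∑ r, ∑ k, f r k = ∑ k, ∑ r, f r k := fun f => sum_comm
  have s2 : ∀ f : ι → Fin n → Fin n → R,
      ∑ r, ∑ k, ∑ l, f r k l = ∑ k, ∑ l, ∑ r, f r k l := fun f => by
    rw [sum_comm]
    exact sum_congr rfl fun k _ => sum_comm
  have s3 : ∀ f : ι → R, ∑ r, w * f r = w * ∑ r, f r := fun f => (mul_sum _ _ _).symm
  have s4 : ∀ f : ι → R, ∑ r, w * w * f r = w * w * ∑ r, f r := fun f =>
    (mul_sum _ _ _).symm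
  simp only [e1, sum_add_distrib, sum_sub_distrib, s3, s4, s2]
  simp only [s1, h.dirDer_dirDer hd he hee,
    h.dirDer_divg hd he hee, h.dirDer_mul_divg hd he hee, h.divg_dirDer hd he hee,
    h.divg_divg hd he hee, h.dirDer_mul_der hd he hee, h.der_mul_dirDer hd he hee,
    h.dirDer_der hd he hee, h.der_divg hd he hee, h.divg_der hd he hee, h.der_der hd he hee]
  have f1 : ∀ (p : Fin n) (u : Fin n → R), ∑ k, ∑ l, -casCoeff e p k k l * u l = 2 * n * u p := by
    intro p u
    rw [sum_comm]
    simp only [← sum_mul, sum_neg_distrib]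
    have : ∀ l, ∑ k, casCoeff e p k k l = if p = l then -(2 * (n : R)) else 0 := fun l => by
      rw [← sum_casCoeff hee]
      exact sum_congr rfl fun k _ => by rw [casCoeff_symm, casCoeff_swap]
    simp only [this]
    simp
  have f2 : ∀ p q : Fin n, ∑ k, ∑ l, -casCoeff e p q k l * a k l
      = 4 * a p q - if p = q then 2 * (e p * trc e a) else 0 := by
    intro p q
    have g1 : ∀ k l, -casCoeff e p q k l * a k l =
        (if p = k then if q = l then 2 * a k l else 0 else 0)
        + (if p = l then if q = k then 2 * a k l else 0 else 0)
        - (if k = l then if p = q then 2 * (e p * (e k * a k k)) else 0 else 0) := by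
      intro k l
      simp only [casCoeff]
      split_ifs <;> subst_vars <;> ring
    simp only [g1, sum_add_distrib, sum_sub_distrib, sum_ite_eq,
      Finset.mem_univ, if_true]
    have g2 : ∑ k, ∑ l, (if p = k then if q = l then 2 * a k l else 0 else 0) = 2 * a p q := by
      rw [Finset.sum_eq_single p]
      · simp
      · intro b _ hb; simp [hb.symm]
      · simp
    rw [g2, ha q p]
    have g4 : ∑ k, (if p = q then 2 * (e p * (e k * a k k)) else 0)
        = if p = q then 2 * (e p * trc e a) else 0 := by
      split_ifs
      · simp only [trc, mul_sum]
      · simp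
    rw [g4]; ring
  have f3 : ∑ k, ∑ l, -casCoeff e j i k l * a l k
      = 4 * a i j - if i = j then 2 * (e i * trc e a) else 0 := by
    have : ∀ k l, -casCoeff e j i k l * a l k = -casCoeff e j i k l * a k l := fun k l => by
      rw [ha]
    simp only [this, f2, ha j i]
    by_cases hij : i = j
    · subst hij; rfl
    · rw [if_neg hij, if_neg (Ne.symm hij)]
  rw [f1 i (fun l => a l j), f1 j (fun l => a i l), f2, f3]
  simp only [sum_ite_eq, Finset.mem_univ, if_true, sum_const_zero]
  split_ifs <;> ring

end Casimir

/-! ### Germs of smooth functions -/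

section Germs

open Filter

variable {n : ℕ} {𝕜 : Type*} [RCLike 𝕜]

/-- The partial derivative `∂F/∂yⁱ`. -/
def pd (i : Fin n) (F : Model n → 𝕜) (y : Model n) : 𝕜 := fderiv ℝ F y (basisVec n i)

lemma contDiffAt_pd {F : Model n → 𝕜} {y : Model n} (hF : ContDiffAt ℝ ∞ F y) (i : Fin n) :
    ContDiffAt ℝ ∞ (pd i F) y :=
  (hF.fderiv_right (m := ∞) (by simp)).clm_apply contDiffAt_const

lemma eventually_differentiableAt {F : Model n → 𝕜} {y : Model n} (hF : ContDiffAt ℝ ∞ F y) :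
    ∀ᶠ z in 𝓝 y, DifferentiableAt ℝ F z := by
  have h1 : ContDiffAt ℝ 1 F y := hF.of_le (by exact_mod_cast le_top)
  filter_upwards [h1.eventually (by simp)] with z hz
  exact hz.differentiableAt (by simp)

lemma pd_congr {F G : Model n → 𝕜} {y : Model n} (h : F =ᶠ[𝓝 y] G) (i : Fin n) :
    pd i F =ᶠ[𝓝 y] pd i G := by
  filter_upwards [h.fderiv (𝕜 := ℝ)] with z hz
  simp only [pd, hz]

lemma sum_basisVec (u : Model n) : u = ∑ i, u i • basisVec n i := by
  ext j
  simp [basisVec, Finset.sum_apply, Pi.single_apply]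

lemma fderiv_eq_sum_pd (F : Model n → 𝕜) (y u : Model n) :
    fderiv ℝ F y u = ∑ i, (u i : 𝕜) * pd i F y := by
  conv_lhs => rw [sum_basisVec u]
  simp [pd, RCLike.real_smul_eq_coe_mul]

variable (𝕜) in
/-- The ring of germs at `y` of smooth functions. -/
def smoothGerm (y : Model n) : Subring (Germ (𝓝 y) 𝕜) where
  carrier := {γ | ∃ F : Model n → 𝕜, ContDiffAt ℝ ∞ F y ∧ γ = (F : Germ (𝓝 y) 𝕜)}
  mul_mem' := by
    rintro _ _ ⟨F, hF, rfl⟩ ⟨G, hG, rfl⟩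
    exact ⟨F * G, hF.mul hG, rfl⟩
  one_mem' := ⟨fun _ => 1, contDiffAt_const, rfl⟩
  add_mem' := by
    rintro _ _ ⟨F, hF, rfl⟩ ⟨G, hG, rfl⟩
    exact ⟨F + G, hF.add hG, rfl⟩
  zero_mem' := ⟨fun _ => 0, contDiffAt_const, rfl⟩
  neg_mem' := by
    rintro _ ⟨F, hF, rfl⟩
    exact ⟨-F, hF.neg, rfl⟩

variable (𝕜) in
/-- The ring of germs at `y` of smooth functions, as a type. -/
def SmGerm (y : Model n) : Type _ := smoothGerm 𝕜 y

instance (y : Model n) : CommRing (SmGerm 𝕜 y) := inferInstanceAs (CommRing (smoothGerm 𝕜 y))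

open Classical in
/-- The germ of the function `F` at `y` (zero if `F` is not smooth at `y`). -/
def gm (y : Model n) (F : Model n → 𝕜) : SmGerm 𝕜 y :=
  if h : ContDiffAt ℝ ∞ F y then ⟨(F : Germ (𝓝 y) 𝕜), F, h, rfl⟩ else 0

variable {y : Model n}

lemma gm_of_smooth {F : Model n → 𝕜} (hF : ContDiffAt ℝ ∞ F y) :
    gm y F = ⟨(F : Germ (𝓝 y) 𝕜), F, hF, rfl⟩ := dif_pos hF

lemma gm_surj (γ : SmGerm 𝕜 y) : ∃ F : Model n → 𝕜, ContDiffAt ℝ ∞ F y ∧ γ = gm y F := by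
  obtain ⟨_, F, hF, rfl⟩ := γ
  exact ⟨F, hF, (gm_of_smooth hF).symm⟩

lemma gm_eq_iff {F G : Model n → 𝕜} (hF : ContDiffAt ℝ ∞ F y) (hG : ContDiffAt ℝ ∞ G y) :
    gm y F = gm y G ↔ F =ᶠ[𝓝 y] G := by
  rw [gm_of_smooth hF, gm_of_smooth hG]
  exact ⟨fun h => Germ.coe_eq.1 (congrArg Subtype.val h), fun h => Subtype.ext (Germ.coe_eq.2 h)⟩

lemma gm_congr {F G : Model n → 𝕜} (h : F =ᶠ[𝓝 y] G) : gm y F = gm y G := by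
  by_cases hF : ContDiffAt ℝ ∞ F y
  · exact (gm_eq_iff hF (hF.congr_of_eventuallyEq h.symm)).2 h
  · have hG : ¬ ContDiffAt ℝ ∞ G y := fun hG => hF (hG.congr_of_eventuallyEq h)
    exact (dif_neg hF : gm y F = 0).trans (dif_neg hG : gm y G = 0).symm

lemma gm_add {F G : Model n → 𝕜} (hF : ContDiffAt ℝ ∞ F y) (hG : ContDiffAt ℝ ∞ G y) :
    gm y (fun z => F z + G z) = gm y F + gm y G := by
  rw [gm_of_smooth hF, gm_of_smooth hG, gm_of_smooth (hF.add hG)]; rfl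

lemma gm_sub {F G : Model n → 𝕜} (hF : ContDiffAt ℝ ∞ F y) (hG : ContDiffAt ℝ ∞ G y) :
    gm y (fun z => F z - G z) = gm y F - gm y G := by
  rw [gm_of_smooth hF, gm_of_smooth hG, gm_of_smooth (hF.sub hG)]; rfl

lemma gm_mul {F G : Model n → 𝕜} (hF : ContDiffAt ℝ ∞ F y) (hG : ContDiffAt ℝ ∞ G y) :
    gm y (fun z => F z * G z) = gm y F * gm y G := by
  rw [gm_of_smooth hF, gm_of_smooth hG, gm_of_smooth (hF.mul hG)]; rfl

variable (y) in
/-- The germ of a constant function. -/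
def constGerm : 𝕜 →+* SmGerm 𝕜 y where
  toFun c := gm y (fun _ => c)
  map_one' := by rw [gm_of_smooth contDiffAt_const]; rfl
  map_mul' a b := by rw [← gm_mul contDiffAt_const contDiffAt_const]
  map_zero' := by rw [gm_of_smooth contDiffAt_const]; rfl
  map_add' a b := by rw [← gm_add contDiffAt_const contDiffAt_const]

instance : Algebra 𝕜 (SmGerm 𝕜 y) := (constGerm y).toAlgebra

lemma algebraMap_germ (c : 𝕜) : algebraMap 𝕜 (SmGerm 𝕜 y) c = gm y (fun _ => c) := rfl

lemma gm_zero : gm y (fun _ => (0 : 𝕜)) = 0 := (constGerm y).map_zero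

lemma gm_one : gm y (fun _ => (1 : 𝕜)) = 1 := (constGerm y).map_one

lemma smul_gm (c : 𝕜) {F : Model n → 𝕜} (hF : ContDiffAt ℝ ∞ F y) :
    c • gm y F = gm y (fun z => c * F z) := by
  rw [Algebra.smul_def, algebraMap_germ, gm_mul contDiffAt_const hF]

lemma gm_sum {ι : Type*} (s : Finset ι) {F : ι → Model n → 𝕜}
    (hF : ∀ i ∈ s, ContDiffAt ℝ ∞ (F i) y) :
    gm y (fun z => ∑ i ∈ s, F i z) = ∑ i ∈ s, gm y (F i) := by
  classical
  induction s using Finset.induction_on with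
  | empty => simp [gm_zero]
  | insert a s ha ih =>
    have h1 : ∀ i ∈ s, ContDiffAt ℝ ∞ (F i) y := fun i hi => hF i (Finset.mem_insert_of_mem hi)
    simp only [Finset.sum_insert ha]
    rw [gm_add (hF a (Finset.mem_insert_self _ _)) (ContDiffAt.sum h1), ih h1]

variable (𝕜 y) in
/-- The value of a germ at the base point. -/
def evGerm : SmGerm 𝕜 y →+* 𝕜 := Germ.valueRingHom.comp (smoothGerm 𝕜 y).subtype

lemma ev_gm {F : Model n → 𝕜} (hF : ContDiffAt ℝ ∞ F y) : evGerm 𝕜 y (gm y F) = F y := by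
  rw [gm_of_smooth hF]; rfl

lemma ev_algebraMap (c : 𝕜) : evGerm 𝕜 y (algebraMap 𝕜 _ c) = c := by
  rw [algebraMap_germ, ev_gm contDiffAt_const]

/-- The partial derivative of a germ. -/
def derFun (i : Fin n) (γ : SmGerm 𝕜 y) : SmGerm 𝕜 y := gm y (pd i (gm_surj γ).choose)

lemma derFun_gm {F : Model n → 𝕜} (hF : ContDiffAt ℝ ∞ F y) (i : Fin n) :
    derFun i (gm y F) = gm y (pd i F) := by
  obtain ⟨h1, h2⟩ := (gm_surj (gm y F)).choose_spec
  exact gm_congr (pd_congr ((gm_eq_iff hF h1).1 h2).symm i)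

variable (𝕜 y) in
/-- The partial derivatives of germs, as derivations. -/
def der (i : Fin n) : Derivation 𝕜 (SmGerm 𝕜 y) (SmGerm 𝕜 y) :=
  Derivation.mk'
    { toFun := derFun i
      map_add' := by
        intro γ ρ
        obtain ⟨F, hF, rfl⟩ := gm_surj γ
        obtain ⟨G, hG, rfl⟩ := gm_surj ρ
        rw [← gm_add hF hG, derFun_gm hF, derFun_gm hG, derFun_gm (hF.add hG),
          ← gm_add (contDiffAt_pd hF i) (contDiffAt_pd hG i)]
        refine gm_congr ?_
        filter_upwards [eventually_differentiableAt hF, eventually_differentiableAt hG] with z h1 h2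
        have := fderiv_fun_add (𝕜 := ℝ) h1
          h2
        simp [pd, this]
      map_smul' := by
        intro c γ
        obtain ⟨F, hF, rfl⟩ := gm_surj γ
        rw [smul_gm c hF, RingHom.id_apply, derFun_gm hF, derFun_gm (contDiffAt_const.mul hF),
          smul_gm c (contDiffAt_pd hF i)]
        refine gm_congr ?_
        filter_upwards [eventually_differentiableAt hF] with z h1
        simp only [pd]
        rw [fderiv_const_mul h1]
        simp }
    (by
      intro γ ρ
      obtain ⟨F, hF, rfl⟩ := gm_surj γ
      obtain ⟨G, hG, rfl⟩ := gm_surj ρ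
      simp only [LinearMap.coe_mk, AddHom.coe_mk, smul_eq_mul]
      rw [← gm_mul hF hG, derFun_gm hF, derFun_gm hG, derFun_gm (hF.mul hG),
        ← gm_mul hF (contDiffAt_pd hG i), ← gm_mul hG (contDiffAt_pd hF i),
        ← gm_add (hF.mul (contDiffAt_pd hG i)) (hG.mul (contDiffAt_pd hF i))]
      refine gm_congr ?_
      filter_upwards [eventually_differentiableAt hF, eventually_differentiableAt hG] with z h1 h2
      simp only [pd]
      rw [fderiv_fun_mul h1 h2]
      simp)

lemma der_gm {F : Model n → 𝕜} (hF : ContDiffAt ℝ ∞ F y) (i : Fin n) :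
    der 𝕜 y i (gm y F) = gm y (pd i F) := derFun_gm hF i

lemma der_comm (i j : Fin n) (γ : SmGerm 𝕜 y) :
    der 𝕜 y i (der 𝕜 y j γ) = der 𝕜 y j (der 𝕜 y i γ) := by
  obtain ⟨F, hF, rfl⟩ := gm_surj γ
  rw [der_gm hF, der_gm hF, der_gm (contDiffAt_pd hF j), der_gm (contDiffAt_pd hF i)]
  refine gm_congr ?_
  have h2 : ContDiffAt ℝ 2 F y :=
    hF.of_le (WithTop.coe_le_coe.2 (le_top : (2 : ℕ∞) ≤ ⊤))
  filter_upwards [h2.eventually (by simp)] with z hz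
  have hs : IsSymmSndFDerivAt ℝ F z := hz.isSymmSndFDerivAt (by simp)
  have hd : DifferentiableAt ℝ (fderiv ℝ F) z :=
    (hz.fderiv_right (m := 1) (by norm_num)).differentiableAt (by simp)
  have e : ∀ k l : Fin n, pd k (pd l F) z
      = fderiv ℝ (fderiv ℝ F) z (basisVec n k) (basisVec n l) := by
    intro k l
    have : pd l F = fun z => fderiv ℝ F z (basisVec n l) := rfl
    rw [pd, this, fderiv_clm_apply hd (differentiableAt_const _)]
    simp
  rw [e, e]
  exact hs _ _

end Germs

/-! ### Hadamard's lemma -/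

section Hadamard

open MeasureTheory

variable {n : ℕ} {𝕜 : Type*} [RCLike 𝕜]

lemma contDiff_integral_unitInterval {H : Model n → ℝ → 𝕜}
    (hH : ContDiff ℝ ∞ (fun p : Model n × ℝ => H p.1 p.2)) :
    ContDiff ℝ ∞ (fun y => ∫ t in (0 : ℝ)..1, H y t) := by
  let b : ContDiffBump (0 : ℝ) := ⟨2, 3, by norm_num, by norm_num⟩
  have h1 : ContDiffOn ℝ ∞ (fun q : Model n × ℝ =>
      (convolution (Set.indicator (Set.Ioc (0 : ℝ) 1) (fun _ => (1 : ℝ)))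
        (fun t => b t • H q.1 (-t)) (ContinuousLinearMap.lsmul ℝ ℝ) volume) q.2)
      (Set.univ ×ˢ Set.univ) := by
    refine contDiffOn_convolution_right_with_param (n := ⊤) (f := Set.indicator (Set.Ioc (0 : ℝ) 1)
      (fun _ => (1 : ℝ))) (g := fun (y : Model n) t => b t • H y (-t))
      (ContinuousLinearMap.lsmul ℝ ℝ) (k := Metric.closedBall 0 3) isOpen_univ
      (isCompact_closedBall _ _) ?_ ?_ ?_
    · intro p x _ hx
      have : b x = 0 := by
        apply b.zero_of_le_dist
        simp only [Metric.mem_closedBall, not_le] at hx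
        exact hx.le
      simp [this]
    · exact ((integrable_indicator_iff measurableSet_Ioc).2
        (integrableOn_const (by simp))).locallyIntegrable
    · rw [Set.univ_prod_univ, contDiffOn_univ]
      have h2 : ContDiff ℝ ∞ (fun p : Model n × ℝ => b p.2) := b.contDiff.comp contDiff_snd
      have h3 : ContDiff ℝ ∞ (fun p : Model n × ℝ => H p.1 (-p.2)) :=
        hH.comp (contDiff_fst.prodMk contDiff_snd.neg)
      exact h2.smul h3
  rw [Set.univ_prod_univ, contDiffOn_univ] at h1
  have h2 : (fun y => ∫ t in (0 : ℝ)..1, H y t) = fun y =>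
      (convolution (Set.indicator (Set.Ioc (0 : ℝ) 1) (fun _ => (1 : ℝ)))
        (fun t => b t • H y (-t)) (ContinuousLinearMap.lsmul ℝ ℝ) volume) 0 := by
    funext y
    rw [convolution_def, intervalIntegral.integral_of_le zero_le_one,
      ← integral_indicator measurableSet_Ioc]
    congr 1
    funext t
    by_cases ht : t ∈ Set.Ioc (0 : ℝ) 1
    · have hb : b (0 - t) = 1 := by
        apply b.one_of_mem_closedBall
        simp only [zero_sub, Metric.mem_closedBall, dist_zero_right, norm_neg, Real.norm_eq_abs]
        rw [abs_of_pos ht.1]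
        exact ht.2.trans (by norm_num [b])
      simp [ht, hb]
      simp at hb
      simp [hb]
    · simp [ht]
  rw [h2]
  exact h1.comp (contDiff_id.prodMk contDiff_const)

/-- Hadamard's lemma. -/
lemma exists_eq_add_sum_mul {F : Model n → 𝕜} (hF : ContDiff ℝ ∞ F) (y₀ : Model n) :
    ∃ G : Fin n → Model n → 𝕜, (∀ i, ContDiff ℝ ∞ (G i)) ∧ (∀ i, G i y₀ = pd i F y₀) ∧
      ∀ y, F y = F y₀ + ∑ i, ((y i - y₀ i : ℝ) : 𝕜) * G i y := by
  have hp : ∀ i, ContDiff ℝ ∞ (pd i F) := fun i => contDiff_iff_contDiffAt.2 fun y =>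
    contDiffAt_pd hF.contDiffAt i
  refine ⟨fun i y => ∫ t in (0 : ℝ)..1, pd i F (y₀ + t • (y - y₀)), fun i => ?_, fun i => ?_,
    fun y => ?_⟩
  · refine contDiff_integral_unitInterval (H := fun y t => pd i F (y₀ + t • (y - y₀))) ?_
    exact (hp i).comp (contDiff_const.add (contDiff_snd.smul (contDiff_fst.sub contDiff_const)))
  · simp
  · have hc : ∀ i, Continuous fun t : ℝ => pd i F (y₀ + t • (y - y₀)) := fun i =>
      (hp i).continuous.comp (by fun_prop)
    have h1 : ∀ t : ℝ, HasDerivAt (fun t : ℝ => F (y₀ + t • (y - y₀)))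
        (∑ i, ((y i - y₀ i : ℝ) : 𝕜) * pd i F (y₀ + t • (y - y₀))) t := by
      intro t
      have h2 : HasDerivAt (fun t : ℝ => y₀ + t • (y - y₀)) (y - y₀) t := by
        simpa using ((hasDerivAt_id t).smul_const (y - y₀)).const_add y₀
      have h3 := ((hF.differentiable (by simp)) (y₀ + t • (y - y₀))).hasFDerivAt.comp_hasDerivAt t h2
      rw [fderiv_eq_sum_pd] at h3
      exact h3
    have h4 := intervalIntegral.integral_eq_sub_of_hasDerivAt (a := 0) (b := 1)
      (fun t _ => h1 t) (Continuous.intervalIntegrable (by fun_prop) _ _)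
    rw [intervalIntegral.integral_finsetSum
      (fun i _ => Continuous.intervalIntegrable (by fun_prop) _ _)] at h4
    simp only [intervalIntegral.integral_const_mul, one_smul, zero_smul, add_zero,
      add_sub_cancel] at h4
    rw [h4]; ring

end Hadamard

/-! ### Charts, bump functions and derivations -/

section Charts

variable {n : ℕ} {M : Type*} [TopologicalSpace M] [ChartedSpace (Model n) M]
  {𝕜 : Type*} [RCLike 𝕜] [IsManifold (𝓡 n) ∞ M]

lemma contDiffAt_chart_iff {F : Type*} [NormedAddCommGroup F] [NormedSpace ℝ F] {f : M → F}
    {φ : OpenPartialHomeomorph M (Model n)} (hφ : φ ∈ smoothCharts (n := n) M) {x : M}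
    (hx : x ∈ φ.source) :
    ContMDiffAt (𝓡 n) 𝓘(ℝ, F) ∞ f x ↔ ContDiffAt ℝ ∞ (f ∘ φ.symm) (φ x) := by
  rw [← contMDiffAt_iff_contDiffAt]
  constructor
  · intro h
    have h1 := contMDiffAt_symm_of_mem_maximalAtlas hφ (φ.map_source hx)
    refine ContMDiffAt.comp (φ x) ?_ h1
    rwa [φ.left_inv hx]
  · intro h
    have h1 := h.comp x (contMDiffAt_of_mem_maximalAtlas hφ hx)
    refine h1.congr_of_eventuallyEq ?_
    filter_upwards [φ.open_source.mem_nhds hx] with z hz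
    simp [φ.left_inv hz]

lemma mfderiv_chart_comp {F : Type*} [NormedAddCommGroup F] [NormedSpace ℝ F] {f : M → F}
    {φ : OpenPartialHomeomorph M (Model n)} (hφ : φ ∈ smoothCharts (n := n) M) {x : M}
    (hx : x ∈ φ.source) (hf : ContMDiffAt (𝓡 n) 𝓘(ℝ, F) ∞ f x) (v : TangentSpace (𝓡 n) x) :
    mfderiv (𝓡 n) 𝓘(ℝ, F) f x v
      = fderiv ℝ (f ∘ φ.symm) (φ x) (mfderiv (𝓡 n) (𝓡 n) φ x v) := by
  have h0 : f =ᶠ[𝓝 x] (f ∘ φ.symm) ∘ φ := by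
    filter_upwards [φ.open_source.mem_nhds hx] with z hz
    simp [φ.left_inv hz]
  have h1 : MDifferentiableAt (𝓡 n) 𝓘(ℝ, F) (f ∘ φ.symm) (φ x) :=
    (((contDiffAt_chart_iff hφ hx).1 hf).differentiableAt (by simp)).mdifferentiableAt
  have h2 : MDifferentiableAt (𝓡 n) (𝓡 n) φ x :=
    (contMDiffAt_of_mem_maximalAtlas hφ hx).mdifferentiableAt (by simp)
  rw [h0.mfderiv_eq, mfderiv_comp x h1 h2, mfderiv_eq_fderiv]
  rfl

variable [T2Space M]

lemma exists_bump {x : M} {O : Set M} (hO : O ∈ 𝓝 x) :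
    ∃ χ : M → ℝ, ContMDiff (𝓡 n) 𝓘(ℝ, ℝ) ∞ χ ∧ (∀ᶠ z in 𝓝 x, χ z = 1) ∧ tsupport χ ⊆ O := by
  obtain ⟨f, -, hf⟩ := (SmoothBumpFunction.nhds_basis_tsupport (I := 𝓡 n) x).mem_iff.1 hO
  exact ⟨f, f.contMDiff, f.eventuallyEq_one, hf⟩

lemma contMDiff_bump_mul {χ : M → ℝ} (hχ : ContMDiff (𝓡 n) 𝓘(ℝ, ℝ) ∞ χ) {f : M → 𝕜}
    (hf : ∀ x ∈ tsupport χ, ContMDiffAt (𝓡 n) 𝓘(ℝ, 𝕜) ∞ f x) :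
    ContMDiff (𝓡 n) 𝓘(ℝ, 𝕜) ∞ (fun x => (χ x : 𝕜) * f x) := by
  refine contMDiff_of_tsupport fun x hx => ?_
  have h1 : x ∈ tsupport χ := by
    refine closure_mono ?_ hx
    intro z hz hz'
    exact hz (by simp [hz'])
  have h2 : (fun x => (χ x : 𝕜) * f x) = fun x => χ x • f x := by
    funext z; rw [RCLike.real_smul_eq_coe_mul]
  rw [h2]
  exact (hχ x).smul (hf x h1)

/-- The product of a bump function and a function that is smooth on its support. -/
def bumpMul (χ : M → ℝ) (hχ : ContMDiff (𝓡 n) 𝓘(ℝ, ℝ) ∞ χ) (f : M → 𝕜)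
    (hf : ∀ x ∈ tsupport χ, ContMDiffAt (𝓡 n) 𝓘(ℝ, 𝕜) ∞ f x) : smoothFun n 𝕜 M :=
  ⟨fun x => (χ x : 𝕜) * f x, contMDiff_bump_mul hχ hf⟩

lemma smoothFun_contDiffAt (f : smoothFun n 𝕜 M) {φ : OpenPartialHomeomorph M (Model n)}
    (hφ : φ ∈ smoothCharts (n := n) M) {y : Model n} (hy : y ∈ φ.target) :
    ContDiffAt ℝ ∞ (f.1 ∘ φ.symm) y := by
  have := (contDiffAt_chart_iff hφ (φ.map_target hy)).1 (f.2 (φ.symm y))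
  rwa [φ.right_inv hy] at this

/-- A coordinate function of the chart `φ` is smooth. -/
lemma contMDiffAt_coord {φ : OpenPartialHomeomorph M (Model n)}
    (hφ : φ ∈ smoothCharts (n := n) M) {x : M} (hx : x ∈ φ.source) {G : Model n → 𝕜}
    (hG : ContDiffAt ℝ ∞ G (φ x)) : ContMDiffAt (𝓡 n) 𝓘(ℝ, 𝕜) ∞ (fun z => G (φ z)) x :=
  (contMDiffAt_iff_contDiffAt.2 hG).comp x (contMDiffAt_of_mem_maximalAtlas hφ hx)

/-- A derivation at `x` vanishes on the functions that vanish to second order at `x`. -/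
lemma derivation_eq_zero {x : M} (D : smoothFun n 𝕜 M →ₗ[𝕜] 𝕜)
    (hD : ∀ f g, D (f * g) = f.1 x * D g + g.1 x * D f)
    {φ : OpenPartialHomeomorph M (Model n)} (hφ : φ ∈ smoothCharts (n := n) M) (hx : x ∈ φ.source)
    (f : smoothFun n 𝕜 M) (hf : f.1 x = 0) (hf' : ∀ i, pd i (f.1 ∘ φ.symm) (φ x) = 0) :
    D f = 0 := by
  have ht : φ.target ∈ 𝓝 (φ x) := φ.open_target.mem_nhds (φ.map_source hx)
  obtain ⟨ρ, hρ, hρ1, hρt⟩ := exists_bump (n := n) (M := Model n) ht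
  have hF : ContDiff ℝ ∞ (fun y => (ρ y : 𝕜) * (f.1 ∘ φ.symm) y) := by
    rw [← contMDiff_iff_contDiff]
    exact contMDiff_bump_mul hρ fun y hy =>
      contMDiffAt_iff_contDiffAt.2 (smoothFun_contDiffAt f hφ (hρt hy))
  have hFe : (fun y => (ρ y : 𝕜) * (f.1 ∘ φ.symm) y) =ᶠ[𝓝 (φ x)] f.1 ∘ φ.symm := by
    filter_upwards [hρ1] with y hy
    simp [hy]
  obtain ⟨G, hG, hG0, hGF⟩ := exists_eq_add_sum_mul hF (φ x)
  have hG0' : ∀ i, G i (φ x) = 0 := fun i => by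
    rw [hG0, (pd_congr hFe i).eq_of_nhds, hf']
  have hF0 : (ρ (φ x) : 𝕜) * (f.1 ∘ φ.symm) (φ x) = 0 := by
    simp [φ.left_inv hx, hf]
  have hO : φ.source ∩ φ ⁻¹' {y | ρ y = 1} ∈ 𝓝 x := by
    refine Filter.inter_mem (φ.open_source.mem_nhds hx) ?_
    exact (φ.continuousAt hx).eventually hρ1
  obtain ⟨χ, hχ, hχ1, hχt⟩ := exists_bump (n := n) hO
  have hcoord : ∀ i, ∀ z ∈ tsupport χ,
      ContMDiffAt (𝓡 n) 𝓘(ℝ, 𝕜) ∞ (fun z => ((φ z i - φ x i : ℝ) : 𝕜)) z := fun i z hz => by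
    refine contMDiffAt_coord (G := fun y => ((y i - φ x i : ℝ) : 𝕜)) hφ (hχt hz).1 ?_
    exact (RCLike.ofRealCLM (K := 𝕜)).contDiff.contDiffAt.comp _ (by fun_prop)
  have hGs : ∀ i, ∀ z ∈ tsupport χ,
      ContMDiffAt (𝓡 n) 𝓘(ℝ, 𝕜) ∞ (fun z => G i (φ z)) z := fun i z hz =>
    contMDiffAt_coord hφ (hχt hz).1 (hG i).contDiffAt
  let c : smoothFun n 𝕜 M := ofRealFun χ hχ
  have hc1 : c.1 x = 1 := by
    show ((χ x : ℝ) : 𝕜) = 1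
    rw [hχ1.self_of_nhds]; simp
  have hsplit : f = (1 - c * c) * f + ∑ i, bumpMul χ hχ _ (hcoord i) * bumpMul χ hχ _ (hGs i) := by
    have key : c * c * f = ∑ i, bumpMul χ hχ _ (hcoord i) * bumpMul χ hχ _ (hGs i) := by
      apply Subtype.ext
      funext z
      have e1 : (c * c * f).1 z = (χ z : 𝕜) * (χ z : 𝕜) * f.1 z := rfl
      have e2 : (∑ i, bumpMul χ hχ _ (hcoord i) * bumpMul χ hχ _ (hGs i)).1 z
          = ∑ i, ((χ z : 𝕜) * ((φ z i - φ x i : ℝ) : 𝕜)) * ((χ z : 𝕜) * G i (φ z)) := by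
        rw [AddSubmonoidClass.coe_finsetSum, Finset.sum_apply]; rfl
      rw [e1, e2]
      by_cases hz : z ∈ tsupport χ
      · have h1 := hGF (φ z)
        rw [hF0, zero_add] at h1
        have h2 : (ρ (φ z) : 𝕜) = 1 := by
          have : ρ (φ z) = 1 := (hχt hz).2
          simp [this]
        rw [h2, one_mul] at h1
        simp only [Function.comp, φ.left_inv (hχt hz).1] at h1
        rw [h1, mul_sum]
        exact sum_congr rfl fun i _ => by ring
      · have : χ z = 0 := image_eq_zero_of_notMem_tsupport hz
        simp [this]
    rw [← key]; ring
  rw [hsplit, map_add, map_sum, hD]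
  have e1 : (1 - c * c : smoothFun n 𝕜 M).1 x = 0 := by
    have : (1 - c * c : smoothFun n 𝕜 M).1 x = 1 - c.1 x * c.1 x := rfl
    rw [this, hc1]; ring
  rw [e1, hf]
  have e2 : ∀ i, D (bumpMul χ hχ _ (hcoord i) * bumpMul χ hχ _ (hGs i)) = 0 := by
    intro i
    rw [hD]
    have h1 : (bumpMul χ hχ _ (hcoord i)).1 x = (χ x : 𝕜) * ((φ x i - φ x i : ℝ) : 𝕜) := rfl
    have h2 : (bumpMul χ hχ _ (hGs i)).1 x = (χ x : 𝕜) * G i (φ x) := rfl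
    rw [h1, h2, hG0']; simp
  rw [sum_eq_zero fun i _ => e2 i]; ring

/-- A derivation at `x` in coordinates. -/
lemma derivation_eq_sum {x : M} (D : smoothFun n 𝕜 M →ₗ[𝕜] 𝕜)
    (hD : ∀ f g, D (f * g) = f.1 x * D g + g.1 x * D f)
    {φ : OpenPartialHomeomorph M (Model n)} (hφ : φ ∈ smoothCharts (n := n) M) (hx : x ∈ φ.source)
    (u : Fin n → smoothFun n 𝕜 M) (hu : ∀ i, ∀ᶠ z in 𝓝 x, (u i).1 z = (φ z i : 𝕜))
    (f : smoothFun n 𝕜 M) :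
    D f = ∑ i, D (u i) * pd i (f.1 ∘ φ.symm) (φ x) := by
  have hD1 : D 1 = 0 := by
    have := hD 1 1
    rw [mul_one] at this
    have e : (1 : smoothFun n 𝕜 M).1 x = 1 := rfl
    rw [e] at this
    linear_combination -this
  let a : Fin n → 𝕜 := fun i => pd i (f.1 ∘ φ.symm) (φ x)
  let g : smoothFun n 𝕜 M := f - (f.1 x) • (1 : smoothFun n 𝕜 M)
    - ∑ i, a i • (u i - (φ x i : 𝕜) • (1 : smoothFun n 𝕜 M))
  have hval : ∀ z, g.1 z = f.1 z - f.1 x - ∑ i, a i * ((u i).1 z - (φ x i : 𝕜)) := by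
    intro z
    have : g.1 z = f.1 z - (f.1 x) * 1
      - (∑ i, a i • (u i - (φ x i : 𝕜) • (1 : smoothFun n 𝕜 M))).1 z := rfl
    rw [this, AddSubmonoidClass.coe_finsetSum, Finset.sum_apply, mul_one]
    congr 1
    refine sum_congr rfl fun i _ => ?_
    show a i * ((u i).1 z - (φ x i : 𝕜) * 1) = _
    rw [mul_one]
  have hsymm : Filter.Tendsto φ.symm (𝓝 (φ x)) (𝓝 x) := by
    have := φ.continuousAt_symm (φ.map_source hx)
    rwa [ContinuousAt, φ.left_inv hx] at this
  have hgφ : g.1 ∘ φ.symm =ᶠ[𝓝 (φ x)]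
      fun y => (f.1 ∘ φ.symm) y - f.1 x - ∑ i, a i * ((y i : 𝕜) - (φ x i : 𝕜)) := by
    have h1 : ∀ᶠ y in 𝓝 (φ x), ∀ i, (u i).1 (φ.symm y) = (φ (φ.symm y) i : 𝕜) :=
      Filter.eventually_all.2 fun i => hsymm.eventually (hu i)
    filter_upwards [h1, φ.open_target.mem_nhds (φ.map_source hx)] with y hy hy'
    simp only [Function.comp, hval]
    congr 1
    refine sum_congr rfl fun i _ => ?_
    rw [hy i, φ.right_inv hy']
  have hg0 : D g = 0 := by
    refine derivation_eq_zero D hD hφ hx g ?_ fun j => ?_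
    · rw [hval]
      have : ∀ i, (u i).1 x = (φ x i : 𝕜) := fun i => (hu i).self_of_nhds
      simp [this]
    · rw [(pd_congr hgφ j).eq_of_nhds]
      have hfd := (smoothFun_contDiffAt f hφ (φ.map_source hx)).differentiableAt (by simp)
      have h1 : ∀ i : Fin n, HasFDerivAt (fun y : Model n => ((y i : ℝ) : 𝕜))
          ((RCLike.ofRealCLM (K := 𝕜)).comp (EuclideanSpace.proj i)) (φ x) := fun i =>
        ((RCLike.ofRealCLM (K := 𝕜)).comp (EuclideanSpace.proj i)).hasFDerivAt
      have h2 := (hfd.hasFDerivAt.sub_const (f.1 x)).fun_sub (HasFDerivAt.fun_sum (u := Finset.univ)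
        fun i _ => ((h1 i).sub_const (φ x i : 𝕜)).const_mul (a i))
      rw [pd, HasFDerivAt.fderiv h2]
      simp [basisVec, Pi.single_apply, a, pd, Finset.sum_apply]
  have h3 : D g = D f - ∑ i, D (u i) * a i := by
    simp only [g, map_sub, map_smul, map_sum, hD1, smul_eq_mul, mul_zero, sub_zero]
    congr 1
    exact sum_congr rfl fun i _ => mul_comm _ _
  rw [h3] at hg0
  linear_combination hg0

end Charts

/-! ### Differential operators and principal symbols -/

section Operators

variable {n : ℕ} {M : Type*} [TopologicalSpace M] [ChartedSpace (Model n) M]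
  {𝕜 : Type*} [RCLike 𝕜]

lemma commOp_apply (A : FunOp n 𝕜 M) (f g : smoothFun n 𝕜 M) :
    commOp A f g = A (f * g) - f * A g := rfl

lemma commOp_comm (A : FunOp n 𝕜 M) (f g : smoothFun n 𝕜 M) :
    commOp (commOp A f) g = commOp (commOp A g) f := by
  ext1 h
  simp only [commOp_apply, mul_sub, ← mul_assoc, mul_comm f g]
  ring

lemma commOp_add_left (A B : FunOp n 𝕜 M) (f : smoothFun n 𝕜 M) :
    commOp (A + B) f = commOp A f + commOp B f := by
  ext1 h; simp only [commOp_apply, LinearMap.add_apply]; ring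

lemma commOp_sub_left (A B : FunOp n 𝕜 M) (f : smoothFun n 𝕜 M) :
    commOp (A - B) f = commOp A f - commOp B f := by
  ext1 h; simp only [commOp_apply, LinearMap.sub_apply]; ring

lemma commOp_add (A : FunOp n 𝕜 M) (f g : smoothFun n 𝕜 M) :
    commOp A (f + g) = commOp A f + commOp A g := by
  ext1 h
  simp only [commOp_apply, add_mul, map_add, LinearMap.add_apply]; ring

lemma commOp_smul (A : FunOp n 𝕜 M) (c : 𝕜) (f : smoothFun n 𝕜 M) :
    commOp A (c • f) = c • commOp A f := by
  ext1 h
  simp only [commOp_apply, smul_mul_assoc, map_smul, LinearMap.smul_apply, smul_sub]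

lemma commOp_mul (A : FunOp n 𝕜 M) (f g h : smoothFun n 𝕜 M) :
    commOp A (f * g) h = commOp A f (g * h) + f * commOp A g h := by
  simp only [commOp_apply, mul_assoc, mul_sub]; ring

lemma mem_diffOp_zero {A : FunOp n 𝕜 M} : A ∈ diffOp n 𝕜 M 0 ↔ ∀ f, A f = A 1 * f := by
  constructor
  · rintro ⟨a, rfl⟩ f
    simp [mulOp]
  · intro h
    exact ⟨A 1, LinearMap.ext h⟩

lemma mem_diffOp_succ {A : FunOp n 𝕜 M} {k : ℕ} :
    A ∈ diffOp n 𝕜 M (k + 1) ↔ ∀ f, commOp A f ∈ diffOp n 𝕜 M k := Iff.rfl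

lemma mem_diffOp_zero_of_commOp {A : FunOp n 𝕜 M} (h : ∀ f, commOp A f = 0) :
    A ∈ diffOp n 𝕜 M 0 := by
  rw [mem_diffOp_zero]
  intro f
  have := congrArg (fun B => B 1) (h f)
  simp only [commOp_apply, mul_one, LinearMap.zero_apply] at this
  rw [sub_eq_zero.1 this, mul_comm]

lemma diffOp_mono {k : ℕ} : diffOp n 𝕜 M k ≤ diffOp n 𝕜 M (k + 1) := by
  induction k with
  | zero =>
    intro A hA f
    have h0 : commOp A f = 0 := by
      ext1 g
      rw [commOp_apply, mem_diffOp_zero.1 hA (f * g), mem_diffOp_zero.1 hA g]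
      simp only [LinearMap.zero_apply]; ring
    rw [h0]
    exact Submodule.zero_mem _
  | succ k ih => intro A hA f; exact ih (hA f)

lemma eq_zero_of_mem_diffOp_zero {A : FunOp n 𝕜 M} (hA : A ∈ diffOp n 𝕜 M 0) (h : A 1 = 0) :
    A = 0 := by
  ext1 f
  rw [mem_diffOp_zero.1 hA, h]; simp

/-- A smooth function is a combination of two real ones. -/
lemma exists_ofRealFun (f : smoothFun n 𝕜 M) :
    ∃ (a b : M → ℝ) (ha : ContMDiff (𝓡 n) 𝓘(ℝ, ℝ) ∞ a) (hb : ContMDiff (𝓡 n) 𝓘(ℝ, ℝ) ∞ b),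
      f = ofRealFun a ha + (RCLike.I : 𝕜) • ofRealFun b hb := by
  refine ⟨fun x => RCLike.re (f.1 x), fun x => RCLike.im (f.1 x), fun x => ?_, fun x => ?_, ?_⟩
  · exact (RCLike.reCLM (K := 𝕜)).contDiff.contMDiff.contMDiffAt.comp x (f.2 x)
  · exact (RCLike.imCLM (K := 𝕜)).contDiff.contMDiff.contMDiffAt.comp x (f.2 x)
  · apply Subtype.ext
    funext x
    show f.1 x = (RCLike.re (f.1 x) : 𝕜) + RCLike.I * (RCLike.im (f.1 x) : 𝕜)
    rw [mul_comm, RCLike.re_add_im]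

lemma ofRealFun_add {a b : M → ℝ} (ha : ContMDiff (𝓡 n) 𝓘(ℝ, ℝ) ∞ a)
    (hb : ContMDiff (𝓡 n) 𝓘(ℝ, ℝ) ∞ b) :
    (ofRealFun (fun x => a x + b x) (ha.add hb) : smoothFun n 𝕜 M)
      = ofRealFun a ha + ofRealFun b hb := by
  apply Subtype.ext
  funext x
  exact RCLike.ofReal_add _ _

lemma mem_diffOp_zero_of_symbol {A : FunOp n 𝕜 M} (hA : A ∈ diffOp n 𝕜 M 1)
    (h : ∀ (f : M → ℝ) (hf : ContMDiff (𝓡 n) 𝓘(ℝ, ℝ) ∞ f), commOp A (ofRealFun f hf) 1 = 0) :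
    A ∈ diffOp n 𝕜 M 0 := by
  refine mem_diffOp_zero_of_commOp fun f => ?_
  obtain ⟨a, b, ha, hb, rfl⟩ := exists_ofRealFun f
  rw [commOp_add, commOp_smul, eq_zero_of_mem_diffOp_zero (hA _) (h a ha),
    eq_zero_of_mem_diffOp_zero (hA _) (h b hb)]
  simp

lemma commOp_commOp_polarize {A : FunOp n 𝕜 M}
    (h : ∀ (f : M → ℝ) (hf : ContMDiff (𝓡 n) 𝓘(ℝ, ℝ) ∞ f),
      commOp (commOp A (ofRealFun f hf)) (ofRealFun f hf) 1 = 0)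
    {f g : M → ℝ} (hf : ContMDiff (𝓡 n) 𝓘(ℝ, ℝ) ∞ f) (hg : ContMDiff (𝓡 n) 𝓘(ℝ, ℝ) ∞ g) :
    commOp (commOp A (ofRealFun f hf)) (ofRealFun g hg) 1 = 0 := by
  have h1 := h _ (hf.add hg)
  have e : (ofRealFun (f + g) (hf.add hg) : smoothFun n 𝕜 M)
      = ofRealFun f hf + ofRealFun g hg := ofRealFun_add hf hg
  have e2 : commOp (commOp A (ofRealFun f hf + ofRealFun g hg)) (ofRealFun f hf + ofRealFun g hg)
      = commOp (commOp A (ofRealFun f hf)) (ofRealFun f hf)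
        + commOp (commOp A (ofRealFun f hf)) (ofRealFun g hg)
        + (commOp (commOp A (ofRealFun f hf)) (ofRealFun g hg)
        + commOp (commOp A (ofRealFun g hg)) (ofRealFun g hg)) := by
    rw [commOp_add, commOp_add A, commOp_add_left, commOp_add_left,
      commOp_comm A (ofRealFun g hg) (ofRealFun f hf)]
  rw [e, e2, LinearMap.add_apply,
    LinearMap.add_apply, LinearMap.add_apply, h f hf, h g hg, zero_add, add_zero] at h1
  have h2 : (2 : 𝕜) • commOp (commOp A (ofRealFun f hf)) (ofRealFun g hg) 1 = 0 := by
    rw [two_smul]; exact h1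
  exact (smul_eq_zero.1 h2).resolve_left two_ne_zero

lemma mem_diffOp_one_of_symbol {A : FunOp n 𝕜 M} (hA : A ∈ diffOp n 𝕜 M 2)
    (h : ∀ (f : M → ℝ) (hf : ContMDiff (𝓡 n) 𝓘(ℝ, ℝ) ∞ f),
      commOp (commOp A (ofRealFun f hf)) (ofRealFun f hf) 1 = 0) :
    A ∈ diffOp n 𝕜 M 1 := by
  have h1 : ∀ (f : M → ℝ) (hf : ContMDiff (𝓡 n) 𝓘(ℝ, ℝ) ∞ f),
      commOp A (ofRealFun f hf) ∈ diffOp n 𝕜 M 0 := fun f hf =>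
    mem_diffOp_zero_of_symbol (hA _) fun g hg => commOp_commOp_polarize h hf hg
  intro f
  obtain ⟨a, b, ha, hb, rfl⟩ := exists_ofRealFun f
  rw [commOp_add, commOp_smul]
  exact Submodule.add_mem _ (h1 a ha) (Submodule.smul_mem _ _ (h1 b hb))

/-- For an operator of order one, `f ↦ [A, f](1)(x)` is a derivation at `x`. -/
def derivationAt (A : FunOp n 𝕜 M) (x : M) : smoothFun n 𝕜 M →ₗ[𝕜] 𝕜 where
  toFun f := (commOp A f 1).1 x
  map_add' f g := by rw [commOp_add]; rfl
  map_smul' c f := by rw [commOp_smul]; rfl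

lemma derivationAt_apply (A : FunOp n 𝕜 M) (x : M) (f : smoothFun n 𝕜 M) :
    derivationAt A x f = (commOp A f 1).1 x := rfl

lemma derivationAt_mul {A : FunOp n 𝕜 M} (hA : A ∈ diffOp n 𝕜 M 1) (x : M)
    (f g : smoothFun n 𝕜 M) :
    derivationAt A x (f * g) = f.1 x * derivationAt A x g + g.1 x * derivationAt A x f := by
  simp only [derivationAt_apply, commOp_mul, mul_one]
  rw [mem_diffOp_zero.1 (hA f) g]
  show (commOp A f 1).1 x * g.1 x + f.1 x * (commOp A g 1).1 x = _
  ring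

lemma apply_eq_of_mem_diffOp_one {A : FunOp n 𝕜 M} (f : smoothFun n 𝕜 M) :
    A f = commOp A f 1 + f * A 1 := by
  rw [commOp_apply, mul_one]; ring

variable [IsManifold (𝓡 n) ∞ M] [T2Space M]

/-- Smooth functions that agree near `x` with the coordinates of a chart. -/
lemma exists_coord_fun {φ : OpenPartialHomeomorph M (Model n)}
    (hφ : φ ∈ smoothCharts (n := n) M) {x : M} (hx : x ∈ φ.source) :
    ∃ (u : Fin n → M → ℝ), (∀ i, ContMDiff (𝓡 n) 𝓘(ℝ, ℝ) ∞ (u i)) ∧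
      ∀ᶠ z in 𝓝 x, ∀ i, u i z = φ z i := by
  obtain ⟨χ, hχ, hχ1, hχt⟩ := exists_bump (n := n) (φ.open_source.mem_nhds hx)
  refine ⟨fun i z => χ z * φ z i, fun i => ?_, ?_⟩
  · refine contMDiff_bump_mul (𝕜 := ℝ) hχ fun z hz => ?_
    exact contMDiffAt_coord (𝕜 := ℝ) (G := fun y => y i) hφ (hχt hz) (by fun_prop)
  · filter_upwards [hχ1] with z hz i
    rw [hz, one_mul]

/-- The differential of a chart. -/
def dchart (φ : OpenPartialHomeomorph M (Model n)) (z : M) :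
    TangentSpace (𝓡 n) z →L[ℝ] Model n := mfderiv (𝓡 n) (𝓡 n) φ z

/-- The coordinate vectors of a chart at the point `z`. -/
def cvec (φ : OpenPartialHomeomorph M (Model n)) (z : M) (i : Fin n) : TangentSpace (𝓡 n) z :=
  (dchart φ z).inverse (basisVec n i)

lemma chart_mdifferentiable {φ : OpenPartialHomeomorph M (Model n)}
    (hφ : φ ∈ smoothCharts (n := n) M) : φ.MDifferentiable (𝓡 n) (𝓡 n) :=
  ⟨(contMDiffOn_of_mem_maximalAtlas hφ).mdifferentiableOn (by simp),
    (contMDiffOn_symm_of_mem_maximalAtlas hφ).mdifferentiableOn (by simp)⟩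

lemma dchart_invertible {φ : OpenPartialHomeomorph M (Model n)}
    (hφ : φ ∈ smoothCharts (n := n) M) {z : M} (hz : z ∈ φ.source) :
    (dchart φ z).IsInvertible :=
  ⟨(chart_mdifferentiable hφ).mfderiv hz, rfl⟩

lemma dchart_cvec {φ : OpenPartialHomeomorph M (Model n)}
    (hφ : φ ∈ smoothCharts (n := n) M) {z : M} (hz : z ∈ φ.source) (i : Fin n) :
    dchart φ z (cvec φ z i) = basisVec n i := (dchart_invertible hφ hz).self_apply_inverse _

lemma eq_sum_cvec {φ : OpenPartialHomeomorph M (Model n)}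
    (hφ : φ ∈ smoothCharts (n := n) M) {z : M} (hz : z ∈ φ.source) (v : TangentSpace (𝓡 n) z) :
    v = ∑ i, dchart φ z v i • cvec φ z i := by
  have h1 : dchart φ z v = ∑ i, dchart φ z v i • basisVec n i := sum_basisVec _
  have h2 := congrArg (dchart φ z).inverse h1
  rw [(dchart_invertible hφ hz).inverse_apply_self, map_sum] at h2
  simp only [map_smul] at h2
  exact h2

lemma covector_apply {φ : OpenPartialHomeomorph M (Model n)}
    (hφ : φ ∈ smoothCharts (n := n) M) {z : M} (hz : z ∈ φ.source) (ξ : Cotangent n z)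
    (v : TangentSpace (𝓡 n) z) : ξ v = ∑ i, dchart φ z v i * ξ (cvec φ z i) := by
  conv_lhs => rw [eq_sum_cvec hφ hz v]
  rw [map_sum]
  simp

lemma mfderiv_cvec {φ : OpenPartialHomeomorph M (Model n)}
    (hφ : φ ∈ smoothCharts (n := n) M) {z : M} (hz : z ∈ φ.source) {f : M → 𝕜}
    (hf : ContMDiffAt (𝓡 n) 𝓘(ℝ, 𝕜) ∞ f z) (i : Fin n) :
    mfderiv (𝓡 n) 𝓘(ℝ, 𝕜) f z (cvec φ z i) = pd i (f ∘ φ.symm) (φ z) := by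
  rw [mfderiv_chart_comp hφ hz hf]
  exact congrArg _ (dchart_cvec hφ hz i)

/-- Near `x`, the function `P` on the cotangent bundle is a polynomial of degree two with
coefficients `a2`, `a1`, `a0` in the chart `φ`. -/
def HasCoeffs (φ : OpenPartialHomeomorph M (Model n)) (x : M) (P : (x : M) → Cotangent n x → 𝕜)
    (a2 : Fin n → Fin n → Model n → 𝕜) (a1 : Fin n → Model n → 𝕜) (a0 : Model n → 𝕜) : Prop :=
  ∀ᶠ z in 𝓝 x, ∀ ξ : Cotangent n z, P z ξ =
    ∑ i, ∑ j, a2 i j (φ z) * ((ξ (cvec φ z i) : 𝕜) * (ξ (cvec φ z j) : 𝕜))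
      + ∑ i, a1 i (φ z) * (ξ (cvec φ z i) : 𝕜) + a0 (φ z)

lemma covector_comp_smooth {φ ψ : OpenPartialHomeomorph M (Model n)}
    (hφ : φ ∈ smoothCharts (n := n) M) (hψ : ψ ∈ smoothCharts (n := n) M)
    (η : Model n →L[ℝ] ℝ) {x : M} (hx : x ∈ φ.source) (hx' : x ∈ ψ.source) (i : Fin n) :
    ContDiffAt ℝ ∞ (fun y => (η.comp (dchart ψ (ψ.symm y))) (cvec φ (ψ.symm y) i)) (ψ x) := by
  have hs : ∀ z ∈ ψ.source, ContMDiffAt (𝓡 n) 𝓘(ℝ, ℝ) ∞ (fun z => η (ψ z)) z := fun z hz =>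
    contMDiffAt_coord (𝕜 := ℝ) (G := fun y => η y) hψ hz η.contDiff.contDiffAt
  have h1 : ContDiffAt ℝ ∞ (fun y => pd i ((fun z => η (ψ z)) ∘ φ.symm) (φ (ψ.symm y))) (ψ x) := by
    have h2 := contDiffAt_pd ((contDiffAt_chart_iff hφ hx).1 (hs x hx')) i
    have h3 : ContDiffAt ℝ ∞ (φ ∘ ψ.symm) (ψ x) :=
      (contDiffAt_chart_iff hψ hx').1 (contMDiffAt_of_mem_maximalAtlas hφ hx)
    have h2' : ContDiffAt ℝ ∞ (pd i ((fun z => η (ψ z)) ∘ φ.symm)) ((φ ∘ ψ.symm) (ψ x)) := by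
      simpa [ψ.left_inv hx'] using h2
    exact h2'.comp (ψ x) h3
  refine h1.congr_of_eventuallyEq ?_
  have hsy : ∀ᶠ y in 𝓝 (ψ x), ψ.symm y ∈ φ.source := by
    have := ψ.continuousAt_symm (ψ.map_source hx')
    refine this.eventually ?_
    rw [ψ.left_inv hx']
    exact φ.open_source.mem_nhds hx
  filter_upwards [hsy, ψ.open_target.mem_nhds (ψ.map_source hx')] with y hy hy'
  have hyψ := ψ.map_target hy'
  have h4 := mfderiv_cvec (𝕜 := ℝ) hφ hy (hs _ hyψ) i
  have h5 : mfderiv (𝓡 n) 𝓘(ℝ, ℝ) (fun z => η (ψ z)) (ψ.symm y)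
      = η.comp (dchart ψ (ψ.symm y)) := by
    have h6 : MDifferentiableAt (𝓡 n) (𝓡 n) ψ (ψ.symm y) :=
      (contMDiffAt_of_mem_maximalAtlas hψ hyψ).mdifferentiableAt (by simp)
    have h7 : MDifferentiableAt (𝓡 n) 𝓘(ℝ, ℝ) η (ψ (ψ.symm y)) :=
      η.differentiableAt.mdifferentiableAt
    have h8 := mfderiv_comp (ψ.symm y) h7 h6
    rw [mfderiv_eq_fderiv, ContinuousLinearMap.fderiv] at h8
    exact h8
  exact (DFunLike.congr_fun h5 _).symm.trans h4

/-- A function on the cotangent bundle that is given by smooth coefficients in charts is a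
symbol. -/
lemma mem_symbols2_of_local {P : (x : M) → Cotangent n x → 𝕜}
    (h : ∀ x, ∃ φ ∈ smoothCharts (n := n) M, x ∈ φ.source ∧
      ∃ (a2 : Fin n → Fin n → Model n → 𝕜) (a1 : Fin n → Model n → 𝕜) (a0 : Model n → 𝕜),
        (∀ i j, ContDiffAt ℝ ∞ (a2 i j) (φ x)) ∧ (∀ i, ContDiffAt ℝ ∞ (a1 i) (φ x)) ∧
        ContDiffAt ℝ ∞ a0 (φ x) ∧ HasCoeffs φ x P a2 a1 a0) :
    P ∈ symbols2 n 𝕜 M := by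
  constructor
  · intro x
    obtain ⟨φ, hφ, hx, a2, a1, a0, -, -, -, hP⟩ := h x
    have hP := hP.self_of_nhds
    refine ⟨LinearMap.mk₂ ℝ (fun ξ ζ => ∑ i, ∑ j, a2 i j (φ x) *
        ((ξ (cvec φ x i) : 𝕜) * (ζ (cvec φ x j) : 𝕜))) ?_ ?_ ?_ ?_,
      { toFun := fun ξ => ∑ i, a1 i (φ x) * (ξ (cvec φ x i) : 𝕜)
        map_add' := ?_
        map_smul' := ?_ }, a0 (φ x), hP⟩
    · intro a b c
      simp only [← sum_add_distrib, add_apply, map_add]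
      exact sum_congr rfl fun i _ => sum_congr rfl fun j _ => by ring
    · intro a b c
      simp only [smul_sum, smul_apply, smul_eq_mul, map_mul,
        RCLike.real_smul_eq_coe_mul]
      exact sum_congr rfl fun i _ => sum_congr rfl fun j _ => by
        ring
    · intro a b c
      simp only [← sum_add_distrib, add_apply, map_add]
      exact sum_congr rfl fun i _ => sum_congr rfl fun j _ => by ring
    · intro a b c
      simp only [smul_sum, smul_apply, smul_eq_mul, map_mul,
        RCLike.real_smul_eq_coe_mul]
      exact sum_congr rfl fun i _ => sum_congr rfl fun j _ => by
        ring
    · intro a b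
      simp only [← sum_add_distrib, add_apply, map_add]
      exact sum_congr rfl fun i _ => by ring
    · intro a b
      simp only [smul_sum, smul_apply, smul_eq_mul, map_mul,
        RCLike.real_smul_eq_coe_mul, RingHom.id_apply]
      exact sum_congr rfl fun i _ => by ring
  · intro ψ hψ η y hy
    obtain ⟨φ, hφ, hx, a2, a1, a0, h2, h1, h0, hP⟩ := h (ψ.symm y)
    have hx' := ψ.map_target hy
    have hyy : ψ (ψ.symm y) = y := ψ.right_inv hy
    have hτ : ContDiffAt ℝ ∞ (φ ∘ ψ.symm) (ψ (ψ.symm y)) :=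
      (contDiffAt_chart_iff hψ hx').1 (contMDiffAt_of_mem_maximalAtlas hφ hx)
    have hc : ∀ i, ContDiffAt ℝ ∞ (fun y => (((η.comp (dchart ψ (ψ.symm y)))
        (cvec φ (ψ.symm y) i) : ℝ) : 𝕜)) (ψ (ψ.symm y)) := fun i =>
      (RCLike.ofRealCLM (K := 𝕜)).contDiff.contDiffAt.comp _
        (covector_comp_smooth hφ hψ η hx hx' i)
    have hcomp : ∀ {F : Model n → 𝕜}, ContDiffAt ℝ ∞ F (φ (ψ.symm y)) →
        ContDiffAt ℝ ∞ (fun z => F (φ (ψ.symm z))) (ψ (ψ.symm y)) := by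
      intro F hF
      have hF' : ContDiffAt ℝ ∞ F ((φ ∘ ψ.symm) (ψ (ψ.symm y))) := by
        simpa [hyy] using hF
      exact hF'.comp _ hτ
    rw [hyy] at hτ hc hcomp
    have key : ContDiffAt ℝ ∞ (fun y => ∑ i, ∑ j, a2 i j (φ (ψ.symm y)) *
        ((((η.comp (dchart ψ (ψ.symm y))) (cvec φ (ψ.symm y) i) : ℝ) : 𝕜)
          * (((η.comp (dchart ψ (ψ.symm y))) (cvec φ (ψ.symm y) j) : ℝ) : 𝕜))
        + ∑ i, a1 i (φ (ψ.symm y)) *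
          (((η.comp (dchart ψ (ψ.symm y))) (cvec φ (ψ.symm y) i) : ℝ) : 𝕜)
        + a0 (φ (ψ.symm y))) y := by
      refine ((ContDiffAt.sum fun i _ => ContDiffAt.sum fun j _ => ?_).add
        (ContDiffAt.sum fun i _ => ?_)).add (hcomp h0)
      · exact (hcomp (h2 i j)).mul ((hc i).mul (hc j))
      · exact (hcomp (h1 i)).mul (hc i)
    refine (key.congr_of_eventuallyEq ?_).contDiffWithinAt
    have := (ψ.continuousAt_symm hy).eventually hP
    filter_upwards [this] with z hz
    exact hz _

/-- The coefficient of order zero of a symbol. -/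
def sc0 (φ : OpenPartialHomeomorph M (Model n)) (P : (x : M) → Cotangent n x → 𝕜)
    (y : Model n) : 𝕜 := symbolCoord φ P y 0

/-- The coefficients of order one of a symbol. -/
def sc1 (φ : OpenPartialHomeomorph M (Model n)) (P : (x : M) → Cotangent n x → 𝕜) (i : Fin n)
    (y : Model n) : 𝕜 :=
  (symbolCoord φ P y (EuclideanSpace.proj i) - symbolCoord φ P y (-EuclideanSpace.proj i)) / 2

/-- The even part of a symbol, without its constant term. -/
def scQ (φ : OpenPartialHomeomorph M (Model n)) (P : (x : M) → Cotangent n x → 𝕜)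
    (η : Model n →L[ℝ] ℝ) (y : Model n) : 𝕜 :=
  (symbolCoord φ P y η + symbolCoord φ P y (-η)) / 2 - symbolCoord φ P y 0

/-- The coefficients of order two of a symbol. -/
def sc2 (φ : OpenPartialHomeomorph M (Model n)) (P : (x : M) → Cotangent n x → 𝕜) (i j : Fin n)
    (y : Model n) : 𝕜 :=
  (scQ φ P (EuclideanSpace.proj i + EuclideanSpace.proj j) y - scQ φ P (EuclideanSpace.proj i) y
    - scQ φ P (EuclideanSpace.proj j) y) / 2

lemma sc2_symm (φ : OpenPartialHomeomorph M (Model n)) (P : (x : M) → Cotangent n x → 𝕜)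
    (i j : Fin n) (y : Model n) : sc2 φ P i j y = sc2 φ P j i y := by
  simp only [sc2]
  rw [add_comm (EuclideanSpace.proj i) (EuclideanSpace.proj j)]
  ring

section Coeffs

variable {φ : OpenPartialHomeomorph M (Model n)} (hφ : φ ∈ smoothCharts (n := n) M)
  (P : symbols2 n 𝕜 M) {y : Model n} (hy : y ∈ φ.target)
include hφ hy

lemma sc_smooth (η : Model n →L[ℝ] ℝ) : ContDiffAt ℝ ∞ (fun y => symbolCoord φ P.1 y η) y :=
  (P.2.2 φ hφ η).contDiffAt (φ.open_target.mem_nhds hy)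

lemma sc0_smooth : ContDiffAt ℝ ∞ (sc0 φ P.1) y := sc_smooth hφ P hy 0

lemma sc1_smooth (i : Fin n) : ContDiffAt ℝ ∞ (sc1 φ P.1 i) y :=
  ((sc_smooth hφ P hy _).sub (sc_smooth hφ P hy _)).div_const 2

lemma scQ_smooth (η : Model n →L[ℝ] ℝ) : ContDiffAt ℝ ∞ (scQ φ P.1 η) y :=
  (((sc_smooth hφ P hy _).add (sc_smooth hφ P hy _)).div_const 2).sub (sc_smooth hφ P hy _)

lemma sc2_smooth (i j : Fin n) : ContDiffAt ℝ ∞ (sc2 φ P.1 i j) y :=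
  (((scQ_smooth hφ P hy _).sub (scQ_smooth hφ P hy _)).sub (scQ_smooth hφ P hy _)).div_const 2

end Coeffs

lemma symbol_eq_coeffs {φ : OpenPartialHomeomorph M (Model n)} (hφ : φ ∈ smoothCharts (n := n) M)
    (P : symbols2 n 𝕜 M) {z : M} (hz : z ∈ φ.source) (ξ : Cotangent n z) :
    P.1 z ξ = ∑ i, ∑ j, sc2 φ P.1 i j (φ z) * ((ξ (cvec φ z i) : 𝕜) * (ξ (cvec φ z j) : 𝕜))
      + ∑ i, sc1 φ P.1 i (φ z) * (ξ (cvec φ z i) : 𝕜) + sc0 φ P.1 (φ z) := by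
  obtain ⟨b, l, c, h⟩ := P.2.1 z
  have hS : ∀ η : Model n →L[ℝ] ℝ, symbolCoord φ P.1 (φ z) η
      = b (η.comp (dchart φ z)) (η.comp (dchart φ z)) + l (η.comp (dchart φ z)) + c := by
    intro η
    rw [← h]
    have : ∀ z', z' = z → P.1 z' (η.comp (mfderiv (𝓡 n) (𝓡 n) φ z'))
        = P.1 z (η.comp (dchart φ z)) := by
      rintro z' rfl; rfl
    exact this _ (φ.left_inv hz)
  let δ : Fin n → Cotangent n z := fun i => (EuclideanSpace.proj i : Model n →L[ℝ] ℝ).comp (dchart φ z)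
  have hneg : ∀ η : Model n →L[ℝ] ℝ, (-η).comp (dchart φ z) = -(η.comp (dchart φ z)) := fun η => rfl
  have hadd : ∀ η ζ : Model n →L[ℝ] ℝ, (η + ζ).comp (dchart φ z)
      = η.comp (dchart φ z) + ζ.comp (dchart φ z) := fun η ζ => rfl
  have h0 : sc0 φ P.1 (φ z) = c := by
    rw [sc0, hS]; simp
  have h1 : ∀ i, sc1 φ P.1 i (φ z) = l (δ i) := by
    intro i
    rw [sc1, hS, hS, hneg]
    simp only [map_neg, LinearMap.neg_apply]
    ring
  have hQ : ∀ η, scQ φ P.1 η (φ z) = b (η.comp (dchart φ z)) (η.comp (dchart φ z)) := by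
    intro η
    have := h0
    rw [sc0] at this
    rw [scQ, hS, hS, this, hneg]
    simp only [map_neg, LinearMap.neg_apply]
    ring
  have h2 : ∀ i j, sc2 φ P.1 i j (φ z) = (b (δ i) (δ j) + b (δ j) (δ i)) / 2 := by
    intro i j
    rw [sc2, hQ, hQ, hQ, hadd]
    simp only [map_add, LinearMap.add_apply]
    ring
  have hξ : ξ = ∑ i, ξ (cvec φ z i) • δ i := by
    ext v
    rw [covector_apply hφ hz ξ v, sum_apply]
    exact sum_congr rfl fun i _ => mul_comm _ _
  have hb : b ξ ξ = ∑ i, ∑ j, (ξ (cvec φ z i) : 𝕜) * ((ξ (cvec φ z j) : 𝕜) * b (δ i) (δ j)) := by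
    conv_lhs => rw [hξ]
    simp only [map_sum, LinearMap.sum_apply, map_smul, LinearMap.smul_apply,
      RCLike.real_smul_eq_coe_mul, mul_sum]
    rw [sum_comm]
    exact sum_congr rfl fun i _ => sum_congr rfl fun j _ => by ring
  have hl : l ξ = ∑ i, (ξ (cvec φ z i) : 𝕜) * l (δ i) := by
    conv_lhs => rw [hξ]
    simp only [map_sum, map_smul, RCLike.real_smul_eq_coe_mul]
  rw [h ξ, h0]
  simp only [h1, h2]
  congr 1
  congr 1
  · rw [hb]
    have e : ∑ i, ∑ j, (ξ (cvec φ z i) : 𝕜) * ((ξ (cvec φ z j) : 𝕜) * b (δ j) (δ i))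
        = ∑ i, ∑ j, (ξ (cvec φ z i) : 𝕜) * ((ξ (cvec φ z j) : 𝕜) * b (δ i) (δ j)) := by
      rw [sum_comm]
      exact sum_congr rfl fun i _ => sum_congr rfl fun j _ => by ring
    have e3 : ∀ i j, (b (δ i) (δ j) + b (δ j) (δ i)) / 2 *
        ((ξ (cvec φ z i) : 𝕜) * (ξ (cvec φ z j) : 𝕜))
        = ((ξ (cvec φ z i) : 𝕜) * ((ξ (cvec φ z j) : 𝕜) * b (δ i) (δ j))
          + (ξ (cvec φ z i) : 𝕜) * ((ξ (cvec φ z j) : 𝕜) * b (δ j) (δ i))) / 2 := by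
      intro i j; ring
    simp only [e3, ← Finset.sum_div, sum_add_distrib, e]
    ring
  · rw [hl]
    exact sum_congr rfl fun i _ => mul_comm _ _

end Operators

/-! ### Symbols of operators -/

section Symbols

variable {n : ℕ} {M : Type*} [TopologicalSpace M] [ChartedSpace (Model n) M]
  {𝕜 : Type*} [RCLike 𝕜] [IsManifold (𝓡 n) ∞ M]

/-- The differential of a function. -/
def dfun (f : M → 𝕜) (x : M) : TangentSpace (𝓡 n) x →L[ℝ] 𝕜 := mfderiv (𝓡 n) 𝓘(ℝ, 𝕜) f x

lemma dfun_eq {φ : OpenPartialHomeomorph M (Model n)} (hφ : φ ∈ smoothCharts (n := n) M) {x : M}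
    (hx : x ∈ φ.source) {f : M → 𝕜} (hf : ContMDiffAt (𝓡 n) 𝓘(ℝ, 𝕜) ∞ f x)
    (v : TangentSpace (𝓡 n) x) : dfun f x v = fderiv ℝ (f ∘ φ.symm) (φ x) (dchart φ x v) :=
  mfderiv_chart_comp hφ hx hf v

lemma dfun_ofRealFun {f : M → ℝ} (hf : ContMDiff (𝓡 n) 𝓘(ℝ, ℝ) ∞ f) (x : M)
    (v : TangentSpace (𝓡 n) x) :
    dfun (ofRealFun f hf : smoothFun n 𝕜 M).1 x v
      = ((dfun f x v : ℝ) : 𝕜) := by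
  have h1 : MDifferentiableAt (𝓡 n) 𝓘(ℝ, ℝ) f x := (hf x).mdifferentiableAt (by simp)
  have h2 : MDifferentiableAt 𝓘(ℝ, ℝ) 𝓘(ℝ, 𝕜) (RCLike.ofRealCLM (K := 𝕜)) (f x) :=
    (RCLike.ofRealCLM (K := 𝕜)).differentiableAt.mdifferentiableAt
  have h3 := mfderiv_comp x h2 h1
  rw [mfderiv_eq_fderiv, ContinuousLinearMap.fderiv] at h3
  exact DFunLike.congr_fun h3 v

lemma diffOp_sub_mem {k : ℕ} {A B : FunOp n 𝕜 M} (hA : A ∈ diffOp n 𝕜 M k)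
    (hB : B ∈ diffOp n 𝕜 M k) : A - B ∈ diffOp n 𝕜 M k := by
  have h : A - B = A + (-1 : 𝕜) • B := by
    ext1 f
    rw [LinearMap.sub_apply, LinearMap.add_apply, LinearMap.smul_apply, neg_one_smul,
      sub_eq_add_neg]
  rw [h]
  exact Submodule.add_mem _ hA (Submodule.smul_mem _ _ hB)

/-- Homogeneous symbols of degree `k`. -/
def IsHomog (k : ℕ) (P : symbols2 n 𝕜 M) : Prop :=
  ∀ (x : M) (t : ℝ) (ξ : Cotangent n x), P.1 x (t • ξ) = (t : 𝕜) ^ k * P.1 x ξ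

/-- The symbol `P(x, tξ)`. -/
def dilate (t : ℝ) (P : symbols2 n 𝕜 M) : symbols2 n 𝕜 M :=
  ⟨fun x ξ => P.1 x (t • ξ), by
    refine ⟨fun x => ?_, fun φ hφ η => ?_⟩
    · obtain ⟨b, l, c, h⟩ := P.2.1 x
      refine ⟨(t * t) • b, t • l, c, fun ξ => ?_⟩
      show P.1 x (t • ξ) = _
      rw [h]
      simp only [map_smul, LinearMap.smul_apply, smul_smul]
    · exact P.2.2 φ hφ (t • η)⟩

lemma dilate_apply (t : ℝ) (P : symbols2 n 𝕜 M) (x : M) (ξ : Cotangent n x) :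
    (dilate t P).1 x ξ = P.1 x (t • ξ) := rfl

/-- Symbols are sums of homogeneous ones. -/
lemma exists_homog_decomp (P : symbols2 n 𝕜 M) :
    ∃ P2 P1 P0 : symbols2 n 𝕜 M, IsHomog 2 P2 ∧ IsHomog 1 P1 ∧ IsHomog 0 P0 ∧
      P = P2 + P1 + P0 := by
  have e : ∀ (a : 𝕜) (R : symbols2 n 𝕜 M) x (ξ : Cotangent n x), (a • R).1 x ξ = a * R.1 x ξ :=
    fun a R x ξ => rfl
  have ea : ∀ (R S : symbols2 n 𝕜 M) x (ξ : Cotangent n x), (R + S).1 x ξ = R.1 x ξ + S.1 x ξ :=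
    fun R S x ξ => rfl
  have es : ∀ (R S : symbols2 n 𝕜 M) x (ξ : Cotangent n x), (R - S).1 x ξ = R.1 x ξ - S.1 x ξ :=
    fun R S x ξ => rfl
  refine ⟨(2⁻¹ : 𝕜) • (P + dilate (-1) P) - dilate 0 P, (2⁻¹ : 𝕜) • (P - dilate (-1) P),
    dilate 0 P, fun x t ξ => ?_, fun x t ξ => ?_, fun x t ξ => ?_, ?_⟩
  · obtain ⟨b, l, c, h⟩ := P.2.1 x
    simp only [e, ea, es, dilate_apply, h, map_smul, LinearMap.smul_apply,
      RCLike.real_smul_eq_coe_mul]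
    push_cast
    ring
  · obtain ⟨b, l, c, h⟩ := P.2.1 x
    simp only [e, ea, es, dilate_apply, h, map_smul, LinearMap.smul_apply,
      RCLike.real_smul_eq_coe_mul]
    push_cast
    ring
  · simp [dilate_apply]
  · apply Subtype.ext
    funext x ξ
    simp only [ea, es, e]
    ring

variable [T2Space M]

lemma exists_mfderiv_eq (x : M) (ξ : Cotangent n x) :
    ∃ f : M → ℝ, ContMDiff (𝓡 n) 𝓘(ℝ, ℝ) ∞ f ∧ dfun f x = ξ := by
  have hφ : chartAt (Model n) x ∈ smoothCharts (n := n) M := IsManifold.chart_mem_maximalAtlas x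
  have hx := mem_chart_source (Model n) x
  set φ := chartAt (Model n) x
  obtain ⟨u, hu, hu'⟩ := exists_coord_fun hφ hx
  have hf : ContMDiff (𝓡 n) 𝓘(ℝ, ℝ) ∞ fun z => ∑ i, ξ (cvec φ x i) * u i z :=
    ContMDiff.sum fun i _ => contMDiff_const.mul (hu i)
  refine ⟨fun z => ∑ i, ξ (cvec φ x i) * u i z, hf, ?_⟩
  ext v
  rw [covector_apply hφ hx ξ v, dfun_eq hφ hx (hf x)]
  have h1 : HasFDerivAt (fun y : Model n => ∑ i, ξ (cvec φ x i) * y i)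
      (∑ i, ξ (cvec φ x i) • (EuclideanSpace.proj i : Model n →L[ℝ] ℝ)) (φ x) :=
    HasFDerivAt.fun_sum fun i _ => (EuclideanSpace.proj i : Model n →L[ℝ] ℝ).hasFDerivAt.const_mul _
  have h2 : (fun z => ∑ i, ξ (cvec φ x i) * u i z) ∘ φ.symm
      =ᶠ[𝓝 (φ x)] fun y : Model n => ∑ i, ξ (cvec φ x i) * y i := by
    have hs := φ.continuousAt_symm (φ.map_source hx)
    rw [ContinuousAt, φ.left_inv hx] at hs
    filter_upwards [hs.eventually hu', φ.open_target.mem_nhds (φ.map_source hx)] with y hy hy'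
    simp only [Function.comp]
    refine sum_congr rfl fun i _ => ?_
    rw [hy, φ.right_inv hy']
  rw [(h1.congr_of_eventuallyEq h2).fderiv, sum_apply]
  exact sum_congr rfl fun i _ => mul_comm _ _

variable {φ : OpenPartialHomeomorph M (Model n)}

lemma commOp_symbol_one {A : FunOp n 𝕜 M} (hA : A ∈ diffOp n 𝕜 M 1)
    (hφ : φ ∈ smoothCharts (n := n) M) {x : M} (hx : x ∈ φ.source)
    {u : Fin n → smoothFun n 𝕜 M} (hu : ∀ i, ∀ᶠ z in 𝓝 x, (u i).1 z = (φ z i : 𝕜))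
    (f : smoothFun n 𝕜 M) :
    (commOp A f 1).1 x = ∑ i, (commOp A (u i) 1).1 x
      * dfun f.1 x (cvec φ x i) := by
  have := derivation_eq_sum (derivationAt A x) (derivationAt_mul hA x) hφ hx u hu f
  rw [derivationAt_apply] at this
  rw [this]
  refine sum_congr rfl fun i _ => ?_
  rw [← mfderiv_cvec hφ hx (f.2 x), derivationAt_apply]
  rfl

lemma commOp_symbol_two {A : FunOp n 𝕜 M} (hA : A ∈ diffOp n 𝕜 M 2)
    (hφ : φ ∈ smoothCharts (n := n) M) {x : M} (hx : x ∈ φ.source)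
    {u : Fin n → smoothFun n 𝕜 M} (hu : ∀ i, ∀ᶠ z in 𝓝 x, (u i).1 z = (φ z i : 𝕜))
    (f g : smoothFun n 𝕜 M) :
    (commOp (commOp A f) g 1).1 x = ∑ i, ∑ j, (commOp (commOp A (u i)) (u j) 1).1 x
      * (dfun f.1 x (cvec φ x i)
        * dfun g.1 x (cvec φ x j)) := by
  rw [commOp_symbol_one (hA f) hφ hx hu g, sum_comm]
  refine sum_congr rfl fun j _ => ?_
  rw [commOp_comm, commOp_symbol_one (hA (u j)) hφ hx hu f, sum_mul]
  refine sum_congr rfl fun i _ => ?_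
  rw [commOp_comm]
  ring

lemma exists_smoothFun_coord (hφ : φ ∈ smoothCharts (n := n) M) {x : M} (hx : x ∈ φ.source) :
    ∃ u : Fin n → smoothFun n 𝕜 M, ∀ᶠ w in 𝓝 x, ∀ i, (u i).1 w = (φ w i : 𝕜) := by
  obtain ⟨u, hu, hu'⟩ := exists_coord_fun hφ hx
  refine ⟨fun i => ofRealFun (u i) (hu i), ?_⟩
  filter_upwards [hu'] with w hw i
  show ((u i w : ℝ) : 𝕜) = _
  rw [hw]

lemma exists_symbol_two {A : FunOp n 𝕜 M} (hA : A ∈ diffOp n 𝕜 M 2) :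
    ∃ P : symbols2 n 𝕜 M, IsHomog 2 P ∧ ∀ (f : M → ℝ) (hf : ContMDiff (𝓡 n) 𝓘(ℝ, ℝ) ∞ f) (x : M),
      (commOp (commOp A (ofRealFun f hf)) (ofRealFun f hf) 1).1 x
        = 2 * P.1 x (dfun f x) := by
  choose F hF hF' using fun (x : M) (ξ : Cotangent n x) => exists_mfderiv_eq x ξ
  let P : (x : M) → Cotangent n x → 𝕜 := fun x ξ =>
    2⁻¹ * (commOp (commOp A (ofRealFun (F x ξ) (hF x ξ))) (ofRealFun (F x ξ) (hF x ξ)) 1).1 x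
  have key : ∀ x, ∃ u : Fin n → smoothFun n 𝕜 M, ∀ᶠ z in 𝓝 x, ∀ ξ : Cotangent n z, P z ξ =
      ∑ i, ∑ j, 2⁻¹ * (commOp (commOp A (u i)) (u j) 1).1 z
        * ((ξ (cvec (chartAt (Model n) x) z i) : 𝕜) * (ξ (cvec (chartAt (Model n) x) z j) : 𝕜)) := by
    intro x
    have hφ : chartAt (Model n) x ∈ smoothCharts (n := n) M := IsManifold.chart_mem_maximalAtlas x
    have hx := mem_chart_source (Model n) x
    obtain ⟨u, hu⟩ := exists_smoothFun_coord (𝕜 := 𝕜) hφ hx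
    refine ⟨u, ?_⟩
    filter_upwards [hu.eventually_nhds, (chartAt (Model n) x).open_source.mem_nhds hx] with z hz hz'
    intro ξ
    simp only [P]
    rw [commOp_symbol_two hA hφ hz' (u := u) (fun i => hz.mono fun w hw => hw i), mul_sum]
    refine sum_congr rfl fun i _ => ?_
    rw [mul_sum]
    refine sum_congr rfl fun j _ => ?_
    rw [dfun_ofRealFun, dfun_ofRealFun, hF']
    ring
  have hP : P ∈ symbols2 n 𝕜 M := by
    refine mem_symbols2_of_local (n := n) fun x => ?_
    have hφ : chartAt (Model n) x ∈ smoothCharts (n := n) M := IsManifold.chart_mem_maximalAtlas x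
    have hx := mem_chart_source (Model n) x
    obtain ⟨u, hu⟩ := key x
    refine ⟨_, hφ, hx, fun i j y => 2⁻¹ * (commOp (commOp A (u i)) (u j) 1).1
      ((chartAt (Model n) x).symm y), fun _ _ => 0, fun _ => 0, fun i j => ?_,
      fun i => contDiffAt_const, contDiffAt_const, ?_⟩
    · exact contDiffAt_const.mul (smoothFun_contDiffAt _ hφ ((chartAt (Model n) x).map_source hx))
    · filter_upwards [hu, (chartAt (Model n) x).open_source.mem_nhds hx] with z hz hz' ξ
      rw [hz ξ]
      simp [(chartAt (Model n) x).left_inv hz']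
  refine ⟨⟨P, hP⟩, fun x t ξ => ?_, fun f hf x => ?_⟩
  · obtain ⟨u, hu⟩ := key x
    have h1 := hu.self_of_nhds
    show P x (t • ξ) = (t : 𝕜) ^ 2 * P x ξ
    rw [h1, h1, mul_sum]
    refine sum_congr rfl fun i _ => ?_
    rw [mul_sum]
    refine sum_congr rfl fun j _ => ?_
    simp only [smul_apply, smul_eq_mul]
    push_cast
    ring
  · have hφ : chartAt (Model n) x ∈ smoothCharts (n := n) M := IsManifold.chart_mem_maximalAtlas x
    have hx := mem_chart_source (Model n) x
    obtain ⟨u, hu⟩ := exists_smoothFun_coord (𝕜 := 𝕜) hφ hx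
    have hu' : ∀ i, ∀ᶠ w in 𝓝 x, (u i).1 w = (chartAt (Model n) x w i : 𝕜) :=
      fun i => hu.mono fun w hw => hw i
    show _ = 2 * (2⁻¹ * _)
    rw [commOp_symbol_two hA hφ hx hu', commOp_symbol_two hA hφ hx hu', ← mul_assoc,
      mul_inv_cancel₀ two_ne_zero, one_mul]
    simp only [dfun_ofRealFun, hF']

lemma exists_symbol_one {A : FunOp n 𝕜 M} (hA : A ∈ diffOp n 𝕜 M 1) :
    ∃ P : symbols2 n 𝕜 M, IsHomog 1 P ∧ ∀ (f : M → ℝ) (hf : ContMDiff (𝓡 n) 𝓘(ℝ, ℝ) ∞ f) (x : M),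
      (commOp A (ofRealFun f hf) 1).1 x = P.1 x (dfun f x) := by
  choose F hF hF' using fun (x : M) (ξ : Cotangent n x) => exists_mfderiv_eq x ξ
  let P : (x : M) → Cotangent n x → 𝕜 := fun x ξ =>
    (commOp A (ofRealFun (F x ξ) (hF x ξ)) 1).1 x
  have key : ∀ x, ∃ u : Fin n → smoothFun n 𝕜 M, ∀ᶠ z in 𝓝 x, ∀ ξ : Cotangent n z, P z ξ =
      ∑ i, (commOp A (u i) 1).1 z * (ξ (cvec (chartAt (Model n) x) z i) : 𝕜) := by
    intro x
    have hφ : chartAt (Model n) x ∈ smoothCharts (n := n) M := IsManifold.chart_mem_maximalAtlas x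
    have hx := mem_chart_source (Model n) x
    obtain ⟨u, hu⟩ := exists_smoothFun_coord (𝕜 := 𝕜) hφ hx
    refine ⟨u, ?_⟩
    filter_upwards [hu.eventually_nhds, (chartAt (Model n) x).open_source.mem_nhds hx] with z hz hz'
    intro ξ
    simp only [P]
    rw [commOp_symbol_one hA hφ hz' (u := u) (fun i => hz.mono fun w hw => hw i)]
    simp only [dfun_ofRealFun, hF']
  have hP : P ∈ symbols2 n 𝕜 M := by
    refine mem_symbols2_of_local (n := n) fun x => ?_
    have hφ : chartAt (Model n) x ∈ smoothCharts (n := n) M := IsManifold.chart_mem_maximalAtlas x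
    have hx := mem_chart_source (Model n) x
    obtain ⟨u, hu⟩ := key x
    refine ⟨_, hφ, hx, fun _ _ _ => 0, fun i y => (commOp A (u i) 1).1
      ((chartAt (Model n) x).symm y), fun _ => 0, fun i j => contDiffAt_const,
      fun i => ?_, contDiffAt_const, ?_⟩
    · exact smoothFun_contDiffAt _ hφ ((chartAt (Model n) x).map_source hx)
    · filter_upwards [hu, (chartAt (Model n) x).open_source.mem_nhds hx] with z hz hz' ξ
      rw [hz ξ]
      simp [(chartAt (Model n) x).left_inv hz']
  refine ⟨⟨P, hP⟩, fun x t ξ => ?_, fun f hf x => ?_⟩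
  · obtain ⟨u, hu⟩ := key x
    have h1 := hu.self_of_nhds
    show P x (t • ξ) = (t : 𝕜) ^ 1 * P x ξ
    rw [h1, h1, mul_sum]
    refine sum_congr rfl fun i _ => ?_
    simp only [smul_apply, smul_eq_mul]
    push_cast
    ring
  · have hφ : chartAt (Model n) x ∈ smoothCharts (n := n) M := IsManifold.chart_mem_maximalAtlas x
    have hx := mem_chart_source (Model n) x
    obtain ⟨u, hu⟩ := exists_smoothFun_coord (𝕜 := 𝕜) hφ hx
    have hu' : ∀ i, ∀ᶠ w in 𝓝 x, (u i).1 w = (chartAt (Model n) x w i : 𝕜) :=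
      fun i => hu.mono fun w hw => hw i
    show _ = (commOp A _ 1).1 x
    rw [commOp_symbol_one hA hφ hx hu', commOp_symbol_one hA hφ hx hu']
    simp only [dfun_ofRealFun, hF']

lemma exists_symbol_zero (a : smoothFun n 𝕜 M) :
    ∃ P : symbols2 n 𝕜 M, IsHomog 0 P ∧ ∀ x ξ, P.1 x ξ = a.1 x := by
  refine ⟨⟨fun x _ => a.1 x, mem_symbols2_of_local (n := n) fun x => ?_⟩, fun x t ξ => by simp,
    fun x ξ => rfl⟩
  have hφ : chartAt (Model n) x ∈ smoothCharts (n := n) M := IsManifold.chart_mem_maximalAtlas x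
  have hx := mem_chart_source (Model n) x
  refine ⟨_, hφ, hx, fun _ _ _ => 0, fun _ _ => 0, a.1 ∘ (chartAt (Model n) x).symm,
    fun i j => contDiffAt_const, fun i => contDiffAt_const,
    smoothFun_contDiffAt _ hφ ((chartAt (Model n) x).map_source hx), ?_⟩
  filter_upwards [(chartAt (Model n) x).open_source.mem_nhds hx] with z hz' ξ
  simp [(chartAt (Model n) x).left_inv hz']

/-! ### Linear maps that preserve principal symbols -/

/-- The linear map `Q` from symbols to operators has the principal symbol `χ P` on homogeneous
symbols `P`. -/
structure HasPrincipalSymbol (Q : symbols2 n 𝕜 M →ₗ[𝕜] FunOp n 𝕜 M) (χ : M → 𝕜) : Prop where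
  two_mem : ∀ P, IsHomog 2 P → Q P ∈ diffOp n 𝕜 M 2
  one_mem : ∀ P, IsHomog 1 P → Q P ∈ diffOp n 𝕜 M 1
  zero_mem : ∀ P, IsHomog 0 P → Q P ∈ diffOp n 𝕜 M 0
  two : ∀ P, IsHomog 2 P → ∀ (f : M → ℝ) (hf : ContMDiff (𝓡 n) 𝓘(ℝ, ℝ) ∞ f) (x : M),
    (commOp (commOp (Q P) (ofRealFun f hf)) (ofRealFun f hf) 1).1 x
      = χ x * (2 * P.1 x (dfun f x))
  one : ∀ P, IsHomog 1 P → ∀ (f : M → ℝ) (hf : ContMDiff (𝓡 n) 𝓘(ℝ, ℝ) ∞ f) (x : M),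
    (commOp (Q P) (ofRealFun f hf) 1).1 x = χ x * P.1 x (dfun f x)
  zero : ∀ P, IsHomog 0 P → ∀ x, (Q P 1).1 x = χ x * P.1 x 0

/-- A linear map from symbols to operators that lowers the order. -/
structure LowersOrder (T : symbols2 n 𝕜 M →ₗ[𝕜] FunOp n 𝕜 M) : Prop where
  two : ∀ P, IsHomog 2 P → T P ∈ diffOp n 𝕜 M 1
  one : ∀ P, IsHomog 1 P → T P ∈ diffOp n 𝕜 M 0
  zero : ∀ P, IsHomog 0 P → T P = 0

lemma HasPrincipalSymbol.lowersOrder_sub {Q Q' T : symbols2 n 𝕜 M →ₗ[𝕜] FunOp n 𝕜 M} {χ : M → 𝕜}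
    (h : HasPrincipalSymbol Q χ) (h' : HasPrincipalSymbol Q' χ)
    (hT : ∀ P, T P = Q P - Q' P) : LowersOrder T := by
  have es : ∀ a b : smoothFun n 𝕜 M, (∀ x, a.1 x = b.1 x) → a - b = 0 := fun a b hab =>
    sub_eq_zero.2 (Subtype.ext (funext hab))
  refine ⟨fun P hP => ?_, fun P hP => ?_, fun P hP => ?_⟩ <;> rw [hT]
  · refine mem_diffOp_one_of_symbol (diffOp_sub_mem (h.two_mem P hP) (h'.two_mem P hP))
      fun f hf => ?_
    rw [commOp_sub_left, commOp_sub_left, LinearMap.sub_apply]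
    exact es _ _ fun x => by rw [h.two P hP, h'.two P hP]
  · refine mem_diffOp_zero_of_symbol (diffOp_sub_mem (h.one_mem P hP) (h'.one_mem P hP))
      fun f hf => ?_
    rw [commOp_sub_left, LinearMap.sub_apply]
    exact es _ _ fun x => by rw [h.one P hP, h'.one P hP]
  · refine eq_zero_of_mem_diffOp_zero
      (diffOp_sub_mem (h.zero_mem P hP) (h'.zero_mem P hP)) ?_
    rw [LinearMap.sub_apply]
    exact es _ _ fun x => by rw [h.zero P hP, h'.zero P hP]

lemma commOp_eq_zero {A : FunOp n 𝕜 M} (hA : A ∈ diffOp n 𝕜 M 0) (f : smoothFun n 𝕜 M) :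
    commOp A f = 0 := by
  ext1 h
  rw [commOp_apply, mem_diffOp_zero.1 hA (f * h), mem_diffOp_zero.1 hA h, LinearMap.zero_apply]
  ring

lemma commOp_commOp_eq_zero {A : FunOp n 𝕜 M} (hA : A ∈ diffOp n 𝕜 M 1) (f g : smoothFun n 𝕜 M) :
    commOp (commOp A f) g = 0 := commOp_eq_zero (hA f) g

lemma HasPrincipalSymbol.mem {Q : symbols2 n 𝕜 M →ₗ[𝕜] FunOp n 𝕜 M} {χ : M → 𝕜}
    (h : HasPrincipalSymbol Q χ) (P : symbols2 n 𝕜 M) : Q P ∈ diffOp n 𝕜 M 2 := by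
  obtain ⟨P2, P1, P0, h2, h1, h0, rfl⟩ := exists_homog_decomp P
  rw [map_add, map_add]
  exact Submodule.add_mem _ (Submodule.add_mem _ (h.two_mem _ h2) (diffOp_mono (h.one_mem _ h1)))
    (diffOp_mono (diffOp_mono (h.zero_mem _ h0)))

lemma symbol_eq_zero {P : symbols2 n 𝕜 M}
    (h : ∀ f : M → ℝ, ContMDiff (𝓡 n) 𝓘(ℝ, ℝ) ∞ f → ∀ x,
      P.1 x (dfun f x) = 0) : P = 0 := by
  apply Subtype.ext
  funext x ξ
  obtain ⟨f, hf, rfl⟩ := exists_mfderiv_eq x ξ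
  exact h f hf x

lemma HasPrincipalSymbol.injective {Q : symbols2 n 𝕜 M →ₗ[𝕜] FunOp n 𝕜 M}
    (h : HasPrincipalSymbol Q fun _ => 1) : Function.Injective Q := by
  rw [injective_iff_map_eq_zero]
  intro P hP
  obtain ⟨P2, P1, P0, h2, h1, h0, rfl⟩ := exists_homog_decomp P
  rw [map_add, map_add] at hP
  have e2 : P2 = 0 := by
    refine symbol_eq_zero fun f hf x => ?_
    have h3 := h.two P2 h2 f hf x
    have h4 := congrArg (fun A => commOp (commOp A (ofRealFun f hf)) (ofRealFun f hf)) hP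
    simp only [commOp_add_left, commOp_commOp_eq_zero (h.one_mem P1 h1),
      commOp_commOp_eq_zero (diffOp_mono (h.zero_mem P0 h0)), add_zero] at h4
    rw [h4, commOp_commOp_eq_zero (Submodule.zero_mem _)] at h3
    have h5 : (0 : 𝕜) = 1 * (2 * P2.1 x (dfun f x)) := h3
    simpa using h5.symm
  subst e2
  rw [map_zero, zero_add] at hP
  have e1 : P1 = 0 := by
    refine symbol_eq_zero fun f hf x => ?_
    have h3 := h.one P1 h1 f hf x
    have h4 := congrArg (fun A => commOp A (ofRealFun f hf)) hP
    simp only [commOp_add_left, commOp_eq_zero (h.zero_mem P0 h0), add_zero] at h4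
    rw [h4, commOp_eq_zero (Submodule.zero_mem _)] at h3
    have h5 : (0 : 𝕜) = 1 * P1.1 x (dfun f x) := h3
    simpa using h5.symm
  subst e1
  rw [map_zero, zero_add] at hP
  rw [zero_add, zero_add]
  apply Subtype.ext
  funext x ξ
  have h3 := h.zero P0 h0 x
  rw [hP] at h3
  have h4 := h0 x 0 ξ
  rw [zero_smul, pow_zero, one_mul] at h4
  rw [← h4]
  have h5 : (0 : 𝕜) = 1 * P0.1 x 0 := h3
  rw [one_mul] at h5
  exact h5.symm

lemma HasPrincipalSymbol.surjective {Q : symbols2 n 𝕜 M →ₗ[𝕜] FunOp n 𝕜 M}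
    (h : HasPrincipalSymbol Q fun _ => 1) {A : FunOp n 𝕜 M} (hA : A ∈ diffOp n 𝕜 M 2) :
    ∃ P, Q P = A := by
  have es : ∀ a b : smoothFun n 𝕜 M, (∀ x, a.1 x = b.1 x) → a - b = 0 := fun a b hab =>
    sub_eq_zero.2 (Subtype.ext (funext hab))
  obtain ⟨P2, h2, e2⟩ := exists_symbol_two hA
  have hA1 : A - Q P2 ∈ diffOp n 𝕜 M 1 := by
    refine mem_diffOp_one_of_symbol (diffOp_sub_mem hA (h.two_mem _ h2)) fun f hf => ?_
    rw [commOp_sub_left, commOp_sub_left, LinearMap.sub_apply]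
    exact es _ _ fun x => by rw [e2, h.two P2 h2, one_mul]
  obtain ⟨P1, h1, e1⟩ := exists_symbol_one hA1
  have hA0 : A - Q P2 - Q P1 ∈ diffOp n 𝕜 M 0 := by
    refine mem_diffOp_zero_of_symbol (diffOp_sub_mem hA1 (h.one_mem _ h1)) fun f hf => ?_
    rw [commOp_sub_left, LinearMap.sub_apply]
    exact es _ _ fun x => by rw [e1, h.one P1 h1, one_mul]
  obtain ⟨P0, h0, e0⟩ := exists_symbol_zero ((A - Q P2 - Q P1) 1)
  have hA' : A - Q P2 - Q P1 - Q P0 = 0 := by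
    refine eq_zero_of_mem_diffOp_zero (diffOp_sub_mem hA0 (h.zero_mem _ h0)) ?_
    rw [LinearMap.sub_apply]
    exact es _ _ fun x => by rw [h.zero P0 h0, e0, one_mul]
  refine ⟨P2 + P1 + P0, ?_⟩
  rw [map_add, map_add]
  rw [eq_comm, ← sub_eq_zero, ← hA']
  abel

end Symbols

/-! ### Changes of coordinates -/

section Jacobi

variable {K S : Type*} [Field K] [CommRing S] [Algebra K S] {n : ℕ}

lemma derivation_prod {ι : Type*} [DecidableEq ι] (D : Derivation K S S) (s : Finset ι)
    (f : ι → S) :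
    D (∏ i ∈ s, f i) = ∑ i ∈ s, ∏ j ∈ s, if j = i then D (f j) else f j := by
  induction s using Finset.induction_on with
  | empty => simp
  | insert a s ha ih =>
    rw [Finset.prod_insert ha, Derivation.leibniz, ih, Finset.sum_insert ha,
      Finset.prod_insert ha, if_pos rfl, add_comm, smul_eq_mul, smul_eq_mul]
    congr 1
    · rw [mul_comm]
      congr 1
      refine Finset.prod_congr rfl fun j hj => ?_
      rw [if_neg (by rintro rfl; exact ha hj)]
    · rw [mul_sum]
      refine sum_congr rfl fun i hi => ?_
      rw [Finset.prod_insert ha, if_neg (by rintro rfl; exact ha hi)]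

/-- Jacobi's formula. -/
lemma derivation_det (D : Derivation K S S) {J Ji : Matrix (Fin n) (Fin n) S} (h : Ji * J = 1) :
    D J.det = J.det * ∑ i, ∑ j, Ji j i * D (J i j) := by
  have h1 : D J.det = ∑ j, (J.updateCol j fun i => D (J i j)).det := by
    simp only [Matrix.det_apply, map_sum]
    rw [sum_comm]
    refine sum_congr rfl fun σ _ => ?_
    rw [← smul_sum, Units.smul_def, Units.smul_def, map_zsmul, derivation_prod]
    congr 1
    refine sum_congr rfl fun i _ => Finset.prod_congr rfl fun j _ => ?_
    by_cases hj : j = i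
    · subst hj; simp
    · simp [hj]
  have h2 : J.adjugate = J.det • Ji := by
    have h3 : J * Ji = 1 := mul_eq_one_comm.1 h
    calc J.adjugate = J.adjugate * (J * Ji) := by rw [h3, mul_one]
      _ = J.det • Ji := by rw [← mul_assoc, Matrix.adjugate_mul, smul_mul_assoc, one_mul]
  rw [h1, sum_comm, mul_sum]
  refine sum_congr rfl fun j _ => ?_
  rw [← Matrix.cramer_apply, Matrix.cramer_eq_adjugate_mulVec, h2, Matrix.mulVec, dotProduct,
    mul_sum]
  refine sum_congr rfl fun i _ => ?_
  simp only [Matrix.smul_apply, smul_eq_mul]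
  ring

end Jacobi

section Change

variable {K R S : Type*} [Field K] [CommRing R] [Algebra K R] [CommRing S] [Algebra K S] {n : ℕ}

/-- A change of coordinates with Jacobian matrix `J`. -/
structure CoordChange (d : Fin n → Derivation K R R) (d' : Fin n → Derivation K S S)
    (h : R →+* S) (J Ji : Matrix (Fin n) (Fin n) S) : Prop where
  chain : ∀ i F, d' i (h F) = ∑ c, h (d c F) * J c i
  symm : ∀ i j c, d' i (J c j) = d' j (J c i)
  inv : Ji * J = 1

variable {d : Fin n → Derivation K R R} {d' : Fin n → Derivation K S S} {h : R →+* S}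
  {J Ji : Matrix (Fin n) (Fin n) S} (C : CoordChange d d' h J Ji)
include C

lemma CoordChange.inv' : J * Ji = 1 := mul_eq_one_comm.1 C.inv

lemma CoordChange.sum_inv (i j : Fin n) : ∑ a, Ji i a * J a j = if i = j then 1 else 0 := by
  rw [← Matrix.mul_apply, C.inv, Matrix.one_apply]

lemma CoordChange.sum_inv' (i j : Fin n) : ∑ a, J i a * Ji a j = if i = j then 1 else 0 := by
  rw [← Matrix.mul_apply, C.inv', Matrix.one_apply]

lemma CoordChange.map_divg {W : Fin n → R} {Y : Fin n → S} (hW : ∀ c, h (W c) = ∑ i, J c i * Y i) :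
    h (divg d W) = divg d' Y + ∑ k, Y k * ∑ i, ∑ j, Ji j i * d' k (J i j) := by
  have e1 : ∑ a, ∑ b, Ji b a * d' b (h (W a)) = h (divg d W) := by
    simp only [C.chain, ConfQuant.divg, map_sum, mul_sum]
    refine sum_congr rfl fun a _ => ?_
    rw [sum_comm]
    have : ∀ c, ∑ b, Ji b a * (h (d c (W a)) * J c b)
        = h (d c (W a)) * if c = a then 1 else 0 := by
      intro c
      rw [← C.sum_inv' c a, mul_sum]
      exact sum_congr rfl fun b _ => by ring
    simp [this]
  have e2 : ∀ a b, d' b (h (W a)) = ∑ c, (J a c * d' b (Y c) + Y c * d' c (J a b)) := by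
    intro a b
    rw [hW, map_sum]
    refine sum_congr rfl fun c _ => ?_
    rw [Derivation.leibniz, smul_eq_mul, smul_eq_mul, C.symm b c]
  rw [← e1]
  simp only [e2, sum_add_distrib, mul_add]
  congr 1
  · have : ∀ b, ∑ a, Ji b a * ∑ c, J a c * d' b (Y c) = d' b (Y b) := by
      intro b
      simp only [mul_sum]
      rw [sum_comm]
      have : ∀ c, ∑ a, Ji b a * (J a c * d' b (Y c)) = (if b = c then 1 else 0) * d' b (Y c) := by
        intro c
        rw [← C.sum_inv b c, sum_mul]
        exact sum_congr rfl fun b _ => by ring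
      simp [this]
    rw [sum_comm]
    simp only [this, ConfQuant.divg]
  · simp only [mul_sum]
    conv_rhs => rw [sum_comm]
    refine sum_congr rfl fun a _ => ?_
    rw [sum_comm]
    refine sum_congr rfl fun c _ => ?_
    exact sum_congr rfl fun b _ => by ring

variable {e : Fin n → R} {e' : Fin n → S} {ρ ρi : S} (he : ∀ i, h (e i) = e' i)
  (he' : ∀ i j, d' i (e' j) = 0)
  (hJ : ∀ i j, ∑ k, e' k * J k i * J k j = if i = j then ρ * e' i else 0) (hρ : ρi * ρ = 1)
include he he' hJ hρ

lemma CoordChange.sym [CharZero K] {E : Fin n → R} {s : R} {V : Fin n → S}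
    (hE : ∀ c, h (E c) = ∑ k, J c k * V k)
    (sym : ∀ i j, e j * d i (E j) + e i * d j (E i) = if i = j then 2 * s * e i else 0) :
    ∃ s', ∀ i j, e' j * d' i (V j) + e' i * d' j (V i) = if i = j then 2 * s' * e' i else 0 := by
  have a1 : ∀ k i, ∑ m, V m * d' m (J k i)
      = ∑ c, h (d c (E k)) * J c i - ∑ m, J k m * d' i (V m) := by
    intro k i
    rw [← C.chain, hE, map_sum, ← sum_sub_distrib]
    refine sum_congr rfl fun m _ => ?_
    rw [Derivation.leibniz, smul_eq_mul, smul_eq_mul, C.symm i m]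
    ring
  have a2 : ∀ i j, ∑ m, V m * d' m (∑ k, e' k * J k i * J k j)
      = ∑ k, e' k * (J k j * ∑ m, V m * d' m (J k i) + J k i * ∑ m, V m * d' m (J k j)) := by
    intro i j
    simp only [map_sum, Derivation.leibniz, smul_eq_mul, he', mul_zero, add_zero, mul_sum,
      ← sum_add_distrib]
    rw [sum_comm]
    refine sum_congr rfl fun k _ => sum_congr rfl fun m _ => by ring
  have a3 : ∀ i j, ∑ k, e' k * (J k j * ∑ c, h (d c (E k)) * J c i)
      + ∑ k, e' k * (J k i * ∑ c, h (d c (E k)) * J c j)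
      = 2 * h s * ∑ k, e' k * J k i * J k j := by
    intro i j
    have b1 : ∑ k, e' k * (J k i * ∑ c, h (d c (E k)) * J c j)
        = ∑ k, ∑ c, e' c * (J c i * (h (d k (E c)) * J k j)) := by
      simp only [mul_sum]
      rw [sum_comm]
    rw [b1]
    simp only [mul_sum, ← sum_add_distrib]
    refine sum_congr rfl fun k _ => ?_
    have b2 : ∀ c, e' k * (J k j * (h (d c (E k)) * J c i))
        + e' c * (J c i * (h (d k (E c)) * J k j))
        = (if c = k then 2 * h s * (e' k * J k i * J k j) else 0) := by
      intro c
      have b3 := congrArg h (sym c k)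
      simp only [map_add, map_mul, he] at b3
      have b4 : e' k * (J k j * (h (d c (E k)) * J c i))
        + e' c * (J c i * (h (d k (E c)) * J k j))
          = (e' k * h (d c (E k)) + e' c * h (d k (E c))) * (J c i * J k j) := by ring
      rw [b4, b3]
      by_cases hc : c = k
      · subst hc
        simp only [if_true, map_mul, map_ofNat, he]
        ring
      · simp [hc]
    simp [b2]
  have a4 : ∀ i j, ∑ k, e' k * (J k j * ∑ m, J k m * d' i (V m)) = ρ * (e' j * d' i (V j)) := by
    intro i j
    simp only [mul_sum]
    rw [sum_comm]
    have b : ∀ m, ∑ k, e' k * (J k j * (J k m * d' i (V m)))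
        = (if m = j then ρ * e' m else 0) * d' i (V m) := by
      intro m
      rw [← hJ m j, sum_mul]
      exact sum_congr rfl fun k _ => by ring
    simp [b, mul_assoc]
  refine ⟨h s - algebraMap K S 2⁻¹ * (ρi * ∑ m, V m * d' m ρ), fun i j => ?_⟩
  have a5 := a2 i j
  simp only [a1, mul_sub, mul_add, sum_sub_distrib, sum_add_distrib, a4] at a5
  have a6 := a3 i j
  rw [hJ i j] at a5 a6
  have a7 : ∑ m, V m * d' m (if i = j then ρ * e' i else 0)
      = if i = j then (∑ m, V m * d' m ρ) * e' i else 0 := by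
    split_ifs with hij
    · rw [sum_mul]
      refine sum_congr rfl fun m _ => ?_
      rw [Derivation.leibniz, he', smul_eq_mul, smul_eq_mul]
      ring
    · simp
  rw [a7] at a5
  have a8 : ρ * (e' j * d' i (V j) + e' i * d' j (V i))
      = 2 * h s * (if i = j then ρ * e' i else 0)
        - (if i = j then (∑ m, V m * d' m ρ) * e' i else 0) := by
    linear_combination a6 + a5
  have h2 : algebraMap K S 2⁻¹ * 2 = 1 := by
    rw [← map_ofNat (algebraMap K S) 2, ← map_mul, inv_mul_cancel₀ two_ne_zero, map_one]
  have a9 : e' j * d' i (V j) + e' i * d' j (V i)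
      = ρi * (2 * h s * (if i = j then ρ * e' i else 0)
        - (if i = j then (∑ m, V m * d' m ρ) * e' i else 0)) := by
    rw [← a8]
    linear_combination -(e' j * d' i (V j) + e' i * d' j (V i)) * hρ
  rw [a9]
  split_ifs with hij
  · linear_combination (2 * h s * e' i) * hρ + e' i * ρi * (∑ m, V m * d' m ρ) * h2
  · ring

end Change

section CasimirChange

variable {K R S : Type*} [Field K] [CommRing R] [Algebra K R] [CommRing S] [Algebra K S] {n : ℕ}
  {d : Fin n → Derivation K R R} {d' : Fin n → Derivation K S S} {h : R →+* S}
  {J Ji : Matrix (Fin n) (Fin n) S} (C : CoordChange d d' h J Ji)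

lemma sum_mul_sum_mul {ι : Type*} [Fintype ι] (A B : Fin n → S) (p r : ι → Fin n → S) :
    ∑ x, (∑ b, A b * p x b) * (∑ c, B c * r x c) = ∑ b, ∑ c, A b * B c * ∑ x, p x b * r x c := by
  simp only [Finset.sum_mul_sum]
  rw [sum_comm]
  refine sum_congr rfl fun b _ => ?_
  rw [sum_comm]
  refine sum_congr rfl fun c _ => ?_
  rw [mul_sum]
  exact sum_congr rfl fun x _ => by ring

lemma sum_ite_const {ι : Type*} (s : Finset ι) (p : Prop) [Decidable p] (f : ι → S) :
    ∑ i ∈ s, (if p then f i else 0) = if p then ∑ i ∈ s, f i else 0 := by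
  split_ifs <;> simp

include C

lemma CoordChange.tensor_cancel {T T' : Fin n → Fin n → S}
    (hT : ∀ a a', ∑ b, ∑ c, J a b * J a' c * T b c = ∑ b, ∑ c, J a b * J a' c * T' b c)
    (i j : Fin n) : T i j = T' i j := by
  have e : ∀ T : Fin n → Fin n → S, ∀ a a', ∑ b, ∑ c, J a b * J a' c * T b c
      = (J * Matrix.of T * J.transpose) a a' := by
    intro T a a'
    simp only [Matrix.mul_apply, Matrix.transpose_apply, Matrix.of_apply, sum_mul]
    rw [sum_comm]
    exact sum_congr rfl fun b _ => sum_congr rfl fun c _ => by ring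
  have h1 : J * Matrix.of T * J.transpose = J * Matrix.of T' * J.transpose := by
    ext a a'
    rw [← e, ← e, hT]
  have hi : J.transpose * Ji.transpose = 1 := by
    rw [← Matrix.transpose_mul, C.inv, Matrix.transpose_one]
  have h2 : ∀ T : Matrix (Fin n) (Fin n) S, Ji * (J * T * J.transpose) * Ji.transpose = T := by
    intro T
    have : Ji * (J * T * J.transpose) * Ji.transpose
        = (Ji * J) * T * (J.transpose * Ji.transpose) := by simp only [mul_assoc]
    rw [this, C.inv, hi, one_mul, mul_one]
  have h3 := congrArg (fun T => Ji * T * Ji.transpose) h1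
  simp only [h2] at h3
  exact congrFun (congrFun h3 i) j

variable {e : Fin n → R} {e' : Fin n → S} {ρ ρi : S} (he : ∀ i, h (e i) = e' i)
  (hee : ∀ i, e' i * e' i = 1)
  (hJ : ∀ i j, ∑ k, e' k * J k i * J k j = if i = j then ρ * e' i else 0) (hρ : ρi * ρ = 1)
include he hee hJ hρ

omit he in
lemma CoordChange.dual_conf (i j : Fin n) :
    ∑ k, e' k * J i k * J j k = if i = j then ρ * e' i else 0 := by
  have h1 : J.transpose * Matrix.diagonal e' * J = ρ • Matrix.diagonal e' := by
    ext i j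
    rw [Matrix.mul_apply]
    simp only [Matrix.mul_diagonal, Matrix.transpose_apply, Matrix.smul_apply,
      Matrix.diagonal_apply, smul_eq_mul]
    have := hJ i j
    rw [mul_ite, mul_zero, ← this]
    exact sum_congr rfl fun k _ => by ring
  have hdd : Matrix.diagonal e' * Matrix.diagonal e' = (1 : Matrix (Fin n) (Fin n) S) := by
    rw [Matrix.diagonal_mul_diagonal, ← Matrix.diagonal_one]
    congr 1
    exact funext hee
  have h2 : (Matrix.diagonal e' * J.transpose * Matrix.diagonal e') * J
      = ρ • (1 : Matrix (Fin n) (Fin n) S) := by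
    rw [mul_assoc, mul_assoc, ← mul_assoc J.transpose, h1, mul_smul_comm, hdd]
  have h3 : Matrix.diagonal e' * J.transpose * Matrix.diagonal e' = ρ • Ji := by
    have := congrArg (· * Ji) h2
    simp only [mul_assoc, C.inv', mul_one, smul_mul_assoc, one_mul] at this
    simpa only [mul_assoc] using this
  have h4 : J * (Matrix.diagonal e' * J.transpose * Matrix.diagonal e')
      = ρ • (1 : Matrix (Fin n) (Fin n) S) := by
    rw [h3, mul_smul_comm, C.inv']
  have h5 : J * Matrix.diagonal e' * J.transpose = ρ • Matrix.diagonal e' := by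
    have := congrArg (· * Matrix.diagonal e') h4
    simp only [mul_assoc, hdd, mul_one, smul_mul_assoc, one_mul] at this
    simpa only [mul_assoc] using this
  have h6 := congrFun (congrFun h5 i) j
  rw [Matrix.mul_apply] at h6
  simp only [Matrix.mul_diagonal, Matrix.transpose_apply, Matrix.smul_apply,
    Matrix.diagonal_apply, smul_eq_mul, mul_ite, mul_zero] at h6
  rw [← h6]
  exact sum_congr rfl fun k _ => by ring

lemma CoordChange.casimir {ι : Type*} [Fintype ι] {Y Z : ι → Fin n → R} {V W : ι → Fin n → S}
    (hY : ∀ r c, h (Y r c) = ∑ k, J c k * V r k) (hZ : ∀ r c, h (Z r c) = ∑ k, J c k * W r k)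
    (H : IsCasimir d e Y Z) : IsCasimir d' e' V W := by
  have zero : ∀ i j, ∑ r, V r i * W r j = 0 := by
    refine C.tensor_cancel (T := fun i j => ∑ r, V r i * W r j) (T' := fun _ _ => 0) fun a a' => ?_
    rw [← sum_mul_sum_mul]
    simp only [← hY, ← hZ, ← map_mul, ← map_sum, H.zero]
    simp
  have hd1 : ∀ r l a, d' l (h (Y r a))
      = ∑ k, J a k * d' l (V r k) + ∑ k, d' l (J a k) * V r k := by
    intro r l a
    rw [hY, map_sum, ← sum_add_distrib]
    refine sum_congr rfl fun k _ => ?_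
    rw [Derivation.leibniz, smul_eq_mul, smul_eq_mul]; ring
  have one : ∀ l i j, ∑ r, d' l (V r i) * W r j = 0 := by
    intro l
    refine C.tensor_cancel (T := fun i j => ∑ r, d' l (V r i) * W r j) (T' := fun _ _ => 0)
      fun a a' => ?_
    have h1 : ∑ r, d' l (h (Y r a)) * h (Z r a') = 0 := by
      simp only [C.chain, sum_mul]
      rw [sum_comm]
      refine sum_eq_zero fun c _ => ?_
      have : ∀ r, h (d c (Y r a)) * J c l * h (Z r a') = h (d c (Y r a) * Z r a') * J c l := by
        intro r; rw [map_mul]; ring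
      simp only [this, ← sum_mul, ← map_sum, H.one, map_zero, zero_mul]
    simp only [hd1, hZ, add_mul, sum_add_distrib] at h1
    rw [sum_mul_sum_mul, sum_mul_sum_mul] at h1
    simp only [zero, mul_zero, sum_const_zero, add_zero] at h1
    rw [h1]
    simp
  refine ⟨zero, one, fun l m => ?_⟩
  refine C.tensor_cancel (T := fun i j => ∑ r, d' l (d' m (V r i)) * W r j)
    (T' := fun i j => casCoeff e' i j l m) fun a a' => ?_
  have h1 : ∑ r, d' l (d' m (h (Y r a))) * h (Z r a')
      = ∑ c, ∑ c', h (casCoeff e a a' c' c) * (J c' l * J c m) := by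
    have e1 : ∀ r, d' l (d' m (h (Y r a))) = ∑ c, ∑ c', h (d c' (d c (Y r a))) * (J c' l * J c m)
        + ∑ c, h (d c (Y r a)) * d' l (J c m) := by
      intro r
      rw [C.chain, map_sum, ← sum_add_distrib]
      refine sum_congr rfl fun c _ => ?_
      rw [Derivation.leibniz, C.chain, smul_eq_mul, smul_eq_mul, mul_sum, add_comm]
      congr 1
      exact sum_congr rfl fun c' _ => by ring
    simp only [e1, add_mul, sum_add_distrib, sum_mul]
    have e2 : ∑ r, ∑ c, h (d c (Y r a)) * d' l (J c m) * h (Z r a') = 0 := by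
      rw [sum_comm]
      refine sum_eq_zero fun c _ => ?_
      have : ∀ r, h (d c (Y r a)) * d' l (J c m) * h (Z r a')
          = h (d c (Y r a) * Z r a') * d' l (J c m) := by
        intro r; rw [map_mul]; ring
      simp only [this, ← sum_mul, ← map_sum, H.one, map_zero, zero_mul]
    rw [e2, add_zero, sum_comm]
    refine sum_congr rfl fun c _ => ?_
    rw [sum_comm]
    refine sum_congr rfl fun c' _ => ?_
    have : ∀ r, h (d c' (d c (Y r a))) * (J c' l * J c m) * h (Z r a')
        = h (d c' (d c (Y r a)) * Z r a') * (J c' l * J c m) := by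
      intro r; rw [map_mul]; ring
    simp only [this, ← sum_mul, ← map_sum, H.two]
  have h2 : ∑ r, d' l (d' m (h (Y r a))) * h (Z r a')
      = ∑ b, ∑ c, J a b * J a' c * ∑ r, d' l (d' m (V r b)) * W r c := by
    have e1 : ∀ r, d' l (d' m (h (Y r a))) = ∑ k, J a k * d' l (d' m (V r k))
        + ∑ k, d' l (J a k) * d' m (V r k) + ∑ k, d' m (J a k) * d' l (V r k)
        + ∑ k, d' l (d' m (J a k)) * V r k := by
      intro r
      rw [hd1, map_add, map_sum, map_sum]
      simp only [← sum_add_distrib]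
      refine sum_congr rfl fun k _ => ?_
      simp only [Derivation.leibniz, smul_eq_mul]; ring
    simp only [e1, hZ, add_mul, sum_add_distrib]
    rw [sum_mul_sum_mul, sum_mul_sum_mul, sum_mul_sum_mul, sum_mul_sum_mul]
    simp only [zero, one, mul_zero, sum_const_zero, add_zero]
  rw [← h2, h1]
  have hc : ∀ a a' c' c, h (casCoeff e a a' c' c) = casCoeff e' a a' c' c := by
    intro a a' c' c
    simp only [casCoeff, map_mul, map_sub, apply_ite h, map_zero, map_one, map_ofNat, he]
  simp only [hc]
  have lhs : ∑ c, ∑ c', casCoeff e' a a' c' c * (J c' l * J c m)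
      = 2 * ((if l = m then ρ * e' l else 0) * (if a = a' then e' a else 0)
        - J a l * J a' m - J a' l * J a m) := by
    have t : ∀ c c', casCoeff e' a a' c' c * (J c' l * J c m)
        = (if c' = c then 2 * (e' c' * J c' l * J c m * (if a = a' then e' a else 0)) else 0)
          - (if c' = a then (if c = a' then 2 * (J c' l * J c m) else 0) else 0)
          - (if c' = a' then (if c = a then 2 * (J c' l * J c m) else 0) else 0) := by
      intro c c'
      simp only [casCoeff, @eq_comm _ a c', @eq_comm _ a' c', @eq_comm _ a c, @eq_comm _ a' c]
      split_ifs <;> ring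
    simp only [t, sum_sub_distrib, sum_ite_eq, sum_ite_eq', Finset.mem_univ,
      if_true]
    rw [← mul_sum, ← sum_mul, hJ]
    ring
  have rhs : ∑ b, ∑ c, J a b * J a' c * casCoeff e' b c l m
      = 2 * ((if a = a' then ρ * e' a else 0) * (if l = m then e' l else 0)
        - J a l * J a' m - J a' l * J a m) := by
    have t : ∀ b c, J a b * J a' c * casCoeff e' b c l m
        = (if c = b then 2 * (e' b * J a b * J a' c * (if l = m then e' l else 0)) else 0)
          - (if b = l then (if c = m then 2 * (J a b * J a' c) else 0) else 0)
          - (if b = m then (if c = l then 2 * (J a b * J a' c) else 0) else 0) := by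
      intro b c
      simp only [casCoeff, @eq_comm _ b c]
      split_ifs <;> ring
    simp only [t, sum_sub_distrib, sum_ite_eq, sum_ite_eq', Finset.mem_univ,
      if_true, sum_ite_const]
    rw [← mul_sum, ← sum_mul, C.dual_conf hee hJ hρ]
    ring
  rw [lhs, rhs]
  split_ifs <;> ring

end CasimirChange

/-! ### Pull-back of germs -/

section Pull

variable {n : ℕ} {𝕜 : Type*} [RCLike 𝕜] {y y' : Model n} {τ : Model n → Model n}

lemma comp_smooth (hτ : ContDiffAt ℝ ∞ τ y) (h : τ y = y') {F : Model n → 𝕜}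
    (hF : ContDiffAt ℝ ∞ F y') : ContDiffAt ℝ ∞ (F ∘ τ) y := by
  subst h; exact hF.comp y hτ

lemma comp_eventuallyEq (hτ : ContDiffAt ℝ ∞ τ y) (h : τ y = y') {F G : Model n → 𝕜}
    (hF : F =ᶠ[𝓝 y'] G) : F ∘ τ =ᶠ[𝓝 y] G ∘ τ := by
  subst h; exact hτ.continuousAt.eventually hF

lemma gm_comp_choose (hτ : ContDiffAt ℝ ∞ τ y) (h : τ y = y') {F : Model n → 𝕜}
    (hF : ContDiffAt ℝ ∞ F y') :
    gm y ((gm_surj (gm y' F)).choose ∘ τ) = gm y (F ∘ τ) := by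
  obtain ⟨h1, h2⟩ := (gm_surj (gm y' F)).choose_spec
  exact gm_congr (comp_eventuallyEq hτ h ((gm_eq_iff hF h1).1 h2).symm)

/-- The pull-back of germs by a smooth map. -/
def pullGerm (hτ : ContDiffAt ℝ ∞ τ y) (h : τ y = y') : SmGerm 𝕜 y' →+* SmGerm 𝕜 y where
  toFun γ := gm y ((gm_surj γ).choose ∘ τ)
  map_one' := by rw [← gm_one, gm_comp_choose hτ h contDiffAt_const, ← gm_one]; rfl
  map_zero' := by rw [← gm_zero, gm_comp_choose hτ h contDiffAt_const, ← gm_zero]; rfl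
  map_mul' γ ρ := by
    obtain ⟨F, hF, rfl⟩ := gm_surj γ
    obtain ⟨G, hG, rfl⟩ := gm_surj ρ
    rw [gm_comp_choose hτ h hF, gm_comp_choose hτ h hG, ← gm_mul hF hG,
      gm_comp_choose hτ h (hF.mul hG), ← gm_mul (comp_smooth hτ h hF) (comp_smooth hτ h hG)]
    rfl
  map_add' γ ρ := by
    obtain ⟨F, hF, rfl⟩ := gm_surj γ
    obtain ⟨G, hG, rfl⟩ := gm_surj ρ
    rw [gm_comp_choose hτ h hF, gm_comp_choose hτ h hG, ← gm_add hF hG,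
      gm_comp_choose hτ h (hF.add hG), ← gm_add (comp_smooth hτ h hF) (comp_smooth hτ h hG)]
    rfl

lemma pull_gm (hτ : ContDiffAt ℝ ∞ τ y) (h : τ y = y') {F : Model n → 𝕜}
    (hF : ContDiffAt ℝ ∞ F y') : pullGerm hτ h (gm y' F) = gm y (F ∘ τ) :=
  gm_comp_choose hτ h hF

lemma ev_pull (hτ : ContDiffAt ℝ ∞ τ y) (h : τ y = y') (γ : SmGerm 𝕜 y') :
    evGerm 𝕜 y (pullGerm hτ h γ) = evGerm 𝕜 y' γ := by
  obtain ⟨F, hF, rfl⟩ := gm_surj γ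
  rw [pull_gm hτ h hF, ev_gm (comp_smooth hτ h hF), ev_gm hF, Function.comp, h]

lemma ofReal_smooth {f : Model n → ℝ} (hf : ContDiffAt ℝ ∞ f y) :
    ContDiffAt ℝ ∞ (fun z => ((f z : ℝ) : 𝕜)) y :=
  (RCLike.ofRealCLM (K := 𝕜)).contDiff.contDiffAt.comp y hf

lemma coord_smooth (hτ : ContDiffAt ℝ ∞ τ y) (c : Fin n) : ContDiffAt ℝ ∞ (fun z => τ z c) y :=
  (EuclideanSpace.proj c : Model n →L[ℝ] ℝ).contDiff.contDiffAt.comp y hτ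

lemma pd_coord {z : Model n} (hτ : DifferentiableAt ℝ τ z) (i c : Fin n) :
    pd i (fun z => ((τ z c : ℝ) : 𝕜)) z = ((fderiv ℝ τ z (basisVec n i) c : ℝ) : 𝕜) := by
  have h := ((RCLike.ofRealCLM (K := 𝕜)).comp (EuclideanSpace.proj c : Model n →L[ℝ] ℝ)).hasFDerivAt.comp
    z hτ.hasFDerivAt
  have h2 : fderiv ℝ (fun z => ((τ z c : ℝ) : 𝕜)) z
      = ((RCLike.ofRealCLM (K := 𝕜)).comp (EuclideanSpace.proj c : Model n →L[ℝ] ℝ)).comp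
        (fderiv ℝ τ z) := h.fderiv
  rw [pd, h2]
  rfl

lemma pd_ofReal {f : Model n → ℝ} {z : Model n} (hf : DifferentiableAt ℝ f z) (i : Fin n) :
    pd i (fun z => ((f z : ℝ) : 𝕜)) z = ((pd i f z : ℝ) : 𝕜) := by
  have h : fderiv ℝ (fun z => ((f z : ℝ) : 𝕜)) z = (RCLike.ofRealCLM (K := 𝕜)).comp
        (fderiv ℝ f z) := ((RCLike.ofRealCLM (K := 𝕜)).hasFDerivAt.comp z hf.hasFDerivAt).fderiv
  rw [pd, h]
  rfl

variable (𝕜) in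
/-- The Jacobian matrix of a smooth map, as a matrix of germs. -/
def jac (τ : Model n → Model n) (y : Model n) : Matrix (Fin n) (Fin n) (SmGerm 𝕜 y) :=
  Matrix.of fun c i => der 𝕜 y i (gm y fun z => ((τ z c : ℝ) : 𝕜))

lemma jac_apply (hτ : ContDiffAt ℝ ∞ τ y) (c i : Fin n) :
    jac 𝕜 τ y c i = gm y fun z => ((fderiv ℝ τ z (basisVec n i) c : ℝ) : 𝕜) := by
  rw [jac, Matrix.of_apply, der_gm (ofReal_smooth (coord_smooth hτ c))]
  refine gm_congr ?_
  have h1 : ContDiffAt ℝ 1 τ y := hτ.of_le (by exact_mod_cast le_top)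
  filter_upwards [h1.eventually (by simp)] with z hz
  exact pd_coord (hz.differentiableAt (by simp)) i c

lemma fderiv_entry_smooth (hτ : ContDiffAt ℝ ∞ τ y) (c i : Fin n) :
    ContDiffAt ℝ ∞ (fun z => fderiv ℝ τ z (basisVec n i) c) y :=
  coord_smooth ((hτ.fderiv_right (m := ∞) (by simp)).clm_apply contDiffAt_const) c

lemma pull_chain (hτ : ContDiffAt ℝ ∞ τ y) (h : τ y = y') (i : Fin n) (γ : SmGerm 𝕜 y') :
    der 𝕜 y i (pullGerm hτ h γ) = ∑ c, pullGerm hτ h (der 𝕜 y' c γ) * jac 𝕜 τ y c i := by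
  obtain ⟨F, hF, rfl⟩ := gm_surj γ
  have hpd : ∀ c, ContDiffAt ℝ ∞ (pd c F ∘ τ) y := fun c => comp_smooth hτ h (contDiffAt_pd hF c)
  have hj : ∀ c, ContDiffAt ℝ ∞ (fun z => ((fderiv ℝ τ z (basisVec n i) c : ℝ) : 𝕜)) y :=
    fun c => ofReal_smooth (fderiv_entry_smooth hτ c i)
  have e : ∀ c, pullGerm hτ h (der 𝕜 y' c (gm y' F)) * jac 𝕜 τ y c i
      = gm y fun z => (pd c F ∘ τ) z * ((fderiv ℝ τ z (basisVec n i) c : ℝ) : 𝕜) := by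
    intro c
    rw [der_gm hF, pull_gm hτ h (contDiffAt_pd hF c), jac_apply hτ, gm_mul (hpd c) (hj c)]
  rw [sum_congr rfl fun c _ => e c, ← gm_sum _ fun c _ => (hpd c).mul (hj c),
    pull_gm hτ h hF, der_gm (comp_smooth hτ h hF)]
  refine gm_congr ?_
  have h1 : ContDiffAt ℝ 1 τ y := hτ.of_le (by exact_mod_cast le_top)
  have h2 : ∀ᶠ z in 𝓝 y, DifferentiableAt ℝ F (τ z) := by
    subst h; exact hτ.continuousAt.eventually (eventually_differentiableAt hF)
  filter_upwards [h1.eventually (by simp), h2] with z hz hz2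
  rw [pd, fderiv_comp z hz2 (hz.differentiableAt (by simp)), ContinuousLinearMap.comp_apply,
    fderiv_eq_sum_pd]
  exact sum_congr rfl fun c _ => mul_comm _ _

/-- The germs of a local diffeomorphism form a change of coordinates. -/
lemma coordChange_germ {σ : Model n → Model n} (hτ : ContDiffAt ℝ ∞ τ y) (h : τ y = y')
    (hσ : ContDiffAt ℝ ∞ σ y') (hστ : ∀ᶠ z in 𝓝 y, σ (τ z) = z) :
    CoordChange (der 𝕜 y') (der 𝕜 y) (pullGerm hτ h) (jac 𝕜 τ y)
      ((jac 𝕜 σ y').map (pullGerm hτ h)) where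
  chain i F := pull_chain hτ h i F
  symm i j c := by
    simp only [jac, Matrix.of_apply]
    exact der_comm _ _ _
  inv := by
    ext a b
    rw [Matrix.mul_apply]
    have h1 := pull_chain hτ h b (gm y' fun z => ((σ z a : ℝ) : 𝕜))
    simp only [Matrix.map_apply]
    have h2 : ∀ c, jac 𝕜 σ y' a c = der 𝕜 y' c (gm y' fun z => ((σ z a : ℝ) : 𝕜)) := fun c => rfl
    simp only [h2]
    rw [← h1, pull_gm hτ h (ofReal_smooth (coord_smooth hσ a))]
    have h3 : gm y ((fun z => ((σ z a : ℝ) : 𝕜)) ∘ τ) = gm y fun z => ((z a : ℝ) : 𝕜) := by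
      refine gm_congr ?_
      filter_upwards [hστ] with z hz
      simp [hz]
    have hid : ContDiffAt ℝ ∞ (fun z : Model n => z) y := contDiffAt_id
    rw [h3, der_gm (ofReal_smooth (coord_smooth hid a))]
    have h4 : (pd b fun z : Model n => ((z a : ℝ) : 𝕜)) = fun _ => if a = b then 1 else 0 := by
      funext z
      rw [pd_coord (τ := fun z => z) differentiableAt_fun_id, fderiv_fun_id]
      simp [basisVec, Pi.single_apply]
    rw [h4, Matrix.one_apply]
    split_ifs
    · exact gm_one
    · exact gm_zero

end Pull

/-! ### Vector fields in charts -/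

section VectorFields

variable {n : ℕ} {M : Type*} [TopologicalSpace M] [ChartedSpace (Model n) M]
  {𝕜 : Type*} [RCLike 𝕜] [IsManifold (𝓡 n) ∞ M]
  {φ ψ : OpenPartialHomeomorph M (Model n)} {X : VField n M} {x : M}

lemma vfCoord_chart (X : VField n M) (hx : x ∈ φ.source) :
    vfCoord φ X (φ x) = dchart φ x (X x) := by
  have : ∀ w, w = x → (mfderiv (𝓡 n) (𝓡 n) φ w (X w) : Model n) = dchart φ x (X x) := by
    rintro w rfl; rfl
  exact this _ (φ.left_inv hx)

lemma trans_smooth (hφ : φ ∈ smoothCharts (n := n) M) (hψ : ψ ∈ smoothCharts (n := n) M)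
    (hx : x ∈ φ.source) (hx' : x ∈ ψ.source) : ContDiffAt ℝ ∞ (φ ∘ ψ.symm) (ψ x) :=
  (contDiffAt_chart_iff hψ hx').1 (contMDiffAt_of_mem_maximalAtlas hφ hx)

lemma trans_apply (hx' : x ∈ ψ.source) : (φ ∘ ψ.symm) (ψ x) = φ x := by
  simp [ψ.left_inv hx']

lemma dchart_change (hφ : φ ∈ smoothCharts (n := n) M) (hψ : ψ ∈ smoothCharts (n := n) M)
    (hx : x ∈ φ.source) (hx' : x ∈ ψ.source) (v : TangentSpace (𝓡 n) x) :
    dchart φ x v = fderiv ℝ (φ ∘ ψ.symm) (ψ x) (dchart ψ x v) :=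
  mfderiv_chart_comp hψ hx' (contMDiffAt_of_mem_maximalAtlas hφ hx) v

lemma symm_tendsto (hx : x ∈ φ.source) : Filter.Tendsto φ.symm (𝓝 (φ x)) (𝓝 x) := by
  have := φ.continuousAt_symm (φ.map_source hx)
  rwa [ContinuousAt, φ.left_inv hx] at this

/-- Near `φ x` every point is the image of a point near `x`. -/
lemma eventually_chart {p : Model n → Prop} (hx : x ∈ φ.source)
    (h : ∀ᶠ z in 𝓝 x, z ∈ φ.source → p (φ z)) : ∀ᶠ y in 𝓝 (φ x), p y := by
  filter_upwards [(symm_tendsto hx).eventually h, φ.open_target.mem_nhds (φ.map_source hx)]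
    with y hy hy'
  have := hy (φ.map_target hy')
  rwa [φ.right_inv hy'] at this

lemma coordChange_chart (hφ : φ ∈ smoothCharts (n := n) M) (hψ : ψ ∈ smoothCharts (n := n) M)
    (hx : x ∈ φ.source) (hx' : x ∈ ψ.source) :
    CoordChange (der 𝕜 (φ x)) (der 𝕜 (ψ x)) (pullGerm (trans_smooth hφ hψ hx hx') (trans_apply hx'))
      (jac 𝕜 (φ ∘ ψ.symm) (ψ x)) ((jac 𝕜 (ψ ∘ φ.symm) (φ x)).map
        (pullGerm (trans_smooth hφ hψ hx hx') (trans_apply hx'))) := by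
  refine coordChange_germ _ _ (trans_smooth hψ hφ hx' hx) ?_
  refine eventually_chart hx' ?_
  filter_upwards [φ.open_source.mem_nhds hx] with z hz hz'
  simp [ψ.left_inv hz', φ.left_inv hz]

variable (X x) in
/-- The vector field `X` is smooth near `x`, in the sense that it is smooth in charts. -/
def SmoothVFAt : Prop :=
  ∀ φ ∈ smoothCharts (n := n) M, x ∈ φ.source → ContDiffAt ℝ ∞ (vfCoord φ X) (φ x)

lemma vfCoord_change (hφ : φ ∈ smoothCharts (n := n) M) (hψ : ψ ∈ smoothCharts (n := n) M)
    (hx : x ∈ φ.source) (hx' : x ∈ ψ.source) (X : VField n M) :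
    vfCoord φ X (φ x) = fderiv ℝ (φ ∘ ψ.symm) (ψ x) (vfCoord ψ X (ψ x)) := by
  rw [vfCoord_chart X hx, vfCoord_chart X hx', dchart_change hφ hψ hx hx']

lemma smoothVFAt_of_chart (hφ : φ ∈ smoothCharts (n := n) M) (hx : x ∈ φ.source)
    (h : ContDiffAt ℝ ∞ (vfCoord φ X) (φ x)) : SmoothVFAt X x := by
  intro ψ hψ hx'
  have h1 := trans_smooth hφ hψ hx hx'
  have h2 : ContDiffAt ℝ ∞ (vfCoord φ X ∘ (φ ∘ ψ.symm)) (ψ x) := by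
    have h' : ContDiffAt ℝ ∞ (vfCoord φ X) ((φ ∘ ψ.symm) (ψ x)) := by rwa [trans_apply hx']
    exact h'.comp _ h1
  have h3 : ContDiffAt ℝ ∞ (fun y => fderiv ℝ (ψ ∘ φ.symm) ((φ ∘ ψ.symm) y)) (ψ x) := by
    have h' : ContDiffAt ℝ ∞ (fderiv ℝ (ψ ∘ φ.symm)) ((φ ∘ ψ.symm) (ψ x)) := by
      rw [trans_apply hx']
      exact (trans_smooth hψ hφ hx' hx).fderiv_right (m := ∞) (by simp)
    exact h'.comp _ h1
  refine (h3.clm_apply h2).congr_of_eventuallyEq ?_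
  refine eventually_chart hx' ?_
  filter_upwards [φ.open_source.mem_nhds hx] with z hz hz'
  have e : (φ ∘ ψ.symm) (ψ z) = φ z := trans_apply hz'
  simp only [Function.comp_apply] at e ⊢
  rw [e]
  exact vfCoord_change hψ hφ hz' hz X

variable (𝕜) in
/-- The germs of the components of a vector field. -/
def vfGerm (φ : OpenPartialHomeomorph M (Model n)) (X : VField n M) (y : Model n) (i : Fin n) :
    SmGerm 𝕜 y := gm y fun z => ((vfCoord φ X z i : ℝ) : 𝕜)

lemma pull_vfGerm (hφ : φ ∈ smoothCharts (n := n) M) (hψ : ψ ∈ smoothCharts (n := n) M)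
    (hx : x ∈ φ.source) (hx' : x ∈ ψ.source) (hX : SmoothVFAt X x) (c : Fin n) :
    pullGerm (trans_smooth hφ hψ hx hx') (trans_apply hx') (vfGerm 𝕜 φ X (φ x) c)
      = ∑ i, jac 𝕜 (φ ∘ ψ.symm) (ψ x) c i * vfGerm 𝕜 ψ X (ψ x) i := by
  have hτ := trans_smooth hφ hψ hx hx'
  have h1 := fun i => ofReal_smooth (𝕜 := 𝕜) (fderiv_entry_smooth hτ c i)
  have h2 := fun i => ofReal_smooth (𝕜 := 𝕜) (coord_smooth (hX ψ hψ hx') i)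
  rw [vfGerm, pull_gm _ _ (ofReal_smooth (coord_smooth (hX φ hφ hx) c))]
  simp only [jac_apply hτ, vfGerm]
  rw [sum_congr rfl fun i _ => (gm_mul (h1 i) (h2 i)).symm,
    ← gm_sum _ fun i _ => (h1 i).mul (h2 i)]
  refine gm_congr ?_
  refine eventually_chart hx' ?_
  filter_upwards [φ.open_source.mem_nhds hx] with z hz hz'
  have e : (φ ∘ ψ.symm) (ψ z) = φ z := trans_apply hz'
  simp only [Function.comp_apply] at e ⊢
  rw [e, vfCoord_change hφ hψ hz hz']
  conv_lhs => rw [sum_basisVec (vfCoord ψ X (ψ z)), map_sum]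
  simp only [map_smul, WithLp.ofLp_sum, Finset.sum_apply, PiLp.smul_apply, smul_eq_mul]
  push_cast
  exact sum_congr rfl fun i _ => mul_comm _ _

end VectorFields

/-! ### Volume and divergence in charts -/

section Volume

variable {n : ℕ} {M : Type*} [TopologicalSpace M] [ChartedSpace (Model n) M]
  [IsManifold (𝓡 n) ∞ M] [T2Space M] (g : PseudoRiemannianMetric n M)
  {φ ψ : OpenPartialHomeomorph M (Model n)} {X : VField n M} {x : M}

/-- The Gram matrix of the coordinate vectors of a chart. -/
def gram (φ : OpenPartialHomeomorph M (Model n)) (z : M) : Matrix (Fin n) (Fin n) ℝ :=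
  Matrix.of fun i j => g.form z (cvec φ z i) (cvec φ z j)

lemma coordVec_eq (hφ : φ ∈ smoothCharts (n := n) M) {y : Model n} (hy : y ∈ φ.target)
    (i : Fin n) : coordVec φ y i = cvec φ (φ.symm y) i := by
  have h1 := (chart_mdifferentiable hφ).comp_symm_deriv hy
  have h2 : dchart φ (φ.symm y) (coordVec φ y i) = basisVec n i := DFunLike.congr_fun h1 _
  rw [cvec, ← h2, (dchart_invertible hφ (φ.map_target hy)).inverse_apply_self]

lemma volCoord_eq (hφ : φ ∈ smoothCharts (n := n) M) {y : Model n} (hy : y ∈ φ.target) :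
    volCoord g φ y = √|(gram g φ (φ.symm y)).det| := by
  simp only [volCoord, coordVec_eq hφ hy]
  rfl

lemma volCoord_chart (hφ : φ ∈ smoothCharts (n := n) M) (hx : x ∈ φ.source) :
    volCoord g φ (φ x) = √|(gram g φ x).det| := by
  rw [volCoord_eq g hφ (φ.map_source hx), φ.left_inv hx]

lemma gram_change (hφ : φ ∈ smoothCharts (n := n) M) (hψ : ψ ∈ smoothCharts (n := n) M)
    (hx : x ∈ φ.source) (hx' : x ∈ ψ.source) :
    gram g ψ x = (Matrix.of fun a i => fderiv ℝ (φ ∘ ψ.symm) (ψ x) (basisVec n i) a).transpose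
      * gram g φ x * Matrix.of fun a i => fderiv ℝ (φ ∘ ψ.symm) (ψ x) (basisVec n i) a := by
  ext i j
  have h : ∀ i, cvec ψ x i
      = ∑ a, fderiv ℝ (φ ∘ ψ.symm) (ψ x) (basisVec n i) a • cvec φ x a := by
    intro i
    conv_lhs => rw [eq_sum_cvec hφ hx (cvec ψ x i), dchart_change hφ hψ hx hx',
      dchart_cvec hψ hx']
  simp only [gram, Matrix.mul_apply, Matrix.of_apply, Matrix.transpose_apply, h, map_sum, map_smul,
    sum_apply, smul_apply, smul_eq_mul, mul_sum, sum_mul]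
  exact sum_congr rfl fun a _ => sum_congr rfl fun b _ => by ring

lemma volCoord_change (hφ : φ ∈ smoothCharts (n := n) M) (hψ : ψ ∈ smoothCharts (n := n) M)
    (hx : x ∈ φ.source) (hx' : x ∈ ψ.source) :
    volCoord g ψ (ψ x) = |(Matrix.of fun a i => fderiv ℝ (φ ∘ ψ.symm) (ψ x) (basisVec n i) a).det|
      * volCoord g φ (φ x) := by
  rw [volCoord_chart g hφ hx, volCoord_chart g hψ hx', gram_change g hφ hψ hx hx', Matrix.det_mul,
    Matrix.det_mul, Matrix.det_transpose]
  set D := (Matrix.of fun a i => fderiv ℝ (φ ∘ ψ.symm) (ψ x) (basisVec n i) a).det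
  have : |D * (gram g φ x).det * D| = D ^ 2 * |(gram g φ x).det| := by
    rw [abs_mul, abs_mul, ← sq_abs D]; ring
  rw [this, Real.sqrt_mul (sq_nonneg _), Real.sqrt_sq_eq_abs]

lemma det_smooth {y : Model n} {A : Model n → Matrix (Fin n) (Fin n) ℝ}
    (hA : ∀ i j, ContDiffAt ℝ ∞ (fun z => A z i j) y) : ContDiffAt ℝ ∞ (fun z => (A z).det) y := by
  simp only [Matrix.det_apply]
  refine ContDiffAt.sum fun σ _ => ?_
  refine ContDiffAt.const_smul _ ?_
  exact contDiffAt_prod fun i _ => hA _ _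

lemma gm_det {y : Model n} {A : Model n → Matrix (Fin n) (Fin n) ℝ}
    (hA : ∀ i j, ContDiffAt ℝ ∞ (fun z => A z i j) y) :
    gm y (fun z => (A z).det) = (Matrix.of fun i j => gm y fun z => A z i j).det := by
  have hp : ∀ (σ : Equiv.Perm (Fin n)) (s : Finset (Fin n)),
      gm y (fun z => ∏ i ∈ s, A z (σ i) i) = ∏ i ∈ s, gm y fun z => A z (σ i) i := by
    intro σ s
    induction s using Finset.induction_on with
    | empty => simp [gm_one]
    | insert a s ha ih =>
      simp only [Finset.prod_insert ha]
      rw [gm_mul (hA _ _) (contDiffAt_prod fun i _ => hA _ _), ih]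
  have hs : ∀ σ : Equiv.Perm (Fin n), ContDiffAt ℝ ∞ (fun z => ∏ i, A z (σ i) i) y :=
    fun σ => contDiffAt_prod fun i _ => hA _ _
  simp only [Matrix.det_apply', Matrix.of_apply]
  rw [gm_sum _ fun σ _ => contDiffAt_const.mul (hs σ)]
  refine sum_congr rfl fun σ _ => ?_
  rw [gm_mul contDiffAt_const (hs σ), hp]
  congr 1
  rw [← algebraMap_germ]
  simp

/-- The divergence in an arbitrary chart. -/
lemma divergence_eq (hφ : φ ∈ smoothCharts (n := n) M) (hx : x ∈ φ.source) (hX : SmoothVFAt X x)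
    (hv : ContDiffAt ℝ ∞ (volCoord g φ) (φ x)) (hv0 : 0 < volCoord g φ (φ x)) :
    divergence g X x = evGerm ℝ (φ x) (divg (der ℝ (φ x)) (vfGerm ℝ φ X (φ x))
      + dirDer (der ℝ (φ x)) (vfGerm ℝ φ X (φ x))
        (gm (φ x) fun y => Real.log (volCoord g φ y))) := by
  obtain ⟨ψ, hψdef⟩ : ∃ ψ, ψ = chartAt (Model n) x := ⟨_, rfl⟩
  have hψ : ψ ∈ smoothCharts (n := n) M := hψdef ▸ IsManifold.chart_mem_maximalAtlas x
  have hx' : x ∈ ψ.source := hψdef ▸ mem_chart_source (Model n) x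
  have hτ := trans_smooth hφ hψ hx hx'
  have h := trans_apply (φ := φ) hx'
  have C := coordChange_chart (𝕜 := ℝ) hφ hψ hx hx'
  set τ := φ ∘ ψ.symm
  set y := ψ x
  set A : Model n → Matrix (Fin n) (Fin n) ℝ :=
    fun z => Matrix.of fun a i => fderiv ℝ τ z (basisVec n i) a with hAdef
  have hA : ∀ i j, ContDiffAt ℝ ∞ (fun z => A z i j) y := fun i j => fderiv_entry_smooth hτ i j
  have hD : ContDiffAt ℝ ∞ (fun z => (A z).det) y := det_smooth hA
  have hgD : gm y (fun z => (A z).det) = (jac ℝ τ y).det := by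
    rw [gm_det hA]
    congr 1
    ext i j
    rw [Matrix.of_apply, jac_apply hτ]
    rfl
  have hvτ : ContDiffAt ℝ ∞ (volCoord g φ ∘ τ) y := comp_smooth hτ h hv
  have hL : volCoord g ψ =ᶠ[𝓝 y] fun z => |(A z).det| * (volCoord g φ ∘ τ) z := by
    refine eventually_chart hx' ?_
    filter_upwards [φ.open_source.mem_nhds hx] with z hz hz'
    have e : τ (ψ z) = φ z := trans_apply hz'
    rw [volCoord_change g hφ hψ hz hz', Function.comp_apply, e]
  have hD0 : (A y).det ≠ 0 := by
    have h1 : evGerm ℝ y (jac ℝ τ y).det ≠ 0 := by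
      have h2 := congrArg Matrix.det C.inv
      rw [Matrix.det_mul, Matrix.det_one] at h2
      have h3 := congrArg (evGerm ℝ y) h2
      rw [map_mul, map_one] at h3
      exact right_ne_zero_of_mul_eq_one h3
    rwa [← hgD, ev_gm hD] at h1
  have hLs : ContDiffAt ℝ ∞ (volCoord g ψ) y := by
    refine ContDiffAt.congr_of_eventuallyEq ?_ hL
    exact ((contDiffAt_abs hD0).comp y hD).mul hvτ
  have hL0 : volCoord g ψ y ≠ 0 := by
    rw [hL.self_of_nhds]
    refine mul_ne_zero (abs_ne_zero.2 hD0) ?_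
    rw [Function.comp_apply, h]
    exact hv0.ne'
  have hlog : ContDiffAt ℝ ∞ (fun y => Real.log (volCoord g φ y)) (φ x) := hv.log hv0.ne'
  set l := gm y (volCoord g ψ)
  set v := gm (φ x) (volCoord g φ)
  set D := (jac ℝ τ y).det
  set pl := pullGerm (𝕜 := ℝ) hτ h
  set W := vfGerm ℝ φ X (φ x)
  set Y := vfGerm ℝ ψ X y
  set ℓ := gm (φ x) fun y => Real.log (volCoord g φ y)
  have hll : l * l = D * D * (pl v * pl v) := by
    rw [← hgD, pull_gm hτ h hv, ← gm_mul hLs hLs, ← gm_mul hD hD, ← gm_mul hvτ hvτ,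
      ← gm_mul (hD.mul hD) (hvτ.mul hvτ)]
    refine gm_congr ?_
    filter_upwards [hL] with z hz
    rw [hz]
    calc |(A z).det| * (volCoord g φ ∘ τ) z * (|(A z).det| * (volCoord g φ ∘ τ) z)
        = (|(A z).det| * |(A z).det|) * ((volCoord g φ ∘ τ) z * (volCoord g φ ∘ τ) z) := by ring
      _ = _ := by rw [abs_mul_abs_self]
  have hdv : ∀ c, der ℝ (φ x) c v = v * der ℝ (φ x) c ℓ := by
    intro c
    rw [der_gm hv, der_gm hlog, ← gm_mul hv (contDiffAt_pd hlog c)]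
    refine gm_congr ?_
    have hpos : ∀ᶠ z in 𝓝 (φ x), 0 < volCoord g φ z := hv.continuousAt.eventually_const_lt hv0
    filter_upwards [hpos, eventually_differentiableAt (𝕜 := ℝ) hv] with z hz hz'
    have := (hz'.hasFDerivAt.log hz.ne').fderiv
    simp only [pd]
    rw [this, smul_apply, smul_eq_mul, mul_inv_cancel_left₀ hz.ne']
  set T : Fin n → SmGerm ℝ y := fun k => ∑ i, ∑ j,
    ((jac ℝ (ψ ∘ φ.symm) (φ x)).map pl) j i * der ℝ y k (jac ℝ τ y i j)
  have hdl : ∀ k, l * der ℝ y k l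
      = l * l * (T k + ∑ c, pl (der ℝ (φ x) c ℓ) * jac ℝ τ y c k) := by
    intro k
    refine two_mul_cancel (K := ℝ) ?_
    have h1 := congrArg (der ℝ y k) hll
    have h2 : der ℝ y k D = D * T k := derivation_det _ C.inv
    have h3 : der ℝ y k (pl v) = pl v * ∑ c, pl (der ℝ (φ x) c ℓ) * jac ℝ τ y c k := by
      rw [C.chain, mul_sum]
      refine sum_congr rfl fun c _ => ?_
      rw [hdv, map_mul]; ring
    simp only [Derivation.leibniz, smul_eq_mul, h2, h3] at h1
    linear_combination h1 - 2 * (T k + ∑ c, pl (der ℝ (φ x) c ℓ) * jac ℝ τ y c k) * hll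
  have hW : ∀ c, pl (W c) = ∑ i, jac ℝ τ y c i * Y i := fun c => pull_vfGerm hφ hψ hx hx' hX c
  have hdiv := C.map_divg hW
  have hYs : ∀ i, ContDiffAt ℝ ∞ (fun z => vfCoord ψ X z i) y := fun i =>
    coord_smooth (hX ψ hψ hx') i
  have hYi : ∀ i, Y i = gm y fun z => vfCoord ψ X z i := fun i => rfl
  have e0 : divergence g X x = (evGerm ℝ y l)⁻¹ * evGerm ℝ y (∑ i, der ℝ y i (l * Y i)) := by
    have : ∀ i, evGerm ℝ y (der ℝ y i (l * Y i))
        = fderiv ℝ (fun y => volCoord g ψ y * vfCoord ψ X y i) (ψ x) (basisVec n i) := by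
      intro i
      rw [hYi, ← gm_mul hLs (hYs i), der_gm (hLs.mul (hYs i)),
        ev_gm (contDiffAt_pd (hLs.mul (hYs i)) i)]
      rfl
    rw [map_sum, sum_congr rfl fun i _ => this i, ev_gm hLs, hψdef]
    simp only [y, hψdef]
    rfl
  have hel : evGerm ℝ y l ≠ 0 := by rw [ev_gm hLs]; exact hL0
  have e1 : l * ∑ i, der ℝ y i (l * Y i) = l * l * pl (divg (der ℝ (φ x)) W
      + dirDer (der ℝ (φ x)) W ℓ) := by
    have e2 : pl (dirDer (der ℝ (φ x)) W ℓ)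
        = ∑ k, Y k * ∑ c, pl (der ℝ (φ x) c ℓ) * jac ℝ τ y c k := by
      rw [dirDer_apply, map_sum]
      simp only [map_mul, hW, mul_sum, sum_mul]
      rw [sum_comm]
      exact sum_congr rfl fun c _ => sum_congr rfl fun b _ => by ring
    rw [map_add, hdiv, e2, divg, add_assoc, ← sum_add_distrib, ← sum_add_distrib,
      mul_sum, mul_sum]
    refine sum_congr rfl fun k _ => ?_
    rw [Derivation.leibniz, smul_eq_mul, smul_eq_mul]
    linear_combination (Y k) * hdl k
  have e3 := congrArg (evGerm ℝ y) e1
  rw [map_mul, map_mul, map_mul, ev_pull hτ h] at e3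
  rw [e0]
  field_simp
  have e4 : evGerm ℝ y l * evGerm ℝ y (∑ i, der ℝ y i (l * Y i))
    = evGerm ℝ y l * (evGerm ℝ y l * evGerm ℝ (φ x) (divg (der ℝ (φ x)) W
      + dirDer (der ℝ (φ x)) W ℓ)) := by rw [e3]; ring
  exact mul_left_cancel₀ hel e4

end Volume

/-! ### Families of germs of one smooth function -/

section Families

variable {n : ℕ} {𝕜 : Type*} [RCLike 𝕜] {y₀ : Model n}

/-- Near `y₀`, the germs `γ y` are the germs of one smooth function. -/
def IsFam (y₀ : Model n) (γ : (y : Model n) → SmGerm 𝕜 y) : Prop :=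
  ∃ F : Model n → 𝕜, ∀ᶠ y in 𝓝 y₀, ContDiffAt ℝ ∞ F y ∧ γ y = gm y F

lemma isFam_gm {F : Model n → 𝕜} (hF : ∀ᶠ y in 𝓝 y₀, ContDiffAt ℝ ∞ F y) :
    IsFam y₀ fun y => gm y F := ⟨F, hF.mono fun _ h => ⟨h, rfl⟩⟩

lemma IsFam.add {γ ρ : (y : Model n) → SmGerm 𝕜 y} (h : IsFam y₀ γ) (h' : IsFam y₀ ρ) :
    IsFam y₀ fun y => γ y + ρ y := by
  obtain ⟨F, hF⟩ := h
  obtain ⟨G, hG⟩ := h'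
  refine ⟨fun y => F y + G y, ?_⟩
  filter_upwards [hF, hG] with y h1 h2
  exact ⟨h1.1.add h2.1, by rw [h1.2, h2.2, gm_add h1.1 h2.1]⟩

lemma IsFam.sub {γ ρ : (y : Model n) → SmGerm 𝕜 y} (h : IsFam y₀ γ) (h' : IsFam y₀ ρ) :
    IsFam y₀ fun y => γ y - ρ y := by
  obtain ⟨F, hF⟩ := h
  obtain ⟨G, hG⟩ := h'
  refine ⟨fun y => F y - G y, ?_⟩
  filter_upwards [hF, hG] with y h1 h2
  exact ⟨h1.1.sub h2.1, by rw [h1.2, h2.2, gm_sub h1.1 h2.1]⟩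

lemma IsFam.mul {γ ρ : (y : Model n) → SmGerm 𝕜 y} (h : IsFam y₀ γ) (h' : IsFam y₀ ρ) :
    IsFam y₀ fun y => γ y * ρ y := by
  obtain ⟨F, hF⟩ := h
  obtain ⟨G, hG⟩ := h'
  refine ⟨fun y => F y * G y, ?_⟩
  filter_upwards [hF, hG] with y h1 h2
  exact ⟨h1.1.mul h2.1, by rw [h1.2, h2.2, gm_mul h1.1 h2.1]⟩

lemma isFam_const (c : 𝕜) : IsFam y₀ fun y => algebraMap 𝕜 (SmGerm 𝕜 y) c :=
  isFam_gm (Filter.Eventually.of_forall fun _ => contDiffAt_const)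

lemma isFam_zero : IsFam y₀ fun y => (0 : SmGerm 𝕜 y) := by
  simpa using isFam_const (y₀ := y₀) (0 : 𝕜)

lemma IsFam.sum {ι : Type*} (s : Finset ι) {γ : ι → (y : Model n) → SmGerm 𝕜 y}
    (h : ∀ i, IsFam y₀ (γ i)) : IsFam y₀ fun y => ∑ i ∈ s, γ i y := by
  classical
  induction s using Finset.induction_on with
  | empty => simpa using isFam_zero
  | insert a s ha ih =>
    simp only [Finset.sum_insert ha]
    exact (h a).add ih

lemma IsFam.der {γ : (y : Model n) → SmGerm 𝕜 y} (h : IsFam y₀ γ) (i : Fin n) :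
    IsFam y₀ fun y => der 𝕜 y i (γ y) := by
  obtain ⟨F, hF⟩ := h
  refine ⟨pd i F, ?_⟩
  filter_upwards [hF] with y h1
  exact ⟨contDiffAt_pd h1.1 i, by rw [h1.2, der_gm h1.1]⟩

lemma IsFam.smooth {γ : (y : Model n) → SmGerm 𝕜 y} (h : IsFam y₀ γ) :
    ContDiffAt ℝ ∞ (fun y => evGerm 𝕜 y (γ y)) y₀ ∧ gm y₀ (fun y => evGerm 𝕜 y (γ y)) = γ y₀ := by
  obtain ⟨F, hF⟩ := h
  have h1 := hF.self_of_nhds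
  have h2 : (fun y => evGerm 𝕜 y (γ y)) =ᶠ[𝓝 y₀] F := by
    filter_upwards [hF] with y hy
    rw [hy.2, ev_gm hy.1]
  exact ⟨h1.1.congr_of_eventuallyEq h2, (gm_congr h2).trans h1.2.symm⟩

lemma IsFam.eq_of_ev {γ ρ : (y : Model n) → SmGerm 𝕜 y} (h : IsFam y₀ γ) (h' : IsFam y₀ ρ)
    (e : ∀ᶠ y in 𝓝 y₀, evGerm 𝕜 y (γ y) = evGerm 𝕜 y (ρ y)) : γ y₀ = ρ y₀ := by
  rw [← h.smooth.2, ← h'.smooth.2]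
  exact gm_congr e

variable {X v : (y : Model n) → Fin n → SmGerm 𝕜 y} {F : (y : Model n) → SmGerm 𝕜 y}
  {a : (y : Model n) → Fin n → Fin n → SmGerm 𝕜 y}

lemma IsFam.dirDer (hX : ∀ i, IsFam y₀ fun y => X y i) (hF : IsFam y₀ F) :
    IsFam y₀ fun y => dirDer (ConfQuant.der 𝕜 y) (X y) (F y) := by
  simp only [dirDer_apply]
  exact IsFam.sum _ fun k => (hX k).mul (hF.der k)

lemma IsFam.divg (hX : ∀ i, IsFam y₀ fun y => X y i) :
    IsFam y₀ fun y => divg (ConfQuant.der 𝕜 y) (X y) :=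
  IsFam.sum _ fun k => (hX k).der k

lemma IsFam.lie0 (w : 𝕜) (hX : ∀ i, IsFam y₀ fun y => X y i) (hF : IsFam y₀ F) :
    IsFam y₀ fun y => lie0 (ConfQuant.der 𝕜 y) (algebraMap 𝕜 _ w) (X y) (F y) :=
  (IsFam.dirDer hX hF).add (((isFam_const w).mul (IsFam.divg hX)).mul hF)

lemma IsFam.lie1 (w : 𝕜) (hX : ∀ i, IsFam y₀ fun y => X y i) (hv : ∀ i, IsFam y₀ fun y => v y i)
    (i : Fin n) :
    IsFam y₀ fun y => lie1 (ConfQuant.der 𝕜 y) (algebraMap 𝕜 _ w) (X y) (v y) i :=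
  ((IsFam.dirDer hX (hv i)).sub (IsFam.sum _ fun k => (hv k).mul ((hX i).der k))).add
    (((isFam_const w).mul (IsFam.divg hX)).mul (hv i))

lemma IsFam.lie2 (w : 𝕜) (hX : ∀ i, IsFam y₀ fun y => X y i)
    (ha : ∀ i j, IsFam y₀ fun y => a y i j) (i j : Fin n) :
    IsFam y₀ fun y => lie2 (ConfQuant.der 𝕜 y) (algebraMap 𝕜 _ w) (X y) (a y) i j :=
  (((IsFam.dirDer hX (ha i j)).sub (IsFam.sum _ fun k => (ha k j).mul ((hX i).der k))).sub
    (IsFam.sum _ fun k => (ha i k).mul ((hX j).der k))).add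
    (((isFam_const w).mul (IsFam.divg hX)).mul (ha i j))

lemma IsFam.opr (ha : ∀ i j, IsFam y₀ fun y => a y i j) (hv : ∀ i, IsFam y₀ fun y => v y i)
    {b : (y : Model n) → SmGerm 𝕜 y} (hb : IsFam y₀ b) (hF : IsFam y₀ F) :
    IsFam y₀ fun y => opr (ConfQuant.der 𝕜 y) (a y) (v y) (b y) (F y) :=
  ((IsFam.sum _ fun i => IsFam.sum _ fun j => (ha i j).mul ((hF.der j).der i)).add
    (IsFam.sum _ fun i => (hv i).mul (hF.der i))).add (hb.mul hF)

variable {e : Fin n → 𝕜}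

lemma IsFam.divg2 (ha : ∀ i j, IsFam y₀ fun y => a y i j) (j : Fin n) :
    IsFam y₀ fun y => divg2 (ConfQuant.der 𝕜 y) (a y) j :=
  IsFam.sum _ fun i => (ha i j).der i

lemma IsFam.grad_trc (ha : ∀ i j, IsFam y₀ fun y => a y i j) (i : Fin n) :
    IsFam y₀ fun y => grad (ConfQuant.der 𝕜 y) (fun i => algebraMap 𝕜 _ (e i))
      (trc (fun i => algebraMap 𝕜 _ (e i)) (a y)) i :=
  (isFam_const (e i)).mul
    ((IsFam.sum _ fun i => (isFam_const (e i)).mul (ha i i)).der i)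

lemma IsFam.quant1 (b1 b2 : 𝕜) (ha : ∀ i j, IsFam y₀ fun y => a y i j)
    (hv : ∀ i, IsFam y₀ fun y => v y i) (i : Fin n) :
    IsFam y₀ fun y => quant1 (ConfQuant.der 𝕜 y) (fun i => algebraMap 𝕜 _ (e i))
      (algebraMap 𝕜 _ b1) (algebraMap 𝕜 _ b2) (a y) (v y) i :=
  ((hv i).add ((isFam_const b1).mul (IsFam.divg2 ha i))).add
    ((isFam_const b2).mul (IsFam.grad_trc ha i))

lemma IsFam.quant0 (c b3 b4 : 𝕜) (ha : ∀ i j, IsFam y₀ fun y => a y i j)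
    (hv : ∀ i, IsFam y₀ fun y => v y i) (hF : IsFam y₀ F) :
    IsFam y₀ fun y => quant0 (ConfQuant.der 𝕜 y) (fun i => algebraMap 𝕜 _ (e i))
      (algebraMap 𝕜 _ c) (algebraMap 𝕜 _ b3) (algebraMap 𝕜 _ b4) (a y) (v y) (F y) :=
  ((hF.add ((isFam_const c).mul (IsFam.divg hv))).add
    ((isFam_const b3).mul (IsFam.divg (IsFam.divg2 ha)))).add
    ((isFam_const b4).mul (IsFam.divg (IsFam.grad_trc ha)))

end Families

/-! ### Densities in charts -/

section Densities

variable {n : ℕ} {M : Type*} [TopologicalSpace M] [ChartedSpace (Model n) M]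
  {𝕜 : Type*} [RCLike 𝕜] [IsManifold (𝓡 n) ∞ M] [T2Space M] (g : PseudoRiemannianMetric n M)
  {φ : OpenPartialHomeomorph M (Model n)} {X : VField n M} {x : M}

/-- The volume density is smooth in the chart `φ`. -/
def GoodVol (φ : OpenPartialHomeomorph M (Model n)) : Prop :=
  ∀ y ∈ φ.target, ContDiffAt ℝ ∞ (volCoord g φ) y ∧ 0 < volCoord g φ y

lemma GoodVol.log_smooth {g : PseudoRiemannianMetric n M} (h : GoodVol g φ) {y : Model n}
    (hy : y ∈ φ.target) : ContDiffAt ℝ ∞ (fun y => Real.log (volCoord g φ y)) y :=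
  (h y hy).1.log (h y hy).2.ne'

variable (𝕜) in
/-- The germ of the logarithm of the volume density. -/
def logVol (φ : OpenPartialHomeomorph M (Model n)) (y : Model n) : SmGerm 𝕜 y :=
  gm y fun z => ((Real.log (volCoord g φ z) : ℝ) : 𝕜)

/-- The germ of the `w`-th power of the volume density. -/
def gauge (φ : OpenPartialHomeomorph M (Model n)) (w : 𝕜) (y : Model n) : SmGerm 𝕜 y :=
  gm y fun z => NormedSpace.exp (w * ((Real.log (volCoord g φ z) : ℝ) : 𝕜))

lemma exp_smooth : ContDiff ℝ ∞ (NormedSpace.exp : 𝕜 → 𝕜) := by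
  have h : ContDiff 𝕜 ∞ (NormedSpace.exp : 𝕜 → 𝕜) := contDiff_iff_contDiffAt.2 fun x =>
    (NormedSpace.exp_analytic (𝕂 := 𝕜) x).contDiffAt
  exact h.restrict_scalars ℝ

variable {g} (hv : GoodVol g φ)
include hv

lemma gauge_smooth (w : 𝕜) {y : Model n} (hy : y ∈ φ.target) :
    ContDiffAt ℝ ∞ (fun z => NormedSpace.exp (w * ((Real.log (volCoord g φ z) : ℝ) : 𝕜))) y :=
  exp_smooth.contDiffAt.comp y (contDiffAt_const.mul (ofReal_smooth (hv.log_smooth hy)))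

lemma der_gauge (w : 𝕜) {y : Model n} (hy : y ∈ φ.target) (i : Fin n) :
    der 𝕜 y i (gauge g φ w y)
      = algebraMap 𝕜 _ w * der 𝕜 y i (logVol 𝕜 g φ y) * gauge g φ w y := by
  have hl := ofReal_smooth (𝕜 := 𝕜) (hv.log_smooth hy)
  rw [gauge, logVol, der_gm (gauge_smooth hv w hy), der_gm hl, algebraMap_germ,
    ← gm_mul contDiffAt_const (contDiffAt_pd hl i),
    ← gm_mul (contDiffAt_const.mul (contDiffAt_pd hl i)) (gauge_smooth hv w hy)]
  refine gm_congr ?_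
  filter_upwards [eventually_differentiableAt hl] with z hz
  have h1 := hz.hasFDerivAt.const_mul w
  have h2 := ((hasDerivAt_exp (𝕂 := 𝕜)
    (x := w * ((Real.log (volCoord g φ z) : ℝ) : 𝕜))).hasFDerivAt.restrictScalars ℝ).comp z h1
  have h3 : pd i (fun z => NormedSpace.exp (w * ((Real.log (volCoord g φ z) : ℝ) : 𝕜))) z = _ :=
    congrArg (fun L => L (basisVec n i)) h2.fderiv
  rw [h3]
  simp [pd, mul_comm, mul_assoc]

lemma gauge_add (w w' : 𝕜) {y : Model n} (hy : y ∈ φ.target) :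
    gauge g φ (w + w') y = gauge g φ w y * gauge g φ w' y := by
  rw [gauge, gauge, gauge, ← gm_mul (gauge_smooth hv w hy) (gauge_smooth hv w' hy)]
  congr 1
  funext z
  rw [add_mul, NormedSpace.exp_add]

omit hv in
lemma gauge_zero (y : Model n) : gauge g φ (0 : 𝕜) y = 1 := by
  rw [← gm_one, gauge]
  congr 1
  funext z
  simp

lemma gauge_neg_mul (w : 𝕜) {y : Model n} (hy : y ∈ φ.target) :
    gauge g φ (-w) y * gauge g φ w y = 1 := by
  rw [← gauge_add hv _ _ hy, neg_add_cancel, gauge_zero]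

omit hv in
lemma eventually_target {y : Model n} (hy : y ∈ φ.target) : ∀ᶠ z in 𝓝 y, z ∈ φ.target :=
  φ.open_target.mem_nhds hy

lemma isFam_gauge (w : 𝕜) {y : Model n} (hy : y ∈ φ.target) : IsFam y (gauge g φ w) :=
  isFam_gm ((eventually_target hy).mono fun _ h => gauge_smooth hv w h)

lemma isFam_logVol {y : Model n} (hy : y ∈ φ.target) : IsFam y (logVol 𝕜 g φ) :=
  isFam_gm ((eventually_target hy).mono fun _ h => ofReal_smooth (hv.log_smooth h))

omit hv

lemma isFam_vfGerm (hφ : φ ∈ smoothCharts (n := n) M) (hx : x ∈ φ.source)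
    (hX : ∀ᶠ z in 𝓝 x, SmoothVFAt X z) (i : Fin n) :
    IsFam (φ x) fun y => vfGerm 𝕜 φ X y i := by
  refine isFam_gm (eventually_chart hx ?_)
  filter_upwards [hX] with z hz hz'
  exact ofReal_smooth (coord_smooth (hz φ hφ hz') i)

lemma isFam_fun (hφ : φ ∈ smoothCharts (n := n) M) (hx : x ∈ φ.source) (f : smoothFun n 𝕜 M) :
    IsFam (φ x) fun y => gm y (f.1 ∘ φ.symm) :=
  isFam_gm ((eventually_target (φ.map_source hx)).mono fun _ h => smoothFun_contDiffAt f hφ h)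

/-- The divergence germ, in the chart `φ`. -/
lemma ev_divergence (hφ : φ ∈ smoothCharts (n := n) M) (hv : GoodVol g φ) (hx : x ∈ φ.source)
    (hX : SmoothVFAt X x) :
    ((divergence g X x : ℝ) : 𝕜) = evGerm 𝕜 (φ x) (divg (der 𝕜 (φ x)) (vfGerm 𝕜 φ X (φ x))
      + dirDer (der 𝕜 (φ x)) (vfGerm 𝕜 φ X (φ x)) (logVol 𝕜 g φ (φ x))) := by
  have hy := φ.map_source hx
  have hXi := fun i => coord_smooth (hX φ hφ hx) i
  have hl := hv.log_smooth hy
  rw [divergence_eq g hφ hx hX (hv _ hy).1 (hv _ hy).2, dirDer_apply, dirDer_apply]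
  simp only [divg, map_add, map_sum, map_mul]
  have hvR : ∀ i, vfGerm ℝ φ X (φ x) i = gm (φ x) fun z => vfCoord φ X z i := fun i => rfl
  have e1 : ∀ i, evGerm 𝕜 (φ x) (der 𝕜 (φ x) i (vfGerm 𝕜 φ X (φ x) i))
      = ((evGerm ℝ (φ x) (der ℝ (φ x) i (vfGerm ℝ φ X (φ x) i)) : ℝ) : 𝕜) := by
    intro i
    rw [hvR, vfGerm, der_gm (ofReal_smooth (hXi i)), der_gm (𝕜 := ℝ) (hXi i),
      ev_gm (contDiffAt_pd (ofReal_smooth (hXi i)) i), ev_gm (𝕜 := ℝ) (contDiffAt_pd (hXi i) i)]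
    exact pd_ofReal ((hXi i).differentiableAt (by simp)) i
  have e2 : ∀ i, evGerm 𝕜 (φ x) (vfGerm 𝕜 φ X (φ x) i)
      = ((evGerm ℝ (φ x) (vfGerm ℝ φ X (φ x) i) : ℝ) : 𝕜) := by
    intro i
    rw [hvR, vfGerm, ev_gm (ofReal_smooth (hXi i)), ev_gm (𝕜 := ℝ) (hXi i)]
  have e3 : ∀ i, evGerm 𝕜 (φ x) (der 𝕜 (φ x) i (logVol 𝕜 g φ (φ x)))
      = ((evGerm ℝ (φ x) (der ℝ (φ x) i (gm (φ x) fun y => Real.log (volCoord g φ y))) : ℝ) : 𝕜) := by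
    intro i
    rw [logVol, der_gm (ofReal_smooth hl), der_gm (𝕜 := ℝ) hl,
      ev_gm (contDiffAt_pd (ofReal_smooth hl) i), ev_gm (𝕜 := ℝ) (contDiffAt_pd hl i)]
    exact pd_ofReal (hl.differentiableAt (by simp)) i
  simp only [e1, e2, e3]

lemma ev_derivAlong (hφ : φ ∈ smoothCharts (n := n) M) (hx : x ∈ φ.source)
    (hX : SmoothVFAt X x) {f : M → 𝕜} (hf : ContMDiffAt (𝓡 n) 𝓘(ℝ, 𝕜) ∞ f x) :
    derivAlong X f x
      = evGerm 𝕜 (φ x) (dirDer (der 𝕜 (φ x)) (vfGerm 𝕜 φ X (φ x)) (gm (φ x) (f ∘ φ.symm))) := by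
  have h1 : derivAlong X f x = fderiv ℝ (f ∘ φ.symm) (φ x) (vfCoord φ X (φ x)) := by
    rw [vfCoord_chart X hx]
    exact dfun_eq hφ hx hf (X x)
  have hf' := (contDiffAt_chart_iff hφ hx).1 hf
  rw [h1, fderiv_eq_sum_pd, dirDer_apply, map_sum]
  refine sum_congr rfl fun i _ => ?_
  rw [map_mul, vfGerm, ev_gm (ofReal_smooth (coord_smooth (hX φ hφ hx) i)), der_gm hf',
    ev_gm (contDiffAt_pd hf' i)]

/-- The germ of the flat density that corresponds to the density `f |vol|^w`. -/
def dens (g : PseudoRiemannianMetric n M) (φ : OpenPartialHomeomorph M (Model n)) (w : 𝕜)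
    (f : M → 𝕜) (y : Model n) : SmGerm 𝕜 y := gauge g φ w y * gm y (f ∘ φ.symm)

lemma isFam_dens (hφ : φ ∈ smoothCharts (n := n) M) (hv : GoodVol g φ) (hx : x ∈ φ.source) (w : 𝕜)
    (f : smoothFun n 𝕜 M) : IsFam (φ x) (dens g φ w f.1) :=
  (isFam_gauge hv w (φ.map_source hx)).mul (isFam_fun hφ hx f)

lemma lieDensity_germ (hφ : φ ∈ smoothCharts (n := n) M) (hv : GoodVol g φ) (hx : x ∈ φ.source)
    (hX : ∀ᶠ z in 𝓝 x, SmoothVFAt X z) (w : 𝕜) (f f' : smoothFun n 𝕜 M)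
    (h : ∀ᶠ z in 𝓝 x, f'.1 z = lieDensity g w X f.1 z) :
    dens g φ w f'.1 (φ x) = lie0 (der 𝕜 (φ x)) (algebraMap 𝕜 _ w) (vfGerm 𝕜 φ X (φ x))
      (dens g φ w f.1 (φ x)) := by
  have hXf := isFam_vfGerm (𝕜 := 𝕜) hφ hx hX
  have hff := isFam_fun hφ hx f
  have hff' := isFam_fun hφ hx f'
  have key : gm (φ x) (f'.1 ∘ φ.symm)
      = dirDer (der 𝕜 (φ x)) (vfGerm 𝕜 φ X (φ x)) (gm (φ x) (f.1 ∘ φ.symm))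
        + algebraMap 𝕜 _ w * (divg (der 𝕜 (φ x)) (vfGerm 𝕜 φ X (φ x))
          + dirDer (der 𝕜 (φ x)) (vfGerm 𝕜 φ X (φ x)) (logVol 𝕜 g φ (φ x)))
          * gm (φ x) (f.1 ∘ φ.symm) := by
    refine IsFam.eq_of_ev hff' ((IsFam.dirDer hXf hff).add (((isFam_const w).mul
      ((IsFam.divg hXf).add (IsFam.dirDer hXf (isFam_logVol hv (φ.map_source hx))))).mul hff)) ?_
    refine eventually_chart hx ?_
    filter_upwards [h, hX] with z hz hXz hz'
    have hf1 := smoothFun_contDiffAt f hφ (φ.map_source hz')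
    have hf2 := smoothFun_contDiffAt f' hφ (φ.map_source hz')
    rw [ev_gm hf2, map_add, map_mul, map_mul, ev_algebraMap, ← ev_divergence hφ hv hz' hXz,
      ← ev_derivAlong hφ hz' hXz (f.2 z), ev_gm hf1, Function.comp_apply, Function.comp_apply,
      φ.left_inv hz', hz]
    rfl
  have hg : dirDer (der 𝕜 (φ x)) (vfGerm 𝕜 φ X (φ x)) (gauge g φ w (φ x))
      = algebraMap 𝕜 _ w * dirDer (der 𝕜 (φ x)) (vfGerm 𝕜 φ X (φ x)) (logVol 𝕜 g φ (φ x))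
        * gauge g φ w (φ x) := by
    simp only [dirDer_apply, der_gauge hv w (φ.map_source hx), mul_sum, sum_mul]
    exact sum_congr rfl fun i _ => by ring
  rw [dens, key, dens, lie0, Derivation.leibniz, smul_eq_mul, smul_eq_mul, hg]
  ring

end Densities

/-! ### The Lie derivative of symbols in charts -/

section AlgebraicSymbols

variable {K R : Type*} [Field K] [CommRing R] [Algebra K R] {n : ℕ} {d : Fin n → Derivation K R R}

/-- The polynomial with coefficients `a`, `b`, `c`. -/
def polySym (a : Fin n → Fin n → R) (b : Fin n → R) (c : R) (ξ : Fin n → R) : R :=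
  ∑ i, ∑ j, a i j * (ξ i * ξ j) + ∑ i, b i * ξ i + c

lemma lie_polySym (hd : ∀ i j F, d i (d j F) = d j (d i F)) (X : Fin n → R)
    (a : Fin n → Fin n → R) (b : Fin n → R) (c F : R) :
    polySym (lie2 d 0 X a) (lie1 d 0 X b) (lie0 d 0 X c) (fun i => d i F)
      = dirDer d X (polySym a b c fun i => d i F)
        - (∑ i, ∑ j, a i j * (d i F * d j (dirDer d X F) + d i (dirDer d X F) * d j F)
          + ∑ i, b i * d i (dirDer d X F)) := by
  have e2 : ∑ i, ∑ j, (∑ k, a k j * d k (X i)) * (d i F * d j F)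
      = ∑ i, ∑ j, a i j * ((∑ k, d i (X k) * d k F) * d j F) := by
    simp only [sum_mul, mul_sum]
    rw [sum_comm]
    conv_rhs => rw [sum_comm]
    refine sum_congr rfl fun j _ => ?_
    rw [sum_comm]
    exact sum_congr rfl fun k _ => sum_congr rfl fun i _ => by ring
  have e3 : ∑ i, ∑ j, (∑ k, a i k * d k (X j)) * (d i F * d j F)
      = ∑ i, ∑ j, a i j * (d i F * (∑ k, d j (X k) * d k F)) := by
    simp only [sum_mul, mul_sum]
    refine sum_congr rfl fun i _ => ?_
    rw [sum_comm]
    exact sum_congr rfl fun k _ => sum_congr rfl fun i _ => by ring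
  have e1 : ∑ i, (∑ k, b k * d k (X i)) * d i F = ∑ i, b i * (∑ k, d i (X k) * d k F) := by
    simp only [sum_mul, mul_sum]
    rw [sum_comm]
    exact sum_congr rfl fun k _ => sum_congr rfl fun i _ => by ring
  simp only [polySym, lie2, lie1, lie0, zero_mul, add_zero, sub_mul, sum_sub_distrib, e1, e2,
    e3, map_add, map_sum, Derivation.leibniz, smul_eq_mul, der_dirDer hd, mul_add, add_mul,
    sum_add_distrib]
  have r1 : ∑ i, ∑ j, dirDer d X (a i j) * (d i F * d j F)
      = ∑ i, ∑ j, d i F * d j F * dirDer d X (a i j) :=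
    sum_congr rfl fun i _ => sum_congr rfl fun j _ => by ring
  have r2 : ∑ i, ∑ j, a i j * (dirDer d X (d i F) * d j F)
      = ∑ i, ∑ j, a i j * (d j F * dirDer d X (d i F)) :=
    sum_congr rfl fun i _ => sum_congr rfl fun j _ => by ring
  have r3 : ∑ i, dirDer d X (b i) * d i F = ∑ i, d i F * dirDer d X (b i) :=
    sum_congr rfl fun i _ => by ring
  rw [r1, r2, r3]
  ring

end AlgebraicSymbols

section LieSymbols

variable {n : ℕ} {M : Type*} [TopologicalSpace M] [ChartedSpace (Model n) M]
  {𝕜 : Type*} [RCLike 𝕜] [IsManifold (𝓡 n) ∞ M] [T2Space M] {g : PseudoRiemannianMetric n M}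
  {φ : OpenPartialHomeomorph M (Model n)} {X : VField n M} {x : M}

lemma dfun_ofReal {f : M → ℝ} (hf : ContMDiffAt (𝓡 n) 𝓘(ℝ, ℝ) ∞ f x)
    (v : TangentSpace (𝓡 n) x) :
    dfun (fun z => ((f z : ℝ) : 𝕜)) x v = ((dfun f x v : ℝ) : 𝕜) := by
  have h1 : MDifferentiableAt (𝓡 n) 𝓘(ℝ, ℝ) f x := hf.mdifferentiableAt (by simp)
  have h2 : MDifferentiableAt 𝓘(ℝ, ℝ) 𝓘(ℝ, 𝕜) (RCLike.ofRealCLM (K := 𝕜)) (f x) :=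
    (RCLike.ofRealCLM (K := 𝕜)).differentiableAt.mdifferentiableAt
  have h3 := mfderiv_comp x h2 h1
  rw [mfderiv_eq_fderiv, ContinuousLinearMap.fderiv] at h3
  exact DFunLike.congr_fun h3 v

/-- The germs of the coefficients of order two of a symbol. -/
def cs2 (φ : OpenPartialHomeomorph M (Model n)) (P : symbols2 n 𝕜 M) (y : Model n) (i j : Fin n) :
    SmGerm 𝕜 y := gm y (sc2 φ P.1 i j)

/-- The germs of the coefficients of order one of a symbol. -/
def cs1 (φ : OpenPartialHomeomorph M (Model n)) (P : symbols2 n 𝕜 M) (y : Model n) (i : Fin n) :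
    SmGerm 𝕜 y := gm y (sc1 φ P.1 i)

/-- The germ of the coefficient of order zero of a symbol. -/
def cs0 (φ : OpenPartialHomeomorph M (Model n)) (P : symbols2 n 𝕜 M) (y : Model n) :
    SmGerm 𝕜 y := gm y (sc0 φ P.1)

lemma cs2_symm (P : symbols2 n 𝕜 M) (y : Model n) (i j : Fin n) : cs2 φ P y i j = cs2 φ P y j i := by
  rw [cs2, cs2]
  congr 1
  funext z
  exact sc2_symm φ P.1 i j z

lemma isFam_cs2 (hφ : φ ∈ smoothCharts (n := n) M) (P : symbols2 n 𝕜 M) (hx : x ∈ φ.source)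
    (i j : Fin n) : IsFam (φ x) fun y => cs2 φ P y i j :=
  isFam_gm ((eventually_target (φ.map_source hx)).mono fun _ h => sc2_smooth hφ P h i j)

lemma isFam_cs1 (hφ : φ ∈ smoothCharts (n := n) M) (P : symbols2 n 𝕜 M) (hx : x ∈ φ.source)
    (i : Fin n) : IsFam (φ x) fun y => cs1 φ P y i :=
  isFam_gm ((eventually_target (φ.map_source hx)).mono fun _ h => sc1_smooth hφ P h i)

lemma isFam_cs0 (hφ : φ ∈ smoothCharts (n := n) M) (P : symbols2 n 𝕜 M) (hx : x ∈ φ.source) :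
    IsFam (φ x) fun y => cs0 φ P y :=
  isFam_gm ((eventually_target (φ.map_source hx)).mono fun _ h => sc0_smooth hφ P h)

lemma symbol_eq_polySym (hφ : φ ∈ smoothCharts (n := n) M) (P : symbols2 n 𝕜 M)
    (hx : x ∈ φ.source) (ξ : Cotangent n x) :
    P.1 x ξ = polySym (fun i j => evGerm 𝕜 (φ x) (cs2 φ P (φ x) i j))
      (fun i => evGerm 𝕜 (φ x) (cs1 φ P (φ x) i)) (evGerm 𝕜 (φ x) (cs0 φ P (φ x)))
      (fun i => (ξ (cvec φ x i) : 𝕜)) := by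
  have hy := φ.map_source hx
  simp only [cs2, cs1, cs0, ev_gm (sc2_smooth hφ P hy _ _), ev_gm (sc1_smooth hφ P hy _),
    ev_gm (sc0_smooth hφ P hy)]
  exact symbol_eq_coeffs hφ P hx ξ

lemma ev_polySym {y : Model n} (a : Fin n → Fin n → SmGerm 𝕜 y) (b : Fin n → SmGerm 𝕜 y)
    (c : SmGerm 𝕜 y) (ξ : Fin n → SmGerm 𝕜 y) :
    evGerm 𝕜 y (polySym a b c ξ) = polySym (fun i j => evGerm 𝕜 y (a i j))
      (fun i => evGerm 𝕜 y (b i)) (evGerm 𝕜 y c) (fun i => evGerm 𝕜 y (ξ i)) := by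
  simp only [polySym, map_add, map_sum, map_mul]

/-- The derivative of the symbol `P` at `ξ` in the direction `ζ`. -/
def polar (P : symbols2 n 𝕜 M) (x : M) (ξ ζ : Cotangent n x) : 𝕜 :=
  P.1 x (ξ + ζ) - P.1 x ξ - (P.1 x ζ + P.1 x (-ζ)) / 2 + P.1 x 0

lemma polar_eq (hφ : φ ∈ smoothCharts (n := n) M) (P : symbols2 n 𝕜 M) (hx : x ∈ φ.source)
    (ξ ζ : Cotangent n x) :
    polar P x ξ ζ = ∑ i, ∑ j, evGerm 𝕜 (φ x) (cs2 φ P (φ x) i j)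
        * ((ξ (cvec φ x i) : 𝕜) * (ζ (cvec φ x j) : 𝕜) + (ζ (cvec φ x i) : 𝕜) * (ξ (cvec φ x j) : 𝕜))
      + ∑ i, evGerm 𝕜 (φ x) (cs1 φ P (φ x) i) * (ζ (cvec φ x i) : 𝕜) := by
  simp only [polar, symbol_eq_polySym hφ P hx, polySym, add_apply, neg_apply, zero_apply]
  push_cast
  simp only [mul_add, add_mul, sum_add_distrib, mul_neg, neg_mul, neg_neg,
    sum_neg_distrib, mul_zero, sum_const_zero]
  ring

/-- The coordinate expression of the part of the Lie derivative of a symbol that does not involve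
the divergence, evaluated at the differential of a function with germ `F`. -/
def lieSym (φ : OpenPartialHomeomorph M (Model n)) (X : VField n M) (P : symbols2 n 𝕜 M)
    (y : Model n) (F : SmGerm 𝕜 y) : SmGerm 𝕜 y :=
  polySym (lie2 (der 𝕜 y) 0 (vfGerm 𝕜 φ X y) (cs2 φ P y))
    (lie1 (der 𝕜 y) 0 (vfGerm 𝕜 φ X y) (cs1 φ P y))
    (lie0 (der 𝕜 y) 0 (vfGerm 𝕜 φ X y) (cs0 φ P y)) fun i => der 𝕜 y i F

lemma dfun_cvec (hφ : φ ∈ smoothCharts (n := n) M) (hx : x ∈ φ.source) {f : M → ℝ}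
    (hf : ContMDiffAt (𝓡 n) 𝓘(ℝ, ℝ) ∞ f x) (i : Fin n) :
    ((dfun f x (cvec φ x i) : ℝ) : 𝕜)
      = evGerm 𝕜 (φ x) (der 𝕜 (φ x) i (gm (φ x) ((fun z => ((f z : ℝ) : 𝕜)) ∘ φ.symm))) := by
  have hf' : ContMDiffAt (𝓡 n) 𝓘(ℝ, 𝕜) ∞ (fun z => ((f z : ℝ) : 𝕜)) x :=
    (RCLike.ofRealCLM (K := 𝕜)).contDiff.contMDiff.contMDiffAt.comp x hf
  have h := (contDiffAt_chart_iff hφ hx).1 hf'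
  rw [← dfun_ofReal hf, der_gm h, ev_gm (contDiffAt_pd h i)]
  exact mfderiv_cvec hφ hx hf' i

lemma lieSym_invariant (hφ : φ ∈ smoothCharts (n := n) M) (hx : x ∈ φ.source)
    (hX : ∀ᶠ z in 𝓝 x, SmoothVFAt X z) (P : symbols2 n 𝕜 M) {f : M → ℝ}
    (hf : ContMDiff (𝓡 n) 𝓘(ℝ, ℝ) ∞ f) :
    evGerm 𝕜 (φ x) (lieSym φ X P (φ x) (gm (φ x) ((ofRealFun f hf : smoothFun n 𝕜 M).1 ∘ φ.symm)))
      = derivAlong X (fun z => P.1 z (dfun f z)) x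
        - polar P x (dfun f x) (dfun (fun z => dfun f z (X z)) x) := by
  have hXf := isFam_vfGerm (𝕜 := 𝕜) hφ hx hX
  have hff := isFam_fun (𝕜 := 𝕜) hφ hx (ofRealFun f hf)
  have hX0 := hX.self_of_nhds
  have hdf : ∀ z ∈ φ.source, ∀ i, ((dfun f z (cvec φ z i) : ℝ) : 𝕜) = evGerm 𝕜 (φ z)
      (der 𝕜 (φ z) i (gm (φ z) ((ofRealFun f hf : smoothFun n 𝕜 M).1 ∘ φ.symm))) :=
    fun z hz i => dfun_cvec hφ hz (hf z) i
  -- the function `X f`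
  have hq := IsFam.dirDer hXf hff
  have hqe : ((fun z => ((dfun f z (X z) : ℝ) : 𝕜)) ∘ φ.symm) =ᶠ[𝓝 (φ x)] fun y =>
      evGerm 𝕜 y (dirDer (der 𝕜 y) (vfGerm 𝕜 φ X y)
        (gm y ((ofRealFun f hf : smoothFun n 𝕜 M).1 ∘ φ.symm))) := by
    refine eventually_chart hx ?_
    filter_upwards [hX] with z hz hz'
    rw [← ev_derivAlong hφ hz' hz ((ofRealFun f hf : smoothFun n 𝕜 M).2 z), Function.comp_apply,
      φ.left_inv hz']
    exact (dfun_ofReal (hf z) (X z)).symm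
  have hqs : ContMDiffAt (𝓡 n) 𝓘(ℝ, 𝕜) ∞ (fun z => ((dfun f z (X z) : ℝ) : 𝕜)) x :=
    (contDiffAt_chart_iff hφ hx).2 (hq.smooth.1.congr_of_eventuallyEq hqe)
  have hqr : ContMDiffAt (𝓡 n) 𝓘(ℝ, ℝ) ∞ (fun z => dfun f z (X z)) x := by
    have := (RCLike.reCLM (K := 𝕜)).contDiff.contMDiff.contMDiffAt.comp x hqs
    refine this.congr_of_eventuallyEq (Filter.Eventually.of_forall fun z => ?_)
    simp
  have hqg : gm (φ x) ((fun z => ((dfun f z (X z) : ℝ) : 𝕜)) ∘ φ.symm)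
      = dirDer (der 𝕜 (φ x)) (vfGerm 𝕜 φ X (φ x))
        (gm (φ x) ((ofRealFun f hf : smoothFun n 𝕜 M).1 ∘ φ.symm)) :=
    (gm_congr hqe).trans hq.smooth.2
  -- the function `P(df)`
  have hp : IsFam (φ x) fun y => polySym (cs2 φ P y) (cs1 φ P y) (cs0 φ P y)
      (fun i => der 𝕜 y i (gm y ((ofRealFun f hf : smoothFun n 𝕜 M).1 ∘ φ.symm))) :=
    ((IsFam.sum _ fun i => IsFam.sum _ fun j => (isFam_cs2 hφ P hx i j).mul
      ((hff.der i).mul (hff.der j))).add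
      (IsFam.sum _ fun i => (isFam_cs1 hφ P hx i).mul (hff.der i))).add (isFam_cs0 hφ P hx)
  have hpe : ((fun z => P.1 z (dfun f z)) ∘ φ.symm) =ᶠ[𝓝 (φ x)] fun y =>
      evGerm 𝕜 y (polySym (cs2 φ P y) (cs1 φ P y) (cs0 φ P y)
      (fun i => der 𝕜 y i (gm y ((ofRealFun f hf : smoothFun n 𝕜 M).1 ∘ φ.symm)))) := by
    refine eventually_chart hx ?_
    filter_upwards with z hz'
    rw [ev_polySym, Function.comp_apply, φ.left_inv hz', symbol_eq_polySym hφ P hz']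
    simp only [hdf z hz']
  have hps : ContMDiffAt (𝓡 n) 𝓘(ℝ, 𝕜) ∞ (fun z => P.1 z (dfun f z)) x :=
    (contDiffAt_chart_iff hφ hx).2 (hp.smooth.1.congr_of_eventuallyEq hpe)
  rw [ev_derivAlong hφ hx hX0 hps, gm_congr hpe, hp.smooth.2, polar_eq hφ P hx, lieSym,
    lie_polySym der_comm, map_sub]
  congr 1
  simp only [map_add, map_sum, map_mul, hdf x hx]
  have hζ : ∀ i, ((dfun (fun z => dfun f z (X z)) x (cvec φ x i) : ℝ) : 𝕜)
      = evGerm 𝕜 (φ x) (der 𝕜 (φ x) i (dirDer (der 𝕜 (φ x)) (vfGerm 𝕜 φ X (φ x))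
        (gm (φ x) ((ofRealFun f hf : smoothFun n 𝕜 M).1 ∘ φ.symm)))) := by
    intro i
    rw [dfun_cvec hφ hx hqr i, hqg]
  simp only [hζ]

lemma fderiv_quadratic (A : Fin n → Fin n → 𝕜) (B : Fin n → 𝕜) (c : 𝕜) (η ζ : Model n →L[ℝ] ℝ) :
    fderiv ℝ (fun η : Model n →L[ℝ] ℝ => polySym A B c fun i => (η (basisVec n i) : 𝕜)) η ζ
      = ∑ i, ∑ j, A i j * ((η (basisVec n i) : 𝕜) * (ζ (basisVec n j) : 𝕜)
          + (ζ (basisVec n i) : 𝕜) * (η (basisVec n j) : 𝕜))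
        + ∑ i, B i * (ζ (basisVec n i) : 𝕜) := by
  have hL : ∀ i : Fin n, HasFDerivAt (fun η : Model n →L[ℝ] ℝ => ((η (basisVec n i) : ℝ) : 𝕜))
      ((RCLike.ofRealCLM (K := 𝕜)).comp (ContinuousLinearMap.apply ℝ ℝ (basisVec n i))) η :=
    fun i => ((RCLike.ofRealCLM (K := 𝕜)).comp
      (ContinuousLinearMap.apply ℝ ℝ (basisVec n i))).hasFDerivAt
  have h := ((HasFDerivAt.fun_sum (u := Finset.univ) fun i _ =>
    HasFDerivAt.fun_sum (u := Finset.univ) fun j _ =>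
      ((hL i).mul (hL j)).const_mul (A i j)).fun_add
    (HasFDerivAt.fun_sum (u := Finset.univ) fun i _ => (hL i).const_mul (B i))).add_const c
  have h2 : fderiv ℝ (fun η : Model n →L[ℝ] ℝ =>
    polySym A B c fun i => (η (basisVec n i) : 𝕜)) η = _ := h.fderiv
  rw [h2]
  simp only [add_apply, sum_apply, smul_apply, smul_eq_mul, ContinuousLinearMap.comp_apply,
    ContinuousLinearMap.apply_apply, RCLike.ofRealCLM_apply]
  congr 1
  refine sum_congr rfl fun i _ => sum_congr rfl fun j _ => ?_
  ring

lemma symbolCoord_eq_polySym (hφ : φ ∈ smoothCharts (n := n) M) (P : symbols2 n 𝕜 M)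
    {y : Model n} (hy : y ∈ φ.target) (η : Model n →L[ℝ] ℝ) :
    symbolCoord φ P.1 y η = polySym (fun i j => sc2 φ P.1 i j y) (fun i => sc1 φ P.1 i y)
      (sc0 φ P.1 y) fun i => (η (basisVec n i) : 𝕜) := by
  have h := symbol_eq_coeffs hφ P (φ.map_target hy) (η.comp (dchart φ (φ.symm y)))
  simp only [φ.right_inv hy, ContinuousLinearMap.comp_apply, dchart_cvec hφ (φ.map_target hy)] at h
  exact h

lemma lieSymbol_chartAt (hX : ∀ᶠ z in 𝓝 x, SmoothVFAt X z) (w : 𝕜) (P : symbols2 n 𝕜 M) {f : M → ℝ}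
    (hf : ContMDiff (𝓡 n) 𝓘(ℝ, ℝ) ∞ f) :
    lieSymbol g w X P.1 x (dfun f x) = evGerm 𝕜 (chartAt (Model n) x x)
      (lieSym (chartAt (Model n) x) X P (chartAt (Model n) x x) (gm (chartAt (Model n) x x)
        ((ofRealFun f hf : smoothFun n 𝕜 M).1 ∘ (chartAt (Model n) x).symm)))
      + w * (divergence g X x : 𝕜) * P.1 x (dfun f x) := by
  have hψ : chartAt (Model n) x ∈ smoothCharts (n := n) M := IsManifold.chart_mem_maximalAtlas x
  have hx := mem_chart_source (Model n) x
  rw [lieSymbol]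
  set ψ := chartAt (Model n) x
  have hy := ψ.map_source hx
  have hX0 := hX.self_of_nhds ψ hψ hx
  have hXd : DifferentiableAt ℝ (vfCoord ψ X) (ψ x) := hX0.differentiableAt (by simp)
  set F := gm (ψ x) ((ofRealFun f hf : smoothFun n 𝕜 M).1 ∘ ψ.symm)
  set η : Model n →L[ℝ] ℝ := (dfun f x).comp (mfderiv (𝓡 n) (𝓡 n) ψ x).inverse
  have hη : ∀ i, ((η (basisVec n i) : ℝ) : 𝕜) = evGerm 𝕜 (ψ x) (der 𝕜 (ψ x) i F) :=
    fun i => dfun_cvec hψ hx (hf x) i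
  have hc : ∀ i, ContDiffAt ℝ ∞ (fun _ : Model n => ((η (basisVec n i) : ℝ) : 𝕜)) (ψ x) :=
    fun i => contDiffAt_const
  have h2 := fun i j => sc2_smooth hψ P hy i j
  have h1 := fun i => sc1_smooth hψ P hy i
  have h0 := sc0_smooth hψ P hy
  have hXi := fun i => coord_smooth hX0 i
  -- the derivative in the base directions
  have t1 : fderiv ℝ (fun y => symbolCoord ψ P.1 y η) (ψ x) (vfCoord ψ X (ψ x))
      = evGerm 𝕜 (ψ x) (dirDer (der 𝕜 (ψ x)) (vfGerm 𝕜 ψ X (ψ x)) (polySym (cs2 ψ P (ψ x))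
        (cs1 ψ P (ψ x)) (cs0 ψ P (ψ x))
        fun i => algebraMap 𝕜 _ ((η (basisVec n i) : ℝ) : 𝕜))) := by
    have e : (fun y => symbolCoord ψ P.1 y η) =ᶠ[𝓝 (ψ x)] fun y =>
        polySym (fun i j => sc2 ψ P.1 i j y) (fun i => sc1 ψ P.1 i y)
      (sc0 ψ P.1 y) fun i => (η (basisVec n i) : 𝕜) := by
      filter_upwards [ψ.open_target.mem_nhds hy] with y hy'
      exact symbolCoord_eq_polySym hψ P hy' η
    have s2 : ∀ i j, ContDiffAt ℝ ∞ (fun y => sc2 ψ P.1 i j y *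
        ((η (basisVec n i) : 𝕜) * (η (basisVec n j) : 𝕜))) (ψ x) :=
      fun i j => (h2 i j).mul ((hc i).mul (hc j))
    have s1 : ∀ i, ContDiffAt ℝ ∞ (fun y => sc1 ψ P.1 i y * (η (basisVec n i) : 𝕜)) (ψ x) :=
      fun i => (h1 i).mul (hc i)
    have hs : ContDiffAt ℝ ∞ (fun y =>
        polySym (fun i j => sc2 ψ P.1 i j y) (fun i => sc1 ψ P.1 i y)
      (sc0 ψ P.1 y) fun i => (η (basisVec n i) : 𝕜)) (ψ x) :=
      ((ContDiffAt.sum fun i _ => ContDiffAt.sum fun j _ => s2 i j).add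
        (ContDiffAt.sum fun i _ => s1 i)).add h0
    have eg : gm (ψ x) (fun y =>
        polySym (fun i j => sc2 ψ P.1 i j y) (fun i => sc1 ψ P.1 i y)
      (sc0 ψ P.1 y) fun i => (η (basisVec n i) : 𝕜)) = polySym (cs2 ψ P (ψ x))
        (cs1 ψ P (ψ x)) (cs0 ψ P (ψ x))
        fun i => algebraMap 𝕜 _ ((η (basisVec n i) : ℝ) : 𝕜) := by
      simp only [polySym, algebraMap_germ, cs2, cs1, cs0]
      rw [gm_add ((ContDiffAt.sum fun i _ => ContDiffAt.sum fun j _ => s2 i j).add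
        (ContDiffAt.sum fun i _ => s1 i)) h0,
        gm_add (ContDiffAt.sum fun i _ => ContDiffAt.sum fun j _ => s2 i j)
        (ContDiffAt.sum fun i _ => s1 i), gm_sum _ fun i _ => s1 i,
        gm_sum _ fun i _ => ContDiffAt.sum fun j _ => s2 i j]
      congr 1
      congr 1
      · refine sum_congr rfl fun i _ => ?_
        rw [gm_sum _ fun j _ => s2 i j]
        refine sum_congr rfl fun j _ => ?_
        rw [gm_mul (h2 i j) ((hc i).mul (hc j)), gm_mul (hc i) (hc j)]
      · refine sum_congr rfl fun i _ => ?_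
        rw [gm_mul (h1 i) (hc i)]
    rw [e.fderiv_eq, fderiv_eq_sum_pd, ← eg, dirDer_apply, map_sum]
    refine sum_congr rfl fun k _ => ?_
    rw [map_mul, der_gm hs, ev_gm (contDiffAt_pd hs k), vfGerm, ev_gm (ofReal_smooth (hXi k))]
  -- the derivative in the fibre directions
  have t2 : fderiv ℝ (symbolCoord ψ P.1 (ψ x)) η (η.comp (fderiv ℝ (vfCoord ψ X) (ψ x)))
      = ∑ i, ∑ j, sc2 ψ P.1 i j (ψ x) * ((η (basisVec n i) : 𝕜)
          * (((η.comp (fderiv ℝ (vfCoord ψ X) (ψ x))) (basisVec n j) : ℝ) : 𝕜)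
          + (((η.comp (fderiv ℝ (vfCoord ψ X) (ψ x))) (basisVec n i) : ℝ) : 𝕜)
            * (η (basisVec n j) : 𝕜))
        + ∑ i, sc1 ψ P.1 i (ψ x)
          * (((η.comp (fderiv ℝ (vfCoord ψ X) (ψ x))) (basisVec n i) : ℝ) : 𝕜) := by
    have e : symbolCoord ψ P.1 (ψ x) = fun η =>
        polySym (fun i j => sc2 ψ P.1 i j (ψ x)) (fun i => sc1 ψ P.1 i (ψ x))
      (sc0 ψ P.1 (ψ x)) fun i => (η (basisVec n i) : 𝕜) :=
      funext fun η => symbolCoord_eq_polySym hψ P hy η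
    rw [e, fderiv_quadratic]
  have hζ : ∀ i, (((η.comp (fderiv ℝ (vfCoord ψ X) (ψ x))) (basisVec n i) : ℝ) : 𝕜)
      = ∑ k, evGerm 𝕜 (ψ x) (der 𝕜 (ψ x) i (vfGerm 𝕜 ψ X (ψ x) k))
        * evGerm 𝕜 (ψ x) (der 𝕜 (ψ x) k F) := by
    intro i
    rw [ContinuousLinearMap.comp_apply,
      sum_basisVec (fderiv ℝ (vfCoord ψ X) (ψ x) (basisVec n i)), map_sum]
    push_cast
    refine sum_congr rfl fun k _ => ?_
    rw [← hη, vfGerm, der_gm (ofReal_smooth (hXi k)), ev_gm (contDiffAt_pd (ofReal_smooth (hXi k)) i),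
      pd_coord hXd, map_smul, smul_eq_mul]
    push_cast
    rfl
  congr 1
  rw [t1, t2]
  simp only [hζ]
  have e2 : ∀ i j, sc2 ψ P.1 i j (ψ x) = evGerm 𝕜 (ψ x) (cs2 ψ P (ψ x) i j) := fun i j => by
    rw [cs2, ev_gm (h2 i j)]
  have e1 : ∀ i, sc1 ψ P.1 i (ψ x) = evGerm 𝕜 (ψ x) (cs1 ψ P (ψ x) i) := fun i => by
    rw [cs1, ev_gm (h1 i)]
  have hd0 : ∀ i, dirDer (der 𝕜 (ψ x)) (vfGerm 𝕜 ψ X (ψ x))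
      (algebraMap 𝕜 _ ((η (basisVec n i) : ℝ) : 𝕜)) = 0 := fun i => Derivation.map_algebraMap _ _
  rw [lieSym, lie_polySym der_comm]
  simp only [polySym, map_add, map_sub, map_sum, map_mul, Derivation.leibniz, smul_eq_mul, hd0,
    mul_zero, add_zero, zero_add, ev_algebraMap]
  simp only [hη, e2, e1, der_dirDer der_comm, map_add, map_sum, map_mul,
    sum_add_distrib, mul_add, add_mul]
  have r3 : ∑ i, ∑ j, evGerm 𝕜 (ψ x) (cs2 ψ P (ψ x) i j)
      * (evGerm 𝕜 (ψ x) (der 𝕜 (ψ x) j F) * evGerm 𝕜 (ψ x)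
        (dirDer (der 𝕜 (ψ x)) (vfGerm 𝕜 ψ X (ψ x)) (der 𝕜 (ψ x) i F)))
      = ∑ i, ∑ j, evGerm 𝕜 (ψ x) (cs2 ψ P (ψ x) i j)
      * (evGerm 𝕜 (ψ x) (dirDer (der 𝕜 (ψ x)) (vfGerm 𝕜 ψ X (ψ x)) (der 𝕜 (ψ x) i F))
        * evGerm 𝕜 (ψ x) (der 𝕜 (ψ x) j F)) :=
    sum_congr rfl fun i _ => sum_congr rfl fun j _ => by ring
  rw [r3]
  ring

lemma lieSymbol_eq (hφ : φ ∈ smoothCharts (n := n) M) (hx : x ∈ φ.source)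
    (hX : ∀ᶠ z in 𝓝 x, SmoothVFAt X z) (w : 𝕜) (P : symbols2 n 𝕜 M) {f : M → ℝ}
    (hf : ContMDiff (𝓡 n) 𝓘(ℝ, ℝ) ∞ f) :
    lieSymbol g w X P.1 x (dfun f x) = evGerm 𝕜 (φ x) (lieSym φ X P (φ x)
      (gm (φ x) ((ofRealFun f hf : smoothFun n 𝕜 M).1 ∘ φ.symm)))
      + w * (divergence g X x : 𝕜) * P.1 x (dfun f x) := by
  have hψ : chartAt (Model n) x ∈ smoothCharts (n := n) M := IsManifold.chart_mem_maximalAtlas x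
  rw [lieSymbol_chartAt hX w P hf, lieSym_invariant hφ hx hX P hf,
    lieSym_invariant hψ (mem_chart_source (Model n) x) hX P hf]

end LieSymbols

/-! ### Smoothness of the volume density -/

section Volume

variable {n : ℕ} {M : Type*} [TopologicalSpace M] [ChartedSpace (Model n) M]
  [IsManifold (𝓡 n) ∞ M] [T2Space M] (g : PseudoRiemannianMetric n M)
  {φ : OpenPartialHomeomorph M (Model n)}

lemma coordVec_smooth (hφ : φ ∈ smoothCharts (n := n) M) {y : Model n} (hy : y ∈ φ.target)
    (i : Fin n) : ContMDiffAt (𝓡 n) ((𝓡 n).prod (𝓡 n)) ∞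
      (fun z => (Bundle.TotalSpace.mk' (Model n) (φ.symm z) (coordVec φ z i) :
        TangentBundle (𝓡 n) M)) y := by
  have h1 : ContMDiffOn (𝓡 n) (𝓡 n) ∞ φ.symm φ.target := contMDiffOn_symm_of_mem_maximalAtlas hφ
  have h2 := h1.contMDiffOn_tangentMapWithin (m := ∞) (by simp) φ.open_target.uniqueMDiffOn
  have h3 : ContMDiffAt (𝓡 n) ((𝓡 n).prod (𝓡 n)) ∞
      (fun z => (⟨z, basisVec n i⟩ : TangentBundle (𝓡 n) (Model n))) y := by
    exact contMDiffAt_vectorSpace_iff_contDiffAt.2 contDiffAt_const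
  have h4 : (Bundle.TotalSpace.proj ⁻¹' φ.target : Set (TangentBundle (𝓡 n) (Model n))) ∈
      𝓝 (⟨y, basisVec n i⟩ : TangentBundle (𝓡 n) (Model n)) :=
    (φ.open_target.preimage (FiberBundle.continuous_proj _ _)).mem_nhds hy
  refine ((h2.contMDiffAt h4).comp y h3).congr_of_eventuallyEq ?_
  filter_upwards [φ.open_target.mem_nhds hy] with z hz
  simp only [Function.comp_apply, tangentMapWithin, mfderivWithin_of_isOpen φ.open_target hz]
  rfl

lemma form_coordVec_smooth (hφ : φ ∈ smoothCharts (n := n) M) {y : Model n} (hy : y ∈ φ.target)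
    (i j : Fin n) :
    ContDiffAt ℝ ∞ (fun z => g.form (φ.symm z) (coordVec φ z i) (coordVec φ z j)) y := by
  have h1 := coordVec_smooth hφ hy i
  have h2 := coordVec_smooth hφ hy j
  have h0 : ContMDiffAt (𝓡 n) (𝓡 n) ∞ φ.symm y := contMDiffAt_symm_of_mem_maximalAtlas hφ hy
  have h3 := (g.smooth (φ.symm y)).comp y h0
  have h4 := ContMDiffAt.clm_bundle_apply₂ (F₁ := Model n) (F₂ := Model n) (F₃ := ℝ)
    (E₁ := fun x : M => TangentSpace (𝓡 n) x) (E₂ := fun x : M => TangentSpace (𝓡 n) x)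
    (E₃ := fun _ : M => ℝ) (b := fun z => φ.symm z) (ψ := fun z => g.form (φ.symm z)) h3 h1 h2
  rw [Bundle.contMDiffAt_totalSpace] at h4
  rw [← contMDiffAt_iff_contDiffAt]
  exact h4.2

lemma gram_det_ne_zero (hφ : φ ∈ smoothCharts (n := n) M) {x : M} (hx : x ∈ φ.source) :
    (gram g φ x).det ≠ 0 := by
  intro h
  obtain ⟨v, hv, h0⟩ := Matrix.exists_mulVec_eq_zero_iff.2 h
  apply hv
  have h1 : ∑ j, v j • cvec φ x j = 0 := by
    apply g.nondegenerate x
    intro u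
    rw [g.symm, eq_sum_cvec hφ hx u]
    simp only [map_sum, sum_apply, map_smul, smul_apply, smul_eq_mul, mul_sum]
    rw [sum_comm]
    refine sum_eq_zero fun i _ => ?_
    have h2 := congrFun h0 i
    simp only [Matrix.mulVec, dotProduct, gram, Matrix.of_apply, Pi.zero_apply] at h2
    calc _ = dchart φ x u i * ∑ j, g.form x (cvec φ x i) (cvec φ x j) * v j := by
          rw [mul_sum]
          exact sum_congr rfl fun j _ => by ring
      _ = 0 := by rw [h2, mul_zero]
  funext i
  have h2 := congrArg (fun u => dchart φ x u i) h1
  simp only [map_sum, map_smul, dchart_cvec hφ hx, map_zero] at h2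
  simpa [basisVec, Finset.sum_apply, Pi.single_apply] using h2

lemma goodVol (hφ : φ ∈ smoothCharts (n := n) M) : GoodVol g φ := by
  intro y hy
  have h0 : Matrix.det (Matrix.of fun i j : Fin n =>
      g.form (φ.symm y) (coordVec φ y i) (coordVec φ y j)) ≠ 0 := by
    simp only [coordVec_eq hφ hy]
    exact gram_det_ne_zero g hφ (φ.map_target hy)
  have h1 : ContDiffAt ℝ ∞ (fun y => Matrix.det (Matrix.of fun i j : Fin n =>
      g.form (φ.symm y) (coordVec φ y i) (coordVec φ y j))) y :=
    det_smooth fun i j => form_coordVec_smooth g hφ hy i j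
  exact ⟨(h1.abs h0).sqrt (abs_pos.2 h0).ne', Real.sqrt_pos.2 (abs_pos.2 h0)⟩

end Volume

/-! ### The coefficients of the Lie derivative of a symbol -/

section SymbolCoeffs

variable {n : ℕ} {𝕜 : Type*} [RCLike 𝕜]

lemma polySym_inj {a a' : Fin n → Fin n → 𝕜} {b b' : Fin n → 𝕜} {c c' : 𝕜}
    (ha : ∀ i j, a i j = a j i) (ha' : ∀ i j, a' i j = a' j i)
    (h : ∀ r : Fin n → ℝ, polySym a b c (fun i => (r i : 𝕜)) = polySym a' b' c' fun i => (r i : 𝕜)) :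
    (∀ i j, a i j = a' i j) ∧ (∀ i, b i = b' i) ∧ c = c' := by
  have hc : c = c' := by simpa [polySym] using h 0
  subst hc
  have h1 : ∀ (t : ℝ) i, (t : 𝕜) * t * a i i + t * b i = (t : 𝕜) * t * a' i i + t * b' i := by
    intro t i
    have := h (Pi.single i t)
    simp only [polySym, Pi.single_apply, apply_ite (RCLike.ofReal (K := 𝕜)), RCLike.ofReal_zero,
      mul_ite, ite_mul, mul_zero, zero_mul, sum_ite_eq', Finset.mem_univ, if_true,
      Finset.sum_ite_irrel, sum_const_zero, add_left_inj] at this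
    linear_combination this
  have hb : ∀ i, b i = b' i := fun i => by
    have e1 := h1 1 i
    have e2 := h1 (-1) i
    push_cast at e1 e2
    have : (2 : 𝕜) * b i = 2 * b' i := by linear_combination e1 - e2
    exact mul_left_cancel₀ two_ne_zero this
  have hd : ∀ i, a i i = a' i i := fun i => by
    have e1 := h1 1 i
    push_cast at e1
    linear_combination e1 - hb i
  refine ⟨fun i j => ?_, hb, rfl⟩
  by_cases hij : i = j
  · rw [hij, hd]
  have := h (Pi.single i 1 + Pi.single j 1)
  simp only [polySym, Pi.add_apply, Pi.single_apply, RCLike.ofReal_add,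
    apply_ite (RCLike.ofReal (K := 𝕜)), RCLike.ofReal_zero, RCLike.ofReal_one, mul_add, add_mul,
    mul_ite, ite_mul, mul_zero, zero_mul, mul_one, sum_add_distrib, sum_ite_eq',
    Finset.mem_univ, if_true, Finset.sum_ite_irrel, sum_const_zero, hb] at this
  have e : (2 : 𝕜) * a i j = 2 * a' i j := by
    linear_combination this + ha i j - ha' i j - hd i - hd j
  exact mul_left_cancel₀ two_ne_zero e

variable {M : Type*} [TopologicalSpace M] [ChartedSpace (Model n) M]
  [IsManifold (𝓡 n) ∞ M] [T2Space M] (g : PseudoRiemannianMetric n M)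
  {φ : OpenPartialHomeomorph M (Model n)} {X : VField n M} {x : M}

lemma exists_covector (hφ : φ ∈ smoothCharts (n := n) M) (hx : x ∈ φ.source) (r : Fin n → ℝ) :
    ∃ ξ : Cotangent n x, ∀ i, ξ (cvec φ x i) = r i := by
  refine ⟨(∑ i, r i • (EuclideanSpace.proj i : Model n →L[ℝ] ℝ)).comp (dchart φ x), fun i => ?_⟩
  rw [ContinuousLinearMap.comp_apply, dchart_cvec hφ hx]
  simp [basisVec, sum_apply, Pi.single_apply]

variable (𝕜 φ X) in
/-- The germ of the divergence, in a chart. -/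
def divGerm (y : Model n) : SmGerm 𝕜 y :=
  divg (der 𝕜 y) (vfGerm 𝕜 φ X y) + dirDer (der 𝕜 y) (vfGerm 𝕜 φ X y) (logVol 𝕜 g φ y)

lemma isFam_divGerm (hφ : φ ∈ smoothCharts (n := n) M) (hx : x ∈ φ.source)
    (hX : ∀ᶠ z in 𝓝 x, SmoothVFAt X z) : IsFam (φ x) (divGerm 𝕜 g φ X) :=
  (IsFam.divg (isFam_vfGerm hφ hx hX)).add
    (IsFam.dirDer (isFam_vfGerm hφ hx hX) (isFam_logVol (goodVol g hφ) (φ.map_source hx)))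

lemma polySym_add_mul {R : Type*} [CommRing R] (a a' : Fin n → Fin n → R) (b b' : Fin n → R)
    (c c' t : R) (r : Fin n → R) :
    polySym (fun i j => a i j + t * a' i j) (fun i => b i + t * b' i) (c + t * c') r
      = polySym a b c r + t * polySym a' b' c' r := by
  simp only [polySym, add_mul, sum_add_distrib, mul_add, mul_sum, mul_assoc]
  ring

lemma lieSymbol_polySym (hφ : φ ∈ smoothCharts (n := n) M) (hx : x ∈ φ.source)
    (hX : ∀ᶠ z in 𝓝 x, SmoothVFAt X z) (w : 𝕜) (P : symbols2 n 𝕜 M) (ξ : Cotangent n x) :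
    lieSymbol g w X P.1 x ξ = polySym
      (fun i j => evGerm 𝕜 (φ x) (lie2 (der 𝕜 (φ x)) (algebraMap 𝕜 _ 0) (vfGerm 𝕜 φ X (φ x))
        (cs2 φ P (φ x)) i j + algebraMap 𝕜 _ w * divGerm 𝕜 g φ X (φ x) * cs2 φ P (φ x) i j))
      (fun i => evGerm 𝕜 (φ x) (lie1 (der 𝕜 (φ x)) (algebraMap 𝕜 _ 0) (vfGerm 𝕜 φ X (φ x))
        (cs1 φ P (φ x)) i + algebraMap 𝕜 _ w * divGerm 𝕜 g φ X (φ x) * cs1 φ P (φ x) i))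
      (evGerm 𝕜 (φ x) (lie0 (der 𝕜 (φ x)) (algebraMap 𝕜 _ 0) (vfGerm 𝕜 φ X (φ x))
        (cs0 φ P (φ x)) + algebraMap 𝕜 _ w * divGerm 𝕜 g φ X (φ x) * cs0 φ P (φ x)))
      (fun i => (ξ (cvec φ x i) : 𝕜)) := by
  obtain ⟨f, hf, rfl⟩ := exists_mfderiv_eq x ξ
  rw [lieSymbol_eq hφ hx hX w P hf, lieSym, ev_polySym, symbol_eq_polySym hφ P hx,
    ev_divergence hφ (goodVol g hφ) hx hX.self_of_nhds]
  have h : ∀ i, evGerm 𝕜 (φ x) (der 𝕜 (φ x) i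
      (gm (φ x) ((ofRealFun f hf : smoothFun n 𝕜 M).1 ∘ φ.symm)))
      = ((dfun f x (cvec φ x i) : ℝ) : 𝕜) := fun i => (dfun_cvec hφ hx (hf x) i).symm
  rw [← map_zero (algebraMap 𝕜 (SmGerm 𝕜 (φ x)))]
  have hs : ∀ a b : SmGerm 𝕜 (φ x), evGerm 𝕜 (φ x) (a + algebraMap 𝕜 _ w * divGerm 𝕜 g φ X (φ x) * b)
      = evGerm 𝕜 (φ x) a + w * evGerm 𝕜 (φ x) (divGerm 𝕜 g φ X (φ x)) * evGerm 𝕜 (φ x) b := by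
    intro a b
    rw [map_add, map_mul, map_mul, ev_algebraMap]
  rw [funext h, show (fun i j => evGerm 𝕜 (φ x) (lie2 (der 𝕜 (φ x)) (algebraMap 𝕜 _ 0)
    (vfGerm 𝕜 φ X (φ x)) (cs2 φ P (φ x)) i j
      + algebraMap 𝕜 _ w * divGerm 𝕜 g φ X (φ x) * cs2 φ P (φ x) i j)) = _ from
        funext fun i => funext fun j => hs _ _, funext fun i => hs _ _, hs, polySym_add_mul]
  rfl

lemma lie2_symm {K R : Type*} [Field K] [CommRing R] [Algebra K R] {d : Fin n → Derivation K R R}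
    (w : R) (X : Fin n → R) {a : Fin n → Fin n → R} (ha : ∀ i j, a i j = a j i) (i j : Fin n) :
    lie2 d w X a i j = lie2 d w X a j i := by
  have e1 : ∀ i j, ∑ k, a k j * d k (X i) = ∑ k, a j k * d k (X i) := fun i j =>
    sum_congr rfl fun k _ => by rw [ha]
  have e2 : ∀ i j, ∑ k, a k i * d k (X j) = ∑ k, a i k * d k (X j) := fun i j =>
    sum_congr rfl fun k _ => by rw [ha]
  rw [lie2, lie2, e1 i j, e2 i j, ha j i]
  ring

/-- The germs of the coefficients of order two, in the gauge given by the volume. -/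
def sy2 (φ : OpenPartialHomeomorph M (Model n)) (w : 𝕜) (P : symbols2 n 𝕜 M) (y : Model n)
    (i j : Fin n) : SmGerm 𝕜 y := gauge g φ w y * cs2 φ P y i j

/-- The germs of the coefficients of order one, in the gauge given by the volume. -/
def sy1 (φ : OpenPartialHomeomorph M (Model n)) (w : 𝕜) (P : symbols2 n 𝕜 M) (y : Model n)
    (i : Fin n) : SmGerm 𝕜 y := gauge g φ w y * cs1 φ P y i

/-- The germ of the coefficient of order zero, in the gauge given by the volume. -/
def sy0 (φ : OpenPartialHomeomorph M (Model n)) (w : 𝕜) (P : symbols2 n 𝕜 M) (y : Model n) :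
    SmGerm 𝕜 y := gauge g φ w y * cs0 φ P y

lemma sy2_symm (w : 𝕜) (P : symbols2 n 𝕜 M) (y : Model n) (i j : Fin n) :
    sy2 g φ w P y i j = sy2 g φ w P y j i := by rw [sy2, cs2_symm, sy2]

lemma dirDer_gauge (hφ : φ ∈ smoothCharts (n := n) M) (w : 𝕜) {y : Model n} (hy : y ∈ φ.target)
    (Y : Fin n → SmGerm 𝕜 y) : dirDer (der 𝕜 y) Y (gauge g φ w y)
      = algebraMap 𝕜 _ w * dirDer (der 𝕜 y) Y (logVol 𝕜 g φ y) * gauge g φ w y := by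
  simp only [dirDer_apply, der_gauge (goodVol g hφ) w hy, mul_sum, sum_mul]
  exact sum_congr rfl fun i _ => by ring

variable {g}

lemma lieSymbol_coeffs (hφ : φ ∈ smoothCharts (n := n) M) (hx : x ∈ φ.source)
    (hX : ∀ᶠ z in 𝓝 x, SmoothVFAt X z) (w : 𝕜) (P P' : symbols2 n 𝕜 M)
    (h : ∀ᶠ z in 𝓝 x, ∀ ξ : Cotangent n z, P'.1 z ξ = lieSymbol g w X P.1 z ξ) :
    (∀ i j, cs2 φ P' (φ x) i j
      = lie2 (der 𝕜 (φ x)) (algebraMap 𝕜 _ 0) (vfGerm 𝕜 φ X (φ x)) (cs2 φ P (φ x)) i j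
        + algebraMap 𝕜 _ w * divGerm 𝕜 g φ X (φ x) * cs2 φ P (φ x) i j) ∧
    (∀ i, cs1 φ P' (φ x) i
      = lie1 (der 𝕜 (φ x)) (algebraMap 𝕜 _ 0) (vfGerm 𝕜 φ X (φ x)) (cs1 φ P (φ x)) i
        + algebraMap 𝕜 _ w * divGerm 𝕜 g φ X (φ x) * cs1 φ P (φ x) i) ∧
    cs0 φ P' (φ x)
      = lie0 (der 𝕜 (φ x)) (algebraMap 𝕜 _ 0) (vfGerm 𝕜 φ X (φ x)) (cs0 φ P (φ x))
        + algebraMap 𝕜 _ w * divGerm 𝕜 g φ X (φ x) * cs0 φ P (φ x) := by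
  have hXf := isFam_vfGerm (𝕜 := 𝕜) hφ hx hX
  have hD := (isFam_const w).mul (isFam_divGerm (𝕜 := 𝕜) g hφ hx hX)
  have key : ∀ᶠ y in 𝓝 (φ x), (∀ i j, evGerm 𝕜 y (cs2 φ P' y i j)
      = evGerm 𝕜 y (lie2 (der 𝕜 y) (algebraMap 𝕜 _ 0) (vfGerm 𝕜 φ X y) (cs2 φ P y) i j
        + algebraMap 𝕜 _ w * divGerm 𝕜 g φ X y * cs2 φ P y i j)) ∧
      (∀ i, evGerm 𝕜 y (cs1 φ P' y i)
      = evGerm 𝕜 y (lie1 (der 𝕜 y) (algebraMap 𝕜 _ 0) (vfGerm 𝕜 φ X y) (cs1 φ P y) i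
        + algebraMap 𝕜 _ w * divGerm 𝕜 g φ X y * cs1 φ P y i)) ∧
      evGerm 𝕜 y (cs0 φ P' y)
      = evGerm 𝕜 y (lie0 (der 𝕜 y) (algebraMap 𝕜 _ 0) (vfGerm 𝕜 φ X y) (cs0 φ P y)
        + algebraMap 𝕜 _ w * divGerm 𝕜 g φ X y * cs0 φ P y) := by
    refine eventually_chart hx ?_
    filter_upwards [h, hX.eventually_nhds] with z hz hXz hz'
    refine polySym_inj (fun i j => by rw [cs2_symm]) (fun i j => ?_) fun r => ?_
    · rw [lie2_symm _ _ (cs2_symm P (φ z)), cs2_symm]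
    obtain ⟨ξ, hξ⟩ := exists_covector hφ hz' r
    have h1 := hz ξ
    rw [symbol_eq_polySym hφ P' hz', lieSymbol_polySym g hφ hz' hXz] at h1
    simpa only [hξ] using h1
  refine ⟨fun i j => ?_, fun i => ?_, ?_⟩
  · exact IsFam.eq_of_ev (isFam_cs2 hφ P' hx i j)
      ((IsFam.lie2 0 hXf (fun i j => isFam_cs2 hφ P hx i j) i j).add
        (hD.mul (isFam_cs2 hφ P hx i j))) (key.mono fun y hy => hy.1 i j)
  · exact IsFam.eq_of_ev (isFam_cs1 hφ P' hx i)
      ((IsFam.lie1 0 hXf (fun i => isFam_cs1 hφ P hx i) i).add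
        (hD.mul (isFam_cs1 hφ P hx i))) (key.mono fun y hy => hy.2.1 i)
  · exact IsFam.eq_of_ev (isFam_cs0 hφ P' hx)
      ((IsFam.lie0 0 hXf (isFam_cs0 hφ P hx)).add
        (hD.mul (isFam_cs0 hφ P hx))) (key.mono fun y hy => hy.2.2)

lemma lieSymbol_sy (hφ : φ ∈ smoothCharts (n := n) M) (hx : x ∈ φ.source)
    (hX : ∀ᶠ z in 𝓝 x, SmoothVFAt X z) (w : 𝕜) (P P' : symbols2 n 𝕜 M)
    (h : ∀ᶠ z in 𝓝 x, ∀ ξ : Cotangent n z, P'.1 z ξ = lieSymbol g w X P.1 z ξ) :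
    sy2 g φ w P' (φ x) = lie2 (der 𝕜 (φ x)) (algebraMap 𝕜 _ w) (vfGerm 𝕜 φ X (φ x))
      (sy2 g φ w P (φ x)) ∧
    sy1 g φ w P' (φ x) = lie1 (der 𝕜 (φ x)) (algebraMap 𝕜 _ w) (vfGerm 𝕜 φ X (φ x))
      (sy1 g φ w P (φ x)) ∧
    sy0 g φ w P' (φ x) = lie0 (der 𝕜 (φ x)) (algebraMap 𝕜 _ w) (vfGerm 𝕜 φ X (φ x))
      (sy0 g φ w P (φ x)) := by
  obtain ⟨h2, h1, h0⟩ := lieSymbol_coeffs hφ hx hX w P P' h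
  have hg := dirDer_gauge g hφ w (φ.map_source hx) (vfGerm 𝕜 φ X (φ x))
  refine ⟨?_, ?_, ?_⟩
  · funext i j
    simp only [sy2, h2, lie2, divGerm, Derivation.leibniz, smul_eq_mul, hg, map_zero, mul_assoc,
      ← mul_sum]
    ring
  · funext i
    simp only [sy1, h1, lie1, divGerm, Derivation.leibniz, smul_eq_mul, hg, map_zero, mul_assoc,
      ← mul_sum]
    ring
  · simp only [sy0, h0, lie0, divGerm, Derivation.leibniz, smul_eq_mul, hg, map_zero]
    ring

end SymbolCoeffs

/-! ### Lie derivatives cut off by bump functions -/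

section LieOps

variable {n : ℕ} {𝕜 : Type*} [RCLike 𝕜] {M : Type*} [TopologicalSpace M] [ChartedSpace (Model n) M]
  [IsManifold (𝓡 n) ∞ M] [T2Space M] {g : PseudoRiemannianMetric n M}
  {φ : OpenPartialHomeomorph M (Model n)} {X : VField n M} {x : M}

lemma symbolCoord_homog {k : ℕ} {P : symbols2 n 𝕜 M} (hP : IsHomog k P) (y : Model n) (t : ℝ)
    (η : Model n →L[ℝ] ℝ) : symbolCoord φ P.1 y (t • η) = (t : 𝕜) ^ k * symbolCoord φ P.1 y η := by
  rw [symbolCoord, symbolCoord, ← hP]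
  rfl

lemma symbolCoord_neg_homog {k : ℕ} {P : symbols2 n 𝕜 M} (hP : IsHomog k P) (y : Model n)
    (η : Model n →L[ℝ] ℝ) : symbolCoord φ P.1 y (-η) = (-1) ^ k * symbolCoord φ P.1 y η := by
  rw [show -η = (-1 : ℝ) • η from (neg_one_smul ℝ η).symm, symbolCoord_homog hP]
  simp

lemma symbolCoord_zero_homog {k : ℕ} {P : symbols2 n 𝕜 M} (hP : IsHomog k P) (y : Model n) :
    symbolCoord φ P.1 y 0 = 0 ^ k * symbolCoord φ P.1 y 0 := by
  simpa using symbolCoord_homog (φ := φ) hP y 0 0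

lemma IsHomog.cs0_two {P : symbols2 n 𝕜 M} (hP : IsHomog 2 P) (y : Model n) : cs0 φ P y = 0 := by
  rw [cs0, ← gm_zero]
  congr 1
  funext y
  rw [sc0, symbolCoord_zero_homog hP]
  simp

lemma IsHomog.cs1_two {P : symbols2 n 𝕜 M} (hP : IsHomog 2 P) (y : Model n) : cs1 φ P y = 0 := by
  funext i
  rw [cs1, Pi.zero_apply, ← gm_zero]
  congr 1
  funext y
  rw [sc1, symbolCoord_neg_homog hP]
  simp

lemma IsHomog.cs0_one {P : symbols2 n 𝕜 M} (hP : IsHomog 1 P) (y : Model n) : cs0 φ P y = 0 := by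
  rw [cs0, ← gm_zero]
  congr 1
  funext y
  rw [sc0, symbolCoord_zero_homog hP]
  simp

lemma IsHomog.cs2_one {P : symbols2 n 𝕜 M} (hP : IsHomog 1 P) (y : Model n) : cs2 φ P y = 0 := by
  funext i j
  rw [cs2, Pi.zero_apply, Pi.zero_apply, ← gm_zero]
  congr 1
  funext y
  have h : ∀ η, scQ φ P.1 η y = 0 := fun η => by
    rw [scQ, symbolCoord_neg_homog hP, symbolCoord_zero_homog hP]
    simp
  rw [sc2, h, h, h]
  simp

lemma IsHomog.cs1_zero {P : symbols2 n 𝕜 M} (hP : IsHomog 0 P) (y : Model n) : cs1 φ P y = 0 := by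
  funext i
  rw [cs1, Pi.zero_apply, ← gm_zero]
  congr 1
  funext y
  rw [sc1, symbolCoord_neg_homog hP]
  simp

lemma IsHomog.cs2_zero {P : symbols2 n 𝕜 M} (hP : IsHomog 0 P) (y : Model n) : cs2 φ P y = 0 := by
  funext i j
  rw [cs2, Pi.zero_apply, Pi.zero_apply, ← gm_zero]
  congr 1
  funext y
  have h : ∀ η, scQ φ P.1 η y = 0 := fun η => by
    have := symbolCoord_homog (φ := φ) hP y 0 η
    rw [zero_smul] at this
    rw [scQ, symbolCoord_neg_homog hP, this]
    simp
  rw [sc2, h, h, h]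
  simp

lemma lie1_zero_right {y : Model n} (w : SmGerm 𝕜 y) (Y : Fin n → SmGerm 𝕜 y) :
    lie1 (der 𝕜 y) w Y 0 = 0 := by
  funext i
  simp [lie1]

lemma lie0_zero_right {y : Model n} (w : SmGerm 𝕜 y) (Y : Fin n → SmGerm 𝕜 y) :
    lie0 (der 𝕜 y) w Y 0 = 0 := by
  simp [lie0]

lemma lie2_zero_right {y : Model n} (w : SmGerm 𝕜 y) (Y : Fin n → SmGerm 𝕜 y) :
    lie2 (der 𝕜 y) w Y 0 = 0 := by
  funext i j
  simp [lie2]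

lemma lieSymbol_homog_two (hX : ∀ᶠ z in 𝓝 x, SmoothVFAt X z) (w : 𝕜) {P : symbols2 n 𝕜 M}
    (hP : IsHomog 2 P) (t : ℝ) (ξ : Cotangent n x) :
    lieSymbol g w X P.1 x (t • ξ) = (t : 𝕜) ^ 2 * lieSymbol g w X P.1 x ξ := by
  have hφ : chartAt (Model n) x ∈ smoothCharts (n := n) M := IsManifold.chart_mem_maximalAtlas x
  have hx := mem_chart_source (Model n) x
  rw [lieSymbol_polySym g hφ hx hX, lieSymbol_polySym g hφ hx hX, hP.cs1_two, hP.cs0_two,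
    lie1_zero_right, lie0_zero_right]
  simp only [polySym, Pi.zero_apply, mul_zero, add_zero, map_zero, zero_mul, sum_const_zero,
    mul_sum, smul_apply, smul_eq_mul]
  refine sum_congr rfl fun i _ => sum_congr rfl fun j _ => ?_
  push_cast
  ring

lemma lieSymbol_homog_one (hX : ∀ᶠ z in 𝓝 x, SmoothVFAt X z) (w : 𝕜) {P : symbols2 n 𝕜 M}
    (hP : IsHomog 1 P) (t : ℝ) (ξ : Cotangent n x) :
    lieSymbol g w X P.1 x (t • ξ) = (t : 𝕜) ^ 1 * lieSymbol g w X P.1 x ξ := by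
  have hφ : chartAt (Model n) x ∈ smoothCharts (n := n) M := IsManifold.chart_mem_maximalAtlas x
  have hx := mem_chart_source (Model n) x
  rw [lieSymbol_polySym g hφ hx hX, lieSymbol_polySym g hφ hx hX, hP.cs2_one, hP.cs0_one,
    lie2_zero_right, lie0_zero_right]
  simp only [polySym, Pi.zero_apply, mul_zero, add_zero, map_zero, zero_mul, sum_const_zero,
    mul_sum, smul_apply, smul_eq_mul, zero_add]
  refine sum_congr rfl fun i _ => ?_
  push_cast
  ring

lemma symLie_of_notMem {χ : M → ℝ} (hx : x ∉ tsupport χ) : χ x = 0 := by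
  by_contra h
  exact hx (subset_tsupport _ h)

lemma exists_symLie {χ : M → ℝ} (hχ : ContMDiff (𝓡 n) 𝓘(ℝ, ℝ) ∞ χ)
    (hX : ∀ x ∈ tsupport χ, ∀ᶠ z in 𝓝 x, SmoothVFAt X z) (w : 𝕜) (P : symbols2 n 𝕜 M) :
    ∃ P' : symbols2 n 𝕜 M, (∀ x ξ, P'.1 x ξ = (χ x : 𝕜) * lieSymbol g w X P.1 x ξ) ∧
      (IsHomog 2 P → IsHomog 2 P') ∧ (IsHomog 1 P → IsHomog 1 P') := by
  refine ⟨⟨fun x ξ => (χ x : 𝕜) * lieSymbol g w X P.1 x ξ,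
    mem_symbols2_of_local (n := n) fun x => ?_⟩, fun x ξ => rfl, fun hP x t ξ => ?_,
    fun hP x t ξ => ?_⟩
  · have hφ : chartAt (Model n) x ∈ smoothCharts (n := n) M := IsManifold.chart_mem_maximalAtlas x
    have hx := mem_chart_source (Model n) x
    refine ⟨_, hφ, hx, ?_⟩
    set φ := chartAt (Model n) x
    by_cases hxχ : x ∈ tsupport χ
    · have hX' := hX x hxχ
      have hXf := isFam_vfGerm (𝕜 := 𝕜) hφ hx hX'
      have hD := (isFam_const w).mul (isFam_divGerm (𝕜 := 𝕜) g hφ hx hX')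
      have hc := isFam_fun (𝕜 := 𝕜) hφ hx (ofRealFun χ hχ)
      have h2 := fun i j => hc.mul ((IsFam.lie2 0 hXf (fun i j => isFam_cs2 hφ P hx i j) i j).add
        (hD.mul (isFam_cs2 hφ P hx i j)))
      have h1 := fun i => hc.mul ((IsFam.lie1 0 hXf (fun i => isFam_cs1 hφ P hx i) i).add
        (hD.mul (isFam_cs1 hφ P hx i)))
      have h0 := hc.mul ((IsFam.lie0 0 hXf (isFam_cs0 hφ P hx)).add
        (hD.mul (isFam_cs0 hφ P hx)))
      refine ⟨_, _, _, fun i j => (h2 i j).smooth.1, fun i => (h1 i).smooth.1, h0.smooth.1, ?_⟩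
      filter_upwards [hX'.eventually_nhds, φ.open_source.mem_nhds hx] with z hXz hz ξ
      rw [lieSymbol_polySym g hφ hz hXz]
      have hs : ∀ A, evGerm 𝕜 (φ z) (gm (φ z) ((ofRealFun χ hχ : smoothFun n 𝕜 M).1 ∘ φ.symm) * A)
          = (χ z : 𝕜) * evGerm 𝕜 (φ z) A := by
        intro A
        rw [map_mul, ev_gm (smoothFun_contDiffAt _ hφ (φ.map_source hz)), Function.comp_apply,
          φ.left_inv hz]
        rfl
      simp only [hs]
      simp only [polySym, mul_add ((χ z : ℝ) : 𝕜), mul_sum, mul_assoc ((χ z : ℝ) : 𝕜)]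
    · refine ⟨fun _ _ _ => 0, fun _ _ => 0, fun _ => 0, fun i j => contDiffAt_const,
        fun i => contDiffAt_const, contDiffAt_const, ?_⟩
      filter_upwards [notMem_tsupport_iff_eventuallyEq.1 hxχ] with z hz ξ
      simp [hz]
  · by_cases hxχ : x ∈ tsupport χ
    · show _ * _ = _ * (_ * _)
      rw [lieSymbol_homog_two (hX x hxχ) w hP]
      ring
    · show (χ x : 𝕜) * _ = _ * ((χ x : 𝕜) * _)
      rw [symLie_of_notMem hxχ]
      simp
  · by_cases hxχ : x ∈ tsupport χ
    · show _ * _ = _ * (_ * _)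
      rw [lieSymbol_homog_one (hX x hxχ) w hP]
      ring
    · show (χ x : 𝕜) * _ = _ * ((χ x : 𝕜) * _)
      rw [symLie_of_notMem hxχ]
      simp

lemma lieDensity_smooth (hX : ∀ᶠ z in 𝓝 x, SmoothVFAt X z) (w : 𝕜) (f : smoothFun n 𝕜 M) :
    ContMDiffAt (𝓡 n) 𝓘(ℝ, 𝕜) ∞ (lieDensity g w X f.1) x := by
  have hφ : chartAt (Model n) x ∈ smoothCharts (n := n) M := IsManifold.chart_mem_maximalAtlas x
  have hx := mem_chart_source (Model n) x
  set φ := chartAt (Model n) x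
  have hXf := isFam_vfGerm (𝕜 := 𝕜) hφ hx hX
  have hD := (isFam_const w).mul (isFam_divGerm (𝕜 := 𝕜) g hφ hx hX)
  have hf := isFam_fun hφ hx f
  have h := (IsFam.dirDer hXf hf).add (hD.mul hf)
  rw [contDiffAt_chart_iff hφ hx]
  refine h.smooth.1.congr_of_eventuallyEq (eventually_chart hx ?_)
  filter_upwards [hX] with z hXz hz
  rw [map_add, map_mul, map_mul, ev_algebraMap, divGerm, ← ev_divergence hφ (goodVol g hφ) hz hXz,
    ← ev_derivAlong hφ hz hXz (f.2 z), ev_gm (smoothFun_contDiffAt f hφ (φ.map_source hz)),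
    Function.comp_apply, Function.comp_apply, φ.left_inv hz]
  rfl

lemma exists_funLie {χ : M → ℝ} (hχ : ContMDiff (𝓡 n) 𝓘(ℝ, ℝ) ∞ χ)
    (hX : ∀ x ∈ tsupport χ, ∀ᶠ z in 𝓝 x, SmoothVFAt X z) (w : 𝕜) (f : smoothFun n 𝕜 M) :
    ∃ f' : smoothFun n 𝕜 M, ∀ x, f'.1 x = (χ x : 𝕜) * lieDensity g w X f.1 x :=
  ⟨bumpMul χ hχ (lieDensity g w X f.1) fun x hx => lieDensity_smooth (hX x hx) w f, fun _ => rfl⟩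

lemma lieSymbol_zero (w : 𝕜) (ξ : Cotangent n x) :
    lieSymbol g w X (0 : symbols2 n 𝕜 M).1 x ξ = 0 := by
  have h : ∀ (ψ : OpenPartialHomeomorph M (Model n)) (y : Model n) (η : Model n →L[ℝ] ℝ),
      symbolCoord ψ (0 : symbols2 n 𝕜 M).1 y η = 0 := fun ψ y η => rfl
  have h' : ∀ (ψ : OpenPartialHomeomorph M (Model n)) (y : Model n),
      symbolCoord ψ (0 : symbols2 n 𝕜 M).1 y = fun _ => 0 := fun ψ y => rfl
  have h0 : (0 : symbols2 n 𝕜 M).1 x ξ = 0 := rfl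
  simp only [lieSymbol, h, h', h0]
  simp

lemma lieDensity_zero_field (w : 𝕜) (f : M → 𝕜) :
    lieDensity g w (fun _ => 0) f x = 0 := by
  have h : ∀ (ψ : OpenPartialHomeomorph M (Model n)) (y : Model n),
      vfCoord ψ (fun _ => 0) y = 0 := fun ψ y => map_zero _
  have hd : divergence g (fun _ => 0) x = 0 := by
    simp only [divergence, h]
    simp
  have h1 : derivAlong (n := n) (𝕜 := 𝕜) (fun _ => 0) f x = 0 := map_zero _
  rw [lieDensity, hd, h1]
  simp

end LieOps

/-! ### Operators of order one in charts -/

section Operators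

variable {n : ℕ} {𝕜 : Type*} [RCLike 𝕜] {M : Type*} [TopologicalSpace M] [ChartedSpace (Model n) M]
  [IsManifold (𝓡 n) ∞ M] [T2Space M] {g : PseudoRiemannianMetric n M}
  {φ : OpenPartialHomeomorph M (Model n)} {X : VField n M} {x : M} {lam mu : 𝕜}

lemma gm_comp_mul (hφ : φ ∈ smoothCharts (n := n) M) (hx : x ∈ φ.source) (f h : smoothFun n 𝕜 M) :
    gm (φ x) ((f * h).1 ∘ φ.symm) = gm (φ x) (f.1 ∘ φ.symm) * gm (φ x) (h.1 ∘ φ.symm) :=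
  gm_mul (smoothFun_contDiffAt f hφ (φ.map_source hx))
    (smoothFun_contDiffAt h hφ (φ.map_source hx))

lemma gm_comp_add (hφ : φ ∈ smoothCharts (n := n) M) (hx : x ∈ φ.source) (f h : smoothFun n 𝕜 M) :
    gm (φ x) ((f + h).1 ∘ φ.symm) = gm (φ x) (f.1 ∘ φ.symm) + gm (φ x) (h.1 ∘ φ.symm) :=
  gm_add (smoothFun_contDiffAt f hφ (φ.map_source hx))
    (smoothFun_contDiffAt h hφ (φ.map_source hx))

lemma exists_fun_germ (hφ : φ ∈ smoothCharts (n := n) M) (hx : x ∈ φ.source)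
    {γ : (y : Model n) → SmGerm 𝕜 y} (hγ : IsFam (φ x) γ) :
    ∃ f : smoothFun n 𝕜 M, gm (φ x) (f.1 ∘ φ.symm) = γ (φ x) := by
  obtain ⟨F, hF⟩ := hγ
  rw [hF.self_of_nhds.2]
  have h2 : ∀ᶠ z in 𝓝 x, z ∈ φ.source ∧ ContDiffAt ℝ ∞ F (φ z) :=
    Filter.Eventually.and (φ.open_source.mem_nhds hx)
      ((φ.continuousAt hx).eventually (hF.mono fun _ h => h.1))
  obtain ⟨χ, hχ, hχ1, hχt⟩ := exists_bump (n := n) h2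
  refine ⟨bumpMul χ hχ (fun z => F (φ z)) fun z hz => ?_, gm_congr ?_⟩
  · exact contMDiffAt_coord hφ (hχt hz).1 (hχt hz).2
  · have h3 : ∀ᶠ y in 𝓝 (φ x), χ (φ.symm y) = 1 := by
      refine eventually_chart hx ?_
      filter_upwards [hχ1] with z hz hz'
      rw [φ.left_inv hz', hz]
    filter_upwards [h3, eventually_target (φ.map_source hx)] with y hy hy'
    show ((χ (φ.symm y) : ℝ) : 𝕜) * F (φ (φ.symm y)) = F y
    rw [hy, φ.right_inv hy']
    simp

lemma exists_opr_of_mem_one {A : FunOp n 𝕜 M} (hA : A ∈ diffOp n 𝕜 M 1)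
    (hφ : φ ∈ smoothCharts (n := n) M) (hx : x ∈ φ.source) :
    ∃ (b : Fin n → SmGerm 𝕜 (φ x)) (t : SmGerm 𝕜 (φ x)), (A ∈ diffOp n 𝕜 M 0 → b = 0) ∧
      ∀ f : smoothFun n 𝕜 M, gm (φ x) ((A f).1 ∘ φ.symm)
        = opr (der 𝕜 (φ x)) 0 b t (gm (φ x) (f.1 ∘ φ.symm)) := by
  obtain ⟨u, hu⟩ := exists_smoothFun_coord (𝕜 := 𝕜) hφ hx
  refine ⟨fun i => gm (φ x) ((commOp A (u i) 1).1 ∘ φ.symm), gm (φ x) ((A 1).1 ∘ φ.symm),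
    fun h0 => ?_, fun f => ?_⟩
  · funext i
    rw [commOp_eq_zero h0]
    exact gm_zero
  · have hs := (smoothFun_contDiffAt f hφ (φ.map_source hx))
    have hc : gm (φ x) ((commOp A f 1).1 ∘ φ.symm) = ∑ i, gm (φ x) ((commOp A (u i) 1).1 ∘ φ.symm)
        * der 𝕜 (φ x) i (gm (φ x) (f.1 ∘ φ.symm)) := by
      simp only [der_gm hs]
      have hsm := fun i => smoothFun_contDiffAt (commOp A (u i) 1) hφ (φ.map_source hx)
      simp only [← gm_mul (hsm _) (contDiffAt_pd hs _)]
      rw [← gm_sum _ fun i _ => (hsm i).mul (contDiffAt_pd hs i)]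
      refine gm_congr (eventually_chart hx ?_)
      filter_upwards [hu.eventually_nhds] with z hz hz'
      rw [Function.comp_apply, φ.left_inv hz', commOp_symbol_one hA hφ hz'
        (fun i => hz.mono fun w hw => hw i) f]
      refine sum_congr rfl fun i _ => ?_
      rw [Function.comp_apply, φ.left_inv hz', ← mfderiv_cvec hφ hz' (f.2 z) i]
      rfl
    conv_lhs => rw [apply_eq_of_mem_diffOp_one (A := A) f]
    rw [gm_comp_add hφ hx, gm_comp_mul hφ hx, hc]
    simp only [opr, Pi.zero_apply, zero_mul, sum_const_zero, zero_add]
    ring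

variable (g lam mu) in
/-- In the gauge given by the volume, the operator `A` has the coefficients `b`, `t` near the point
`x` of the chart `φ`. -/
def HasOpr (φ : OpenPartialHomeomorph M (Model n)) (x : M) (A : FunOp n 𝕜 M)
    (b : Fin n → SmGerm 𝕜 (φ x)) (t : SmGerm 𝕜 (φ x)) : Prop :=
  ∀ f : smoothFun n 𝕜 M, dens g φ mu (A f).1 (φ x)
    = opr (der 𝕜 (φ x)) 0 b t (dens g φ lam f.1 (φ x))

lemma exists_hasOpr {A : FunOp n 𝕜 M} (hA : A ∈ diffOp n 𝕜 M 1)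
    (hφ : φ ∈ smoothCharts (n := n) M) (hx : x ∈ φ.source) :
    ∃ (b : Fin n → SmGerm 𝕜 (φ x)) (t : SmGerm 𝕜 (φ x)), (A ∈ diffOp n 𝕜 M 0 → b = 0) ∧
      HasOpr g lam mu φ x A b t := by
  obtain ⟨b, t, hb, h⟩ := exists_opr_of_mem_one hA hφ hx
  have hy := φ.map_source hx
  set E := gauge g φ mu (φ x)
  set F := gauge g φ (-lam) (φ x)
  set v := logVol 𝕜 g φ (φ x)
  refine ⟨fun i => E * F * b i, E * F * (t - algebraMap 𝕜 _ lam * ∑ i, b i * der 𝕜 (φ x) i v),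
    fun h0 => ?_, fun f => ?_⟩
  · rw [hb h0]
    simp only [Pi.zero_apply, mul_zero]
    rfl
  · have e : gm (φ x) (f.1 ∘ φ.symm) = F * dens g φ lam f.1 (φ x) := by
      rw [dens, ← mul_assoc, gauge_neg_mul (goodVol g hφ) lam hy, one_mul]
    have hF : ∀ i, der 𝕜 (φ x) i F = -algebraMap 𝕜 _ lam * der 𝕜 (φ x) i v * F := fun i => by
      rw [← map_neg]
      exact der_gauge (goodVol g hφ) (-lam) hy i
    rw [show dens g φ mu (A f).1 (φ x) = E * gm (φ x) ((A f).1 ∘ φ.symm) from rfl, h, e]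
    clear_value F v E
    generalize dens g φ lam f.1 (φ x) = G
    simp only [opr, Pi.zero_apply, zero_mul, sum_const_zero, zero_add, Derivation.leibniz,
      smul_eq_mul, hF, mul_add, sum_add_distrib, mul_sum, mul_sub, sum_mul,
      sub_mul]
    have e1 : ∀ i, E * (b i * (G * (-algebraMap 𝕜 _ lam * der 𝕜 (φ x) i v * F)))
        = - (E * F * (algebraMap 𝕜 _ lam * (b i * der 𝕜 (φ x) i v)) * G) :=
      fun i => by ring
    have e2 : ∀ i, E * (b i * (F * der 𝕜 (φ x) i G)) = E * F * b i * der 𝕜 (φ x) i G :=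
      fun i => by ring
    simp only [e1, e2, sum_neg_distrib]
    ring

lemma exists_fun_dens (hφ : φ ∈ smoothCharts (n := n) M) (hx : x ∈ φ.source) (w : 𝕜)
    {γ : (y : Model n) → SmGerm 𝕜 y} (hγ : IsFam (φ x) γ) :
    ∃ f : smoothFun n 𝕜 M, dens g φ w f.1 (φ x) = γ (φ x) := by
  obtain ⟨f, hf⟩ := exists_fun_germ hφ hx
    ((isFam_gauge (goodVol g hφ) (-w) (φ.map_source hx)).mul hγ)
  refine ⟨f, ?_⟩
  rw [dens, hf, ← mul_assoc, mul_comm (gauge g φ w (φ x)),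
    gauge_neg_mul (goodVol g hφ) w (φ.map_source hx), one_mul]

lemma HasOpr.unique (hφ : φ ∈ smoothCharts (n := n) M) (hx : x ∈ φ.source) {A A' : FunOp n 𝕜 M}
    {b b' : Fin n → SmGerm 𝕜 (φ x)} {t t' : SmGerm 𝕜 (φ x)} (h : HasOpr g lam mu φ x A b t)
    (h' : HasOpr g lam mu φ x A' b' t')
    (hA : ∀ f, dens g φ mu (A f).1 (φ x) = dens g φ mu (A' f).1 (φ x)) : b = b' ∧ t = t' := by
  have key : ∀ γ : (y : Model n) → SmGerm 𝕜 y, IsFam (φ x) γ →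
      opr (der 𝕜 (φ x)) 0 b t (γ (φ x)) = opr (der 𝕜 (φ x)) 0 b' t' (γ (φ x)) := by
    intro γ hγ
    obtain ⟨f, hf⟩ := exists_fun_dens (g := g) hφ hx lam hγ
    rw [← hf, ← h f, ← h' f, hA]
  have ht : t = t' := by
    have := key _ (isFam_const 1)
    simpa [opr] using this
  refine ⟨funext fun i => ?_, ht⟩
  have hs : ∀ y : Model n, ContDiffAt ℝ ∞ (fun y : Model n => ((y i : ℝ) : 𝕜)) y :=
    fun y => ofReal_smooth (coord_smooth contDiffAt_id i)
  have h1 := key (fun y => gm y fun y => ((y i : ℝ) : 𝕜)) (isFam_gm (Filter.Eventually.of_forall hs))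
  have h2 : ∀ k, der 𝕜 (φ x) k (gm (φ x) fun y => ((y i : ℝ) : 𝕜)) = if k = i then 1 else 0 := by
    intro k
    rw [der_gm (hs _), ← map_one (algebraMap 𝕜 (SmGerm 𝕜 (φ x))),
      ← map_zero (algebraMap 𝕜 (SmGerm 𝕜 (φ x))), algebraMap_germ, algebraMap_germ]
    have : pd k (fun y : Model n => ((y i : ℝ) : 𝕜)) = fun _ => if k = i then 1 else 0 := by
      funext y
      have := pd_coord (𝕜 := 𝕜) (τ := fun y : Model n => y) (z := y) differentiableAt_id k i
      rw [this]
      simp [basisVec, Pi.single_apply, eq_comm]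
    rw [this]
    split_ifs <;> rfl
  simpa [opr, h2, ht] using h1

end Operators

/-! ### Equivariant maps that lower the order vanish -/

section Uniqueness

variable {n : ℕ} {𝕜 : Type*} [RCLike 𝕜] {M : Type*} [TopologicalSpace M] [ChartedSpace (Model n) M]
  [IsManifold (𝓡 n) ∞ M] [T2Space M] {g : PseudoRiemannianMetric n M}
  {φ : OpenPartialHomeomorph M (Model n)} {X : VField n M} {x : M} {lam mu : 𝕜} {U : Set M}
  {χ : M → ℝ}

lemma dens_add (hφ : φ ∈ smoothCharts (n := n) M) (hx : x ∈ φ.source) (w : 𝕜)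
    (f h : smoothFun n 𝕜 M) :
    dens g φ w (f + h).1 (φ x) = dens g φ w f.1 (φ x) + dens g φ w h.1 (φ x) := by
  rw [dens, gm_comp_add hφ hx, mul_add]
  rfl

lemma dens_smul (hφ : φ ∈ smoothCharts (n := n) M) (hx : x ∈ φ.source) (w c : 𝕜)
    (f : smoothFun n 𝕜 M) :
    dens g φ w (c • f).1 (φ x) = algebraMap 𝕜 _ c * dens g φ w f.1 (φ x) := by
  have h : gm (φ x) ((c • f).1 ∘ φ.symm) = algebraMap 𝕜 _ c * gm (φ x) (f.1 ∘ φ.symm) := by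
    rw [← Algebra.smul_def, smul_gm c (smoothFun_contDiffAt f hφ (φ.map_source hx))]
    rfl
  rw [dens, h, dens]
  ring

lemma dens_zero (w : 𝕜) : dens g φ w (0 : smoothFun n 𝕜 M).1 (φ x) = 0 := by
  have h : gm (φ x) ((0 : smoothFun n 𝕜 M).1 ∘ φ.symm) = 0 := gm_zero
  rw [dens, h, mul_zero]

lemma HasOpr.add (hφ : φ ∈ smoothCharts (n := n) M) (hx : x ∈ φ.source) {A A' : FunOp n 𝕜 M}
    {b b' : Fin n → SmGerm 𝕜 (φ x)} {t t' : SmGerm 𝕜 (φ x)} (h : HasOpr g lam mu φ x A b t)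
    (h' : HasOpr g lam mu φ x A' b' t') : HasOpr g lam mu φ x (A + A') (b + b') (t + t') := by
  intro f
  rw [LinearMap.add_apply, dens_add hφ hx, h, h']
  simp only [opr, Pi.zero_apply, zero_mul, sum_const_zero, zero_add, Pi.add_apply, add_mul,
    sum_add_distrib]
  ring

lemma HasOpr.smul (hφ : φ ∈ smoothCharts (n := n) M) (hx : x ∈ φ.source) {A : FunOp n 𝕜 M}
    {b : Fin n → SmGerm 𝕜 (φ x)} {t : SmGerm 𝕜 (φ x)} (c : 𝕜) (h : HasOpr g lam mu φ x A b t) :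
    HasOpr g lam mu φ x (c • A) (fun i => algebraMap 𝕜 _ c * b i) (algebraMap 𝕜 _ c * t) := by
  intro f
  rw [LinearMap.smul_apply, dens_smul hφ hx, h]
  simp only [opr, Pi.zero_apply, zero_mul, sum_const_zero, zero_add, mul_add, mul_assoc,
    mul_sum]

lemma hasOpr_zero {A : FunOp n 𝕜 M} (h : ∀ f, dens g φ mu (A f).1 (φ x) = 0) :
    HasOpr g lam mu φ x A 0 0 := by
  intro f
  rw [h]
  simp [opr]

lemma HasOpr.sum {ι : Type*} (s : Finset ι) (hφ : φ ∈ smoothCharts (n := n) M) (hx : x ∈ φ.source)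
    {A : ι → FunOp n 𝕜 M} {b : ι → Fin n → SmGerm 𝕜 (φ x)} {t : ι → SmGerm 𝕜 (φ x)}
    (h : ∀ r, HasOpr g lam mu φ x (A r) (b r) (t r)) :
    HasOpr g lam mu φ x (∑ r ∈ s, A r) (∑ r ∈ s, b r) (∑ r ∈ s, t r) := by
  classical
  induction s using Finset.induction_on with
  | empty =>
    simp only [Finset.sum_empty]
    exact hasOpr_zero fun f => dens_zero mu
  | insert a s ha ih =>
    simp only [Finset.sum_insert ha]
    exact (h a).add hφ hx ih

lemma HasOpr.lie (hφ : φ ∈ smoothCharts (n := n) M) (hx : x ∈ φ.source) (hU : U ∈ 𝓝 x)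
    (hχ : ContMDiff (𝓡 n) 𝓘(ℝ, ℝ) ∞ χ) (hχ1 : ∀ z ∈ U, χ z = 1)
    (hX : ∀ x ∈ tsupport χ, ∀ᶠ z in 𝓝 x, SmoothVFAt X z) {A A' : FunOp n 𝕜 M}
    (hA : IsLieOperatorOn g lam mu U X A A')
    {b b' : Fin n → SmGerm 𝕜 (φ x)} {t t' : SmGerm 𝕜 (φ x)} (h : HasOpr g lam mu φ x A b t)
    (h' : HasOpr g lam mu φ x A' b' t') :
    b' = lie1 (der 𝕜 (φ x)) (algebraMap 𝕜 _ (mu - lam)) (vfGerm 𝕜 φ X (φ x)) b ∧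
    t' = lie0 (der 𝕜 (φ x)) (algebraMap 𝕜 _ (mu - lam)) (vfGerm 𝕜 φ X (φ x)) t
      - algebraMap 𝕜 _ lam * ∑ k, b k
        * der 𝕜 (φ x) k (divg (der 𝕜 (φ x)) (vfGerm 𝕜 φ X (φ x))) := by
  have hxU : x ∈ U := mem_of_mem_nhds hU
  have hxχ : x ∈ tsupport χ := subset_tsupport _ (by simp [hχ1 x hxU])
  refine h'.unique hφ hx (A' := A') ?_ fun f => rfl
  intro f
  obtain ⟨f', hf'⟩ := exists_funLie (g := g) hχ hX lam f
  have e1 : ∀ z ∈ U, f'.1 z = lieDensity g lam X f.1 z := fun z hz => by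
    rw [hf', hχ1 z hz]
    simp
  have e2 := hA f f' e1
  have e3 := lieDensity_germ hφ (goodVol g hφ) hx (hX x hxχ) lam f f'
    (Filter.mem_of_superset hU e1)
  have e4 := lieDensity_germ hφ (goodVol g hφ) hx (hX x hxχ) mu (A f) (A' f + A f')
    (Filter.mem_of_superset hU fun z hz => by
      show (A' f).1 z + (A f').1 z = _
      rw [e2 z hz]
      ring)
  rw [dens_add hφ hx, h, h, e3] at e4
  have e5 := lie_opr (d := der 𝕜 (φ x)) der_comm (l := algebraMap 𝕜 _ lam)
    (m := algebraMap 𝕜 _ mu) (fun i => Derivation.map_algebraMap _ _) (vfGerm 𝕜 φ X (φ x))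
    (a2 := 0) (fun i j => rfl) b t (dens g φ lam f.1 (φ x))
  rw [← e4, add_sub_cancel_right, lie2_zero_right, ← map_sub] at e5
  rw [e5]
  simp only [Pi.zero_apply, zero_mul, sum_const_zero, mul_zero, sub_zero]

lemma cs_add (hφ : φ ∈ smoothCharts (n := n) M) (hx : x ∈ φ.source) (P R : symbols2 n 𝕜 M) :
    (∀ i j, cs2 φ (P + R) (φ x) i j = cs2 φ P (φ x) i j + cs2 φ R (φ x) i j) ∧
    (∀ i, cs1 φ (P + R) (φ x) i = cs1 φ P (φ x) i + cs1 φ R (φ x) i) ∧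
    cs0 φ (P + R) (φ x) = cs0 φ P (φ x) + cs0 φ R (φ x) := by
  have hy := φ.map_source hx
  have e : ∀ y η, symbolCoord φ (P + R).1 y η = symbolCoord φ P.1 y η + symbolCoord φ R.1 y η :=
    fun y η => rfl
  refine ⟨fun i j => ?_, fun i => ?_, ?_⟩
  · rw [cs2, cs2, cs2, ← gm_add (sc2_smooth hφ P hy i j) (sc2_smooth hφ R hy i j)]
    congr 1
    funext y
    simp only [sc2, scQ, e]
    ring
  · rw [cs1, cs1, cs1, ← gm_add (sc1_smooth hφ P hy i) (sc1_smooth hφ R hy i)]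
    congr 1
    funext y
    simp only [sc1, e]
    ring
  · rw [cs0, cs0, cs0, ← gm_add (sc0_smooth hφ P hy) (sc0_smooth hφ R hy)]
    rfl

lemma cs_smul (hφ : φ ∈ smoothCharts (n := n) M) (hx : x ∈ φ.source) (c : 𝕜) (P : symbols2 n 𝕜 M) :
    (∀ i j, cs2 φ (c • P) (φ x) i j = algebraMap 𝕜 _ c * cs2 φ P (φ x) i j) ∧
    (∀ i, cs1 φ (c • P) (φ x) i = algebraMap 𝕜 _ c * cs1 φ P (φ x) i) ∧
    cs0 φ (c • P) (φ x) = algebraMap 𝕜 _ c * cs0 φ P (φ x) := by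
  have hy := φ.map_source hx
  have e : ∀ y η, symbolCoord φ (c • P).1 y η = c * symbolCoord φ P.1 y η :=
    fun y η => rfl
  simp only [← Algebra.smul_def]
  refine ⟨fun i j => ?_, fun i => ?_, ?_⟩
  · rw [cs2, cs2, smul_gm c (sc2_smooth hφ P hy i j)]
    congr 1
    funext y
    simp only [sc2, scQ, e]
    ring
  · rw [cs1, cs1, smul_gm c (sc1_smooth hφ P hy i)]
    congr 1
    funext y
    simp only [sc1, e]
    ring
  · rw [cs0, cs0, smul_gm c (sc0_smooth hφ P hy)]
    rfl

lemma sy_add (hφ : φ ∈ smoothCharts (n := n) M) (hx : x ∈ φ.source) (w : 𝕜)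
    (P R : symbols2 n 𝕜 M) :
    sy2 g φ w (P + R) (φ x) = sy2 g φ w P (φ x) + sy2 g φ w R (φ x) ∧
    sy1 g φ w (P + R) (φ x) = sy1 g φ w P (φ x) + sy1 g φ w R (φ x) ∧
    sy0 g φ w (P + R) (φ x) = sy0 g φ w P (φ x) + sy0 g φ w R (φ x) := by
  obtain ⟨h2, h1, h0⟩ := cs_add hφ hx P R
  refine ⟨funext fun i => funext fun j => ?_, funext fun i => ?_, ?_⟩
  · simp only [sy2, h2, mul_add, Pi.add_apply]
  · simp only [sy1, h1, mul_add, Pi.add_apply]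
  · simp only [sy0, h0, mul_add]

lemma sy_smul (hφ : φ ∈ smoothCharts (n := n) M) (hx : x ∈ φ.source) (w c : 𝕜)
    (P : symbols2 n 𝕜 M) :
    (∀ i j, sy2 g φ w (c • P) (φ x) i j = algebraMap 𝕜 _ c * sy2 g φ w P (φ x) i j) ∧
    (∀ i, sy1 g φ w (c • P) (φ x) i = algebraMap 𝕜 _ c * sy1 g φ w P (φ x) i) ∧
    sy0 g φ w (c • P) (φ x) = algebraMap 𝕜 _ c * sy0 g φ w P (φ x) := by
  obtain ⟨h2, h1, h0⟩ := cs_smul hφ hx c P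
  refine ⟨fun i j => ?_, fun i => ?_, ?_⟩
  · simp only [sy2, h2]
    ring
  · simp only [sy1, h1]
    ring
  · simp only [sy0, h0]
    ring

lemma sy_zero (w : 𝕜) (y : Model n) : sy2 g φ w (0 : symbols2 n 𝕜 M) y = 0 ∧
    sy1 g φ w (0 : symbols2 n 𝕜 M) y = 0 := by
  have e : ∀ y η, symbolCoord φ (0 : symbols2 n 𝕜 M).1 y η = 0 := fun y η => rfl
  constructor
  · funext i j
    have : cs2 φ (0 : symbols2 n 𝕜 M) y i j = 0 := by
      rw [cs2, ← gm_zero]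
      congr 1
      funext y
      simp only [sc2, scQ, e]
      norm_num
    rw [sy2, this, mul_zero]
    rfl
  · funext i
    have : cs1 φ (0 : symbols2 n 𝕜 M) y i = 0 := by
      rw [cs1, ← gm_zero]
      congr 1
      funext y
      simp only [sc1, e]
      norm_num
    rw [sy1, this, mul_zero]
    rfl

lemma sy_sum {ι : Type*} (s : Finset ι) (hφ : φ ∈ smoothCharts (n := n) M) (hx : x ∈ φ.source)
    (w : 𝕜) (P : ι → symbols2 n 𝕜 M) :
    sy2 g φ w (∑ r ∈ s, P r) (φ x) = ∑ r ∈ s, sy2 g φ w (P r) (φ x) ∧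
    sy1 g φ w (∑ r ∈ s, P r) (φ x) = ∑ r ∈ s, sy1 g φ w (P r) (φ x) := by
  classical
  induction s using Finset.induction_on with
  | empty =>
    simp only [Finset.sum_empty]
    exact sy_zero w _
  | insert a s ha ih =>
    simp only [Finset.sum_insert ha]
    rw [(sy_add hφ hx w _ _).1, (sy_add hφ hx w _ _).2.1, ih.1, ih.2]
    exact ⟨rfl, rfl⟩

lemma IsHomog.add {k : ℕ} {P R : symbols2 n 𝕜 M} (hP : IsHomog k P) (hR : IsHomog k R) :
    IsHomog k (P + R) := by
  intro x t ξ
  show P.1 x (t • ξ) + R.1 x (t • ξ) = _ * (P.1 x ξ + R.1 x ξ)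
  rw [hP, hR, mul_add]

lemma IsHomog.smul {k : ℕ} {P : symbols2 n 𝕜 M} (hP : IsHomog k P) (c : 𝕜) :
    IsHomog k (c • P) := by
  intro x t ξ
  show c * P.1 x (t • ξ) = _ * (c * P.1 x ξ)
  rw [hP]
  ring

lemma IsHomog.sum {k : ℕ} {ι : Type*} (s : Finset ι) {P : ι → symbols2 n 𝕜 M}
    (hP : ∀ r, IsHomog k (P r)) : IsHomog k (∑ r ∈ s, P r) := by
  classical
  induction s using Finset.induction_on with
  | empty =>
    intro x t ξ
    show (0 : 𝕜) = _ * 0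
    rw [mul_zero]
  | insert a s ha ih =>
    simp only [Finset.sum_insert ha]
    exact (hP a).add ih

lemma symbol_eq_zero_of_sy2 (hφ : φ ∈ smoothCharts (n := n) M) (hx : x ∈ φ.source) (w : 𝕜)
    {P : symbols2 n 𝕜 M} (hP : IsHomog 2 P) (h : sy2 g φ w P (φ x) = 0) (ξ : Cotangent n x) :
    P.1 x ξ = 0 := by
  have h2 : ∀ i j, cs2 φ P (φ x) i j = 0 := fun i j => by
    have := congrFun (congrFun h i) j
    rw [sy2, Pi.zero_apply, Pi.zero_apply] at this
    rw [← one_mul (cs2 φ P (φ x) i j), ← gauge_neg_mul (goodVol g hφ) w (φ.map_source hx),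
      mul_assoc, this, mul_zero]
  rw [symbol_eq_polySym hφ P hx, hP.cs1_two, hP.cs0_two]
  simp [polySym, h2]

lemma symbol_eq_zero_of_sy1 (hφ : φ ∈ smoothCharts (n := n) M) (hx : x ∈ φ.source) (w : 𝕜)
    {P : symbols2 n 𝕜 M} (hP : IsHomog 1 P) (h : sy1 g φ w P (φ x) = 0) (ξ : Cotangent n x) :
    P.1 x ξ = 0 := by
  have h1 : ∀ i, cs1 φ P (φ x) i = 0 := fun i => by
    have := congrFun h i
    rw [sy1, Pi.zero_apply] at this
    rw [← one_mul (cs1 φ P (φ x) i), ← gauge_neg_mul (goodVol g hφ) w (φ.map_source hx),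
      mul_assoc, this, mul_zero]
  rw [symbol_eq_polySym hφ P hx, hP.cs2_one, hP.cs0_one]
  simp [polySym, h1]

variable (g lam mu U) in
/-- The linear map `T` intertwines the actions of the vector field `X` over `U`. -/
def IntertwinesOn (T : symbols2 n 𝕜 M →ₗ[𝕜] FunOp n 𝕜 M) (X : VField n M) : Prop :=
  ∀ P P' : symbols2 n 𝕜 M, IsLieSymbolOn g (mu - lam) U X P P' →
    IsLieOperatorOn g lam mu U X (T P) (T P')

lemma IntertwinesOn.local {T : symbols2 n 𝕜 M →ₗ[𝕜] FunOp n 𝕜 M}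
    (hT : IntertwinesOn g lam mu U T fun _ => 0) {P : symbols2 n 𝕜 M}
    (hP : ∀ x ∈ U, ∀ ξ, P.1 x ξ = 0) (f : smoothFun n 𝕜 M) (hx : x ∈ U) : (T P f).1 x = 0 := by
  have h := hT 0 P (fun x hx ξ => by rw [hP x hx, lieSymbol_zero]) f 0
    (fun x _ => by rw [lieDensity_zero_field]; rfl) x hx
  rw [h, lieDensity_zero_field, map_zero]
  simp

/-- `P'` is the image of `P` under the operator `∑ L_{Yᵣ} L_{Zᵣ}` over `U`. -/
structure CasimirStep (g : PseudoRiemannianMetric n M) (w : 𝕜) (U : Set M) {ι : Type*} [Fintype ι]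
    (Y Z : ι → VField n M) (k : ℕ) (P P' : symbols2 n 𝕜 M) (R S : ι → symbols2 n 𝕜 M) : Prop where
  first : ∀ r, IsLieSymbolOn g w U (Z r) P (R r)
  second : ∀ r, IsLieSymbolOn g w U (Y r) (R r) (S r)
  homog_first : ∀ r, IsHomog k (R r)
  homog_second : ∀ r, IsHomog k (S r)
  eq_sum : P' = ∑ r, S r

variable {ι : Type*} [Fintype ι] {Y Z : ι → VField n M}

lemma CasimirStep.homog {w : 𝕜} {k : ℕ} {P P' : symbols2 n 𝕜 M} {R S : ι → symbols2 n 𝕜 M}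
    (h : CasimirStep g w U Y Z k P P' R S) : IsHomog k P' := by
  rw [h.eq_sum]
  exact IsHomog.sum _ h.homog_second

lemma exists_casimirStep (hχ : ContMDiff (𝓡 n) 𝓘(ℝ, ℝ) ∞ χ) (hχ1 : ∀ z ∈ U, χ z = 1)
    (hY : ∀ r, ∀ x ∈ tsupport χ, ∀ᶠ z in 𝓝 x, SmoothVFAt (Y r) z)
    (hZ : ∀ r, ∀ x ∈ tsupport χ, ∀ᶠ z in 𝓝 x, SmoothVFAt (Z r) z) (w : 𝕜) {k : ℕ}
    (hk : k = 1 ∨ k = 2) {P : symbols2 n 𝕜 M} (hP : IsHomog k P) :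
    ∃ P' R S, CasimirStep g w U Y Z k P P' R S := by
  have key : ∀ X : VField n M, (∀ x ∈ tsupport χ, ∀ᶠ z in 𝓝 x, SmoothVFAt X z) →
      ∀ P : symbols2 n 𝕜 M, IsHomog k P → ∃ P', IsLieSymbolOn g w U X P P' ∧ IsHomog k P' := by
    intro X hX P hP
    obtain ⟨P', h, h2, h1⟩ := exists_symLie (g := g) hχ hX w P
    refine ⟨P', fun x hx ξ => ?_, ?_⟩
    · rw [h, hχ1 x hx]
      simp
    · rcases hk with rfl | rfl
      · exact h1 hP
      · exact h2 hP
  choose R hR hRk using fun r => key (Z r) (hZ r) P hP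
  choose S hS hSk using fun r => key (Y r) (hY r) (R r) (hRk r)
  exact ⟨_, R, S, hR, hS, hRk, hSk, rfl⟩

section AtPoint

variable {e : Fin n → 𝕜} (he : ∀ i, e i * e i = 1) {w : 𝕜} {k : ℕ} {P P' : symbols2 n 𝕜 M}
  {R S : ι → symbols2 n 𝕜 M} (h : CasimirStep g w U Y Z k P P' R S)
  (hφ : φ ∈ smoothCharts (n := n) M) (hx : x ∈ φ.source) (hU : U ∈ 𝓝 x)
  (hC : IsCasimir (der 𝕜 (φ x)) (fun i => algebraMap 𝕜 _ (e i))
    (fun r => vfGerm 𝕜 φ (Y r) (φ x)) (fun r => vfGerm 𝕜 φ (Z r) (φ x)))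

include he h hφ hx hU hC

lemma CasimirStep.sy2_eq (hY : ∀ r, ∀ᶠ z in 𝓝 x, SmoothVFAt (Y r) z)
    (hZ : ∀ r, ∀ᶠ z in 𝓝 x, SmoothVFAt (Z r) z) (i j : Fin n) :
    sy2 g φ w P' (φ x) i j
      = algebraMap 𝕜 _ (2 * n * n * w * (w - 1) + 8 * (n * (1 - w) + 1)) * sy2 g φ w P (φ x) i j
        - if i = j then 4 * (algebraMap 𝕜 _ (e i)
          * trc (fun i => algebraMap 𝕜 _ (e i)) (sy2 g φ w P (φ x))) else 0 := by
  have h1 := hC.lie2_lie2 der_comm (fun i j => Derivation.map_algebraMap _ _)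
    (fun i => by rw [← map_mul, he, map_one]) (w := algebraMap 𝕜 _ w)
    (fun i => Derivation.map_algebraMap _ _) (sy2_symm (φ := φ) g w P (φ x)) i j
  rw [h.eq_sum, (sy_sum _ hφ hx w S).1, Finset.sum_apply, Finset.sum_apply]
  have h2 : ∀ r, sy2 g φ w (S r) (φ x) i j = lie2 (der 𝕜 (φ x)) (algebraMap 𝕜 _ w)
      (vfGerm 𝕜 φ (Y r) (φ x)) (lie2 (der 𝕜 (φ x)) (algebraMap 𝕜 _ w)
      (vfGerm 𝕜 φ (Z r) (φ x)) (sy2 g φ w P (φ x))) i j := by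
    intro r
    rw [(lieSymbol_sy hφ hx (hY r) w (R r) (S r) (Filter.mem_of_superset hU (h.second r))).1,
      (lieSymbol_sy hφ hx (hZ r) w P (R r) (Filter.mem_of_superset hU (h.first r))).1]
  simp only [h2]
  rw [h1]
  simp only [map_add, map_mul, map_sub, map_one, map_natCast, map_ofNat]

lemma CasimirStep.sy1_eq (hY : ∀ r, ∀ᶠ z in 𝓝 x, SmoothVFAt (Y r) z)
    (hZ : ∀ r, ∀ᶠ z in 𝓝 x, SmoothVFAt (Z r) z) (i : Fin n) :
    sy1 g φ w P' (φ x) i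
      = algebraMap 𝕜 _ (2 * n * n * w * (w - 1) + 4 * n * (1 - w)) * sy1 g φ w P (φ x) i := by
  have h1 := hC.lie1_lie1 der_comm (fun i j => Derivation.map_algebraMap _ _)
    (fun i => by rw [← map_mul, he, map_one]) (w := algebraMap 𝕜 _ w)
    (fun i => Derivation.map_algebraMap _ _) (sy1 g φ w P (φ x)) i
  rw [h.eq_sum, (sy_sum _ hφ hx w S).2, Finset.sum_apply]
  have h2 : ∀ r, sy1 g φ w (S r) (φ x) i = lie1 (der 𝕜 (φ x)) (algebraMap 𝕜 _ w)
      (vfGerm 𝕜 φ (Y r) (φ x)) (lie1 (der 𝕜 (φ x)) (algebraMap 𝕜 _ w)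
      (vfGerm 𝕜 φ (Z r) (φ x)) (sy1 g φ w P (φ x))) i := by
    intro r
    rw [(lieSymbol_sy hφ hx (hY r) w (R r) (S r) (Filter.mem_of_superset hU (h.second r))).2.1,
      (lieSymbol_sy hφ hx (hZ r) w P (R r) (Filter.mem_of_superset hU (h.first r))).2.1]
  simp only [h2]
  rw [h1]
  simp only [map_add, map_mul, map_sub, map_one, map_natCast, map_ofNat]

end AtPoint

lemma CasimirStep.hasOpr {e : Fin n → 𝕜} (he : ∀ i, e i * e i = 1)
    (hχ : ContMDiff (𝓡 n) 𝓘(ℝ, ℝ) ∞ χ) (hχ1 : ∀ z ∈ U, χ z = 1)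
    (hY : ∀ r, ∀ x ∈ tsupport χ, ∀ᶠ z in 𝓝 x, SmoothVFAt (Y r) z)
    (hZ : ∀ r, ∀ x ∈ tsupport χ, ∀ᶠ z in 𝓝 x, SmoothVFAt (Z r) z)
    {k : ℕ} {P P' : symbols2 n 𝕜 M} {R S : ι → symbols2 n 𝕜 M}
    (h : CasimirStep g (mu - lam) U Y Z k P P' R S)
    (hφ : φ ∈ smoothCharts (n := n) M) (hx : x ∈ φ.source) (hU : U ∈ 𝓝 x)
    (hC : IsCasimir (der 𝕜 (φ x)) (fun i => algebraMap 𝕜 _ (e i))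
      (fun r => vfGerm 𝕜 φ (Y r) (φ x)) (fun r => vfGerm 𝕜 φ (Z r) (φ x)))
    {T : symbols2 n 𝕜 M →ₗ[𝕜] FunOp n 𝕜 M} (hTk : ∀ P, IsHomog k P → T P ∈ diffOp n 𝕜 M 1)
    (hTY : ∀ r, IntertwinesOn g lam mu U T (Y r)) (hTZ : ∀ r, IntertwinesOn g lam mu U T (Z r))
    {b : Fin n → SmGerm 𝕜 (φ x)} {t : SmGerm 𝕜 (φ x)} (hb : HasOpr g lam mu φ x (T P) b t) :
    ∃ t', HasOpr g lam mu φ x (T P') (fun i => algebraMap 𝕜 _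
      (2 * n * n * (mu - lam) * (mu - lam - 1) + 4 * n * (1 - (mu - lam))) * b i) t' ∧
      (b = 0 → t' = algebraMap 𝕜 _ (2 * n * n * (mu - lam) * (mu - lam - 1)) * t) := by
  choose bR tR _ hR using fun r => exists_hasOpr (g := g) (lam := lam) (mu := mu)
    (hTk _ (h.homog_first r)) hφ hx
  choose bS tS _ hS using fun r => exists_hasOpr (g := g) (lam := lam) (mu := mu)
    (hTk _ (h.homog_second r)) hφ hx
  have eR := fun r => HasOpr.lie hφ hx hU hχ hχ1 (hZ r) (hTZ r _ _ (h.first r)) hb (hR r)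
  have eS := fun r => HasOpr.lie hφ hx hU hχ hχ1 (hY r) (hTY r _ _ (h.second r)) (hR r) (hS r)
  have hsum := HasOpr.sum Finset.univ hφ hx hS
  rw [← map_sum, ← h.eq_sum] at hsum
  refine ⟨∑ r, tS r, ?_, fun hb0 => ?_⟩
  · convert hsum using 1
    funext i
    have h1 := hC.lie1_lie1 der_comm (fun i j => Derivation.map_algebraMap _ _)
      (fun i => by rw [← map_mul, he, map_one]) (w := algebraMap 𝕜 _ (mu - lam))
      (fun i => Derivation.map_algebraMap _ _) b i
    rw [Finset.sum_apply]
    simp only [(eS _).1, (eR _).1]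
    rw [h1]
    simp only [map_add, map_mul, map_sub, map_one, map_natCast, map_ofNat]
  · have h1 := hC.lie0_lie0 der_comm (fun i j => Derivation.map_algebraMap _ _)
      (fun i => by rw [← map_mul, he, map_one]) (w := algebraMap 𝕜 _ (mu - lam))
      (fun i => Derivation.map_algebraMap _ _) t
    have h2 : ∀ r, tS r = lie0 (der 𝕜 (φ x)) (algebraMap 𝕜 _ (mu - lam))
        (vfGerm 𝕜 φ (Y r) (φ x)) (lie0 (der 𝕜 (φ x)) (algebraMap 𝕜 _ (mu - lam))
        (vfGerm 𝕜 φ (Z r) (φ x)) t) := by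
      intro r
      rw [(eS r).2, (eR r).2, (eR r).1, hb0, lie1_zero_right]
      simp
    simp only [h2]
    rw [h1]
    simp only [map_add, map_mul, map_sub, map_one, map_natCast, map_ofNat]

lemma eq_zero_of_dens (hφ : φ ∈ smoothCharts (n := n) M) (hx : x ∈ φ.source) (w : 𝕜)
    (f : smoothFun n 𝕜 M) (h : dens g φ w f.1 (φ x) = 0) : f.1 x = 0 := by
  have h1 : gm (φ x) (f.1 ∘ φ.symm) = 0 := by
    rw [dens] at h
    rw [← one_mul (gm (φ x) (f.1 ∘ φ.symm)), ← gauge_neg_mul (goodVol g hφ) w (φ.map_source hx),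
      mul_assoc, h, mul_zero]
  have h2 := congrArg (evGerm 𝕜 (φ x)) h1
  rwa [ev_gm (smoothFun_contDiffAt f hφ (φ.map_source hx)), map_zero, Function.comp_apply,
    φ.left_inv hx] at h2

lemma dens_eq_zero (hx : x ∈ φ.source) (hU : U ∈ 𝓝 x) (w : 𝕜)
    (f : smoothFun n 𝕜 M) (h : ∀ z ∈ U, f.1 z = 0) : dens g φ w f.1 (φ x) = 0 := by
  have h1 : gm (φ x) (f.1 ∘ φ.symm) = 0 := by
    rw [← gm_zero]
    refine gm_congr (eventually_chart hx ?_)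
    filter_upwards [hU] with z hz hz'
    rw [Function.comp_apply, φ.left_inv hz', h z hz]
  rw [dens, h1, mul_zero]

lemma algebraMap_mul_eq_zero {y : Model n} {c : 𝕜} (hc : c ≠ 0) {t : SmGerm 𝕜 y}
    (h : algebraMap 𝕜 _ c * t = 0) : t = 0 := by
  rw [← one_mul t, ← map_one (algebraMap 𝕜 (SmGerm 𝕜 y)), ← inv_mul_cancel₀ hc, map_mul, mul_assoc,
    h, mul_zero]

/-- An equivariant linear map that lowers the order vanishes. -/
theorem LowersOrder.eq_zero_on {e : Fin n → 𝕜} (he : ∀ i, e i * e i = 1) (hU : IsOpen U)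
    (hχ : ContMDiff (𝓡 n) 𝓘(ℝ, ℝ) ∞ χ) (hχ1 : ∀ z ∈ U, χ z = 1)
    (hY : ∀ r, ∀ x ∈ tsupport χ, ∀ᶠ z in 𝓝 x, SmoothVFAt (Y r) z)
    (hZ : ∀ r, ∀ x ∈ tsupport χ, ∀ᶠ z in 𝓝 x, SmoothVFAt (Z r) z)
    (hC : ∀ x ∈ U, ∃ φ ∈ smoothCharts (n := n) M, x ∈ φ.source ∧
      IsCasimir (der 𝕜 (φ x)) (fun i => algebraMap 𝕜 _ (e i))
        (fun r => vfGerm 𝕜 φ (Y r) (φ x)) (fun r => vfGerm 𝕜 φ (Z r) (φ x)))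
    {T : symbols2 n 𝕜 M →ₗ[𝕜] FunOp n 𝕜 M} (hT : LowersOrder T)
    (hT0 : IntertwinesOn g lam mu U T fun _ => 0)
    (hTY : ∀ r, IntertwinesOn g lam mu U T (Y r)) (hTZ : ∀ r, IntertwinesOn g lam mu U T (Z r))
    (h0 : (n : 𝕜) ≠ 0) (h1 : mu - lam ≠ 1) (h2 : n * (mu - lam) ≠ 2)
    (h3 : 2 * n * (mu - lam) ≠ n + 2) (h4 : n * (mu - lam) ≠ n + 1)
    (h5 : n * (mu - lam) ≠ n + 2) (P : symbols2 n 𝕜 M) (f : smoothFun n 𝕜 M) (hx : x ∈ U) :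
    (T P f).1 x = 0 := by
  obtain ⟨φ, hφ, hxφ, hCx⟩ := hC x hx
  have hUx := hU.mem_nhds hx
  have hxχ : x ∈ tsupport χ := subset_tsupport _ (by simp [hχ1 x hx])
  set γ0 : 𝕜 := 2 * n * n * (mu - lam) * (mu - lam - 1) with hγ0
  set γ1 : 𝕜 := 2 * n * n * (mu - lam) * (mu - lam - 1) + 4 * n * (1 - (mu - lam)) with hγ1
  set α : 𝕜 := 2 * n * n * (mu - lam) * (mu - lam - 1) + 8 * (n * (1 - (mu - lam)) + 1) with hα
  -- symbols of degree one
  have key1 : ∀ P, IsHomog 1 P → (T P f).1 x = 0 := by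
    intro P hP
    obtain ⟨P', R, S, hs⟩ := exists_casimirStep (g := g) (U := U) hχ hχ1 hY hZ (mu - lam)
      (Or.inl rfl) hP
    have hTk : ∀ P, IsHomog 1 P → T P ∈ diffOp n 𝕜 M 1 := fun P hP => diffOp_mono (hT.one P hP)
    obtain ⟨b, t, hb0, hb⟩ := exists_hasOpr (g := g) (lam := lam) (mu := mu) (hTk P hP) hφ hxφ
    have hb0' := hb0 (hT.one P hP)
    obtain ⟨t', hb', ht'⟩ := hs.hasOpr he hχ hχ1 hY hZ hφ hxφ hUx hCx hTk hTY hTZ hb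
    have hz : ∀ z ∈ U, ∀ ξ, (P' + (-γ1) • P).1 z ξ = 0 := by
      intro z hz
      obtain ⟨ψ, hψ, hzψ, hCz⟩ := hC z hz
      have hzχ : z ∈ tsupport χ := subset_tsupport _ (by simp [hχ1 z hz])
      refine symbol_eq_zero_of_sy1 (g := g) hψ hzψ (mu - lam) (hs.homog.add (hP.smul _)) ?_
      funext i
      rw [(sy_add hψ hzψ _ _ _).2.1, Pi.add_apply, (sy_smul hψ hzψ _ _ _).2.1,
        hs.sy1_eq he hψ hzψ (hU.mem_nhds hz) hCz (fun r => hY r z hzχ) (fun r => hZ r z hzχ),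
        ← hγ1, map_neg]
      simp
    have hv : ∀ f, dens g φ mu (T (P' + (-γ1) • P) f).1 (φ x) = 0 := fun f =>
      dens_eq_zero hxφ hUx mu _ fun z hz' => hT0.local hz f hz'
    rw [map_add, map_smul] at hv
    have hu := ((hb'.add hφ hxφ (hb.smul hφ hxφ (-γ1))).unique hφ hxφ (hasOpr_zero hv)
      fun f => rfl).2
    rw [ht' hb0', ← add_mul, ← map_add] at hu
    have ht : t = 0 := by
      refine algebraMap_mul_eq_zero ?_ hu
      have : γ0 + -γ1 = -(4 * n * (1 - (mu - lam))) := by rw [hγ0, hγ1]; ring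
      rw [this]
      exact neg_ne_zero.2 (mul_ne_zero (mul_ne_zero (by norm_num) h0) (sub_ne_zero.2 h1.symm))
    refine eq_zero_of_dens (g := g) hφ hxφ mu _ ?_
    rw [hb f, hb0', ht]
    simp [opr]
  -- symbols of degree two
  have key2 : ∀ P, IsHomog 2 P → (T P f).1 x = 0 := by
    intro P hP
    obtain ⟨P', R, S, hs⟩ := exists_casimirStep (g := g) (U := U) hχ hχ1 hY hZ (mu - lam)
      (Or.inr rfl) hP
    obtain ⟨P'', R', S', hs'⟩ := exists_casimirStep (g := g) (U := U) hχ hχ1 hY hZ (mu - lam)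
      (Or.inr rfl) hs.homog
    obtain ⟨b, t, -, hb⟩ := exists_hasOpr (g := g) (lam := lam) (mu := mu) (hT.two P hP) hφ hxφ
    obtain ⟨t', hb', ht'⟩ := hs.hasOpr he hχ hχ1 hY hZ hφ hxφ hUx hCx hT.two hTY hTZ hb
    obtain ⟨t'', hb'', ht''⟩ := hs'.hasOpr he hχ hχ1 hY hZ hφ hxφ hUx hCx hT.two hTY hTZ hb'
    have hz : ∀ z ∈ U, ∀ ξ,
        (P'' + ((-(2 * α - 4 * n)) • P' + (α * (α - 4 * n)) • P)).1 z ξ = 0 := by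
      intro z hz
      obtain ⟨ψ, hψ, hzψ, hCz⟩ := hC z hz
      have hzχ : z ∈ tsupport χ := subset_tsupport _ (by simp [hχ1 z hz])
      refine symbol_eq_zero_of_sy2 (g := g) hψ hzψ (mu - lam)
        (hs'.homog.add ((hs.homog.smul _).add (hP.smul _))) ?_
      have e1 := hs.sy2_eq he hψ hzψ (hU.mem_nhds hz) hCz (fun r => hY r z hzχ)
        (fun r => hZ r z hzχ)
      have e2 := hs'.sy2_eq he hψ hzψ (hU.mem_nhds hz) hCz (fun r => hY r z hzχ)
        (fun r => hZ r z hzχ)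
      rw [← hα] at e1 e2
      have e3 : trc (fun i => algebraMap 𝕜 _ (e i)) (sy2 g ψ (mu - lam) P' (ψ z))
          = algebraMap 𝕜 _ (α - 4 * n)
            * trc (fun i => algebraMap 𝕜 _ (e i)) (sy2 g ψ (mu - lam) P (ψ z)) := by
        have e4 : ∀ i, algebraMap 𝕜 (SmGerm 𝕜 (ψ z)) (e i) * algebraMap 𝕜 _ (e i) = 1 := fun i => by
          rw [← map_mul, he, map_one]
        have e5 : ∀ i, algebraMap 𝕜 (SmGerm 𝕜 (ψ z)) (e i) * sy2 g ψ (mu - lam) P' (ψ z) i i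
            = algebraMap 𝕜 _ α * (algebraMap 𝕜 _ (e i) * sy2 g ψ (mu - lam) P (ψ z) i i)
            - 4 * trc (fun i => algebraMap 𝕜 _ (e i)) (sy2 g ψ (mu - lam) P (ψ z)) := by
          intro i
          rw [e1, if_pos rfl]
          linear_combination -4 * trc (fun i => algebraMap 𝕜 _ (e i))
            (sy2 g ψ (mu - lam) P (ψ z)) * e4 i
        rw [trc]
        simp only [e5, sum_sub_distrib, ← mul_sum, Finset.sum_const, Finset.card_univ,
          Fintype.card_fin, nsmul_eq_mul, map_sub, map_mul, map_natCast, map_ofNat]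
        rw [← trc]
        ring
      funext i j
      rw [(sy_add hψ hzψ _ _ _).1, (sy_add hψ hzψ _ _ _).1, Pi.add_apply, Pi.add_apply,
        Pi.add_apply, Pi.add_apply, (sy_smul hψ hzψ _ _ _).1, (sy_smul hψ hzψ _ _ _).1, e2, e1, e3]
      simp only [map_sub, map_mul, map_natCast, map_ofNat, map_neg, Pi.zero_apply]
      split_ifs <;> ring
    have hv : ∀ f, dens g φ mu
        (T (P'' + ((-(2 * α - 4 * n)) • P' + (α * (α - 4 * n)) • P)) f).1 (φ x) = 0 := fun f =>
      dens_eq_zero hxφ hUx mu _ fun z hz' => hT0.local hz f hz'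
    rw [map_add, map_add, map_smul, map_smul] at hv
    have hu := (hb''.add hφ hxφ ((hb'.smul hφ hxφ (-(2 * α - 4 * n))).add hφ hxφ
      (hb.smul hφ hxφ (α * (α - 4 * n))))).unique hφ hxφ (hasOpr_zero hv) fun f => rfl
    have hb00 : b = 0 := by
      funext i
      have hi := congrFun hu.1 i
      simp only [Pi.add_apply, Pi.zero_apply] at hi
      have hi' : algebraMap 𝕜 (SmGerm 𝕜 (φ x))
          (γ1 * γ1 + (-(2 * α - 4 * n) * γ1 + α * (α - 4 * n))) * b i = 0 := by
        rw [← hi, hγ1]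
        simp only [map_add, map_mul, map_neg, map_sub, map_one, map_natCast, map_ofNat]
        ring
      refine algebraMap_mul_eq_zero ?_ hi'
      have e1 : γ1 * γ1 + (-(2 * α - 4 * n) * γ1 + α * (α - 4 * n))
          = 16 * (n + 2 - n * (mu - lam)) * (2 - n * (mu - lam)) := by
        rw [hγ1, hα]; ring
      rw [e1]
      exact mul_ne_zero (mul_ne_zero (by norm_num) (sub_ne_zero.2 h5.symm)) (sub_ne_zero.2 h2.symm)
    have hb00' : (fun i => algebraMap 𝕜 (SmGerm 𝕜 (φ x)) (2 * n * n * (mu - lam) * (mu - lam - 1)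
        + 4 * n * (1 - (mu - lam))) * b i) = 0 := by
      rw [hb00]
      funext i
      exact mul_zero _
    have ht : t = 0 := by
      have h6 := hu.2
      rw [ht'' hb00', ht' hb00] at h6
      have h7 : algebraMap 𝕜 (SmGerm 𝕜 (φ x))
          (γ0 * γ0 + (-(2 * α - 4 * n) * γ0 + α * (α - 4 * n))) * t = 0 := by
        rw [← h6, hγ0]
        simp only [map_add, map_mul, map_neg, map_sub, map_one, map_natCast, map_ofNat]
        ring
      refine algebraMap_mul_eq_zero ?_ h7
      have e1 : γ0 * γ0 + (-(2 * α - 4 * n) * γ0 + α * (α - 4 * n))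
          = 32 * (n + 1 - n * (mu - lam)) * (n + 2 - 2 * n * (mu - lam)) := by
        rw [hγ0, hα]; ring
      rw [e1]
      exact mul_ne_zero (mul_ne_zero (by norm_num) (sub_ne_zero.2 h4.symm)) (sub_ne_zero.2 h3.symm)
    refine eq_zero_of_dens (g := g) hφ hxφ mu _ ?_
    rw [hb f, hb00, ht]
    simp [opr]
  obtain ⟨P2, P1, P0, hP2, hP1, hP0, rfl⟩ := exists_homog_decomp P
  rw [map_add, map_add, hT.zero P0 hP0]
  show (T P2 f).1 x + (T P1 f).1 x + 0 = 0
  rw [key1 P1 hP1, key2 P2 hP2, add_zero, add_zero]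

end Uniqueness

/-! ### The quantization map in a chart -/

section OprAlgebra

variable {K R : Type*} [Field K] [CommRing R] [Algebra K R] {n : ℕ} {d : Fin n → Derivation K R R}

lemma opr_mul {a2 : Fin n → Fin n → R} (hs : ∀ i j, a2 i j = a2 j i) (a1 : Fin n → R)
    (a0 E F : R) : opr d a2 a1 a0 (E * F) = opr d (fun i j => E * a2 i j)
      (fun i => E * a1 i + 2 * ∑ j, a2 i j * d j E) (opr d a2 a1 a0 E) F := by
  have e1 : ∑ i, ∑ j, a2 i j * (d i E * d j F) = ∑ i, ∑ j, a2 i j * d j E * d i F := by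
    rw [sum_comm]
    exact sum_congr rfl fun i _ => sum_congr rfl fun j _ => by rw [hs j i]; ring
  have e2 : ∀ i j, a2 i j * d i (d j (E * F)) = E * a2 i j * d i (d j F) + a2 i j * d i (d j E) * F
      + a2 i j * d j E * d i F + a2 i j * (d i E * d j F) := fun i j => by
    simp only [Derivation.leibniz, smul_eq_mul, map_add]
    ring
  have e3 : ∀ i, a1 i * d i (E * F) = E * a1 i * d i F + a1 i * d i E * F := fun i => by
    simp only [Derivation.leibniz, smul_eq_mul, map_add]
    ring
  simp only [opr, e2, e3, sum_add_distrib, e1, add_mul, sum_mul, mul_sum,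
    mul_assoc, two_mul]
  ring

lemma mul_opr (a2 : Fin n → Fin n → R) (a1 : Fin n → R) (a0 E F : R) : E * opr d a2 a1 a0 F
    = opr d (fun i j => E * a2 i j) (fun i => E * a1 i) (E * a0) F := by
  simp only [opr, mul_add, mul_sum, mul_assoc]

lemma opr_comm (a2 : Fin n → Fin n → R) (a1 : Fin n → R) (a0 F G : R) :
    opr d a2 a1 a0 (F * G) - F * opr d a2 a1 a0 G
      = ∑ i, ∑ j, a2 i j * (d i F * d j G + d j F * d i G) + opr d a2 a1 a0 F * G
        - a0 * F * G := by
  have e2 : ∀ i j, a2 i j * d i (d j (F * G)) = F * (a2 i j * d i (d j G))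
      + a2 i j * (d i F * d j G + d j F * d i G) + a2 i j * d i (d j F) * G := fun i j => by
    simp only [Derivation.leibniz, smul_eq_mul, map_add]
    ring
  have e3 : ∀ i, a1 i * d i (F * G) = F * (a1 i * d i G) + a1 i * d i F * G := fun i => by
    simp only [Derivation.leibniz, smul_eq_mul, map_add]
    ring
  simp only [opr, e2, e3, sum_add_distrib, add_mul, sum_mul, ← mul_sum]
  ring

lemma opr_comm_comm (a2 : Fin n → Fin n → R) (a1 : Fin n → R) (a0 F G H : R) :
    opr d a2 a1 a0 (F * (G * H)) - F * opr d a2 a1 a0 (G * H)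
      - G * (opr d a2 a1 a0 (F * H) - F * opr d a2 a1 a0 H)
      = (∑ i, ∑ j, a2 i j * (d i F * d j G + d j F * d i G)) * H := by
  rw [opr_comm, opr_comm]
  have e : ∀ i j, a2 i j * (d i F * d j (G * H) + d j F * d i (G * H))
      = G * (a2 i j * (d i F * d j H + d j F * d i H))
        + a2 i j * (d i F * d j G + d j F * d i G) * H := fun i j => by
    simp only [Derivation.leibniz, smul_eq_mul, map_add]
    ring
  simp only [e, sum_add_distrib, ← mul_sum, ← sum_mul]
  ring

end OprAlgebra

section Quantization

variable {n : ℕ} {𝕜 : Type*} [RCLike 𝕜] {M : Type*} [TopologicalSpace M] [ChartedSpace (Model n) M]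
  [IsManifold (𝓡 n) ∞ M] [T2Space M] {g : PseudoRiemannianMetric n M}
  {φ : OpenPartialHomeomorph M (Model n)} {X : VField n M} {x : M} {lam mu : 𝕜} {U : Set M}
  {χ : M → ℝ}

/-- Numerical data for the quantization map. -/
structure QuantData (n : ℕ) (𝕜 : Type*) where
  /-- the diagonal entries of the flat metric -/
  e : Fin n → 𝕜
  /-- coefficient of the divergence in order one -/
  b1 : 𝕜
  /-- coefficient of the gradient of the trace in order one -/
  b2 : 𝕜
  /-- coefficient of the double divergence in order zero -/
  b3 : 𝕜
  /-- coefficient of the Laplacian of the trace in order zero -/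
  b4 : 𝕜
  /-- coefficient of the divergence in order zero -/
  c : 𝕜

/-- The relations that make the quantization map equivariant. -/
structure QuantData.IsEquivariant (q : QuantData n 𝕜) (lam mu : 𝕜) : Prop where
  ee : ∀ i, q.e i * q.e i = 1
  r1 : q.b1 * (n * (mu - lam - 1) - 2) = -2 - 2 * lam * n
  r2 : q.b2 * ((mu - lam) * n - 2) = 1 - q.b1
  r3 : q.c * (mu - lam - 1) = -lam
  r4 : q.b3 * (2 * n * (mu - lam - 1) - 2) = -(lam * n * q.b1)
  r5 : q.b3 + q.b4 * (n * (2 * (mu - lam) - 1) - 2) = -(lam * n * q.b2)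

variable (g) in
/-- The quantization of the symbol with coefficients `a2`, `a1`, `a0`, acting on germs. -/
def quantOpr (q : QuantData n 𝕜) {y : Model n} (a2 : Fin n → Fin n → SmGerm 𝕜 y)
    (a1 : Fin n → SmGerm 𝕜 y) (a0 F : SmGerm 𝕜 y) : SmGerm 𝕜 y :=
  opr (der 𝕜 y) a2
    (quant1 (der 𝕜 y) (fun i => algebraMap 𝕜 _ (q.e i)) (algebraMap 𝕜 _ q.b1)
      (algebraMap 𝕜 _ q.b2) a2 a1)
    (quant0 (der 𝕜 y) (fun i => algebraMap 𝕜 _ (q.e i)) (algebraMap 𝕜 _ q.c)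
      (algebraMap 𝕜 _ q.b3) (algebraMap 𝕜 _ q.b4) a2 a1 a0) F

variable (g lam mu) in
/-- The germs of the function obtained from `f` by the quantization of `P` in the chart `φ`. -/
def quantGerm (q : QuantData n 𝕜) (φ : OpenPartialHomeomorph M (Model n)) (P : symbols2 n 𝕜 M)
    (f : M → 𝕜) (y : Model n) : SmGerm 𝕜 y :=
  gauge g φ (-mu) y * quantOpr q (sy2 g φ (mu - lam) P y) (sy1 g φ (mu - lam) P y)
    (sy0 g φ (mu - lam) P y) (dens g φ lam f y)

variable {q : QuantData n 𝕜}

lemma quant1_zero_left {y : Model n} (e : Fin n → SmGerm 𝕜 y) (b1 b2 : SmGerm 𝕜 y)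
    (a1 : Fin n → SmGerm 𝕜 y) : quant1 (der 𝕜 y) e b1 b2 0 a1 = a1 := by
  funext i
  simp [quant1, divg2, grad, trc]

lemma quant0_zero_left {y : Model n} (e : Fin n → SmGerm 𝕜 y) (c b3 b4 : SmGerm 𝕜 y)
    (a0 : SmGerm 𝕜 y) : quant0 (der 𝕜 y) e c b3 b4 0 0 a0 = a0 := by
  simp [quant0, divg2, grad, trc, divg]

lemma gauge_cancel (hφ : φ ∈ smoothCharts (n := n) M) (hx : x ∈ φ.source) :
    gauge g φ (-mu) (φ x) * (gauge g φ lam (φ x) * gauge g φ (mu - lam) (φ x)) = 1 := by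
  have hv := goodVol g hφ
  have hy := φ.map_source hx
  rw [← gauge_add hv _ _ hy, ← gauge_add hv _ _ hy]
  have : -mu + (lam + (mu - lam)) = 0 := by ring
  rw [this, gauge_zero]

lemma quantGerm_eq_opr (hφ : φ ∈ smoothCharts (n := n) M) (hx : x ∈ φ.source)
    (P : symbols2 n 𝕜 M) : ∃ (a1 : Fin n → SmGerm 𝕜 (φ x)) (a0 : SmGerm 𝕜 (φ x)),
      (∀ f : M → 𝕜, quantGerm g lam mu q φ P f (φ x)
        = opr (der 𝕜 (φ x)) (cs2 φ P (φ x)) a1 a0 (gm (φ x) (f ∘ φ.symm))) ∧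
      (cs2 φ P (φ x) = 0 → a1 = cs1 φ P (φ x) ∧ (cs1 φ P (φ x) = 0 → a0 = cs0 φ P (φ x))) := by
  have h := gauge_cancel (g := g) (lam := lam) (mu := mu) hφ hx
  set A1 := quant1 (der 𝕜 (φ x)) (fun i => algebraMap 𝕜 _ (q.e i)) (algebraMap 𝕜 _ q.b1)
      (algebraMap 𝕜 _ q.b2) (sy2 g φ (mu - lam) P (φ x)) (sy1 g φ (mu - lam) P (φ x)) with hA1
  set A0 := quant0 (der 𝕜 (φ x)) (fun i => algebraMap 𝕜 _ (q.e i)) (algebraMap 𝕜 _ q.c)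
      (algebraMap 𝕜 _ q.b3) (algebraMap 𝕜 _ q.b4) (sy2 g φ (mu - lam) P (φ x))
      (sy1 g φ (mu - lam) P (φ x)) (sy0 g φ (mu - lam) P (φ x)) with hA0
  refine ⟨fun i => gauge g φ (-mu) (φ x) * (gauge g φ lam (φ x) * A1 i
    + 2 * ∑ j, sy2 g φ (mu - lam) P (φ x) i j * der 𝕜 (φ x) j (gauge g φ lam (φ x))),
    gauge g φ (-mu) (φ x) * opr (der 𝕜 (φ x)) (sy2 g φ (mu - lam) P (φ x)) A1 A0
      (gauge g φ lam (φ x)), fun f => ?_, fun h2 => ?_⟩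
  · have e1 : cs2 φ P (φ x) = fun i j => gauge g φ (-mu) (φ x) * (gauge g φ lam (φ x)
        * sy2 g φ (mu - lam) P (φ x) i j) := by
      funext i j
      rw [sy2, ← mul_assoc (gauge g φ lam (φ x)), ← mul_assoc, h, one_mul]
    rw [quantGerm, quantOpr, dens, opr_mul (sy2_symm g (mu - lam) P (φ x)), ← hA1, ← hA0, e1, mul_opr]
  · have hs2 : sy2 g φ (mu - lam) P (φ x) = 0 := by
      funext i j
      rw [sy2, h2]
      exact mul_zero _
    rw [hs2, quant1_zero_left] at hA1
    refine ⟨?_, fun h1 => ?_⟩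
    · funext i
      rw [hs2, hA1]
      simp only [Pi.zero_apply, zero_mul, sum_const_zero, mul_zero, add_zero, sy1]
      rw [← mul_assoc (gauge g φ lam (φ x)), ← mul_assoc, h, one_mul]
    · have hs1 : sy1 g φ (mu - lam) P (φ x) = 0 := by
        funext i
        rw [sy1, h1]
        exact mul_zero _
      rw [hs2, hs1, quant0_zero_left] at hA0
      rw [hs2, hA1, hs1, hA0]
      simp only [opr, Pi.zero_apply, zero_mul, sum_const_zero, zero_add, sy0]
      calc _ = (gauge g φ (-mu) (φ x) * (gauge g φ lam (φ x) * gauge g φ (mu - lam) (φ x)))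
            * cs0 φ P (φ x) := by ring
        _ = _ := by rw [h, one_mul]

lemma isFam_quantGerm (hφ : φ ∈ smoothCharts (n := n) M) (hx : x ∈ φ.source) (P : symbols2 n 𝕜 M)
    (f : smoothFun n 𝕜 M) : IsFam (φ x) (quantGerm g lam mu q φ P f.1) := by
  have hy := φ.map_source hx
  have hv := goodVol g hφ
  have h2 := fun i j => (isFam_gauge hv (mu - lam) hy).mul (isFam_cs2 hφ P hx i j)
  have h1 := fun i => (isFam_gauge hv (mu - lam) hy).mul (isFam_cs1 hφ P hx i)
  have h0 := (isFam_gauge hv (mu - lam) hy).mul (isFam_cs0 hφ P hx)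
  exact (isFam_gauge hv (-mu) hy).mul (IsFam.opr h2 (IsFam.quant1 q.b1 q.b2 h2 h1)
    (IsFam.quant0 q.c q.b3 q.b4 h2 h1 h0) (isFam_dens hφ hv hx lam f))

/-- The function obtained from `f` by the quantization of `P` in the chart `φ`. -/
def quantLoc (g : PseudoRiemannianMetric n M) (lam mu : 𝕜) (q : QuantData n 𝕜)
    (φ : OpenPartialHomeomorph M (Model n)) (P : symbols2 n 𝕜 M) (f : M → 𝕜) (z : M) : 𝕜 :=
  evGerm 𝕜 (φ z) (quantGerm g lam mu q φ P f (φ z))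

lemma quantLoc_smooth (hφ : φ ∈ smoothCharts (n := n) M) (hx : x ∈ φ.source) (P : symbols2 n 𝕜 M)
    (f : smoothFun n 𝕜 M) : ContMDiffAt (𝓡 n) 𝓘(ℝ, 𝕜) ∞ (quantLoc g lam mu q φ P f.1) x := by
  rw [contDiffAt_chart_iff hφ hx]
  have hfam := isFam_quantGerm (g := g) (lam := lam) (mu := mu) (q := q) hφ hx P f
  refine hfam.smooth.1.congr_of_eventuallyEq (eventually_chart hx ?_)
  filter_upwards with z hz
  rw [Function.comp_apply, φ.left_inv hz, quantLoc]

lemma gm_quantLoc (hφ : φ ∈ smoothCharts (n := n) M) (hx : x ∈ φ.source) (P : symbols2 n 𝕜 M)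
    (f : smoothFun n 𝕜 M) :
    gm (φ x) (quantLoc g lam mu q φ P f.1 ∘ φ.symm) = quantGerm g lam mu q φ P f.1 (φ x) := by
  rw [← (isFam_quantGerm hφ hx P f).smooth.2]
  refine gm_congr (eventually_chart hx ?_)
  filter_upwards with z hz
  rw [Function.comp_apply, φ.left_inv hz, quantLoc]

lemma quantGerm_add_fun (hφ : φ ∈ smoothCharts (n := n) M) (hx : x ∈ φ.source)
    (P : symbols2 n 𝕜 M) (f h : smoothFun n 𝕜 M) : quantGerm g lam mu q φ P (f + h).1 (φ x)
      = quantGerm g lam mu q φ P f.1 (φ x) + quantGerm g lam mu q φ P h.1 (φ x) := by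
  obtain ⟨a1, a0, ha, -⟩ := quantGerm_eq_opr (g := g) (lam := lam) (mu := mu) (q := q) hφ hx P
  rw [ha, ha, ha, gm_comp_add hφ hx]
  simp only [opr, map_add, mul_add, sum_add_distrib]
  ring

lemma quantGerm_smul_fun (hφ : φ ∈ smoothCharts (n := n) M) (hx : x ∈ φ.source)
    (P : symbols2 n 𝕜 M) (r : 𝕜) (f : smoothFun n 𝕜 M) :
    quantGerm g lam mu q φ P (r • f).1 (φ x)
      = algebraMap 𝕜 _ r * quantGerm g lam mu q φ P f.1 (φ x) := by
  obtain ⟨a1, a0, ha, -⟩ := quantGerm_eq_opr (g := g) (lam := lam) (mu := mu) (q := q) hφ hx P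
  have h : gm (φ x) ((r • f).1 ∘ φ.symm) = r • gm (φ x) (f.1 ∘ φ.symm) := by
    rw [smul_gm r (smoothFun_contDiffAt f hφ (φ.map_source hx))]
    rfl
  rw [ha, ha, h, ← Algebra.smul_def]
  simp only [opr, Derivation.map_smul, mul_smul_comm, smul_sum, smul_add]

lemma quantGerm_add_symbol (hφ : φ ∈ smoothCharts (n := n) M) (hx : x ∈ φ.source)
    (P R : symbols2 n 𝕜 M) (f : M → 𝕜) : quantGerm g lam mu q φ (P + R) f (φ x)
      = quantGerm g lam mu q φ P f (φ x) + quantGerm g lam mu q φ R f (φ x) := by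
  obtain ⟨h2, h1, h0⟩ := sy_add (g := g) hφ hx (mu - lam) P R
  rw [quantGerm, h2, h1, h0, quantGerm, quantGerm, ← mul_add]
  congr 1
  simp only [quantOpr, opr, quant1, quant0, divg, divg2, grad, trc, Pi.add_apply, map_add, mul_add,
    add_mul, sum_add_distrib]
  ring

lemma quantGerm_smul_symbol (hφ : φ ∈ smoothCharts (n := n) M) (hx : x ∈ φ.source) (r : 𝕜)
    (P : symbols2 n 𝕜 M) (f : M → 𝕜) : quantGerm g lam mu q φ (r • P) f (φ x)
      = algebraMap 𝕜 _ r * quantGerm g lam mu q φ P f (φ x) := by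
  obtain ⟨h2, h1, h0⟩ := sy_smul (g := g) hφ hx (mu - lam) r P
  have e2 : sy2 g φ (mu - lam) (r • P) (φ x) = r • sy2 g φ (mu - lam) P (φ x) := by
    funext i j
    rw [h2, ← Algebra.smul_def]
    rfl
  have e1 : sy1 g φ (mu - lam) (r • P) (φ x) = r • sy1 g φ (mu - lam) P (φ x) := by
    funext i
    rw [h1, ← Algebra.smul_def]
    rfl
  rw [← Algebra.smul_def] at h0 ⊢
  rw [quantGerm, e2, e1, h0, quantGerm, ← mul_smul_comm]
  congr 1
  simp only [quantOpr, opr, quant1, quant0, divg, divg2, grad, trc, Pi.smul_apply, Derivation.map_smul,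
    mul_smul_comm, smul_mul_assoc, ← smul_sum, ← smul_add]

lemma quantGerm_lie (hq : q.IsEquivariant lam mu) (hφ : φ ∈ smoothCharts (n := n) M)
    (hx : x ∈ φ.source) (hX : ∀ᶠ z in 𝓝 x, SmoothVFAt X z) {s : SmGerm 𝕜 (φ x)}
    (hs : IsConf (der 𝕜 (φ x)) (fun i => algebraMap 𝕜 _ (q.e i)) (vfGerm 𝕜 φ X (φ x)) s)
    (P P' : symbols2 n 𝕜 M) (f f' : smoothFun n 𝕜 M)
    (hP : ∀ᶠ z in 𝓝 x, ∀ ξ : Cotangent n z, P'.1 z ξ = lieSymbol g (mu - lam) X P.1 z ξ)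
    (hf : ∀ᶠ z in 𝓝 x, f'.1 z = lieDensity g lam X f.1 z) :
    gauge g φ mu (φ x) * (quantGerm g lam mu q φ P' f.1 (φ x)
        + quantGerm g lam mu q φ P f'.1 (φ x))
      = lie0 (der 𝕜 (φ x)) (algebraMap 𝕜 _ mu) (vfGerm 𝕜 φ X (φ x))
          (gauge g φ mu (φ x) * quantGerm g lam mu q φ P f.1 (φ x)) := by
  have hc : ∀ (r : 𝕜) i, der 𝕜 (φ x) i (algebraMap 𝕜 _ r) = 0 :=
    fun r i => Derivation.map_algebraMap _ _
  have hm : ∀ (a b : 𝕜), a = b → algebraMap 𝕜 (SmGerm 𝕜 (φ x)) a = algebraMap 𝕜 _ b :=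
    fun a b h => by rw [h]
  have r1 := hm _ _ hq.r1
  have r2 := hm _ _ hq.r2
  have r3 := hm _ _ hq.r3
  have r4 := hm _ _ hq.r4
  have r5 := hm _ _ hq.r5
  simp only [map_mul, map_add, map_sub, map_neg, map_one, map_natCast, map_ofNat] at r1 r2 r3 r4 r5
  have key := lie_quant (d := der 𝕜 (φ x)) der_comm (fun i j => hc _ _)
    (fun i => by rw [← map_mul, hq.ee, map_one]) (hc lam) (hc mu) (hc q.b1) (hc q.b2) (hc q.b3)
    (hc q.b4) (hc q.c) r1 r2 r3 r4 r5 hs (sy2_symm (φ := φ) g (mu - lam) P (φ x))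
    (sy1 g φ (mu - lam) P (φ x)) (sy0 g φ (mu - lam) P (φ x)) (dens g φ lam f.1 (φ x))
  rw [← map_sub] at key
  obtain ⟨h2, h1, h0⟩ := lieSymbol_sy hφ hx hX (mu - lam) P P' hP
  rw [← h2, ← h1, ← h0, ← lieDensity_germ hφ (goodVol g hφ) hx hX lam f f' hf] at key
  have hg : ∀ G, gauge g φ mu (φ x) * (gauge g φ (-mu) (φ x) * G) = G := by
    intro G
    rw [← mul_assoc, mul_comm (gauge g φ mu (φ x)),
      gauge_neg_mul (goodVol g hφ) mu (φ.map_source hx), one_mul]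
  simp only [quantGerm, mul_add, hg]
  rw [quantOpr, ← key, quantOpr, quantOpr]
  ring

end Quantization

/-! ### Quantization as an operator on functions -/

section QuantOperators

variable {n : ℕ} {𝕜 : Type*} [RCLike 𝕜] {M : Type*} [TopologicalSpace M] [ChartedSpace (Model n) M]
  [IsManifold (𝓡 n) ∞ M] [T2Space M] {g : PseudoRiemannianMetric n M}
  {φ ψ : OpenPartialHomeomorph M (Model n)} {X : VField n M} {x : M} {lam mu : 𝕜} {U : Set M}
  {χ : M → ℝ} {q : QuantData n 𝕜}

lemma exists_bilinear (v : symbols2 n 𝕜 M → smoothFun n 𝕜 M → M → 𝕜)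
    (hv : ∀ P f, ContMDiff (𝓡 n) 𝓘(ℝ, 𝕜) ∞ (v P f))
    (h1 : ∀ P P' f x, v (P + P') f x = v P f x + v P' f x)
    (h2 : ∀ (r : 𝕜) P f x, v (r • P) f x = r * v P f x)
    (h3 : ∀ P f f' x, v P (f + f') x = v P f x + v P f' x)
    (h4 : ∀ (r : 𝕜) P f x, v P (r • f) x = r * v P f x) :
    ∃ Q : symbols2 n 𝕜 M →ₗ[𝕜] FunOp n 𝕜 M, ∀ P f x, (Q P f).1 x = v P f x :=
  ⟨LinearMap.mk₂ 𝕜 (fun P f => (⟨v P f, hv P f⟩ : smoothFun n 𝕜 M))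
    (fun P P' f => Subtype.ext (funext (h1 P P' f)))
    (fun r P f => Subtype.ext (funext (h2 r P f)))
    (fun P f f' => Subtype.ext (funext (h3 P f f')))
    (fun r P f => Subtype.ext (funext (h4 r P f))), fun _ _ _ => rfl⟩

section AtPoint

variable (hφ : φ ∈ smoothCharts (n := n) M) (hx : x ∈ φ.source)
include hφ hx

lemma quantLoc_add_symbol (P P' : symbols2 n 𝕜 M) (f : M → 𝕜) :
    quantLoc g lam mu q φ (P + P') f x
      = quantLoc g lam mu q φ P f x + quantLoc g lam mu q φ P' f x := by
  rw [quantLoc, quantGerm_add_symbol hφ hx, map_add]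
  rfl

lemma quantLoc_smul_symbol (r : 𝕜) (P : symbols2 n 𝕜 M) (f : M → 𝕜) :
    quantLoc g lam mu q φ (r • P) f x = r * quantLoc g lam mu q φ P f x := by
  rw [quantLoc, quantGerm_smul_symbol hφ hx, map_mul, ev_algebraMap]
  rfl

lemma quantLoc_add_fun (P : symbols2 n 𝕜 M) (f f' : smoothFun n 𝕜 M) :
    quantLoc g lam mu q φ P (f + f').1 x
      = quantLoc g lam mu q φ P f.1 x + quantLoc g lam mu q φ P f'.1 x := by
  rw [quantLoc, quantGerm_add_fun hφ hx, map_add]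
  rfl

lemma quantLoc_smul_fun (r : 𝕜) (P : symbols2 n 𝕜 M) (f : smoothFun n 𝕜 M) :
    quantLoc g lam mu q φ P (r • f).1 x = r * quantLoc g lam mu q φ P f.1 x := by
  rw [quantLoc, quantGerm_smul_fun hφ hx, map_mul, ev_algebraMap]
  rfl

end AtPoint

lemma exists_cutQuant (g : PseudoRiemannianMetric n M) (lam mu : 𝕜) (q : QuantData n 𝕜)
    (hφ : φ ∈ smoothCharts (n := n) M) (hχ : ContMDiff (𝓡 n) 𝓘(ℝ, ℝ) ∞ χ)
    (hs : tsupport χ ⊆ φ.source) : ∃ Q : symbols2 n 𝕜 M →ₗ[𝕜] FunOp n 𝕜 M,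
      ∀ P f x, (Q P f).1 x = (χ x : 𝕜) * quantLoc g lam mu q φ P f.1 x := by
  have h0 : ∀ x, x ∉ φ.source → (χ x : 𝕜) = 0 := fun x hx => by
    rw [symLie_of_notMem fun h => hx (hs h), RCLike.ofReal_zero]
  refine exists_bilinear _ (fun P f => contMDiff_bump_mul hχ fun x hx =>
    quantLoc_smooth hφ (hs hx) P f) (fun P P' f x => ?_) (fun r P f x => ?_) (fun P f f' x => ?_)
    (fun r P f x => ?_) <;> by_cases hx : x ∈ φ.source
  · rw [quantLoc_add_symbol hφ hx, mul_add]
  · rw [h0 x hx]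
    ring
  · rw [quantLoc_smul_symbol hφ hx]
    ring
  · rw [h0 x hx]
    ring
  · rw [quantLoc_add_fun hφ hx, mul_add]
  · rw [h0 x hx]
    ring
  · rw [quantLoc_smul_fun hφ hx]
    ring
  · rw [h0 x hx]
    ring

/-- Operators given in charts by the quantization, up to the factor `χ`, preserve the principal
symbol up to this factor. -/
lemma hasPrincipalSymbol_of_quantLoc {Q : symbols2 n 𝕜 M →ₗ[𝕜] FunOp n 𝕜 M} {χ : M → 𝕜}
    (h : ∀ x, ∃ φ ∈ smoothCharts (n := n) M, x ∈ φ.source ∧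
      ∀ P f, (Q P f).1 x = χ x * quantLoc g lam mu q φ P f.1 x) : HasPrincipalSymbol Q χ := by
  have key : ∀ P x, ∃ φ ∈ smoothCharts (n := n) M, ∃ hx : x ∈ φ.source,
      ∃ (a1 : Fin n → SmGerm 𝕜 (φ x)) (a0 : SmGerm 𝕜 (φ x)),
      (∀ f : smoothFun n 𝕜 M, (Q P f).1 x = χ x * evGerm 𝕜 (φ x)
        (opr (der 𝕜 (φ x)) (cs2 φ P (φ x)) a1 a0 (gm (φ x) (f.1 ∘ φ.symm)))) ∧
      (cs2 φ P (φ x) = 0 → a1 = cs1 φ P (φ x) ∧ (cs1 φ P (φ x) = 0 → a0 = cs0 φ P (φ x))) := by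
    intro P x
    obtain ⟨φ, hφ, hx, hQ⟩ := h x
    obtain ⟨a1, a0, ha, ha'⟩ := quantGerm_eq_opr (g := g) (lam := lam) (mu := mu) (q := q) hφ hx P
    exact ⟨φ, hφ, hx, a1, a0, fun f => by rw [hQ, quantLoc, ha], ha'⟩
  have hev : ∀ {φ : OpenPartialHomeomorph M (Model n)} {x : M}, φ ∈ smoothCharts (n := n) M →
      x ∈ φ.source → ∀ f : smoothFun n 𝕜 M, f.1 x = evGerm 𝕜 (φ x) (gm (φ x) (f.1 ∘ φ.symm)) := by
    intro φ x hφ hx f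
    rw [ev_gm (smoothFun_contDiffAt f hφ (φ.map_source hx)), Function.comp_apply, φ.left_inv hx]
  have hone : ∀ {φ : OpenPartialHomeomorph M (Model n)} {x : M},
      gm (φ x) ((1 : smoothFun n 𝕜 M).1 ∘ φ.symm) = 1 := gm_one
  have hm : ∀ (a b : smoothFun n 𝕜 M) x, (a * b).1 x = a.1 x * b.1 x := fun _ _ _ => rfl
  have hs : ∀ (a b : smoothFun n 𝕜 M) x, (a - b).1 x = a.1 x - b.1 x := fun _ _ _ => rfl
  have h0 : ∀ {x : M} (f : M → ℝ), ContMDiff (𝓡 n) 𝓘(ℝ, ℝ) ∞ f →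
      ∀ (φ : OpenPartialHomeomorph M (Model n)), φ ∈ smoothCharts (n := n) M → x ∈ φ.source →
      ∀ (hf : ContMDiff (𝓡 n) 𝓘(ℝ, ℝ) ∞ f) i, evGerm 𝕜 (φ x) (der 𝕜 (φ x) i
        (gm (φ x) ((ofRealFun f hf : smoothFun n 𝕜 M).1 ∘ φ.symm)))
      = ((dfun f x (cvec φ x i) : ℝ) : 𝕜) :=
    fun f _ φ hφ hx hf i => (dfun_cvec hφ hx (hf _) i).symm
  -- double commutators
  have two : ∀ P (F G H : smoothFun n 𝕜 M) x, ∃ φ ∈ smoothCharts (n := n) M, ∃ hx : x ∈ φ.source,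
      ∀ H : smoothFun n 𝕜 M, (commOp (commOp (Q P) F) G H).1 x
        = χ x * evGerm 𝕜 (φ x) (∑ i, ∑ j, cs2 φ P (φ x) i j
          * (der 𝕜 (φ x) i (gm (φ x) (F.1 ∘ φ.symm)) * der 𝕜 (φ x) j (gm (φ x) (G.1 ∘ φ.symm))
          + der 𝕜 (φ x) j (gm (φ x) (F.1 ∘ φ.symm)) * der 𝕜 (φ x) i (gm (φ x) (G.1 ∘ φ.symm))))
          * H.1 x := by
    intro P F G _ x
    obtain ⟨φ, hφ, hx, a1, a0, ha, -⟩ := key P x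
    refine ⟨φ, hφ, hx, fun H => ?_⟩
    simp only [commOp_apply, hs, hm, ha, gm_comp_mul hφ hx]
    rw [hev hφ hx F, hev hφ hx G, hev hφ hx H, mul_assoc (χ x), ← map_mul, ← opr_comm_comm _ a1 a0]
    simp only [map_sub, map_mul]
    ring
  -- commutators
  have one : ∀ P, IsHomog 1 P → ∀ (F : smoothFun n 𝕜 M) x, ∃ φ ∈ smoothCharts (n := n) M,
      ∃ hx : x ∈ φ.source, ∀ H : smoothFun n 𝕜 M, (commOp (Q P) F H).1 x
        = χ x * evGerm 𝕜 (φ x) (∑ i, cs1 φ P (φ x) i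
          * der 𝕜 (φ x) i (gm (φ x) (F.1 ∘ φ.symm))) * H.1 x := by
    intro P hP F x
    obtain ⟨φ, hφ, hx, a1, a0, ha, ha'⟩ := key P x
    rw [hP.cs2_one] at ha ha'
    rw [(ha' rfl).1] at ha
    refine ⟨φ, hφ, hx, fun H => ?_⟩
    simp only [commOp_apply, hs, hm, ha, gm_comp_mul hφ hx]
    rw [hev hφ hx F, hev hφ hx H, mul_assoc (χ x), ← map_mul, mul_left_comm _ (χ x), ← mul_sub,
      ← map_mul, ← map_sub, opr_comm]
    simp only [opr, Pi.zero_apply, zero_mul, sum_const_zero, zero_add, add_mul]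
    congr 2
    ring
  have zero : ∀ P, IsHomog 0 P → ∀ (F : smoothFun n 𝕜 M) x,
      (Q P F).1 x = χ x * P.1 x 0 * F.1 x := by
    intro P hP F x
    obtain ⟨φ, hφ, hx, a1, a0, ha, ha'⟩ := key P x
    rw [hP.cs2_zero] at ha ha'
    rw [hP.cs1_zero] at ha'
    rw [(ha' rfl).1, (ha' rfl).2 rfl] at ha
    rw [ha, hev hφ hx F, symbol_eq_polySym hφ P hx, hP.cs2_zero, hP.cs1_zero]
    simp only [opr, polySym, Pi.zero_apply, zero_mul, sum_const_zero, zero_add, map_mul,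
      map_zero]
    ring
  refine ⟨fun P hP => ?_, fun P hP => ?_, fun P hP => ?_, fun P hP f hf x => ?_,
    fun P hP f hf x => ?_, fun P hP x => ?_⟩
  · refine mem_diffOp_succ.2 fun F => mem_diffOp_succ.2 fun G => mem_diffOp_zero.2 fun H => ?_
    refine Subtype.ext (funext fun x => ?_)
    obtain ⟨φ, hφ, hx, h⟩ := two P F G H x
    rw [hm, h, h]
    show _ = _ * 1 * _
    ring
  · refine mem_diffOp_succ.2 fun F => mem_diffOp_zero.2 fun H => ?_
    refine Subtype.ext (funext fun x => ?_)
    obtain ⟨φ, hφ, hx, h⟩ := one P hP F x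
    rw [hm, h, h]
    show _ = _ * 1 * _
    ring
  · refine mem_diffOp_zero.2 fun H => Subtype.ext (funext fun x => ?_)
    rw [hm, zero P hP, zero P hP]
    show _ = _ * 1 * _
    ring
  · obtain ⟨φ, hφ, hx, h⟩ := two P (ofRealFun f hf) (ofRealFun f hf) 1 x
    rw [h, symbol_eq_polySym hφ P hx, hP.cs1_two, hP.cs0_two]
    show _ * _ * 1 = _
    simp only [polySym, map_sum, map_mul, map_add, h0 f hf φ hφ hx hf, Pi.zero_apply, map_zero,
      zero_mul, sum_const_zero, add_zero, mul_sum, mul_one]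
    refine sum_congr rfl fun i _ => sum_congr rfl fun j _ => ?_
    ring
  · obtain ⟨φ, hφ, hx, h⟩ := one P hP (ofRealFun f hf) x
    rw [h, symbol_eq_polySym hφ P hx, hP.cs2_one, hP.cs0_one]
    show _ * _ * 1 = _
    simp only [polySym, map_sum, map_mul, map_add, h0 f hf φ hφ hx hf, Pi.zero_apply, map_zero,
      zero_mul, sum_const_zero, add_zero, zero_add, mul_one]
  · rw [zero P hP]
    exact mul_one _

lemma eq_of_dens_eq (hφ : φ ∈ smoothCharts (n := n) M) (hx : x ∈ φ.source) (w : 𝕜)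
    (f h : smoothFun n 𝕜 M) (e : dens g φ w f.1 (φ x) = dens g φ w h.1 (φ x)) : f.1 x = h.1 x := by
  have h1 := eq_zero_of_dens (g := g) hφ hx w (f + (-1 : 𝕜) • h) (by
    rw [dens_add hφ hx, dens_smul hφ hx, e, map_neg, map_one]
    ring)
  have h2 : f.1 x + (-1 : 𝕜) * h.1 x = 0 := h1
  linear_combination h2

lemma intertwinesOn_of_quantLoc (hq : q.IsEquivariant lam mu) (hU : IsOpen U)
    {Q : symbols2 n 𝕜 M →ₗ[𝕜] FunOp n 𝕜 M}
    (h : ∀ x ∈ U, ∃ φ ∈ smoothCharts (n := n) M, x ∈ φ.source ∧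
      (∀ᶠ z in 𝓝 x, ∀ P f, (Q P f).1 z = quantLoc g lam mu q φ P f.1 z) ∧
      ∃ s, IsConf (der 𝕜 (φ x)) (fun i => algebraMap 𝕜 _ (q.e i)) (vfGerm 𝕜 φ X (φ x)) s)
    (hX : ∀ x ∈ U, ∀ᶠ z in 𝓝 x, SmoothVFAt X z) : IntertwinesOn g lam mu U Q X := by
  intro P P' hP f f' hf x hx
  obtain ⟨φ, hφ, hxφ, hQ, s, hs⟩ := h x hx
  have hUx := hU.mem_nhds hx
  have hg : ∀ P f, gm (φ x) ((Q P f).1 ∘ φ.symm) = quantGerm g lam mu q φ P f.1 (φ x) := by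
    intro P f
    rw [← gm_quantLoc hφ hxφ]
    refine gm_congr (eventually_chart hxφ ?_)
    filter_upwards [hQ] with z hz hz'
    rw [Function.comp_apply, Function.comp_apply, φ.left_inv hz', hz]
  have h1 := quantGerm_lie hq hφ hxφ (hX x hx) hs P P' f f' (Filter.mem_of_superset hUx hP)
    (Filter.mem_of_superset hUx hf)
  obtain ⟨χ, hχ, hχ1, hχt⟩ := exists_bump (n := n) (hX x hx).eventually_nhds
  obtain ⟨h', hh'⟩ := exists_funLie (g := g) hχ (fun z hz => hχt hz) mu (Q P f)
  have h2 := lieDensity_germ hφ (goodVol g hφ) hxφ (hX x hx) mu (Q P f) h' (by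
    filter_upwards [hχ1] with z hz
    rw [hh', hz]
    simp)
  have h3 := eq_of_dens_eq (g := g) hφ hxφ mu (Q P' f + Q P f') h' (by
    rw [h2, dens, gm_comp_add hφ hxφ, hg, hg, h1, dens, hg])
  have h4 : (Q P' f).1 x + (Q P f').1 x = lieDensity g mu X (Q P f).1 x := by
    rw [hh', hχ1.self_of_nhds] at h3
    simpa using h3
  rw [← h4]
  ring

lemma lieDensity_sub_fun (w : 𝕜) (f h : smoothFun n 𝕜 M) :
    lieDensity g w X (f + (-1 : 𝕜) • h).1 x = lieDensity g w X f.1 x - lieDensity g w X h.1 x := by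
  have e : (f + (-1 : 𝕜) • h).1 = f.1 - h.1 := by
    funext z
    show f.1 z + (-1 : 𝕜) * h.1 z = f.1 z - h.1 z
    ring
  have hf : MDifferentiableAt (𝓡 n) 𝓘(ℝ, 𝕜) f.1 x := (f.2 x).mdifferentiableAt (by simp)
  have hh : MDifferentiableAt (𝓡 n) 𝓘(ℝ, 𝕜) h.1 x := (h.2 x).mdifferentiableAt (by simp)
  have hd : derivAlong X (f.1 - h.1) x = derivAlong X f.1 x - derivAlong X h.1 x := by
    rw [derivAlong, mfderiv_sub hf hh]
    rfl
  rw [e, lieDensity, hd, lieDensity, lieDensity, Pi.sub_apply]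
  ring

lemma IntertwinesOn.sub {T T' : symbols2 n 𝕜 M →ₗ[𝕜] FunOp n 𝕜 M}
    (h : IntertwinesOn g lam mu U T X) (h' : IntertwinesOn g lam mu U T' X) :
    IntertwinesOn g lam mu U (T + (-1 : 𝕜) • T') X := by
  intro P P' hP f f' hf x hx
  have e1 := h P P' hP f f' hf x hx
  have e2 := h' P P' hP f f' hf x hx
  have e3 : ∀ P f, (T + (-1 : 𝕜) • T') P f = T P f + (-1 : 𝕜) • T' P f := fun P f => rfl
  have e4 : ∀ P f, ((T + (-1 : 𝕜) • T') P f).1 x = (T P f).1 x + (-1 : 𝕜) * (T' P f).1 x :=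
    fun P f => rfl
  rw [e4, e4, e3, lieDensity_sub_fun, e1, e2]
  ring

lemma smoothVFAt_zero : SmoothVFAt (fun _ => 0 : VField n M) x := by
  intro φ hφ hx
  have h : vfCoord φ (fun _ => 0 : VField n M) = fun _ => 0 := funext fun y => map_zero _
  rw [h]
  exact contDiffAt_const

lemma vfGerm_zero (y : Model n) : vfGerm 𝕜 φ (fun _ => 0 : VField n M) y = 0 := by
  funext i
  have h : ∀ y, vfCoord φ (fun _ => 0 : VField n M) y i = 0 := fun y => by
    rw [vfCoord, map_zero]
    rfl
  rw [vfGerm, Pi.zero_apply, ← gm_zero]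
  congr 1
  funext y
  rw [h, RCLike.ofReal_zero]

lemma isConf_zero {y : Model n} (e : Fin n → SmGerm 𝕜 y) : IsConf (der 𝕜 y) e 0 0 :=
  ⟨fun i j => by simp, fun i j => by simp⟩

/-- The quantization does not depend on the chart. -/
lemma quantLoc_eq_quantLoc {ι : Type*} [Fintype ι] {Y Z : ι → VField n M}
    (hq : q.IsEquivariant lam mu) (hφ : φ ∈ smoothCharts (n := n) M)
    (hψ : ψ ∈ smoothCharts (n := n) M) (hx : x ∈ φ.source) (hx' : x ∈ ψ.source) {O : Set M}
    (hO : O ∈ 𝓝 x) (hY : ∀ r, ∀ x ∈ O, ∀ᶠ z in 𝓝 x, SmoothVFAt (Y r) z)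
    (hZ : ∀ r, ∀ x ∈ O, ∀ᶠ z in 𝓝 x, SmoothVFAt (Z r) z)
    (hYc : ∀ θ, θ = φ ∨ θ = ψ → ∀ r, ∀ x ∈ O, x ∈ θ.source →
      ∃ s, IsConf (der 𝕜 (θ x)) (fun i => algebraMap 𝕜 _ (q.e i)) (vfGerm 𝕜 θ (Y r) (θ x)) s)
    (hZc : ∀ θ, θ = φ ∨ θ = ψ → ∀ r, ∀ x ∈ O, x ∈ θ.source →
      ∃ s, IsConf (der 𝕜 (θ x)) (fun i => algebraMap 𝕜 _ (q.e i)) (vfGerm 𝕜 θ (Z r) (θ x)) s)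
    (hC : ∀ x ∈ O, x ∈ φ.source → IsCasimir (der 𝕜 (φ x)) (fun i => algebraMap 𝕜 _ (q.e i))
        (fun r => vfGerm 𝕜 φ (Y r) (φ x)) (fun r => vfGerm 𝕜 φ (Z r) (φ x)))
    (h0 : (n : 𝕜) ≠ 0) (h1 : mu - lam ≠ 1) (h2 : n * (mu - lam) ≠ 2)
    (h3 : 2 * n * (mu - lam) ≠ n + 2) (h4 : n * (mu - lam) ≠ n + 1)
    (h5 : n * (mu - lam) ≠ n + 2) (P : symbols2 n 𝕜 M) (f : smoothFun n 𝕜 M) :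
    quantLoc g lam mu q φ P f.1 x = quantLoc g lam mu q ψ P f.1 x := by
  have hO' : O ∩ (φ.source ∩ ψ.source) ∈ 𝓝 x :=
    Filter.inter_mem hO ((φ.open_source.inter ψ.open_source).mem_nhds ⟨hx, hx'⟩)
  obtain ⟨χ, hχ, hχ1, hχt⟩ := exists_bump (n := n) hO'
  obtain ⟨U, hU1, hU, hxU⟩ := mem_nhds_iff.1 hχ1
  have hUO : ∀ z ∈ U, z ∈ O ∩ (φ.source ∩ ψ.source) := fun z hz =>
    hχt (subset_tsupport _ (by
      have : χ z = 1 := hU1 hz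
      simp [this]))
  have hloc : ∀ θ, θ = φ ∨ θ = ψ → θ ∈ smoothCharts (n := n) M ∧ tsupport χ ⊆ θ.source ∧
      ∀ z ∈ U, z ∈ θ.source := by
    rintro θ (rfl | rfl)
    · exact ⟨hφ, fun z hz => (hχt hz).2.1, fun z hz => (hUO z hz).2.1⟩
    · exact ⟨hψ, fun z hz => (hχt hz).2.2, fun z hz => (hUO z hz).2.2⟩
  have key : ∀ θ, θ = φ ∨ θ = ψ → ∃ T : symbols2 n 𝕜 M →ₗ[𝕜] FunOp n 𝕜 M,
      (∀ P f x, (T P f).1 x = (χ x : 𝕜) * quantLoc g lam mu q θ P f.1 x) ∧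
      HasPrincipalSymbol T (fun x => (χ x : 𝕜)) ∧
      ∀ X : VField n M, (∀ x ∈ U, ∀ᶠ z in 𝓝 x, SmoothVFAt X z) →
        (∀ x ∈ U, ∃ s, IsConf (der 𝕜 (θ x)) (fun i => algebraMap 𝕜 _ (q.e i))
          (vfGerm 𝕜 θ X (θ x)) s) → IntertwinesOn g lam mu U T X := by
    intro θ hθ
    obtain ⟨hθs, hθt, hθU⟩ := hloc θ hθ
    obtain ⟨T, hT⟩ := exists_cutQuant g lam mu q hθs hχ hθt
    refine ⟨T, hT, hasPrincipalSymbol_of_quantLoc (g := g) (lam := lam) (mu := mu) (q := q)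
      fun x => ?_, fun X hX hXc => ?_⟩
    · by_cases hx : x ∈ θ.source
      · exact ⟨θ, hθs, hx, fun P f => hT P f x⟩
      · refine ⟨_, IsManifold.chart_mem_maximalAtlas x, mem_chart_source (Model n) x,
          fun P f => ?_⟩
        rw [hT, symLie_of_notMem fun h => hx (hθt h)]
        simp
    · refine intertwinesOn_of_quantLoc hq hU (fun x hx => ⟨θ, hθs, hθU x hx, ?_, hXc x hx⟩) hX
      filter_upwards [hU.mem_nhds hx] with z hz P f
      have : χ z = 1 := hU1 hz
      rw [hT, this]
      simp
  obtain ⟨T, hT, hTs, hTi⟩ := key φ (Or.inl rfl)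
  obtain ⟨T', hT', hTs', hTi'⟩ := key ψ (Or.inr rfl)
  have hTT : ∀ P, (T + (-1 : 𝕜) • T') P = T P - T' P := by
    intro P
    ext1 f
    show T P f + (-1 : 𝕜) • T' P f = T P f - T' P f
    rw [neg_one_smul, sub_eq_add_neg]
  have hlow := hTs.lowersOrder_sub hTs' hTT
  have hint : ∀ X : VField n M, (∀ x ∈ O, ∀ᶠ z in 𝓝 x, SmoothVFAt X z) →
      (∀ θ, θ = φ ∨ θ = ψ → ∀ x ∈ O, x ∈ θ.source → ∃ s, IsConf (der 𝕜 (θ x))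
        (fun i => algebraMap 𝕜 _ (q.e i)) (vfGerm 𝕜 θ X (θ x)) s) →
      IntertwinesOn g lam mu U (T + (-1 : 𝕜) • T') X := by
    intro X hX hXc
    exact (hTi X (fun x hx => hX x (hUO x hx).1)
      fun x hx => hXc φ (Or.inl rfl) x (hUO x hx).1 (hUO x hx).2.1).sub
      (hTi' X (fun x hx => hX x (hUO x hx).1)
      fun x hx => hXc ψ (Or.inr rfl) x (hUO x hx).1 (hUO x hx).2.2)
  have := hlow.eq_zero_on (g := g) (lam := lam) (mu := mu) (Y := Y) (Z := Z) hq.ee hU hχ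
    (fun z hz => hU1 hz) (fun r z hz => hY r z (hχt hz).1) (fun r z hz => hZ r z (hχt hz).1)
    (fun z hz => ⟨φ, hφ, (hUO z hz).2.1, hC z (hUO z hz).1 (hUO z hz).2.1⟩)
    (hint _ (fun x _ => Filter.Eventually.of_forall fun z => smoothVFAt_zero)
      fun θ _ x _ _ => ⟨0, by rw [vfGerm_zero]; exact isConf_zero _⟩)
    (fun r => hint _ (hY r) fun θ hθ => hYc θ hθ r) (fun r => hint _ (hZ r) fun θ hθ => hZc θ hθ r)
    h0 h1 h2 h3 h4 h5 P f hxU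
  have h6 : (T P f).1 x + (-1 : 𝕜) * (T' P f).1 x = 0 := this
  have h7 : χ x = 1 := hU1 hxU
  rw [hT, hT', h7, RCLike.ofReal_one] at h6
  linear_combination h6

end QuantOperators

/-! ### The flat conformal vector fields over a ring with coordinates -/

section FlatAlgebra

variable {K R : Type*} [Field K] [CommRing R] [Algebra K R] {n : ℕ}
  {d : Fin n → Derivation K R R} {e x X Y : Fin n → R} {s t : R}

variable (e x) in
/-- The rotation `xₗ ∂ₘ - xₘ ∂ₗ`. -/
def rotGen (l m i : Fin n) : R :=
  (if i = m then e l * x l else 0) - if i = l then e m * x m else 0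

variable (e x) in
/-- The inversion `xⱼ xʲ ∂ₗ - 2 xₗ xʲ ∂ⱼ`. -/
def invGen (l i : Fin n) : R :=
  (if i = l then ∑ k, e k * x k * x k else 0) - 2 * (e l * x l) * x i

lemma IsConf.add (h : IsConf d e X s) (h' : IsConf d e Y t) : IsConf d e (X + Y) (s + t) := by
  refine ⟨fun i j => ?_, fun i j => by simp [h.aff, h'.aff]⟩
  have h1 := h.sym i j
  have h2 := h'.sym i j
  simp only [Pi.add_apply, map_add]
  split_ifs at * <;> linear_combination h1 + h2

lemma IsConf.smul (c : K) (h : IsConf d e X s) : IsConf d e (c • X) (c • s) := by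
  refine ⟨fun i j => ?_, fun i j => by simp [h.aff]⟩
  have h1 := congrArg (c • ·) (h.sym i j)
  simp only [Pi.smul_apply, Derivation.map_smul, mul_smul_comm, smul_mul_assoc, smul_add] at h1 ⊢
  rw [h1]
  split_ifs <;> simp

lemma IsConf.sum {ι : Type*} (r : Finset ι) {X : ι → Fin n → R} {s : ι → R}
    (h : ∀ i, IsConf d e (X i) (s i)) : IsConf d e (∑ i ∈ r, X i) (∑ i ∈ r, s i) := by
  classical
  induction r using Finset.induction_on with
  | empty => exact ⟨fun i j => by simp, fun i j => by simp⟩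
  | insert a r ha ih =>
    rw [Finset.sum_insert ha, Finset.sum_insert ha]
    exact (h a).add ih

variable (he : ∀ i j, d i (e j) = 0) (hee : ∀ i, e i * e i = 1)
  (hx : ∀ i j, d i (x j) = if i = j then 1 else 0)

lemma isConf_const {a : Fin n → R} (ha : ∀ i j, d i (a j) = 0) : IsConf d e a 0 :=
  ⟨fun i j => by simp [ha], fun i j => by simp⟩

include hx

lemma isConf_coord : IsConf d e x 1 := by
  refine ⟨fun i j => ?_, fun i j => by simp⟩
  rcases eq_or_ne i j with rfl | h
  · simp [hx]; ring
  · simp [hx, h, h.symm]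

include he

lemma der_rotGen (k l m i : Fin n) : d k (rotGen e x l m i)
    = (if i = m then if k = l then e l else 0 else 0) - if i = l then if k = m then e m else 0 else 0 := by
  rw [rotGen, map_sub, apply_ite (d k), apply_ite (d k)]
  simp [hx, he]

lemma der_sq (k : Fin n) : d k (∑ m, e m * x m * x m) = 2 * (e k * x k) := by
  simp only [map_sum, Derivation.leibniz, hx, he, smul_eq_mul, sum_add_distrib, mul_ite,
    mul_one, mul_zero, sum_ite_eq, Finset.mem_univ, if_true, zero_add, add_zero]
  ring

lemma der_invGen (k l i : Fin n) : d k (invGen e x l i)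
    = (if i = l then 2 * (e k * x k) else 0) - 2 * ((if k = l then e l * x i else 0)
      + if k = i then e l * x l else 0) := by
  have h2 : d k (2 : R) = 0 := by simpa using Derivation.map_natCast (d k) 2
  rw [invGen, map_sub, apply_ite (d k), der_sq he hx]
  simp only [Derivation.leibniz, hx, he, h2, smul_eq_mul, map_zero, mul_ite, mul_one, mul_zero,
    zero_add, add_zero]
  split_ifs <;> ring

lemma isConf_rotGen (l m : Fin n) : IsConf d e (rotGen e x l m) 0 := by
  refine ⟨fun i j => ?_, fun i j => by simp⟩
  simp only [der_rotGen he hx]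
  by_cases h1 : j = m <;> by_cases h2 : i = l <;> by_cases h3 : j = l <;> by_cases h4 : i = m <;>
    simp [h1, h2, h3, h4] <;> first | done | (subst_vars; simp_all; try ring)

lemma isConf_invGen (l : Fin n) : IsConf d e (invGen e x l) (-2 * (e l * x l)) := by
  have h2 : ∀ k, d k (2 : R) = 0 := fun k => by simpa using Derivation.map_natCast (d k) 2
  refine ⟨fun i j => ?_, fun i j => ?_⟩
  · simp only [der_invGen he hx]
    rcases eq_or_ne i j with rfl | h
    · by_cases h1 : i = l
      · subst h1; simp; ring
      · simp [h1]; ring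
    · by_cases h1 : i = l <;> by_cases h2 : j = l
      · exact absurd (h1.trans h2.symm) h
      · subst h1; simp [h, h.symm]; ring
      · subst h2; simp [h, h.symm]; ring
      · simp [h, h.symm, h1, h2]
  · simp only [Derivation.leibniz, hx, he, h2, smul_eq_mul, map_neg, map_zero, mul_ite, mul_one,
      mul_zero, zero_add, add_zero, neg_zero, neg_mul]
    split_ifs <;> simp [he, h2, Derivation.leibniz]

include hee

lemma sum_inv_mul (i j : Fin n) : ∑ l, e l * invGen e x l i * (if j = l then 1 else 0)
    = (if i = j then e i * ∑ k, e k * x k * x k else 0) - 2 * x i * x j := by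
  simp only [invGen, mul_ite, mul_one, mul_zero, sum_ite_eq, Finset.mem_univ, if_true]
  rw [mul_sub, show e j * (2 * (e j * x j) * x i) = (e j * e j) * (2 * x i * x j) by ring, hee]
  split_ifs with h
  · subst h; ring
  · ring

omit he hx in
lemma sum_rot_mul (a b : Fin n → Fin n → R) (i j : Fin n) (u v : Fin n → R)
    (ha : ∀ l m, a l m = (if i = m then e l * u l else 0) - if i = l then e m * u m else 0)
    (hb : ∀ l m, b l m = (if j = m then e l * v l else 0) - if j = l then e m * v m else 0) :
    ∑ l, ∑ m, e l * e m * a l m * b l m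
      = 2 * ((if i = j then e i * ∑ k, e k * u k * v k else 0) - u j * v i) := by
  have key : ∀ l m, e l * e m * a l m * b l m
      = (if i = m then if j = m then e m * (e l * u l * v l) else 0 else 0)
      - (if i = m then if j = l then u l * v m else 0 else 0)
      - (if i = l then if j = m then u m * v l else 0 else 0)
      + (if i = l then if j = l then e l * (e m * u m * v m) else 0 else 0) := by
    intro l m
    rw [ha, hb]
    have h1 : e l * e m * (e l * u l) * (e l * v l) = e m * (e l * u l * v l) := by
      linear_combination e m * e l * u l * v l * hee l
    have h2 : e l * e m * (e l * u l) * (e m * v m) = u l * v m := by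
      linear_combination (u l * v m * e m * e m) * hee l + u l * v m * hee m
    have h3 : e l * e m * (e m * u m) * (e l * v l) = u m * v l := by
      linear_combination (u m * v l * e m * e m) * hee l + u m * v l * hee m
    have h4 : e l * e m * (e m * u m) * (e m * v m) = e l * (e m * u m * v m) := by
      linear_combination e l * e m * u m * v m * hee m
    have t1 : e l * e m * (if i = m then e l * u l else 0) * (if j = m then e l * v l else 0)
        = if i = m then if j = m then e m * (e l * u l * v l) else 0 else 0 := by
      rw [← h1]; split_ifs <;> ring
    have t2 : e l * e m * (if i = m then e l * u l else 0) * (if j = l then e m * v m else 0)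
        = if i = m then if j = l then u l * v m else 0 else 0 := by
      rw [← h2]; split_ifs <;> ring
    have t3 : e l * e m * (if i = l then e m * u m else 0) * (if j = m then e l * v l else 0)
        = if i = l then if j = m then u m * v l else 0 else 0 := by
      rw [← h3]; split_ifs <;> ring
    have t4 : e l * e m * (if i = l then e m * u m else 0) * (if j = l then e m * v m else 0)
        = if i = l then if j = l then e l * (e m * u m * v m) else 0 else 0 := by
      rw [← h4]; split_ifs <;> ring
    rw [← t1, ← t2, ← t3, ← t4]
    ring
  simp only [key, sum_add_distrib, sum_sub_distrib, sum_ite_const, sum_ite_eq,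
    Finset.mem_univ, if_true, ← mul_sum]
  rcases eq_or_ne i j with rfl | h
  · simp only [if_true]; ring
  · simp only [h, h.symm, if_false]; ring

variable (e x) in
/-- One factor of the Casimir element of the conformal Lie algebra. -/
def casY : Fin n ⊕ Fin n ⊕ Unit ⊕ Fin n × Fin n → Fin n → R
  | .inl l => e l • invGen e x l
  | .inr (.inl l) => e l • Pi.single l 1
  | .inr (.inr (.inl _)) => (2 : R) • x
  | .inr (.inr (.inr r)) => (-(e r.1 * e r.2)) • rotGen e x r.1 r.2

variable (e x) in
/-- The other factor of the Casimir element of the conformal Lie algebra. -/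
def casZ : Fin n ⊕ Fin n ⊕ Unit ⊕ Fin n × Fin n → Fin n → R
  | .inl l => Pi.single l 1
  | .inr (.inl l) => invGen e x l
  | .inr (.inr (.inl _)) => x
  | .inr (.inr (.inr r)) => rotGen e x r.1 r.2

lemma isCasimir_cas : IsCasimir d e (casY e x) (casZ e x) := by
  have h2 : ∀ k, d k (2 : R) = 0 := fun k => by simpa using Derivation.map_natCast (d k) 2
  have single : ∀ (l i : Fin n), (Pi.single l 1 : Fin n → R) i = if i = l then 1 else 0 :=
    fun l i => Pi.single_apply l 1 i
  refine ⟨fun i j => ?_, fun k i j => ?_, fun k m i j => ?_⟩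
  · simp only [Fintype.sum_sum_type, Fintype.sum_prod_type, casY, casZ, Pi.smul_apply, smul_eq_mul,
      Finset.univ_unique, Finset.sum_singleton, single, sum_inv_mul he hee hx]
    have h1 : ∑ l, e l * (if i = l then 1 else 0) * invGen e x l j
        = (if j = i then e j * ∑ k, e k * x k * x k else 0) - 2 * x j * x i := by
      rw [← sum_inv_mul he hee hx]
      exact sum_congr rfl fun _ _ => by ring
    have h3 := sum_rot_mul hee (fun l m => rotGen e x l m i) (fun l m => rotGen e x l m j) i j x x
      (fun _ _ => rfl) (fun _ _ => rfl)
    simp only [neg_mul, sum_neg_distrib, h1, h3]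
    rcases eq_or_ne i j with rfl | h
    · simp only [if_true]; ring
    · simp only [h, h.symm, if_false]; ring
  · simp only [Fintype.sum_sum_type, Fintype.sum_prod_type, casY, casZ, Pi.smul_apply, smul_eq_mul,
      Finset.univ_unique, Finset.sum_singleton, single, Derivation.leibniz, he, h2, map_neg,
      mul_zero, add_zero, neg_zero, apply_ite (d k), Derivation.map_one_eq_zero, map_zero, ite_self,
      zero_mul, sum_const_zero, zero_add, hx]
    have h3 := sum_rot_mul hee (fun l m => d k (rotGen e x l m i)) (fun l m => rotGen e x l m j) i j
      (fun l => if k = l then 1 else 0) x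
      (fun l m => by rw [der_rotGen he hx]; simp only [mul_ite, mul_one, mul_zero]) (fun _ _ => rfl)
    simp only [neg_mul, sum_neg_distrib, h3, der_invGen he hx]
    simp only [mul_ite, mul_one, mul_zero, sum_ite_eq, Finset.mem_univ, if_true, ite_mul,
      zero_mul, one_mul]
    rcases eq_or_ne i j with rfl | h
    · by_cases a : k = i
      · subst a; simp only [if_true]; linear_combination (-4 * x k) * hee k
      · simp only [a, if_true, if_false]; ring
    · simp only [h, h.symm, if_false]
      by_cases a : k = j
      · subst a; simp only [h.symm, if_true, if_false]; linear_combination (-2 * x i) * hee k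
      · by_cases b : k = i
        · subst b; simp only [a, if_true, if_false]; linear_combination (-2 * x j) * hee j
        · simp only [a, b, if_false]; ring
  · simp only [Fintype.sum_sum_type, Fintype.sum_prod_type, casY, casZ, Pi.smul_apply, smul_eq_mul,
      Finset.univ_unique, Finset.sum_singleton, single, Derivation.leibniz, he, h2, map_neg,
      mul_zero, add_zero, neg_zero, apply_ite (d k), apply_ite (d m), Derivation.map_one_eq_zero,
      map_zero, ite_self, zero_mul, sum_const_zero, zero_add, hx, der_invGen he hx,
      der_rotGen he hx, map_sub, map_add, sub_self, sum_ite_eq, Finset.mem_univ, if_true,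
      casCoeff, mul_ite, mul_one]
    rcases eq_or_ne i j with rfl | h
    · rcases eq_or_ne k m with rfl | a
      · by_cases b : k = i
        · subst b; simp only [if_true]; linear_combination (-4 : R) * hee k
        · simp only [b, Ne.symm b, if_true, if_false]; ring
      · by_cases b : m = i
        · subst b; simp only [a, a.symm, if_true, if_false]; ring
        · simp only [a, b, Ne.symm b, if_true, if_false, ite_self]; ring
    · simp only [h, h.symm, if_false, ite_self, zero_sub]
      have h1 := hee j
      simp only [eq_comm (a := i), eq_comm (a := j)]
      by_cases a : m = j
      · have b : m ≠ i := fun b => h (b.symm.trans a)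
        simp only [a, b, h, h.symm, if_true, if_false]
        split_ifs <;> first | ring1 | linear_combination (-2 : R) * h1
      · simp only [a, if_false, ite_self]
        split_ifs <;> first | ring1 | linear_combination (-2 : R) * h1

omit hx in
/-- The conformal vector fields with an affine conformal factor are the combinations of the
translations, the rotations, the homothety and the inversions. -/
lemma IsConf.eq_flat [CharZero K] (hd : ∀ i j F, d i (d j F) = d j (d i F))
    (hx : ∀ i j, d i (x j) = if i = j then 1 else 0)
    (hc : ∀ u : R, (∀ i, d i u = 0) → ∃ c : K, u = algebraMap K R c) (h : IsConf d e X s) :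
    ∃ (b a : Fin n → K) (c : K) (S : Fin n → Fin n → K), X = ∑ l, b l • invGen e x l + c • x
      + ∑ l, ∑ m, S l m • rotGen e x l m + ∑ l, a l • (Pi.single l 1 : Fin n → R) := by
  choose b hb using fun l => hc (d l s) fun i => h.aff i l
  choose ε hε using fun l => hc (e l) fun i => he i l
  obtain ⟨c, hc'⟩ := hc (s - ∑ l, algebraMap K R (b l) * x l) fun i => by
    simp [Derivation.leibniz, hx, hb]
  have half : algebraMap K R (1 / 2) * 2 = 1 := by
    rw [← map_ofNat (algebraMap K R) 2, ← map_mul]; norm_num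
  set b' : Fin n → K := fun l => -(1 / 2) * (ε l * b l) with hb'
  have hW : IsConf d e (X + (-1 : K) • (∑ l, b' l • invGen e x l + c • x)) 0 := by
    have := h.add (((IsConf.sum Finset.univ fun l => (isConf_invGen he hx l).smul (b' l)).add
      ((isConf_coord hx (e := e)).smul c)).smul (-1 : K))
    convert this using 1
    have h3 : ∀ l, b' l • (-2 * (e l * x l)) = algebraMap K R (b l) * x l := by
      intro l
      simp only [Algebra.smul_def, hb', map_mul, map_neg, ← hε]
      linear_combination (algebraMap K R (b l) * x l) * half
        + 2 * algebraMap K R (1 / 2) * algebraMap K R (b l) * x l * hee l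
    rw [sum_congr rfl fun l _ => h3 l, Algebra.smul_def c, ← hc', neg_one_smul]
    ring
  set W := X + (-1 : K) • (∑ l, b' l • invGen e x l + c • x) with hWd
  choose S hS using fun i j => hc (d i (W j)) fun k => by
    rw [second_der_of_sym hd he hee hW.sym]; simp
  choose a ha using fun j => hc (W j - ∑ i, algebraMap K R (S i j) * x i) fun k => by
    simp [Derivation.leibniz, hx, hS]
  refine ⟨b', a, c, fun l m => 1 / 2 * (ε l * S l m), ?_⟩
  have hr : ∀ j, (∑ l, ∑ m, (1 / 2 * (ε l * S l m)) • rotGen e x l m : Fin n → R) j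
      = ∑ i, algebraMap K R (S i j) * x i := by
    intro j
    simp only [Finset.sum_apply, Pi.smul_apply]
    simp only [rotGen, Algebra.smul_def, mul_sub, mul_ite, mul_zero,
      sum_sub_distrib, sum_ite_eq, Finset.mem_univ, if_true, sum_ite_const]
    rw [← sum_sub_distrib]
    refine sum_congr rfl fun i _ => ?_
    have h1 := hW.sym i j
    rw [mul_zero, zero_mul, ite_self, hS, hS] at h1
    simp only [map_mul, ← hε]
    linear_combination (algebraMap K R (S i j) * x i) * half
      + algebraMap K R (1 / 2) * algebraMap K R (S i j) * x i * (hee i + hee j)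
      - algebraMap K R (1 / 2) * x i * e j * h1
  funext j
  have h1 := congrFun hWd j
  have h2 := ha j
  simp only [Pi.add_apply, Pi.smul_apply, neg_one_smul, Pi.neg_apply, hr] at h1 ⊢
  have h4 : (∑ l, a l • (Pi.single l 1 : Fin n → R)) j = algebraMap K R (a j) := by
    simp [Finset.sum_apply, Pi.single_apply, Algebra.smul_def]
  rw [h4, ← h2]
  linear_combination -h1

end FlatAlgebra

/-! ### Germs of the conformal vector fields of the flat space -/

section FlatGerms

variable {𝕜 : Type*} [RCLike 𝕜] {n : ℕ} {Y Z : Model n → Model n} {y : Model n}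

variable (𝕜) in
/-- The germs of the components of a vector field on `ℝⁿ`. -/
def vgm (Y : Model n → Model n) (y : Model n) (i : Fin n) : SmGerm 𝕜 y :=
  gm y fun z => ((Y z i : ℝ) : 𝕜)

variable (𝕜) in
/-- The germs of the coordinates. -/
def cgm (y : Model n) (i : Fin n) : SmGerm 𝕜 y := gm y fun z => ((z i : ℝ) : 𝕜)

lemma contDiff_coord {m : WithTop ℕ∞} (i : Fin n) : ContDiff ℝ m fun z : Model n => z i :=
  (EuclideanSpace.proj i : Model n →L[ℝ] ℝ).contDiff

lemma comp_ofReal_smooth (hY : ContDiffAt ℝ ∞ Y y) (i : Fin n) :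
    ContDiffAt ℝ ∞ (fun z => ((Y z i : ℝ) : 𝕜)) y :=
  ofReal_smooth (coord_smooth hY i)

lemma vgm_congr (h : Y =ᶠ[𝓝 y] Z) : vgm 𝕜 Y y = vgm 𝕜 Z y :=
  funext fun i => gm_congr (by filter_upwards [h] with z hz; rw [hz])

lemma eventuallyEq_of_vgm (hY : ContDiffAt ℝ ∞ Y y) (hZ : ContDiffAt ℝ ∞ Z y)
    (h : vgm ℝ Y y = vgm ℝ Z y) : Y =ᶠ[𝓝 y] Z := by
  have h1 := fun i => (gm_eq_iff (comp_ofReal_smooth (𝕜 := ℝ) hY i) (comp_ofReal_smooth hZ i)).1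
    (congrFun h i)
  filter_upwards [Filter.eventually_all.2 h1] with z hz
  ext i
  exact hz i

lemma vgm_add (hY : ContDiffAt ℝ ∞ Y y) (hZ : ContDiffAt ℝ ∞ Z y) :
    vgm 𝕜 (Y + Z) y = vgm 𝕜 Y y + vgm 𝕜 Z y :=
  funext fun i => by
    simp only [vgm, Pi.add_apply, PiLp.add_apply, RCLike.ofReal_add]
    exact gm_add (comp_ofReal_smooth hY i) (comp_ofReal_smooth hZ i)

lemma vgm_smul (hY : ContDiffAt ℝ ∞ Y y) (c : ℝ) : vgm 𝕜 (c • Y) y = (c : 𝕜) • vgm 𝕜 Y y :=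
  funext fun i => by
    simp only [vgm, Pi.smul_apply, PiLp.smul_apply, smul_eq_mul, RCLike.ofReal_mul]
    exact (smul_gm _ (comp_ofReal_smooth hY i)).symm

lemma vgm_sum {ι : Type*} (s : Finset ι) {Y : ι → Model n → Model n}
    (hY : ∀ r, ContDiffAt ℝ ∞ (Y r) y) : vgm 𝕜 (∑ r ∈ s, Y r) y = ∑ r ∈ s, vgm 𝕜 (Y r) y :=
  funext fun i => by
    simp only [vgm, Finset.sum_apply, WithLp.ofLp_sum, RCLike.ofReal_sum]
    exact gm_sum _ fun r _ => comp_ofReal_smooth (hY r) i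

lemma der_cgm (i j : Fin n) : der 𝕜 y i (cgm 𝕜 y j) = if i = j then 1 else 0 := by
  rw [cgm, der_gm (ofReal_smooth (contDiff_coord j).contDiffAt)]
  have h : pd i (fun z : Model n => ((z j : ℝ) : 𝕜)) = fun _ => if i = j then (1 : 𝕜) else 0 := by
    funext z
    have := pd_coord (𝕜 := 𝕜) (τ := id) (z := z) differentiableAt_id i j
    simp only [id, fderiv_id, ContinuousLinearMap.coe_id', basisVec] at this
    rw [this]
    rcases eq_or_ne i j with rfl | h
    · simp
    · simp [h, h.symm]
  rw [h]
  split_ifs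
  · exact gm_one
  · exact gm_zero

lemma exists_const_germ (γ : SmGerm 𝕜 y) (h : ∀ i, der 𝕜 y i γ = 0) :
    ∃ c : 𝕜, γ = algebraMap 𝕜 _ c := by
  obtain ⟨F, hF, rfl⟩ := gm_surj γ
  refine ⟨F y, ?_⟩
  have h1 : ∀ i, pd i F =ᶠ[𝓝 y] fun _ => 0 := fun i => by
    rw [← gm_eq_iff (contDiffAt_pd hF i) contDiffAt_const, ← der_gm hF, h, gm_zero]
  have h2 : ∀ᶠ z in 𝓝 y, fderiv ℝ F z = 0 := by
    filter_upwards [Filter.eventually_all.2 h1] with z hz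
    ext u
    rw [fderiv_eq_sum_pd]
    simp [hz]
  obtain ⟨r, hr, hb⟩ := Metric.eventually_nhds_iff_ball.1 (h2.and (eventually_differentiableAt hF))
  rw [algebraMap_germ, gm_eq_iff hF contDiffAt_const]
  filter_upwards [Metric.ball_mem_nhds y hr] with z hz
  exact (convex_ball y r).is_const_of_fderivWithin_eq_zero (𝕜 := ℝ)
    (fun w hw => (hb w hw).2.differentiableWithinAt)
    (fun w hw => by rw [fderivWithin_of_isOpen Metric.isOpen_ball hw]; exact (hb w hw).1) hz
    (Metric.mem_ball_self hr)

/-- Two analytic functions with the same germ at one point have the same germ everywhere. -/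
lemma gm_eq_of_analytic {F G : Model n → 𝕜} (hF : ContDiff ℝ ω F) (hG : ContDiff ℝ ω G)
    (h : gm y F = gm y G) (y' : Model n) : gm y' F = gm y' G := by
  have h1 := (gm_eq_iff (hF.of_le le_top).contDiffAt (hG.of_le le_top).contDiffAt).1 h
  rw [(hF.analyticOnNhd (s := Set.univ)).eq_of_eventuallyEq (hG.analyticOnNhd (s := Set.univ)) h1]

lemma contDiff_pd {F : Model n → 𝕜} (hF : ContDiff ℝ ω F) (i : Fin n) : ContDiff ℝ ω (pd i F) :=
  (hF.fderiv_right (m := ω) (by simp)).clm_apply contDiff_const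

/-- The Casimir relations between analytic vector fields propagate from a point. -/
lemma isCasimir_of_analytic {ι : Type*} [Fintype ι] {Y Z : ι → Model n → Model n} {e : Fin n → 𝕜}
    (hY : ∀ r, ContDiff ℝ ω (Y r)) (hZ : ∀ r, ContDiff ℝ ω (Z r))
    (h : IsCasimir (der 𝕜 y) (fun i => algebraMap 𝕜 _ (e i)) (fun r => vgm 𝕜 (Y r) y)
      fun r => vgm 𝕜 (Z r) y) (y' : Model n) :
    IsCasimir (der 𝕜 y') (fun i => algebraMap 𝕜 _ (e i)) (fun r => vgm 𝕜 (Y r) y')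
      fun r => vgm 𝕜 (Z r) y' := by
  have hc : ∀ {Y : Model n → Model n}, ContDiff ℝ ω Y → ∀ i,
      ContDiff ℝ ω fun z => ((Y z i : ℝ) : 𝕜) := fun hY i =>
    (RCLike.ofRealCLM (K := 𝕜)).contDiff.comp ((contDiff_coord i).comp hY)
  have hs : ∀ {F : Model n → 𝕜}, ContDiff ℝ ω F → ∀ y, ContDiffAt ℝ ∞ F y := fun hF y =>
    (hF.of_le le_top).contDiffAt
  have sum : ∀ {F G : ι → Model n → 𝕜}, (∀ r, ContDiff ℝ ω (F r)) → (∀ r, ContDiff ℝ ω (G r)) →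
      ∀ c : 𝕜, ∑ r, gm y (F r) * gm y (G r) = algebraMap 𝕜 _ c →
      ∑ r, gm y' (F r) * gm y' (G r) = algebraMap 𝕜 _ c := by
    intro F G hF hG c h1
    have e1 : ∀ y, ∑ r, gm y (F r) * gm y (G r) = gm y fun z => ∑ r, F r z * G r z := by
      intro y
      rw [gm_sum _ fun r _ => (hs (hF r) y).mul (hs (hG r) y)]
      exact sum_congr rfl fun r _ => (gm_mul (hs (hF r) y) (hs (hG r) y)).symm
    rw [e1, algebraMap_germ] at h1 ⊢
    exact gm_eq_of_analytic (ContDiff.sum fun r _ => (hF r).mul (hG r)) contDiff_const h1 y'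
  have d1 : ∀ {F : Model n → 𝕜}, ContDiff ℝ ω F → ∀ i y, der 𝕜 y i (gm y F) = gm y (pd i F) :=
    fun hF i y => der_gm (hs hF y) i
  have hcas : ∀ (y : Model n) i j l m, casCoeff (fun i => algebraMap 𝕜 (SmGerm 𝕜 y) (e i)) i j l m
      = algebraMap 𝕜 _ (casCoeff e i j l m) := by
    intro y i j l m
    have h2 : algebraMap 𝕜 (SmGerm 𝕜 y) 2 = 2 := map_ofNat _ 2
    simp only [casCoeff]
    split_ifs <;> simp [h2]
  refine ⟨fun i j => ?_, fun l i j => ?_, fun l m i j => ?_⟩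
  · have := sum (fun r => hc (hY r) i) (fun r => hc (hZ r) j) 0 (by rw [map_zero]; exact h.zero i j)
    rwa [map_zero] at this
  · have h1 := h.one l i j
    simp only [vgm, d1 (hc (hY _) _)] at h1 ⊢
    have := sum (fun r => contDiff_pd (hc (hY r) i) l) (fun r => hc (hZ r) j) 0 (by rw [map_zero, h1])
    rwa [map_zero] at this
  · have h1 := h.two l m i j
    simp only [vgm, d1 (hc (hY _) _), d1 (contDiff_pd (hc (hY _) _) _)] at h1 ⊢
    rw [hcas] at h1 ⊢
    exact sum (fun r => contDiff_pd (contDiff_pd (hc (hY r) i) m) l) (fun r => hc (hZ r) j) _ h1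

end FlatGerms

section ConfAlg

variable {p q : ℕ} {𝕜 : Type*} [RCLike 𝕜] {Y : Model (p + q) → Model (p + q)} {y : Model (p + q)}

variable (p q 𝕜) in
/-- The diagonal entries of the flat metric as scalars. -/
def scalSign (i : Fin (p + q)) : 𝕜 := ((flatSign p q i : ℝ) : 𝕜)

variable (p q 𝕜 y) in
/-- The diagonal entries of the flat metric as constant germs. -/
abbrev germSign (i : Fin (p + q)) : SmGerm 𝕜 y := algebraMap 𝕜 _ (scalSign p q 𝕜 i)

lemma scalSign_mul_self (i : Fin (p + q)) : scalSign p q 𝕜 i * scalSign p q 𝕜 i = 1 := by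
  rw [scalSign, flatSign]; split_ifs <;> simp

lemma germSign_mul_self (i : Fin (p + q)) : germSign p q 𝕜 y i * germSign p q 𝕜 y i = 1 := by
  rw [← map_mul, scalSign_mul_self, map_one]

lemma der_germSign (i j : Fin (p + q)) : der 𝕜 y i (germSign p q 𝕜 y j) = 0 :=
  Derivation.map_algebraMap _ _

lemma vgm_translation (l : Fin (p + q)) :
    vgm 𝕜 (translationField p q l) y = Pi.single l 1 := by
  funext i
  have : (fun z : Model (p + q) => ((translationField p q l z i : ℝ) : 𝕜))
      = fun _ => if i = l then 1 else 0 := by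
    funext z; simp [translationField, basisVec, Pi.single_apply]
  rw [vgm, this, Pi.single_apply]
  split_ifs
  · exact gm_one
  · exact gm_zero

lemma gm_coord_mul (l : Fin (p + q)) : gm y (fun z => ((flatSign p q l * z l : ℝ) : 𝕜))
    = germSign p q 𝕜 y l * cgm 𝕜 y l := by
  simp only [RCLike.ofReal_mul]
  rw [gm_mul contDiffAt_const (ofReal_smooth (contDiff_coord l).contDiffAt)]
  rfl

lemma vgm_homothety : vgm 𝕜 (homothetyField p q) y = cgm 𝕜 y := rfl

lemma vgm_rotation (l m : Fin (p + q)) :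
    vgm 𝕜 (rotationField p q l m) y = rotGen (germSign p q 𝕜 y) (cgm 𝕜 y) l m := by
  funext i
  have h1 : ∀ l : Fin (p + q), ContDiffAt ℝ ∞ (fun z : Model (p + q) => flatSign p q l * z l) y :=
    fun l => contDiffAt_const.mul (contDiff_coord l).contDiffAt
  have : (fun z : Model (p + q) => ((rotationField p q l m z i : ℝ) : 𝕜))
      = fun z => (if i = m then ((flatSign p q l * z l : ℝ) : 𝕜) else 0)
        - if i = l then ((flatSign p q m * z m : ℝ) : 𝕜) else 0 := by
    funext z; simp [rotationField, basisVec, Pi.single_apply]; split_ifs <;> simp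
  rw [vgm, this, rotGen, ← gm_coord_mul, ← gm_coord_mul]
  split_ifs
  · exact gm_sub (ofReal_smooth (h1 l)) (ofReal_smooth (h1 m))
  · simp
  · simp only [zero_sub]
    have := gm_sub (contDiffAt_const (c := (0 : 𝕜))) (ofReal_smooth (𝕜 := 𝕜) (h1 m))
    simpa only [gm_zero, zero_sub] using this
  · simp [gm_zero]

lemma vgm_inversion (l : Fin (p + q)) :
    vgm 𝕜 (inversionField p q l) y = invGen (germSign p q 𝕜 y) (cgm 𝕜 y) l := by
  funext i
  have h0 : ∀ l : Fin (p + q), ContDiffAt ℝ ∞ (fun z : Model (p + q) => ((z l : ℝ) : 𝕜)) y :=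
    fun l => ofReal_smooth (contDiff_coord l).contDiffAt
  have h1 : ∀ l : Fin (p + q), ContDiffAt ℝ ∞
      (fun z : Model (p + q) => ((flatSign p q l * z l : ℝ) : 𝕜)) y :=
    fun l => ofReal_smooth (contDiffAt_const.mul (contDiff_coord l).contDiffAt)
  have : (fun z : Model (p + q) => ((inversionField p q l z i : ℝ) : 𝕜))
      = fun z => (if i = l then (∑ k, ((flatSign p q k * z k : ℝ) : 𝕜) * ((z k : ℝ) : 𝕜)) else 0)
        - 2 * ((flatSign p q l * z l : ℝ) : 𝕜) * ((z i : ℝ) : 𝕜) := by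
    funext z
    have h2 : ((2 : ℝ) : 𝕜) = 2 := RCLike.ofReal_ofNat 2
    simp only [inversionField, flatMetric, basisVec, PiLp.sub_apply, PiLp.smul_apply, smul_eq_mul,
      PiLp.single_apply, RCLike.ofReal_sub, RCLike.ofReal_mul, h2, mul_ite, mul_one,
      mul_zero]
    split_ifs <;> simp
  have h2 : ContDiffAt ℝ ∞ (fun z : Model (p + q) => if i = l then
      (∑ k, ((flatSign p q k * z k : ℝ) : 𝕜) * ((z k : ℝ) : 𝕜)) else 0) y := by
    split_ifs
    · exact ContDiffAt.sum fun k _ => (h1 k).mul (h0 k)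
    · exact contDiffAt_const
  have h3 : gm y (fun _ => (2 : 𝕜)) = 2 := by rw [← algebraMap_germ, map_ofNat]
  rw [vgm, this, invGen, gm_sub h2 ((contDiffAt_const.mul (h1 l)).mul (h0 i)),
    gm_mul (contDiffAt_const.mul (h1 l)) (h0 i), gm_mul contDiffAt_const (h1 l), h3, gm_coord_mul]
  congr 1
  split_ifs
  · rw [gm_sum _ fun k _ => (h1 k).mul (h0 k)]
    refine sum_congr rfl fun k _ => ?_
    rw [gm_mul (h1 k) (h0 k), gm_coord_mul]
    rfl
  · exact gm_zero

lemma confAlg_analytic (hY : Y ∈ confAlg p q) : ContDiff ℝ ω Y := by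
  induction hY using Submodule.span_induction with
  | zero => exact contDiff_const
  | add _ _ _ _ h h' => exact h.add h'
  | smul c _ _ h => exact contDiff_const.smul h
  | mem Y hY =>
    have h1 : ∀ l, ContDiff ℝ ω fun z : Model (p + q) => flatSign p q l * z l :=
      fun l => contDiff_const.mul (contDiff_coord l)
    rcases hY with ((⟨l, rfl⟩ | ⟨l, rfl⟩) | rfl) | ⟨l, rfl⟩
    · exact contDiff_const
    · exact ((h1 _).smul contDiff_const).sub ((h1 _).smul contDiff_const)
    · exact contDiff_id
    · exact ((ContDiff.sum fun k _ => (h1 k).mul (contDiff_coord k)).smul contDiff_const).sub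
        ((contDiff_const.mul (h1 l)).smul contDiff_id)

lemma confAlg_smoothAt (hY : Y ∈ confAlg p q) (y : Model (p + q)) : ContDiffAt ℝ ∞ Y y :=
  ((confAlg_analytic hY).of_le le_top).contDiffAt

lemma translation_mem (l : Fin (p + q)) : translationField p q l ∈ confAlg p q :=
  Submodule.subset_span (Or.inl (Or.inl (Or.inl ⟨l, rfl⟩)))

lemma rotation_mem (l m : Fin (p + q)) : rotationField p q l m ∈ confAlg p q :=
  Submodule.subset_span (Or.inl (Or.inl (Or.inr ⟨(l, m), rfl⟩)))

lemma homothety_mem : homothetyField p q ∈ confAlg p q :=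
  Submodule.subset_span (Or.inl (Or.inr rfl))

lemma inversion_mem (l : Fin (p + q)) : inversionField p q l ∈ confAlg p q :=
  Submodule.subset_span (Or.inr ⟨l, rfl⟩)

lemma confAlg_isConf (hY : Y ∈ confAlg p q) (y : Model (p + q)) :
    ∃ s, IsConf (der 𝕜 y) (germSign p q 𝕜 y) (vgm 𝕜 Y y) s := by
  induction hY using Submodule.span_induction with
  | zero =>
    refine ⟨0, ?_⟩
    have : vgm 𝕜 (0 : Model (p + q) → Model (p + q)) y = 0 := by
      funext i; simp [vgm, gm_zero]
    rw [this]
    exact isConf_zero _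
  | add Y Z hY hZ h h' =>
    obtain ⟨s, h⟩ := h
    obtain ⟨t, h'⟩ := h'
    exact ⟨_, by rw [vgm_add (confAlg_smoothAt hY y) (confAlg_smoothAt hZ y)]; exact h.add h'⟩
  | smul c Y hY h =>
    obtain ⟨s, h⟩ := h
    exact ⟨_, by rw [vgm_smul (confAlg_smoothAt hY y)]; exact h.smul _⟩
  | mem Y hY =>
    rcases hY with ((⟨l, rfl⟩ | ⟨l, rfl⟩) | rfl) | ⟨l, rfl⟩
    · rw [vgm_translation]
      refine ⟨0, isConf_const fun i j => ?_⟩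
      rw [Pi.single_apply]
      split_ifs <;> simp
    · exact ⟨_, by rw [vgm_rotation]; exact isConf_rotGen der_germSign der_cgm _ _⟩
    · exact ⟨_, isConf_coord der_cgm⟩
    · exact ⟨_, by rw [vgm_inversion]; exact isConf_invGen der_germSign der_cgm _⟩

/-- A vector field that is conformal with an affine factor belongs to the conformal Lie algebra. -/
lemma exists_confAlg_of_isConf (hY : ContDiffAt ℝ ∞ Y y) {s : SmGerm ℝ y}
    (h : IsConf (der ℝ y) (germSign p q ℝ y) (vgm ℝ Y y) s) :
    ∃ Z ∈ confAlg p q, Y =ᶠ[𝓝 y] Z := by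
  obtain ⟨b, a, c, S, hS⟩ := h.eq_flat der_germSign germSign_mul_self der_comm der_cgm
    exists_const_germ
  have hm : ∀ {ι : Type} [Fintype ι] {W : ι → Model (p + q) → Model (p + q)} (c : ι → ℝ),
      (∀ r, W r ∈ confAlg p q) → ∑ r, c r • W r ∈ confAlg p q := fun c hW =>
    Submodule.sum_mem _ fun r _ => Submodule.smul_mem _ _ (hW r)
  have hg : ∀ {ι : Type} [Fintype ι] {W : ι → Model (p + q) → Model (p + q)} (c : ι → ℝ),
      (∀ r, W r ∈ confAlg p q) → vgm ℝ (∑ r, c r • W r) y = ∑ r, c r • vgm ℝ (W r) y := by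
    intro ι _ W c hW
    rw [vgm_sum _ fun r => confAlg_smoothAt (Submodule.smul_mem _ _ (hW r)) y]
    exact sum_congr rfl fun r _ => vgm_smul (confAlg_smoothAt (hW r) y) (c r)
  have m1 := hm b inversion_mem
  have m2 := Submodule.smul_mem _ c (homothety_mem (p := p) (q := q))
  have m3 := hm (fun r : Fin (p + q) × Fin (p + q) => S r.1 r.2) fun r => rotation_mem r.1 r.2
  have m4 := hm a translation_mem
  have m12 := Submodule.add_mem _ m1 m2
  have m123 := Submodule.add_mem _ m12 m3
  refine ⟨_, Submodule.add_mem _ m123 m4, ?_⟩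
  have hZ := confAlg_smoothAt (Submodule.add_mem _ m123 m4) y
  have e : vgm ℝ Y y = vgm ℝ (∑ r, b r • inversionField p q r + c • homothetyField p q
      + ∑ r : Fin (p + q) × Fin (p + q), S r.1 r.2 • rotationField p q r.1 r.2
      + ∑ r, a r • translationField p q r) y := by
    rw [hS, vgm_add (confAlg_smoothAt m123 y) (confAlg_smoothAt m4 y),
      vgm_add (confAlg_smoothAt m12 y) (confAlg_smoothAt m3 y),
      vgm_add (confAlg_smoothAt m1 y) (confAlg_smoothAt m2 y), hg (W := inversionField p q) b inversion_mem,
      vgm_smul (confAlg_smoothAt homothety_mem y), 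
      hg (W := fun r : Fin (p + q) × Fin (p + q) => rotationField p q r.1 r.2) _
        fun r => rotation_mem r.1 r.2,
      hg (W := translationField p q) a translation_mem, Fintype.sum_prod_type]
    simp only [vgm_inversion, vgm_rotation, vgm_translation, vgm_homothety,
      RCLike.ofReal_real_eq_id, id]
  exact eventuallyEq_of_vgm hY hZ e

/-- The factors of the Casimir element belong to the conformal Lie algebra. -/
lemma exists_casimir (p q : ℕ) (𝕜 : Type*) [RCLike 𝕜] :
    ∃ Y Z : Fin (p + q) ⊕ Fin (p + q) ⊕ Unit ⊕ Fin (p + q) × Fin (p + q) →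
      Model (p + q) → Model (p + q), (∀ r, Y r ∈ confAlg p q) ∧ (∀ r, Z r ∈ confAlg p q) ∧
      ∀ y, IsCasimir (der 𝕜 y) (germSign p q 𝕜 y) (fun r => vgm 𝕜 (Y r) y)
        fun r => vgm 𝕜 (Z r) y := by
  let Y : Fin (p + q) ⊕ Fin (p + q) ⊕ Unit ⊕ Fin (p + q) × Fin (p + q) →
    Model (p + q) → Model (p + q)
    | .inl l => flatSign p q l • inversionField p q l
    | .inr (.inl l) => flatSign p q l • translationField p q l
    | .inr (.inr (.inl _)) => (2 : ℝ) • homothetyField p q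
    | .inr (.inr (.inr r)) => (-(flatSign p q r.1 * flatSign p q r.2)) • rotationField p q r.1 r.2
  let Z : Fin (p + q) ⊕ Fin (p + q) ⊕ Unit ⊕ Fin (p + q) × Fin (p + q) →
    Model (p + q) → Model (p + q)
    | .inl l => translationField p q l
    | .inr (.inl l) => inversionField p q l
    | .inr (.inr (.inl _)) => homothetyField p q
    | .inr (.inr (.inr r)) => rotationField p q r.1 r.2
  refine ⟨Y, Z, ?_, ?_, fun y => ?_⟩
  · rintro (l | l | l | r)
    · exact Submodule.smul_mem _ _ (inversion_mem l)
    · exact Submodule.smul_mem _ _ (translation_mem l)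
    · exact Submodule.smul_mem _ _ homothety_mem
    · exact Submodule.smul_mem _ _ (rotation_mem r.1 r.2)
  · rintro (l | l | l | r)
    · exact translation_mem l
    · exact inversion_mem l
    · exact homothety_mem
    · exact rotation_mem r.1 r.2
  · have hY : (fun r => vgm 𝕜 (Y r) y) = casY (germSign p q 𝕜 y) (cgm 𝕜 y) := by
      funext r i
      rcases r with l | l | l | r
      · show vgm 𝕜 (flatSign p q l • inversionField p q l) y i = _
        rw [vgm_smul (confAlg_smoothAt (inversion_mem l) y), vgm_inversion]
        simp only [casY, Algebra.smul_def, Pi.smul_apply]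
        rfl
      · show vgm 𝕜 (flatSign p q l • translationField p q l) y i = _
        rw [vgm_smul (confAlg_smoothAt (translation_mem l) y), vgm_translation]
        simp only [casY, Algebra.smul_def, Pi.smul_apply]
        rfl
      · show vgm 𝕜 ((2 : ℝ) • homothetyField p q) y i = _
        rw [vgm_smul (confAlg_smoothAt homothety_mem y), vgm_homothety]
        simp only [casY, Algebra.smul_def, Pi.smul_apply, RCLike.ofReal_ofNat, map_ofNat]
      · show vgm 𝕜 ((-(flatSign p q r.1 * flatSign p q r.2)) • rotationField p q r.1 r.2) y i = _
        rw [vgm_smul (confAlg_smoothAt (rotation_mem r.1 r.2) y), vgm_rotation]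
        simp only [casY, Algebra.smul_def, Pi.smul_apply, RCLike.ofReal_neg, RCLike.ofReal_mul,
          map_neg, map_mul]
        rfl
    have hZ : (fun r => vgm 𝕜 (Z r) y) = casZ (germSign p q 𝕜 y) (cgm 𝕜 y) := by
      funext r
      rcases r with l | l | l | r
      · exact vgm_translation l
      · exact vgm_inversion l
      · rfl
      · exact vgm_rotation r.1 r.2
    rw [hY, hZ]
    exact isCasimir_cas der_germSign germSign_mul_self der_cgm

end ConfAlg

/-! ### The local action of the conformal Lie algebra -/

section LocalAction

variable {p q : ℕ} {𝕜 : Type*} [RCLike 𝕜] {M : Type*} [TopologicalSpace M]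
  [ChartedSpace (Model (p + q)) M] [IsManifold (𝓡 (p + q)) ∞ M] [T2Space M]
  {g : PseudoRiemannianMetric (p + q) M} {𝒜 : Set (OpenPartialHomeomorph M (Model (p + q)))}
  {φ ψ : OpenPartialHomeomorph M (Model (p + q))} {X : VField (p + q) M} {x : M} {U : Set M}
  {Y : Model (p + q) → Model (p + q)}

lemma dchart_chartPullback (hφ : φ ∈ smoothCharts (n := p + q) M) (hx : x ∈ φ.source) :
    dchart φ x (chartPullback φ Y x) = Y (φ x) :=
  (dchart_invertible hφ hx).self_apply_inverse _

lemma vfCoord_of_eq_pullback (hφ : φ ∈ smoothCharts (n := p + q) M) (hx : x ∈ φ.source)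
    (h : ∀ᶠ z in 𝓝 x, X z = chartPullback φ Y z) : vfCoord φ X =ᶠ[𝓝 (φ x)] Y := by
  refine eventually_chart hx ?_
  filter_upwards [h] with z hz hz'
  rw [vfCoord_chart X hz', hz, dchart_chartPullback hφ hz']

lemma eq_pullback_of_vfCoord (hφ : φ ∈ smoothCharts (n := p + q) M) (hx : x ∈ φ.source)
    (h : vfCoord φ X =ᶠ[𝓝 (φ x)] Y) : ∀ᶠ z in 𝓝 x, X z = chartPullback φ Y z := by
  filter_upwards [(φ.continuousAt hx).eventually h, φ.open_source.mem_nhds hx] with z hz hz'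
  rw [vfCoord_chart X hz'] at hz
  rw [← (dchart_invertible hφ hz').inverse_apply_self (X z), hz]
  rfl

lemma smoothVFAt_of_eq_pullback (hφ : φ ∈ smoothCharts (n := p + q) M) (hx : x ∈ φ.source)
    (hY : Y ∈ confAlg p q) (h : ∀ᶠ z in 𝓝 x, X z = chartPullback φ Y z) :
    ∀ᶠ z in 𝓝 x, SmoothVFAt X z := by
  filter_upwards [h.eventually_nhds, φ.open_source.mem_nhds hx] with z hz hz'
  exact smoothVFAt_of_chart hφ hz'
    ((confAlg_smoothAt hY _).congr_of_eventuallyEq (vfCoord_of_eq_pullback hφ hz' hz))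

lemma vfGerm_of_eq_pullback (hφ : φ ∈ smoothCharts (n := p + q) M) (hx : x ∈ φ.source)
    (h : ∀ᶠ z in 𝓝 x, X z = chartPullback φ Y z) :
    vfGerm 𝕜 φ X (φ x) = vgm 𝕜 Y (φ x) := vgm_congr (vfCoord_of_eq_pullback hφ hx h)

lemma flatMetric_basisVec (i j : Fin (p + q)) :
    flatMetric p q (basisVec _ i) (basisVec _ j) = if i = j then flatSign p q i else 0 := by
  simp only [flatMetric, basisVec, PiLp.single_apply, mul_ite, mul_one, mul_zero,
    sum_ite_eq', Finset.mem_univ, if_true]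
  rcases eq_or_ne i j with rfl | h
  · simp
  · simp [h, h.symm]

variable (h : IsConformallyFlat g 𝒜)
include h

lemma IsConformallyFlat.gram_eq (hφ : φ ∈ 𝒜) (hx : x ∈ φ.source) :
    ∃ c : ℝ, 0 < c ∧ ∀ i j, gram g φ x i j = if i = j then c * flatSign p q i else 0 := by
  obtain ⟨c, hc, e⟩ := h.conformal φ hφ x hx
  refine ⟨c, hc, fun i j => ?_⟩
  have hv := dchart_cvec (h.smooth hφ) hx
  simp only [gram, Matrix.of_apply, e]
  rw [show mfderiv (𝓡 (p + q)) (𝓡 (p + q)) φ x (cvec φ x i) = _ from hv i,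
    show mfderiv (𝓡 (p + q)) (𝓡 (p + q)) φ x (cvec φ x j) = _ from hv j, flatMetric_basisVec,
    mul_ite, mul_zero]

/-- The transition maps between the given charts are conformal. -/
lemma IsConformallyFlat.conformal_jac (hn : 2 ≤ p + q) (hφ : φ ∈ 𝒜) (hψ : ψ ∈ 𝒜)
    (hx : x ∈ φ.source) (hx' : x ∈ ψ.source) : ∃ ρ ρi : SmGerm 𝕜 (ψ x),
      (∀ i j, ∑ k, germSign p q 𝕜 (ψ x) k * jac 𝕜 (φ ∘ ψ.symm) (ψ x) k i
        * jac 𝕜 (φ ∘ ψ.symm) (ψ x) k j = if i = j then ρ * germSign p q 𝕜 (ψ x) i else 0) ∧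
      ρi * ρ = 1 := by
  set τ := φ ∘ ψ.symm with hτd
  have hτ : ContDiffAt ℝ ∞ τ (ψ x) := trans_smooth (h.smooth hφ) (h.smooth hψ) hx hx'
  let F : Fin (p + q) → Fin (p + q) → Model (p + q) → ℝ := fun i j y =>
    ∑ k, flatSign p q k * fderiv ℝ τ y (basisVec _ i) k * fderiv ℝ τ y (basisVec _ j) k
  have hs : ∀ i j k, ContDiffAt ℝ ∞ (fun y =>
      flatSign p q k * fderiv ℝ τ y (basisVec _ i) k * fderiv ℝ τ y (basisVec _ j) k) (ψ x) :=
    fun i j k => (contDiffAt_const.mul (fderiv_entry_smooth hτ k i)).mul (fderiv_entry_smooth hτ k j)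
  have hF : ∀ i j, ContDiffAt ℝ ∞ (F i j) (ψ x) := fun i j => ContDiffAt.sum fun k _ => hs i j k
  have hgm : ∀ i j, ∑ k, germSign p q 𝕜 (ψ x) k * jac 𝕜 τ (ψ x) k i * jac 𝕜 τ (ψ x) k j
      = gm (ψ x) fun y => ((F i j y : ℝ) : 𝕜) := by
    intro i j
    simp only [F, RCLike.ofReal_sum]
    rw [gm_sum _ fun k _ => ofReal_smooth (hs i j k)]
    refine sum_congr rfl fun k _ => ?_
    simp only [RCLike.ofReal_mul]
    have h1 := fun i => ofReal_smooth (𝕜 := 𝕜) (fderiv_entry_smooth hτ k i)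
    rw [gm_mul (contDiffAt_const.mul (h1 i)) (h1 j), gm_mul contDiffAt_const (h1 i),
      jac_apply hτ, jac_apply hτ]
    rfl
  have key : ∀ z, z ∈ φ.source → z ∈ ψ.source → ∃ c : ℝ, 0 < c ∧ ∀ i j,
      F i j (ψ z) = if i = j then c * flatSign p q i else 0 := by
    intro z hz hz'
    obtain ⟨a, ha, ea⟩ := h.gram_eq hφ hz
    obtain ⟨b, hb, eb⟩ := h.gram_eq hψ hz'
    refine ⟨b / a, div_pos hb ha, fun i j => ?_⟩
    have e1 := congrFun (congrFun (gram_change g (h.smooth hφ) (h.smooth hψ) hz hz') i) j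
    rw [eb] at e1
    simp only [Matrix.mul_apply, Matrix.transpose_apply, Matrix.of_apply, ea, mul_ite, mul_zero,
      sum_ite_eq', Finset.mem_univ, if_true] at e1
    have e2 : a * F i j (ψ z) = if i = j then b * flatSign p q i else 0 := by
      rw [e1, mul_sum]
      exact sum_congr rfl fun k _ => by ring
    rw [← mul_right_inj' ha.ne', e2, mul_ite, mul_zero]
    refine if_congr Iff.rfl ?_ rfl
    field_simp
  let i0 : Fin (p + q) := ⟨0, by omega⟩
  have hε : ∀ i, flatSign p q i * flatSign p q i = 1 := fun i => by
    rw [flatSign]; split_ifs <;> norm_num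
  have hr : ContDiffAt ℝ ∞ (fun y => flatSign p q i0 * F i0 i0 y) (ψ x) :=
    contDiffAt_const.mul (hF i0 i0)
  have hr0 : flatSign p q i0 * F i0 i0 (ψ x) ≠ 0 := by
    obtain ⟨c, hc, e⟩ := key x hx hx'
    rw [e, if_pos rfl, mul_left_comm, hε, mul_one]
    exact hc.ne'
  refine ⟨gm (ψ x) fun y => ((flatSign p q i0 * F i0 i0 y : ℝ) : 𝕜),
    gm (ψ x) fun y => (((flatSign p q i0 * F i0 i0 y)⁻¹ : ℝ) : 𝕜), fun i j => ?_, ?_⟩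
  · have h1 : gm (ψ x) (fun y => ((flatSign p q i0 * F i0 i0 y : ℝ) : 𝕜)) * germSign p q 𝕜 (ψ x) i
        = gm (ψ x) fun y => ((flatSign p q i0 * F i0 i0 y * flatSign p q i : ℝ) : 𝕜) := by
      simp only [RCLike.ofReal_mul (flatSign p q i0 * _)]
      rw [gm_mul (ofReal_smooth hr) contDiffAt_const]
      rfl
    rw [hgm, h1, ← gm_zero, ← apply_ite (gm (ψ x))]
    refine gm_congr (eventually_chart hx' ?_)
    filter_upwards [φ.open_source.mem_nhds hx] with z hz hz'
    obtain ⟨c, hc, e⟩ := key z hz hz'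
    rw [e]
    split_ifs
    · beta_reduce
      rw [e, if_pos rfl, mul_left_comm _ c, hε, mul_one]
    · exact RCLike.ofReal_zero
  · have hi : ContDiffAt ℝ ∞ (fun y => (flatSign p q i0 * F i0 i0 y)⁻¹) (ψ x) := hr.inv hr0
    rw [← gm_mul (ofReal_smooth hi) (ofReal_smooth hr), ← gm_one]
    refine gm_congr ?_
    filter_upwards [hr.continuousAt.eventually_ne hr0] with y hy
    rw [← RCLike.ofReal_mul, inv_mul_cancel₀ hy, RCLike.ofReal_one]

/-- The local actions given by two of the charts agree. -/
lemma IsConformallyFlat.exists_eq_pullback (hn : 2 ≤ p + q) (hφ : φ ∈ 𝒜) (hψ : ψ ∈ 𝒜)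
    (hx : x ∈ φ.source) (hx' : x ∈ ψ.source) (hY : Y ∈ confAlg p q) :
    ∃ Z ∈ confAlg p q, ∀ᶠ z in 𝓝 x, chartPullback φ Y z = chartPullback ψ Z z := by
  rcases hn.eq_or_lt with h2 | h3
  · exact h.compatible h2.symm φ hφ ψ hψ x ⟨hx, hx'⟩ Y hY
  · have hφ' := h.smooth hφ
    have hψ' := h.smooth hψ
    have heq : ∀ᶠ z in 𝓝 x, chartPullback φ Y z = chartPullback φ Y z :=
      Filter.Eventually.of_forall fun _ => rfl
    have hX : SmoothVFAt (chartPullback φ Y) x :=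
      (smoothVFAt_of_eq_pullback hφ' hx hY heq).self_of_nhds
    obtain ⟨s, hs⟩ := confAlg_isConf (𝕜 := ℝ) hY (φ x)
    rw [← vfGerm_of_eq_pullback hφ' hx heq] at hs
    obtain ⟨ρ, ρi, hJ, hρ⟩ := h.conformal_jac (𝕜 := ℝ) hn hφ hψ hx hx'
    obtain ⟨s', hs'⟩ := (coordChange_chart (𝕜 := ℝ) hφ' hψ' hx hx').sym
      (e := germSign p q ℝ (φ x)) (e' := germSign p q ℝ (ψ x)) (fun i => pull_gm _ _ contDiffAt_const)
      der_germSign hJ hρ (fun c => pull_vfGerm hφ' hψ' hx hx' hX c) hs.sym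
    obtain ⟨Z, hZ, e⟩ := exists_confAlg_of_isConf (hX ψ hψ' hx')
      (isConf_of_three_le der_comm der_germSign germSign_mul_self h3 hs')
    exact ⟨Z, hZ, eq_pullback_of_vfCoord hψ' hx' e⟩

lemma IsConformallyFlat.isConformalFieldOn_pullback (hn : 2 ≤ p + q) (hφ : φ ∈ 𝒜)
    (hU : U ⊆ φ.source) (hY : Y ∈ confAlg p q) : IsConformalFieldOn 𝒜 U (chartPullback φ Y) :=
  fun _ hx _ hψ hx' => h.exists_eq_pullback hn hφ hψ (hU hx) hx' hY

lemma IsConformallyFlat.smoothVFAt (hX : IsConformalFieldOn 𝒜 U X) (hx : x ∈ U) :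
    ∀ᶠ z in 𝓝 x, SmoothVFAt X z := by
  obtain ⟨φ, hφ, hxφ⟩ := h.cover x
  obtain ⟨Y, hY, e⟩ := hX x hx φ hφ hxφ
  exact smoothVFAt_of_eq_pullback (h.smooth hφ) hxφ hY e

lemma IsConformallyFlat.isConf (hX : IsConformalFieldOn 𝒜 U X) (hx : x ∈ U) (hφ : φ ∈ 𝒜)
    (hxφ : x ∈ φ.source) :
    ∃ s, IsConf (der 𝕜 (φ x)) (germSign p q 𝕜 (φ x)) (vfGerm 𝕜 φ X (φ x)) s := by
  obtain ⟨Y, hY, e⟩ := hX x hx φ hφ hxφ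
  rw [vfGerm_of_eq_pullback (h.smooth hφ) hxφ e]
  exact confAlg_isConf hY _

section Casimir

variable {ι : Type*} [Fintype ι] {Y Z : ι → VField (p + q) M}

variable (𝕜 𝒜 Y Z x) in
omit h in
/-- The vector fields satisfy the Casimir relations at the point `x`, in one of the charts. -/
def IsCasimirAt : Prop :=
  ∃ φ ∈ 𝒜, x ∈ φ.source ∧ IsCasimir (der 𝕜 (φ x)) (germSign p q 𝕜 (φ x))
    (fun r => vfGerm 𝕜 φ (Y r) (φ x)) fun r => vfGerm 𝕜 φ (Z r) (φ x)

lemma IsConformallyFlat.isCasimir (hn : 2 ≤ p + q) (hY : ∀ r, SmoothVFAt (Y r) x)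
    (hZ : ∀ r, SmoothVFAt (Z r) x) (hC : IsCasimirAt 𝕜 𝒜 x Y Z) (hψ : ψ ∈ 𝒜)
    (hx : x ∈ ψ.source) : IsCasimir (der 𝕜 (ψ x)) (germSign p q 𝕜 (ψ x))
      (fun r => vfGerm 𝕜 ψ (Y r) (ψ x)) fun r => vfGerm 𝕜 ψ (Z r) (ψ x) := by
  obtain ⟨φ, hφ, hxφ, hC⟩ := hC
  obtain ⟨ρ, ρi, hJ, hρ⟩ := h.conformal_jac (𝕜 := 𝕜) hn hφ hψ hxφ hx
  have hφ' := h.smooth hφ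
  have hψ' := h.smooth hψ
  exact (coordChange_chart (𝕜 := 𝕜) hφ' hψ' hxφ hx).casimir (e := germSign p q 𝕜 (φ x))
    (e' := germSign p q 𝕜 (ψ x)) (fun i => pull_gm _ _ contDiffAt_const) germSign_mul_self hJ hρ
    (fun r c => pull_vfGerm hφ' hψ' hxφ hx (hY r) c)
    (fun r c => pull_vfGerm hφ' hψ' hxφ hx (hZ r) c) hC

/-- The Casimir relations propagate along neighbourhoods. -/
lemma IsConformallyFlat.isCasimirAt_nhds (hn : 2 ≤ p + q)
    (hY : ∀ r, IsConformalFieldOn 𝒜 Set.univ (Y r)) (hZ : ∀ r, IsConformalFieldOn 𝒜 Set.univ (Z r))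
    (x : M) : ∃ N ∈ 𝓝 x, ∀ a ∈ N, IsCasimirAt 𝕜 𝒜 a Y Z → ∀ b ∈ N, IsCasimirAt 𝕜 𝒜 b Y Z := by
  obtain ⟨φ, hφ, hx⟩ := h.cover x
  choose y hy ey using fun r => hY r x trivial φ hφ hx
  choose z hz ez using fun r => hZ r x trivial φ hφ hx
  have hev := (Filter.eventually_all.2 fun r => (ey r).eventually_nhds).and
    ((Filter.eventually_all.2 fun r => (ez r).eventually_nhds).and (φ.open_source.mem_nhds hx))
  refine ⟨_, hev, fun a ha hC b hb => ⟨φ, hφ, hb.2.2, ?_⟩⟩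
  have hs := h.smooth hφ
  have hC := h.isCasimir hn (fun r => (h.smoothVFAt (hY r) trivial).self_of_nhds)
    (fun r => (h.smoothVFAt (hZ r) trivial).self_of_nhds) hC hφ ha.2.2
  simp only [fun r => vfGerm_of_eq_pullback (𝕜 := 𝕜) hs ha.2.2 (ha.1 r),
    fun r => vfGerm_of_eq_pullback (𝕜 := 𝕜) hs ha.2.2 (ha.2.1 r)] at hC
  simp only [fun r => vfGerm_of_eq_pullback (𝕜 := 𝕜) hs hb.2.2 (hb.1 r),
    fun r => vfGerm_of_eq_pullback (𝕜 := 𝕜) hs hb.2.2 (hb.2.1 r)]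
  exact isCasimir_of_analytic (fun r => confAlg_analytic (hy r)) (fun r => confAlg_analytic (hz r))
    hC _

/-- The pull-backs of the factors of the Casimir element by one of the charts. -/
lemma IsConformallyFlat.exists_casimir_pullback (hφ : φ ∈ 𝒜) :
    ∃ Y Z : Fin (p + q) ⊕ Fin (p + q) ⊕ Unit ⊕ Fin (p + q) × Fin (p + q) →
      Model (p + q) → Model (p + q), (∀ r, Y r ∈ confAlg p q) ∧ (∀ r, Z r ∈ confAlg p q) ∧
      ∀ Y' Z' : Fin (p + q) ⊕ Fin (p + q) ⊕ Unit ⊕ Fin (p + q) × Fin (p + q) → VField (p + q) M,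
        ∀ x ∈ φ.source, (∀ r, ∀ᶠ z in 𝓝 x, Y' r z = chartPullback φ (Y r) z) →
        (∀ r, ∀ᶠ z in 𝓝 x, Z' r z = chartPullback φ (Z r) z) →
        IsCasimir (der 𝕜 (φ x)) (germSign p q 𝕜 (φ x)) (fun r => vfGerm 𝕜 φ (Y' r) (φ x))
          fun r => vfGerm 𝕜 φ (Z' r) (φ x) := by
  obtain ⟨Y, Z, hY, hZ, hC⟩ := exists_casimir p q 𝕜
  refine ⟨Y, Z, hY, hZ, fun Y' Z' x hx h1 h2 => ?_⟩
  simp only [fun r => vfGerm_of_eq_pullback (𝕜 := 𝕜) (h.smooth hφ) hx (h1 r),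
    fun r => vfGerm_of_eq_pullback (𝕜 := 𝕜) (h.smooth hφ) hx (h2 r)]
  exact hC _

/-- If the local action is global, there are global vector fields with the Casimir relations. -/
lemma IsConformallyFlat.exists_global_casimir (hn : 2 ≤ p + q) (hG : ActsGlobally 𝒜) :
    ∃ Y Z : Fin (p + q) ⊕ Fin (p + q) ⊕ Unit ⊕ Fin (p + q) × Fin (p + q) → VField (p + q) M,
      (∀ r, IsConformalFieldOn 𝒜 Set.univ (Y r)) ∧ (∀ r, IsConformalFieldOn 𝒜 Set.univ (Z r)) ∧
      ∀ x, IsCasimirAt 𝕜 𝒜 x Y Z := by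
  have hbase : ∀ b : M, ∃ Y Z : Fin (p + q) ⊕ Fin (p + q) ⊕ Unit ⊕ Fin (p + q) × Fin (p + q) →
      VField (p + q) M, (∀ r, IsConformalFieldOn 𝒜 Set.univ (Y r)) ∧
      (∀ r, IsConformalFieldOn 𝒜 Set.univ (Z r)) ∧ IsCasimirAt 𝕜 𝒜 b Y Z := by
    intro b
    obtain ⟨φ, hφ, hb⟩ := h.cover b
    obtain ⟨Y, Z, hY, hZ, hC⟩ := h.exists_casimir_pullback (𝕜 := 𝕜) hφ
    choose Y' hY' eY using fun r => hG φ hφ b hb (Y r) (hY r)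
    choose Z' hZ' eZ using fun r => hG φ hφ b hb (Z r) (hZ r)
    exact ⟨Y', Z', hY', hZ', φ, hφ, hb, hC Y' Z' b hb eY eZ⟩
  choose Y Z hY hZ hC using hbase
  have : LocallyConnectedSpace M := ChartedSpace.locallyConnectedSpace (Model (p + q)) M
  let β : M → M := fun x => Quotient.out (ConnectedComponents.mk x)
  have hβ : ∀ x, β x ∈ connectedComponent x := fun x =>
    ConnectedComponents.coe_eq_coe'.1 (Quotient.out_eq (ConnectedComponents.mk x))
  have hβ' : ∀ x, ∀ᶠ z in 𝓝 x, β z = β x := fun x => by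
    filter_upwards [isOpen_connectedComponent.mem_nhds (mem_connectedComponent (x := x))] with z hz
    exact congrArg Quotient.out (ConnectedComponents.coe_eq_coe'.2 hz)
  have glue : ∀ W : M → VField (p + q) M, (∀ b, IsConformalFieldOn 𝒜 Set.univ (W b)) →
      IsConformalFieldOn 𝒜 Set.univ fun x => W (β x) x := by
    intro W hW x _ φ hφ hx
    obtain ⟨y, hy, e⟩ := hW (β x) x trivial φ hφ hx
    refine ⟨y, hy, ?_⟩
    filter_upwards [e, hβ' x] with z hz hz'
    rw [hz', hz]
  have hYg := fun r => glue (fun b => Y b r) fun b => hY b r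
  have hZg := fun r => glue (fun b => Z b r) fun b => hZ b r
  refine ⟨fun r x => Y (β x) r x, fun r x => Z (β x) r x, hYg, hZg, fun x => ?_⟩
  set S : Set M := {a | IsCasimirAt 𝕜 𝒜 a (fun r x => Y (β x) r x) fun r x => Z (β x) r x} with hS
  have hnh := h.isCasimirAt_nhds (𝕜 := 𝕜) hn hYg hZg
  have hclopen : IsClopen S := by
    refine ⟨⟨isOpen_iff_mem_nhds.2 fun a ha => ?_⟩, isOpen_iff_mem_nhds.2 fun a ha => ?_⟩
    · obtain ⟨N, hN, e⟩ := hnh a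
      filter_upwards [hN] with b hb hbS
      exact ha (e b hb hbS a (mem_of_mem_nhds hN))
    · obtain ⟨N, hN, e⟩ := hnh a
      filter_upwards [hN] with b hb
      exact e a (mem_of_mem_nhds hN) ha b hb
  have hb : β x ∈ S := by
    obtain ⟨φ, hφ, hbφ, hCφ⟩ := hC (β x)
    have hbb : β (β x) = β x := congrArg Quotient.out (ConnectedComponents.coe_eq_coe'.2 (hβ x))
    refine ⟨φ, hφ, hbφ, ?_⟩
    have hg : ∀ W : M → VField (p + q) M,
        vfGerm 𝕜 φ (fun x => W (β x) x) (φ (β x)) = vfGerm 𝕜 φ (W (β x)) (φ (β x)) := by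
      intro W
      refine vgm_congr (eventually_chart hbφ ?_)
      filter_upwards [hβ' (β x)] with z hz hz'
      rw [vfCoord_chart _ hz', vfCoord_chart _ hz', hz, hbb]
    simp only [fun r => hg fun b => Y b r, fun r => hg fun b => Z b r]
    exact hCφ
  have hx : connectedComponent (β x) ⊆ S := hclopen.connectedComponent_subset hb
  rw [← connectedComponent_eq (hβ x)] at hx
  exact hx mem_connectedComponent

end Casimir

end LocalAction

/-! ### The conformally equivariant quantization -/

section Main

/-- The weights for which the quantization exists and is unique. -/
structure NonResonant (n : ℕ) {𝕜 : Type*} [RCLike 𝕜] (lam mu : 𝕜) : Prop where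
  h0 : (n : 𝕜) ≠ 0
  h1 : mu - lam ≠ 1
  h2 : n * (mu - lam) ≠ 2
  h3 : 2 * n * (mu - lam) ≠ n + 2
  h4 : n * (mu - lam) ≠ n + 1
  h5 : n * (mu - lam) ≠ n + 2

lemma exists_quantData {n : ℕ} {𝕜 : Type*} [RCLike 𝕜] {lam mu : 𝕜} (hr : NonResonant n lam mu)
    {e : Fin n → 𝕜} (he : ∀ i, e i * e i = 1) :
    ∃ q : QuantData n 𝕜, q.e = e ∧ q.IsEquivariant lam mu := by
  have a1 : (n : 𝕜) * (mu - lam - 1) - 2 ≠ 0 := fun h => hr.h5 (by linear_combination h)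
  have a2 : (mu - lam) * n - 2 ≠ 0 := fun h => hr.h2 (by linear_combination h)
  have a3 : mu - lam - 1 ≠ 0 := sub_ne_zero.2 hr.h1
  have a4 : 2 * (n : 𝕜) * (mu - lam - 1) - 2 ≠ 0 := fun h => hr.h4 (by linear_combination h / 2)
  have a5 : (n : 𝕜) * (2 * (mu - lam) - 1) - 2 ≠ 0 := fun h => hr.h3 (by linear_combination h)
  set b1 : 𝕜 := (-2 - 2 * lam * n) / (n * (mu - lam - 1) - 2)
  set b2 : 𝕜 := (1 - b1) / ((mu - lam) * n - 2)
  set b3 : 𝕜 := -(lam * n * b1) / (2 * n * (mu - lam - 1) - 2)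
  refine ⟨⟨e, b1, b2, b3, (-(lam * n * b2) - b3) / (n * (2 * (mu - lam) - 1) - 2),
    -lam / (mu - lam - 1)⟩, rfl, he, div_mul_cancel₀ _ a1, div_mul_cancel₀ _ a2,
    div_mul_cancel₀ _ a3, div_mul_cancel₀ _ a4, ?_⟩
  show b3 + _ / _ * _ = _
  rw [div_mul_cancel₀ _ a5]
  ring

variable {p q : ℕ} {𝕜 : Type*} [RCLike 𝕜] {M : Type*} [TopologicalSpace M]
  [ChartedSpace (Model (p + q)) M] [IsManifold (𝓡 (p + q)) ∞ M] [T2Space M]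
  {g : PseudoRiemannianMetric (p + q) M} {𝒜 : Set (OpenPartialHomeomorph M (Model (p + q)))}
  {φ ψ : OpenPartialHomeomorph M (Model (p + q))} {X : VField (p + q) M} {x : M} {U : Set M}
  {lam mu : 𝕜}

lemma isConformalFieldOn_zero : IsConformalFieldOn 𝒜 U (fun _ => 0 : VField (p + q) M) :=
  fun _ _ φ _ _ => ⟨0, Submodule.zero_mem _, Filter.Eventually.of_forall fun z =>
    (map_zero (dchart φ z).inverse).symm⟩

variable (h : IsConformallyFlat g 𝒜) (hn : 2 ≤ p + q) (hr : NonResonant (p + q) lam mu)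
include h hn hr

lemma IsConformallyFlat.quantLoc_eq {d : QuantData (p + q) 𝕜} (hd : d.IsEquivariant lam mu)
    (hde : d.e = scalSign p q 𝕜) (hφ : φ ∈ 𝒜) (hψ : ψ ∈ 𝒜) (hx : x ∈ φ.source)
    (hx' : x ∈ ψ.source) (P : symbols2 (p + q) 𝕜 M) (f : smoothFun (p + q) 𝕜 M) :
    quantLoc g lam mu d φ P f.1 x = quantLoc g lam mu d ψ P f.1 x := by
  obtain ⟨Y, Z, hY, hZ, hC⟩ := h.exists_casimir_pullback (𝕜 := 𝕜) hφ
  have hc : ∀ {W}, W ∈ confAlg p q → IsConformalFieldOn 𝒜 φ.source (chartPullback φ W) :=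
    fun hW => h.isConformalFieldOn_pullback hn hφ subset_rfl hW
  have hθ : ∀ θ, θ = φ ∨ θ = ψ → θ ∈ 𝒜 := by rintro θ (rfl | rfl) <;> assumption
  refine quantLoc_eq_quantLoc hd (h.smooth hφ) (h.smooth hψ) hx hx'
    (φ.open_source.mem_nhds hx) (fun r x hx => h.smoothVFAt (hc (hY r)) hx)
    (fun r x hx => h.smoothVFAt (hc (hZ r)) hx)
    (fun θ e r x hx hxθ => ?_) (fun θ e r x hx hxθ => ?_) (fun x hx _ => ?_)
    hr.h0 hr.h1 hr.h2 hr.h3 hr.h4 hr.h5 P f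
  · rw [hde]; exact h.isConf (hc (hY r)) hx (hθ θ e) hxθ
  · rw [hde]; exact h.isConf (hc (hZ r)) hx (hθ θ e) hxθ
  · rw [hde]
    exact hC _ _ x hx (fun r => Filter.Eventually.of_forall fun _ => rfl)
      fun r => Filter.Eventually.of_forall fun _ => rfl

lemma IsConformallyFlat.exists_quantization : ∃ Q : symbols2 (p + q) 𝕜 M →ₗ[𝕜] FunOp (p + q) 𝕜 M,
    HasPrincipalSymbol Q (fun _ => 1) ∧ ∀ U, IsOpen U → ∀ X, IsConformalFieldOn 𝒜 U X →
      IntertwinesOn g lam mu U Q X := by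
  obtain ⟨d, hde, hd⟩ := exists_quantData hr (scalSign_mul_self (p := p) (q := q))
  choose Φ hΦ hxΦ using h.cover
  have hloc : ∀ φ ∈ 𝒜, ∀ x ∈ φ.source, ∀ (P : symbols2 (p + q) 𝕜 M) (f : smoothFun (p + q) 𝕜 M),
      quantLoc g lam mu d (Φ x) P f.1 x = quantLoc g lam mu d φ P f.1 x := fun φ hφ x hx P f =>
    h.quantLoc_eq hn hr hd hde (hΦ x) hφ (hxΦ x) hx P f
  have hs := fun x => h.smooth (hΦ x)
  obtain ⟨Q, hQ⟩ := exists_bilinear (n := p + q) (𝕜 := 𝕜) (M := M)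
    (fun P f x => quantLoc g lam mu d (Φ x) P f.1 x)
    (fun P f x => (quantLoc_smooth (hs x) (hxΦ x) P f).congr_of_eventuallyEq (by
      filter_upwards [(Φ x).open_source.mem_nhds (hxΦ x)] with z hz
      exact hloc _ (hΦ x) z hz P f))
    (fun P P' f x => quantLoc_add_symbol (hs x) (hxΦ x) P P' f.1)
    (fun r P f x => quantLoc_smul_symbol (hs x) (hxΦ x) r P f.1)
    (fun P f f' x => quantLoc_add_fun (hs x) (hxΦ x) P f f')
    (fun r P f x => quantLoc_smul_fun (hs x) (hxΦ x) r P f)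
  refine ⟨Q, hasPrincipalSymbol_of_quantLoc (g := g) (lam := lam) (mu := mu) (q := d) fun x =>
    ⟨Φ x, hs x, hxΦ x, fun P f => by rw [hQ, one_mul]⟩, fun U hU X hX =>
    intertwinesOn_of_quantLoc hd hU (fun x hx => ⟨Φ x, hs x, hxΦ x, ?_, ?_⟩)
      fun x hx => h.smoothVFAt hX hx⟩
  · filter_upwards [(Φ x).open_source.mem_nhds (hxΦ x)] with z hz P f
    rw [hQ, hloc _ (hΦ x) z hz]
  · rw [hde]
    exact h.isConf hX hx (hΦ x) (hxΦ x)

variable {Q Q' : symbols2 (p + q) 𝕜 M →ₗ[𝕜] FunOp (p + q) 𝕜 M}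
  (hQ : HasPrincipalSymbol Q fun _ => 1) (hQ' : HasPrincipalSymbol Q' fun _ => 1)
include hQ hQ'

lemma IsConformallyFlat.eq_on_of_casimir {ι : Type*} [Fintype ι] {Y Z : ι → VField (p + q) M}
    {χ : M → ℝ} {O : Set M} (hU : IsOpen U) (hχ : ContMDiff (𝓡 (p + q)) 𝓘(ℝ, ℝ) ∞ χ)
    (hχ1 : ∀ z ∈ U, χ z = 1) (hO : tsupport χ ⊆ O) (hUO : U ⊆ O)
    (hY : ∀ r, IsConformalFieldOn 𝒜 O (Y r)) (hZ : ∀ r, IsConformalFieldOn 𝒜 O (Z r))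
    (hC : ∀ x ∈ U, IsCasimirAt 𝕜 𝒜 x Y Z)
    (hi : ∀ X, IsConformalFieldOn 𝒜 U X → IntertwinesOn g lam mu U Q X)
    (hi' : ∀ X, IsConformalFieldOn 𝒜 U X → IntertwinesOn g lam mu U Q' X)
    (hx : x ∈ U) (P : symbols2 (p + q) 𝕜 M) (f : smoothFun (p + q) 𝕜 M) :
    (Q P f).1 x = (Q' P f).1 x := by
  have hT : ∀ P, (Q + (-1 : 𝕜) • Q') P = Q P - Q' P := fun P =>
    LinearMap.ext fun f => Subtype.ext (funext fun x => by
      show (Q P f).1 x + (-1 : 𝕜) * (Q' P f).1 x = (Q P f).1 x - (Q' P f).1 x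
      ring)
  have hsub : ∀ X, IsConformalFieldOn 𝒜 U X → IntertwinesOn g lam mu U (Q + (-1 : 𝕜) • Q') X :=
    fun X hX => (hi X hX).sub (hi' X hX)
  have hres : ∀ {W}, IsConformalFieldOn 𝒜 O W → IsConformalFieldOn 𝒜 U W :=
    fun hW x hx => hW x (hUO hx)
  have key := (hQ.lowersOrder_sub hQ' hT).eq_zero_on (scalSign_mul_self (p := p) (q := q)) hU hχ hχ1
    (fun r x hx => h.smoothVFAt (hY r) (hO hx)) (fun r x hx => h.smoothVFAt (hZ r) (hO hx))
    (fun x hx => by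
      obtain ⟨φ, hφ, hxφ, hc⟩ := hC x hx
      exact ⟨φ, h.smooth hφ, hxφ, hc⟩)
    (hsub _ isConformalFieldOn_zero) (fun r => hsub _ (hres (hY r))) (fun r => hsub _ (hres (hZ r)))
    hr.h0 hr.h1 hr.h2 hr.h3 hr.h4 hr.h5 P f hx
  rw [hT] at key
  exact sub_eq_zero.1 key

lemma IsConformallyFlat.quantization_unique
    (hi : ∀ U, IsOpen U → ∀ X, IsConformalFieldOn 𝒜 U X → IntertwinesOn g lam mu U Q X)
    (hi' : ∀ U, IsOpen U → ∀ X, IsConformalFieldOn 𝒜 U X → IntertwinesOn g lam mu U Q' X) :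
    Q = Q' := by
  refine LinearMap.ext fun P => LinearMap.ext fun f => Subtype.ext (funext fun x => ?_)
  obtain ⟨φ, hφ, hx⟩ := h.cover x
  obtain ⟨Y, Z, hY, hZ, hC⟩ := h.exists_casimir_pullback (𝕜 := 𝕜) hφ
  obtain ⟨χ, hχ, hχ1, hs⟩ := exists_bump (n := p + q) (φ.open_source.mem_nhds hx)
  obtain ⟨U, hU1, hU, hxU⟩ := mem_nhds_iff.1 hχ1
  have hUφ : U ⊆ φ.source := fun z hz => hs (subset_tsupport _ (by
    have : χ z = 1 := hU1 hz
    simp [this]))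
  refine h.eq_on_of_casimir hn hr hQ hQ' hU hχ hU1 hs hUφ
    (fun r => h.isConformalFieldOn_pullback hn hφ subset_rfl (hY r))
    (fun r => h.isConformalFieldOn_pullback hn hφ subset_rfl (hZ r)) (fun z hz => ?_)
    (hi U hU) (hi' U hU) hxU P f
  exact ⟨φ, hφ, hUφ hz, hC _ _ z (hUφ hz) (fun r => Filter.Eventually.of_forall fun _ => rfl)
    fun r => Filter.Eventually.of_forall fun _ => rfl⟩

lemma IsConformallyFlat.quantization_unique_of_global (hG : ActsGlobally 𝒜)
    (hi : ∀ X, IsConformalFieldOn 𝒜 Set.univ X → IntertwinesOn g lam mu Set.univ Q X)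
    (hi' : ∀ X, IsConformalFieldOn 𝒜 Set.univ X → IntertwinesOn g lam mu Set.univ Q' X) :
    Q = Q' := by
  refine LinearMap.ext fun P => LinearMap.ext fun f => Subtype.ext (funext fun x => ?_)
  obtain ⟨Y, Z, hY, hZ, hC⟩ := h.exists_global_casimir (𝕜 := 𝕜) hn hG
  exact h.eq_on_of_casimir hn hr hQ hQ' isOpen_univ (χ := fun _ => 1) contMDiff_const
    (fun _ _ => rfl) (Set.subset_univ _) subset_rfl hY hZ (fun z _ => hC z) hi hi' trivial P f

omit h hn hr hQ hQ'

lemma hasPrincipalSymbol_of_preserves {Q : symbols2 (p + q) 𝕜 M ≃ₗ[𝕜] diffOp (p + q) 𝕜 M 2}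
    (hQ : PreservesPrincipalSymbol Q) :
    HasPrincipalSymbol ((diffOp (p + q) 𝕜 M 2).subtype ∘ₗ Q.toLinearMap) fun _ => 1 := by
  refine ⟨fun P hP => (hQ 2 le_rfl P hP).1, fun P hP => (hQ 1 one_le_two P hP).1,
    fun P hP => (hQ 0 zero_le_two P hP).1, fun P hP f hf x => ?_, fun P hP f hf x => ?_,
    fun P hP x => ?_⟩
  · rw [one_mul]
    exact (hQ 2 le_rfl P hP).2 f hf x
  · have := (hQ 1 one_le_two P hP).2 f hf x
    rw [Nat.factorial_one, Nat.cast_one] at this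
    exact this
  · have := (hQ 0 zero_le_two P hP).2 (fun _ => 0) contMDiff_const x
    rw [Nat.factorial_zero, Nat.cast_one, mfderiv_const] at this
    exact this

lemma HasPrincipalSymbol.preserves {Q : symbols2 (p + q) 𝕜 M ≃ₗ[𝕜] diffOp (p + q) 𝕜 M 2}
    (hQ : HasPrincipalSymbol ((diffOp (p + q) 𝕜 M 2).subtype ∘ₗ Q.toLinearMap) fun _ => 1) :
    PreservesPrincipalSymbol Q := by
  intro k hk P hP
  interval_cases k
  · refine ⟨hQ.zero_mem P hP, fun f hf x => ?_⟩
    rw [Nat.factorial_zero, Nat.cast_one]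
    have h1 := hP x 0 (dfun f x)
    rw [zero_smul, pow_zero, one_mul] at h1
    have h2 := hQ.zero P hP x
    rw [h1] at h2
    exact h2
  · refine ⟨hQ.one_mem P hP, fun f hf x => ?_⟩
    rw [Nat.factorial_one, Nat.cast_one]
    exact hQ.one P hP f hf x
  · refine ⟨hQ.two_mem P hP, fun f hf x => ?_⟩
    have := hQ.two P hP f hf x
    rw [one_mul] at this
    exact this

end Main

end ConfQuant

end

open ConfQuant in
theorem theorem1p1 {𝕜 : Type*} [RCLike 𝕜] (p q : ℕ) (hn : 2 ≤ p + q)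
    {M : Type*} [TopologicalSpace M] [T2Space M] [ChartedSpace (Model (p + q)) M]
    [IsManifold (𝓡 (p + q)) ∞ M] (g : PseudoRiemannianMetric (p + q) M)
    (𝒜 : Set (OpenPartialHomeomorph M (Model (p + q)))) (h𝒜 : IsConformallyFlat g 𝒜)
    (n : 𝕜) (hdim : n = ((p + q : ℕ) : 𝕜)) (lam mu : 𝕜)
    (hres : mu - lam ∉ ({2 / n, (n + 2) / (2 * n), 1, (n + 1) / n, (n + 2) / n} : Set 𝕜)) :
    ∃ Q : symbols2 (p + q) 𝕜 M ≃ₗ[𝕜] diffOp (p + q) 𝕜 M 2,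
      IsLocallyEquivariant 𝒜 g lam mu Q ∧ PreservesPrincipalSymbol Q ∧
      (∀ Q' : symbols2 (p + q) 𝕜 M ≃ₗ[𝕜] diffOp (p + q) 𝕜 M 2,
        IsLocallyEquivariant 𝒜 g lam mu Q' → PreservesPrincipalSymbol Q' → Q' = Q) ∧
      (ActsGlobally 𝒜 → ∀ Q' : symbols2 (p + q) 𝕜 M ≃ₗ[𝕜] diffOp (p + q) 𝕜 M 2,
        IsEquivariantOn 𝒜 g lam mu Set.univ Q' → PreservesPrincipalSymbol Q' → Q' = Q) := by
  have hn0 : n ≠ 0 := by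
    rw [hdim, Nat.cast_ne_zero]
    omega
  have hr : NonResonant (p + q) lam mu := by
    simp only [Set.mem_insert_iff, Set.mem_singleton_iff, not_or] at hres
    obtain ⟨r1, r2, r3, r4, r5⟩ := hres
    constructor <;> (try rw [← hdim]) <;> try assumption
    · exact fun e => r1 (by rw [eq_div_iff hn0, ← e, mul_comm])
    · exact fun e => r2 (by rw [eq_div_iff (mul_ne_zero two_ne_zero hn0), ← e, mul_comm])
    · exact fun e => r4 (by rw [eq_div_iff hn0, ← e, mul_comm])
    · exact fun e => r5 (by rw [eq_div_iff hn0, ← e, mul_comm])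
  obtain ⟨Q, hQ, hi⟩ := h𝒜.exists_quantization hn hr
  have hbij : Function.Bijective (Q.codRestrict (diffOp (p + q) 𝕜 M 2) hQ.mem) := by
    refine ⟨fun P P' e => hQ.injective (congrArg Subtype.val e), fun A => ?_⟩
    obtain ⟨P, hP⟩ := hQ.surjective A.2
    exact ⟨P, Subtype.ext hP⟩
  have back : ∀ Q' : symbols2 (p + q) 𝕜 M ≃ₗ[𝕜] diffOp (p + q) 𝕜 M 2,
      Q = (diffOp (p + q) 𝕜 M 2).subtype ∘ₗ Q'.toLinearMap →
      Q' = LinearEquiv.ofBijective _ hbij := by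
    intro Q' e
    refine LinearEquiv.ext fun P => Subtype.ext ?_
    exact (LinearMap.congr_fun e P).symm
  refine ⟨LinearEquiv.ofBijective _ hbij, fun U hU X hX => hi U hU X hX,
    HasPrincipalSymbol.preserves hQ, fun Q' he hp => back Q' ?_, fun hG Q' he hp => back Q' ?_⟩
  · exact h𝒜.quantization_unique hn hr hQ (hasPrincipalSymbol_of_preserves hp) hi
      fun U hU X hX => he U hU X hX
  · exact h𝒜.quantization_unique_of_global hn hr hQ (hasPrincipalSymbol_of_preserves hp) hG
      (hi Set.univ isOpen_univ) fun X hX => he X hX
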